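/- **Conventions.** $1/\infty=0$, $c/0=\infty$ for $c\in(0,\infty]$, $0/0=0$, $0\cdot\infty=0$; $\frac1r+\frac1{r'}=1$; $\|\cdot\|_{r,I}$ is the Lebesgue norm over the interval $I$ (with respect to the variable $t$, or $x$ in an outer norm). *Operators.* Let $(R_1,\mu_1)$, $(R_2,\mu_2)$ be $\sigma$-finite measure spaces of infinite measure, and $f^*(t)=\inf\{h>0:\mu(|f|>h)\le t\}$ the decreasing rearrangement of a measurable scalar (real or complex) function. Let $1\le p_1<p_2\le\infty$, $q_1,q_2\in[1,\infty]$, $q_1\ne q_2$, $m=(\frac1{q_1}-\frac1{q_2})/(\frac1{p_1}-\frac1{p_2})$, and $$S_\sigma g(x)=x^{-1/q_1}\int_0^{x^m}t^{\frac1{p_1}-1}g(t)\,dt+x^{-1/q_2}\int_{x^m}^\infty t^{\frac1{p_2}-1}g(t)\,dt .$$ A quasilinear operator $T$ maps a linear space $\mathcal D$ of $\mu_1$-measurable scalar functions to $\mu_2$-measurable functions so that, for some $k\ge1$, a.e. $|T(f+g)|\le k(|Tf|+|Tg|)$ and $|T(\alpha f)|=|\alpha||Tf|$. It is of joint weak type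 $(p_1,q_1;p_2,q_2)$ if every measurable $f$ with $S_\sigma f^*(1)<\infty$ lies in $\mathcal D$ and there is $C<\infty$ such that $(Tf)^*(x)\le C\,S_\sigma f^*(x)$ for all such $f$ and all $x>0$. It has the lower bound $LB_1$ (respectively $LB_2$) if there is $C<\infty$ such that for every non-increasing $f:(0,\infty)\to[0,\infty)$ with $S_\sigma f(1)<\infty$ there is $g\in\mathcal D$ equimeasurable with $f$ such that for all $x>0$ the first (respectively the second) summand of $S_\sigma f(x)$ is at most $C\,(Tg)^*(x)$. *Spaces.* A measurable $a:(0,\infty)\to[0,\infty]$, not identically $0$ and not identically $\infty$, is slowly varying ($a\in SV(0,\infty)$) if for each $\varepsilon>0$ the function $t^{\varepsilon}a(t)$ is equivalent, up to constant factors, to a non-decreasing function and $t^{-\varepsilon}a(t)$ to a non-increasing one. Put $\|f\|_{p,r;a;I}=\|t^{\frac1p-\frac1r}a(t)f^*(t)\|_{r,I}$. If $P_1<P_2$, then $L_{P_1,\rho_1;a}+L_{P_2,\rho_2;a}$ and $L_{P_1,\rho_1;a}\cap L_{P_2,\rho_2;a}$ (in either order of the two terms) consist of the measurable functions on which $$\|f\|_{P_1,\rho_1;a;(0,1)}+\|f\|_{P_2,\rho_2;a;(1,\infty)},\qquad\text{respectively}\qquad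 \|f\|_{P_2,\rho_2;a;(0,1)}+\|f\|_{P_1,\rho_1;a;(1,\infty)},$$ is finite. $T:X\to Y$ means that $X\subseteq\mathcal D$ and $\|Tf\|_Y\le C\|f\|_X$ for all $f\in X$, with some $C<\infty$. *Quantities.* For $r,s\in[1,\infty]$ and $(A,B)\in\{(0,1),(1,\infty)\}$ let $\frac1\varrho=\frac1s-\frac1r$ if $r>s$, $V(t)=\int_A^tu^{-1}a(u)^r\,du$, and put $$L=\begin{cases}\sup_{A<x<B}\|t^{-\frac1s}b(t)\|_{s,(x,B)}\|t^{-\frac1{r'}}a(t)^{-1}\|_{r',(A,x)},& r\le s,\\ \Big\|x^{-\frac1\varrho}a(x)^{-\frac{r'}\varrho}\|t^{-\frac1s}b(t)\|_{s,(x,B)}\|t^{-\frac1{r'}}a(t)^{-1}\|_{r',(A,x)}^{r'/s'}\Big\|_{\varrho,(A,B)},& r>s,\end{cases}$$ $$R_1=\begin{cases}\sup_{A<x<B}\|t^{-\frac1s}b(t)\log\frac xt\|_{s,(A,x)}\|t^{-\frac1r}a(t)\|_{r,(A,x)}^{-1},& r\le s,\\ \Big\|x^{-\frac1\varrho}a(x)^{\frac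 r\varrho}\|t^{-\frac1s}b(t)\log\frac xt\|_{s,(A,x)}\|t^{-\frac1r}a(t)\|_{r,(A,x)}^{-r/s}\Big\|_{\varrho,(A,B)},& r>s,\end{cases}$$ $$R_2=\begin{cases}\sup_{A<x<B}\|t^{-\frac1s}b(t)\|_{s,(A,x)}\|t^{-\frac1{r'}}a(t)^{\frac r{r'}}V(t)^{-1}\log\frac tx\|_{r',(x,B)},& r\le s,\\ \Big\|x^{-\frac1\varrho}b(x)^{\frac s\varrho}\|t^{-\frac1s}b(t)\|_{s,(A,x)}^{s/r}\|t^{-\frac1{r'}}a(t)^{\frac r{r'}}V(t)^{-1}\log\frac tx\|_{r',(x,B)}\Big\|_{\varrho,(A,B)},& r>s,\end{cases}$$ $$R_3=\Big\|x^{-\frac1s}b(x)\int_x^Bt^{-1}\|a\|_{\infty,(A,t)}^{-1}\,dt\Big\|_{s,(A,B)},$$ and $R_\infty=R_1+R_2$ if $1<r,s<\infty$; $R_\infty=R_1$ if $r=1$ or $1=s<r<\infty$; $R_\infty=R_2$ if $1<r<s=\infty$; $R_\infty=R_3$ if $r=\infty$. All of these depend on $(r,s,a,b;A,B)$. **Theorem.**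 Let $1\le p_1<\infty=p_2$, $q_1,q_2,r_1,s_1,r_2,s_2\in[1,\infty]$, $q_1\ne q_2$, $a,b\in SV(0,\infty)$, and if $r_2=\infty$ let $a$ be non-decreasing. Let $T$ be a quasilinear operator of joint weak type $(p_1,q_1;\infty,q_2)$ that has both lower bounds $LB_1$ and $LB_2$. Put $b_*(t)=b(t^{1/m})$. (i) $T:L_{p_1,r_1;a}+L_{\infty,r_2;a}\to L_{q_1,s_1;b}+L_{q_2,s_2;b}$ if and only if $$\|t^{-1/r_2}a(t)\|_{r_2,(1,\infty)}=\infty\quad\text{and}\quad L(r_1,s_1,a,b_*;0,1)+R_\infty(r_2,s_2,a,b_*;1,\infty)<\infty .$$ (ii) If $$L(r_1,s_1,a,b_*;1,\infty)+R_\infty(r_2,s_2,a,b_*;0,1)<\infty,\tag{$*$}$$ then $T:L_{p_1,r_1;a}\cap L_{\infty,r_2;a}\to L_{q_1,s_1;b}\cap L_{q_2,s_2;b}$. Conversely, if $T$ is bounded between these two intersections and $\|t^{-1/r_2}a(t)\|_{r_2,(0,1)}<\infty$ (that is, $L_{p_1,r_1;a}\cap L_{\infty,r_2;a}\neq\{0\}$),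 then $(*)$ holds. -/

import Mathlib

open MeasureTheory Set
open scoped ENNReal NNReal

noncomputable section

namespace LK

/-- The reciprocal `1/p` of an exponent `p ∈ (0,∞]` as a real number, with `1/∞ = 0`. -/
def recip (p : ℝ≥0∞) : ℝ := (p⁻¹).toReal

/-- The power function `t ↦ t^α`, used for `t > 0` only. -/
def pow (α : ℝ) (t : ℝ) : ℝ≥0∞ := ENNReal.ofReal t ^ α

/-- The Lebesgue norm `‖F‖_{r,I}` over `I` of a `[0,∞]`-valued function. The conventions
`0·∞ = 0`, `1/0 = ∞`, `1/∞ = 0` and `0/0 = 0` are those of `ℝ≥0∞`. -/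
def lp (r : ℝ≥0∞) (I : Set ℝ) (F : ℝ → ℝ≥0∞) : ℝ≥0∞ := eLpNorm F r (volume.restrict I)

/-! ### Slowly varying functions -/

/-- `E ≈ F` on `I`: two-sided estimate up to constants in `(0,∞)`. -/
def EquivOn (I : Set ℝ) (E F : ℝ → ℝ≥0∞) : Prop :=
  ∃ c₁ c₂ : ℝ≥0, 0 < c₁ ∧ 0 < c₂ ∧ ∀ t ∈ I, c₁ * F t ≤ E t ∧ E t ≤ c₂ * F t

/-- `a ∈ SV(I)` for an interval `I ⊆ (0,∞)`: `a` is measurable, neither identically `0` nor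
identically `∞`, and for every `ε > 0` the function `t^ε a(t)` is equivalent to a non-decreasing
function and `t^{-ε} a(t)` to a non-increasing one. -/
structure SlowlyVarying (I : Set ℝ) (a : ℝ → ℝ≥0∞) : Prop where
  aemeasurable : AEMeasurable a (volume.restrict I)
  ne_zero : ∃ t ∈ I, a t ≠ 0
  ne_top : ∃ t ∈ I, a t ≠ ∞
  mono : ∀ ε : ℝ, 0 < ε → ∃ g : ℝ → ℝ≥0∞, MonotoneOn g I ∧
    EquivOn I (fun t => pow ε t * a t) g
  anti : ∀ ε : ℝ, 0 < ε → ∃ g : ℝ → ℝ≥0∞, AntitoneOn g I ∧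
    EquivOn I (fun t => pow (-ε) t * a t) g

/-! ### Rearrangements -/

section Rearrangement

variable {R ε : Type*} [MeasurableSpace R] [ENorm ε]

/-- The distribution function `h ↦ μ {|f| > h}`. -/
def distrib (μ : Measure R) (f : R → ε) (h : ℝ≥0∞) : ℝ≥0∞ := μ {x | h < ‖f x‖ₑ}

/-- The decreasing rearrangement `f^*(t) = inf {h > 0 : μ {|f| > h} ≤ t}`. -/
def rearr (μ : Measure R) (f : R → ε) (t : ℝ) : ℝ≥0∞ :=
  sInf {h : ℝ≥0∞ | 0 < h ∧ distrib μ f h ≤ ENNReal.ofReal t}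

/-- `g` on `(R,μ)` is equimeasurable with the function `f` on `(0,∞)`. -/
def Equimeasurable (μ : Measure R) (g : R → ε) (f : ℝ → ℝ≥0∞) : Prop :=
  ∀ h : ℝ≥0, distrib μ g h = distrib (volume.restrict (Ioi (0 : ℝ))) f h

/-! ### Lorentz-Karamata functionals -/

/-- `‖f‖_{p,r;a;I} = ‖t^{1/p-1/r} a(t) f^*(t)‖_{r,I}`. -/
def lkNorm (μ : Measure R) (p r : ℝ≥0∞) (a : ℝ → ℝ≥0∞) (I : Set ℝ) (f : R → ε) : ℝ≥0∞ :=
  lp r I (fun t => pow (recip p - recip r) t * a t * rearr μ f t)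

/-- The functional of the sum `L_{p₁,r₁;a} + L_{p₂,r₂;a}` (`p₁ ≠ p₂`): the space with the smaller
first index governs `(0,1)`, the one with the larger first index governs `(1,∞)`. -/
def sumNorm (μ : Measure R) (p₁ r₁ p₂ r₂ : ℝ≥0∞) (a : ℝ → ℝ≥0∞) (f : R → ε) : ℝ≥0∞ :=
  if p₁ < p₂ then lkNorm μ p₁ r₁ a (Ioo 0 1) f + lkNorm μ p₂ r₂ a (Ioi 1) f
  else lkNorm μ p₂ r₂ a (Ioo 0 1) f + lkNorm μ p₁ r₁ a (Ioi 1) f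

/-- The functional of the intersection `L_{p₁,r₁;a} ∩ L_{p₂,r₂;a}` (`p₁ ≠ p₂`): the space with the
larger first index governs `(0,1)`, the one with the smaller first index governs `(1,∞)`. -/
def interNorm (μ : Measure R) (p₁ r₁ p₂ r₂ : ℝ≥0∞) (a : ℝ → ℝ≥0∞) (f : R → ε) : ℝ≥0∞ :=
  if p₁ < p₂ then lkNorm μ p₂ r₂ a (Ioo 0 1) f + lkNorm μ p₁ r₁ a (Ioi 1) f
  else lkNorm μ p₁ r₁ a (Ioo 0 1) f + lkNorm μ p₂ r₂ a (Ioi 1) f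

end Rearrangement

/-! ### The Calderón operator -/

/-- The slope `m` of the segment `[(1/p₁,1/q₁);(1/p₂,1/q₂)]`. -/
def slope (p₁ q₁ p₂ q₂ : ℝ≥0∞) : ℝ := (recip q₁ - recip q₂) / (recip p₁ - recip p₂)

/-- `x^{-1/q} ∫_0^{x^m} t^{1/p-1} g(t) dt`. -/
def calderonLeft (p q : ℝ≥0∞) (m : ℝ) (g : ℝ → ℝ≥0∞) (x : ℝ) : ℝ≥0∞ :=
  pow (-recip q) x * ∫⁻ t in Ioo 0 (x ^ m), pow (recip p - 1) t * g t

/-- `x^{-1/q} ∫_{x^m}^∞ t^{1/p-1} g(t) dt`. -/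
def calderonRight (p q : ℝ≥0∞) (m : ℝ) (g : ℝ → ℝ≥0∞) (x : ℝ) : ℝ≥0∞ :=
  pow (-recip q) x * ∫⁻ t in Ioi (x ^ m), pow (recip p - 1) t * g t

/-- The Calderón operator `S_σ` of the segment `σ = [(1/p₁,1/q₁);(1/p₂,1/q₂)]`. -/
def calderon (p₁ q₁ p₂ q₂ : ℝ≥0∞) (g : ℝ → ℝ≥0∞) (x : ℝ) : ℝ≥0∞ :=
  calderonLeft p₁ q₁ (slope p₁ q₁ p₂ q₂) g x + calderonRight p₂ q₂ (slope p₁ q₁ p₂ q₂) g x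

/-! ### Quasilinear operators -/

section Operators

variable {𝕜 R₁ R₂ : Type*} [RCLike 𝕜] [MeasurableSpace R₁] [MeasurableSpace R₂]

/-- A quasilinear operator from a linear space `domain` of `μ₁`-measurable scalar functions to
`μ₂`-measurable scalar functions. -/
structure QuasilinearOp (𝕜 : Type*) [RCLike 𝕜] {R₁ R₂ : Type*} [MeasurableSpace R₁]
    [MeasurableSpace R₂] (μ₁ : Measure R₁) (μ₂ : Measure R₂) where
  domain : Submodule 𝕜 (R₁ → 𝕜)
  aemeasurable_of_mem : ∀ f ∈ domain, AEMeasurable f μ₁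
  toFun : domain → R₂ → 𝕜
  aemeasurable_toFun : ∀ f, AEMeasurable (toFun f) μ₂
  quasiadd : ∃ k : ℝ, 1 ≤ k ∧ ∀ f g : domain, ∀ᵐ y ∂μ₂,
    ‖toFun (f + g) y‖ ≤ k * (‖toFun f y‖ + ‖toFun g y‖)
  homogeneous : ∀ (α : 𝕜) (f : domain), ∀ᵐ y ∂μ₂, ‖toFun (α • f) y‖ = ‖α‖ * ‖toFun f y‖

variable {μ₁ : Measure R₁} {μ₂ : Measure R₂}

/-- Joint weak type `(p₁,q₁;p₂,q₂)`: every measurable `f` with `S_σ f^*(1) < ∞` is in the domain,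
and `(Tf)^* ≲ S_σ f^*` on `(0,∞)` for these `f`, with a constant independent of `f`. -/
def JointWeakType (T : QuasilinearOp 𝕜 μ₁ μ₂) (p₁ q₁ p₂ q₂ : ℝ≥0∞) : Prop :=
  ∃ C : ℝ≥0, ∀ f : R₁ → 𝕜, AEMeasurable f μ₁ → calderon p₁ q₁ p₂ q₂ (rearr μ₁ f) 1 < ∞ →
    ∃ hf : f ∈ T.domain, ∀ x : ℝ, 0 < x →
      rearr μ₂ (T.toFun ⟨f, hf⟩) x ≤ C * calderon p₁ q₁ p₂ q₂ (rearr μ₁ f) x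

/-- The non-increasing functions `f : (0,∞) → [0,∞)` with `S_σ f(1) < ∞`; by this last condition
all functions equimeasurable with `f` are in the domain of an operator of joint weak type. -/
structure Admissible (p₁ q₁ p₂ q₂ : ℝ≥0∞) (f : ℝ → ℝ≥0∞) : Prop where
  antitone : AntitoneOn f (Ioi 0)
  finite : ∀ t : ℝ, 0 < t → f t ≠ ∞
  calderon_finite : calderon p₁ q₁ p₂ q₂ f 1 < ∞

/-- The lower bound `LB₁(p₁,q₁;m)`, `m` being the slope of `[(1/p₁,1/q₁);(1/p₂,1/q₂)]`. -/
def LowerBound₁ (T : QuasilinearOp 𝕜 μ₁ μ₂) (p₁ q₁ p₂ q₂ : ℝ≥0∞) : Prop :=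
  ∃ C : ℝ≥0, ∀ f : ℝ → ℝ≥0∞, Admissible p₁ q₁ p₂ q₂ f →
    ∃ g : T.domain, Equimeasurable μ₁ (g : R₁ → 𝕜) f ∧ ∀ x : ℝ, 0 < x →
      calderonLeft p₁ q₁ (slope p₁ q₁ p₂ q₂) f x ≤ C * rearr μ₂ (T.toFun g) x

/-- The lower bound `LB₂(p₂,q₂;m)`, `m` being the slope of `[(1/p₁,1/q₁);(1/p₂,1/q₂)]`. -/
def LowerBound₂ (T : QuasilinearOp 𝕜 μ₁ μ₂) (p₁ q₁ p₂ q₂ : ℝ≥0∞) : Prop :=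
  ∃ C : ℝ≥0, ∀ f : ℝ → ℝ≥0∞, Admissible p₁ q₁ p₂ q₂ f →
    ∃ g : T.domain, Equimeasurable μ₁ (g : R₁ → 𝕜) f ∧ ∀ x : ℝ, 0 < x →
      calderonRight p₂ q₂ (slope p₁ q₁ p₂ q₂) f x ≤ C * rearr μ₂ (T.toFun g) x

/-- `T : X ⟶ Y`, where `X` and `Y` are the sets of all measurable functions on which the
functionals `NX`, `NY` are finite: `X` is contained in the domain of `T` and
`‖T f‖_Y ≤ C ‖f‖_X` for all `f ∈ X`. -/
def BoundedOp (T : QuasilinearOp 𝕜 μ₁ μ₂) (NX : (R₁ → 𝕜) → ℝ≥0∞) (NY : (R₂ → 𝕜) → ℝ≥0∞) :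
    Prop :=
  ∃ C : ℝ≥0, ∀ f : R₁ → 𝕜, AEMeasurable f μ₁ → NX f < ∞ →
    ∃ hf : f ∈ T.domain, NY (T.toFun ⟨f, hf⟩) ≤ C * NX f

end Operators

/-! ### The quantities `L`, `R₁`, `R₂`, `R₃`, `R_∞` on an interval `I = (A,B)` -/

/-- The exponent `ϱ` with `1/ϱ = 1/s - 1/r`, for `r > s`. -/
def rho (r s : ℝ≥0∞) : ℝ≥0∞ := (s⁻¹ - r⁻¹)⁻¹

/-- `log (x/t)` for `0 < t ≤ x`. -/
def logRatio (x t : ℝ) : ℝ≥0∞ := ENNReal.ofReal (Real.log (x / t))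

/-- `V(t) = ∫_A^t u^{-1} a(u)^r du`, for `r < ∞`. -/
def primV (r : ℝ≥0∞) (a : ℝ → ℝ≥0∞) (I : Set ℝ) (t : ℝ) : ℝ≥0∞ :=
  ∫⁻ u in I ∩ Iio t, pow (-1) u * a u ^ r.toReal

open ENNReal (conjExponent)

/-- `L(r,s,a,b;A,B)`. -/
def quantL (r s : ℝ≥0∞) (a b : ℝ → ℝ≥0∞) (I : Set ℝ) : ℝ≥0∞ :=
  let r' := conjExponent r
  let s' := conjExponent s
  let W : ℝ → ℝ≥0∞ := fun x => lp s (I ∩ Ioi x) (fun t => pow (-recip s) t * b t)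
  let U : ℝ → ℝ≥0∞ := fun x => lp r' (I ∩ Iio x) (fun t => pow (-recip r') t * (a t)⁻¹)
  if r ≤ s then ⨆ x ∈ I, W x * U x
  else lp (rho r s) I (fun x => pow (-recip (rho r s)) x *
    a x ^ (-(r'.toReal * recip (rho r s))) * (W x * U x ^ (r'.toReal * recip s')))

/-- `R₁(r,s,a,b;A,B)`, for `r < ∞`. -/
def quantR₁ (r s : ℝ≥0∞) (a b : ℝ → ℝ≥0∞) (I : Set ℝ) : ℝ≥0∞ :=
  let W : ℝ → ℝ≥0∞ := fun x =>
    lp s (I ∩ Iio x) (fun t => pow (-recip s) t * b t * logRatio x t)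
  let U : ℝ → ℝ≥0∞ := fun x => lp r (I ∩ Iio x) (fun t => pow (-recip r) t * a t)
  if r ≤ s then ⨆ x ∈ I, W x * (U x)⁻¹
  else lp (rho r s) I (fun x => pow (-recip (rho r s)) x *
    a x ^ (r.toReal * recip (rho r s)) * (W x * U x ^ (-(r.toReal * recip s))))

/-- `R₂(r,s,a,b;A,B)`, for `r < ∞`. -/
def quantR₂ (r s : ℝ≥0∞) (a b : ℝ → ℝ≥0∞) (I : Set ℝ) : ℝ≥0∞ :=
  let r' := conjExponent r
  let W : ℝ → ℝ≥0∞ := fun x => lp s (I ∩ Iio x) (fun t => pow (-recip s) t * b t)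
  let U : ℝ → ℝ≥0∞ := fun x => lp r' (I ∩ Ioi x) (fun t =>
    pow (-recip r') t * a t ^ (r.toReal * recip r') * (primV r a I t)⁻¹ * logRatio t x)
  if r ≤ s then ⨆ x ∈ I, W x * U x
  else lp (rho r s) I (fun x => pow (-recip (rho r s)) x *
    b x ^ (s.toReal * recip (rho r s)) * (W x ^ (s.toReal * recip r) * U x))

/-- `R₃(∞,s,a,b;A,B)`. -/
def quantR₃ (s : ℝ≥0∞) (a b : ℝ → ℝ≥0∞) (I : Set ℝ) : ℝ≥0∞ :=
  lp s I (fun x => pow (-recip s) x * b x *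
    ∫⁻ t in I ∩ Ioi x, pow (-1) t * (lp ∞ (I ∩ Iio t) a)⁻¹)

/-- `R_∞(r,s,a,b;A,B)`, for `r, s ∈ [1,∞]`. -/
def quantRInf (r s : ℝ≥0∞) (a b : ℝ → ℝ≥0∞) (I : Set ℝ) : ℝ≥0∞ :=
  if r = ∞ then quantR₃ s a b I
  else if r = 1 ∨ s = 1 then quantR₁ r s a b I
  else if s = ∞ then quantR₂ r s a b I
  else quantR₁ r s a b I + quantR₂ r s a b I

/-- `b_*(t) = b(t^{1/m})`. -/
def star (m : ℝ) (b : ℝ → ℝ≥0∞) (t : ℝ) : ℝ≥0∞ := b (t ^ (1 / m))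

end LK

end

open Filter Topology
open ENNReal (conjExponent ofReal rpow_mul mul_ne_top mul_rpow_of_nonneg rpow_le_rpow rpow_one
  rpow_ne_top_of_nonneg ofReal_ne_top toReal_nonneg add_ne_top rpow_add_of_nonneg inv_ne_top
  one_ne_top toReal_pos coe_ne_top rpow_neg ofReal_mul toReal_mono inv_rpow toReal_lt_toReal
  ofReal_toReal rpow_pos rpow_add rpow_neg_one ofReal_pos ofReal_le_ofReal zero_rpow_of_pos
  toReal_one ofReal_rpow_of_pos ofReal_one top_rpow_of_pos mul_top measurable_ofReal top_mul
  rpow_ne_top_of_ne_zero mul_lt_top rpow_zero one_rpow ofReal_eq_zero natCast_lt_top mul_iSup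
  coe_mul coe_inv add_lt_top)
open MeasureTheory.Measure (restrict_le_self restrict_restrict restrict_mono_set
  restrict_mono_measure restrict_apply_univ)

noncomputable section

namespace LK

section Atomless

variable {μ : Measure ℝ}

lemma exists_measure_Iio_eq [IsFiniteMeasure μ] [NullSingletonClass μ] {c : ℝ≥0∞} (hc0 : 0 < c)
    (hc : c < μ univ) : ∃ x, μ (Iio x) = c := by
  have hlow : ∃ x, μ (Iio x) ≤ c := by
    have h := tendsto_measure_iInter_atTop (μ := μ) (s := fun n : ℕ => Iio (-(n : ℝ)))
      (fun n => measurableSet_Iio.nullMeasurableSet)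
      (fun m n hmn => Iio_subset_Iio (by simpa using hmn)) ⟨0, measure_ne_top _ _⟩
    have he : (⋂ n : ℕ, Iio (-(n : ℝ))) = ∅ := by
      ext x
      simp only [mem_iInter, mem_Iio, mem_empty_iff_false, iff_false, not_forall, not_lt]
      obtain ⟨n, hn⟩ := exists_nat_ge (-x)
      exact ⟨n, by linarith⟩
    rw [he, measure_empty] at h
    obtain ⟨n, hn⟩ := (h.eventually (gt_mem_nhds hc0)).exists
    exact ⟨_, hn.le⟩
  have hhigh : ∃ x, c < μ (Iio x) := by
    have h := tendsto_measure_iUnion_atTop (μ := μ) (s := fun n : ℕ => Iio (n : ℝ))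
      (fun m n hmn => Iio_subset_Iio (by simpa using hmn))
    have he : (⋃ n : ℕ, Iio (n : ℝ)) = univ := by
      ext x
      simp only [mem_iUnion, mem_Iio, mem_univ, iff_true]
      exact exists_nat_gt x
    rw [he] at h
    obtain ⟨n, hn⟩ := (h.eventually (lt_mem_nhds hc)).exists
    exact ⟨_, hn⟩
  obtain ⟨x₀, hx₀⟩ := hlow
  obtain ⟨x₁, hx₁⟩ := hhigh
  set S := {x | μ (Iio x) ≤ c}
  have hbdd : BddAbove S := ⟨x₁, fun x hx => by
    by_contra h
    exact absurd (lt_of_lt_of_le hx₁ (measure_mono (Iio_subset_Iio (not_le.1 h).le))) (not_lt.2 hx)⟩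
  have hne : S.Nonempty := ⟨x₀, hx₀⟩
  refine ⟨sSup S, le_antisymm ?_ ?_⟩
  · have h := tendsto_measure_iUnion_atTop (μ := μ)
      (s := fun n : ℕ => Iio (sSup S - 1 / ((n : ℝ) + 1)))
      (fun m n hmn => Iio_subset_Iio (by
        have : 1 / ((n : ℝ) + 1) ≤ 1 / ((m : ℝ) + 1) :=
          one_div_le_one_div_of_le (by positivity) (by simpa using hmn)
        linarith))
    have he : (⋃ n : ℕ, Iio (sSup S - 1 / ((n : ℝ) + 1))) = Iio (sSup S) := by
      ext x
      simp only [mem_iUnion, mem_Iio]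
      constructor
      · rintro ⟨n, hn⟩
        have : 0 < 1 / ((n : ℝ) + 1) := by positivity
        linarith
      · intro hx
        obtain ⟨n, hn⟩ := exists_nat_one_div_lt (sub_pos.2 hx)
        exact ⟨n, by linarith⟩
    rw [he] at h
    refine le_of_tendsto h (Eventually.of_forall fun n => ?_)
    have : sSup S - 1 / ((n : ℝ) + 1) < sSup S := by
      have : 0 < 1 / ((n : ℝ) + 1) := by positivity
      linarith
    obtain ⟨y, hy, hlt⟩ := exists_lt_of_lt_csSup hne this
    exact (measure_mono (Iio_subset_Iio hlt.le)).trans hy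
  · have h := tendsto_measure_iInter_atTop (μ := μ)
      (s := fun n : ℕ => Iio (sSup S + 1 / ((n : ℝ) + 1)))
      (fun n => measurableSet_Iio.nullMeasurableSet)
      (fun m n hmn => Iio_subset_Iio (by
        have : 1 / ((n : ℝ) + 1) ≤ 1 / ((m : ℝ) + 1) :=
          one_div_le_one_div_of_le (by positivity) (by simpa using hmn)
        linarith)) ⟨0, measure_ne_top _ _⟩
    have he : (⋂ n : ℕ, Iio (sSup S + 1 / ((n : ℝ) + 1))) = Iic (sSup S) := by
      ext x
      simp only [mem_iInter, mem_Iio, mem_Iic]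
      constructor
      · intro hx
        by_contra hlt
        obtain ⟨n, hn⟩ := exists_nat_one_div_lt (sub_pos.2 (not_le.1 hlt))
        have := hx n
        linarith
      · intro hx n
        have : 0 < 1 / ((n : ℝ) + 1) := by positivity
        linarith
    rw [he] at h
    rw [measure_congr (Iio_ae_eq_Iic (μ := μ) (a := sSup S))]
    refine ge_of_tendsto h (Eventually.of_forall fun n => ?_)
    have : sSup S < sSup S + 1 / ((n : ℝ) + 1) := by
      have : 0 < 1 / ((n : ℝ) + 1) := by positivity
      linarith
    have h' := notMem_of_csSup_lt this hbdd
    exact (not_le.1 h').le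

lemma monotone_measure_Iio : Monotone fun t => μ (Iio t) :=
  fun _ _ h => measure_mono (Iio_subset_Iio h)

lemma antitone_measure_Ioi : Antitone fun t => μ (Ioi t) :=
  fun _ _ h => measure_mono (Ioi_subset_Ioi h)

lemma measurable_measure_Iio : Measurable fun t => μ (Iio t) := monotone_measure_Iio.measurable

lemma measurable_measure_Ioi : Measurable fun t => μ (Ioi t) := antitone_measure_Ioi.measurable

/-- The distribution function of an atomless finite measure pushes it forward to Lebesgue
measure. -/
lemma map_measure_Iio [IsFiniteMeasure μ] [NullSingletonClass μ] :
    Measure.map (fun t => (μ (Iio t)).toReal) μ = volume.restrict (Ioo 0 (μ univ).toReal) := by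
  have hG : Measurable fun t => (μ (Iio t)).toReal := measurable_measure_Iio.ennreal_toReal
  have hmono : ∀ x y, x ≤ y → (μ (Iio x)).toReal ≤ (μ (Iio y)).toReal := fun x y h =>
    toReal_mono (measure_ne_top _ _) (monotone_measure_Iio h)
  have : IsFiniteMeasure (volume.restrict (Ioo (0:ℝ) (μ univ).toReal)) :=
    ⟨by simp⟩
  refine Measure.ext_of_Iic _ _ fun c => ?_
  rw [Measure.map_apply hG measurableSet_Iic, Measure.restrict_apply measurableSet_Iic]
  set M := (μ univ).toReal with hM
  have hex : ∀ c : ℝ, 0 < c → c < M → ∃ x, (μ (Iio x)).toReal = c := by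
    intro c h0 h1
    obtain ⟨x, hx⟩ := exists_measure_Iio_eq (μ := μ) (c := ofReal c) (by simpa using h0)
      ((ENNReal.ofReal_lt_iff_lt_toReal h0.le (measure_ne_top _ _)).2 h1)
    exact ⟨x, by rw [hx, ENNReal.toReal_ofReal h0.le]⟩
  have hval : ∀ x, μ (Iio x) = ofReal (μ (Iio x)).toReal := fun x =>
    (ofReal_toReal (measure_ne_top _ _)).symm
  rcases lt_or_ge c 0 with hc | hc
  · have h1 : (fun t => (μ (Iio t)).toReal) ⁻¹' Iic c = ∅ := by
      ext x
      simp only [mem_preimage, mem_Iic, mem_empty_iff_false, iff_false, not_le]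
      exact hc.trans_le toReal_nonneg
    have h2 : Iic c ∩ Ioo 0 M = ∅ := by
      ext x
      simp only [mem_inter_iff, mem_Iic, mem_Ioo, mem_empty_iff_false, iff_false]
      intro h
      linarith [h.1, h.2.1]
    rw [h1, h2, measure_empty, measure_empty]
  rcases lt_or_ge c M with hcM | hcM
  · have h2 : Iic c ∩ Ioo 0 M = Ioc 0 c := by
      ext x
      simp only [mem_inter_iff, mem_Iic, mem_Ioo, mem_Ioc]
      constructor
      · intro h
        exact ⟨h.2.1, h.1⟩
      · intro h
        exact ⟨h.2, h.1, h.2.trans_lt hcM⟩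
    rw [h2, Real.volume_Ioc, sub_zero]
    apply le_antisymm
    · refine ENNReal.le_of_forall_pos_le_add fun ε hε _ => ?_
      set c' := min (c + ε) ((c + M) / 2)
      have hc'1 : c < c' := lt_min (by have := hε; simpa using hε) (by linarith)
      obtain ⟨x, hx⟩ := hex c' (hc.trans_lt hc'1) ((min_le_right _ _).trans_lt (by linarith))
      calc μ ((fun t => (μ (Iio t)).toReal) ⁻¹' Iic c) ≤ μ (Iio x) := by
            refine measure_mono fun t ht => ?_
            by_contra h
            have := hmono x t (not_lt.1 h)
            simp only [mem_preimage, mem_Iic] at ht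
            linarith
        _ = ofReal c' := by rw [hval x, hx]
        _ ≤ ofReal (c + ε) := ofReal_le_ofReal (min_le_left _ _)
        _ = _ := by rw [ENNReal.ofReal_add hc (by positivity)]; simp
    · rcases hc.eq_or_lt with rfl | h0
      · simp
      obtain ⟨x, hx⟩ := hex c h0 hcM
      rw [← hx, ← hval]
      refine measure_mono fun t ht => ?_
      exact hmono t x (le_of_lt ht)
  · have h1 : (fun t => (μ (Iio t)).toReal) ⁻¹' Iic c = univ := by
      ext x
      simp only [mem_preimage, mem_Iic, mem_univ, iff_true]
      exact (toReal_mono (measure_ne_top _ _) (measure_mono (subset_univ _))).trans hcM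
    have h2 : Iic c ∩ Ioo 0 M = Ioo 0 M := by
      ext x
      simp only [mem_inter_iff, mem_Iic, mem_Ioo, and_iff_right_iff_imp]
      intro h
      linarith [h.2]
    rw [h1, h2, Real.volume_Ioo, sub_zero, hM, ofReal_toReal (measure_ne_top _ _)]

lemma lintegral_comp_measure_Iio [IsFiniteMeasure μ] [NullSingletonClass μ] {φ : ℝ≥0∞ → ℝ≥0∞}
    (hφ : Measurable φ) : ∫⁻ t, φ (μ (Iio t)) ∂μ = ∫⁻ s in Ioo 0 (μ univ).toReal, φ (ofReal s) := by
  have h := lintegral_map (μ := μ) (hφ.comp measurable_ofReal)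
    (measurable_measure_Iio (μ := μ)).ennreal_toReal
  rw [map_measure_Iio] at h
  simpa only [ofReal_toReal (measure_ne_top μ _), Function.comp_def] using h.symm

lemma lintegral_Ioo_rpow {p M : ℝ} (hp : 0 < p) (hM : 0 ≤ M) :
    ofReal p * ∫⁻ s in Ioo 0 M, ofReal s ^ (p - 1) = ofReal M ^ p := by
  have h1 : ∫⁻ s in Ioo 0 M, ofReal s ^ (p - 1)
      = ∫⁻ s in Ioc 0 M, ofReal (s ^ (p - 1)) := by
    rw [restrict_Ioo_eq_restrict_Ioc]
    refine setLIntegral_congr_fun measurableSet_Ioc fun s hs => ?_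
    exact ofReal_rpow_of_pos hs.1
  have hint : IntervalIntegrable (fun s : ℝ => s ^ (p - 1)) volume 0 M :=
    intervalIntegral.intervalIntegrable_rpow' (by linarith)
  rw [h1, ← ofReal_integral_eq_lintegral_ofReal
      ((intervalIntegrable_iff_integrableOn_Ioc_of_le hM).1 hint)
      ((ae_restrict_mem measurableSet_Ioc).mono fun s hs => Real.rpow_nonneg hs.1.le _),
    ← intervalIntegral.integral_of_le hM, integral_rpow (Or.inl (by linarith)),
    ← ofReal_mul hp.le, ENNReal.ofReal_rpow_of_nonneg hM hp.le]
  congr 1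
  rw [sub_add_cancel, Real.zero_rpow hp.ne']
  field_simp
  ring

lemma lintegral_Ioo_rpow_neg {p m M : ℝ} (hp : 1 < p) (hm : 0 < m) (hM : m ≤ M) :
    ofReal (p - 1) * ∫⁻ s in Ioo m M, ofReal s ^ (-p) = ofReal (m ^ (1 - p) - M ^ (1 - p)) := by
  have h1 : ∫⁻ s in Ioo m M, ofReal s ^ (-p)
      = ∫⁻ s in Ioc m M, ofReal (s ^ (-p)) := by
    rw [restrict_Ioo_eq_restrict_Ioc]
    refine setLIntegral_congr_fun measurableSet_Ioc fun s hs => ?_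
    exact ofReal_rpow_of_pos (hm.trans hs.1)
  have h0 : (0:ℝ) ∉ uIcc m M := by
    rw [uIcc_of_le hM]
    intro h
    linarith [h.1]
  have hint : IntervalIntegrable (fun s : ℝ => s ^ (-p)) volume m M :=
    intervalIntegral.intervalIntegrable_rpow (Or.inr h0)
  rw [h1, ← ofReal_integral_eq_lintegral_ofReal
      ((intervalIntegrable_iff_integrableOn_Ioc_of_le hM).1 hint)
      ((ae_restrict_mem measurableSet_Ioc).mono fun s hs => Real.rpow_nonneg (hm.trans hs.1).le _),
    ← intervalIntegral.integral_of_le hM,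
    integral_rpow (Or.inr ⟨by linarith, h0⟩), ← ofReal_mul (by linarith)]
  congr 1
  have h2 : -p + 1 = 1 - p := by ring
  have h3 : 1 - p ≠ 0 := by linarith
  rw [h2]
  field_simp
  ring

lemma restrict_Iio_Iio {t y : ℝ} (h : t ≤ y) : (μ.restrict (Iio y)) (Iio t) = μ (Iio t) := by
  rw [Measure.restrict_apply measurableSet_Iio, Iio_inter_Iio, min_eq_left h]

/-- Power rule for the distribution function of an atomless measure. -/
lemma lintegral_Iio_rpow [NullSingletonClass μ] {p y : ℝ} (hp : 0 < p) (hy : μ (Iio y) ≠ ∞) :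
    ofReal p * ∫⁻ t in Iio y, μ (Iio t) ^ (p - 1) ∂μ = μ (Iio y) ^ p := by
  have : IsFiniteMeasure (μ.restrict (Iio y)) := ⟨by simpa using hy.lt_top⟩
  have h1 : ∫⁻ t in Iio y, μ (Iio t) ^ (p - 1) ∂μ
      = ∫⁻ t in Iio y, ((μ.restrict (Iio y)) (Iio t)) ^ (p - 1) ∂μ :=
    setLIntegral_congr_fun measurableSet_Iio fun t ht => by
      simp only [restrict_Iio_Iio (le_of_lt ht)]
  rw [h1, lintegral_comp_measure_Iio (μ := μ.restrict (Iio y))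
    (φ := fun x => x ^ (p - 1)) (by fun_prop), lintegral_Ioo_rpow hp toReal_nonneg,
    restrict_apply_univ, ofReal_toReal hy]

lemma ae_measure_Iio_pos [NullSingletonClass μ] [SigmaFinite μ] : ∀ᵐ t ∂μ, 0 < μ (Iio t) := by
  have key : ∀ ν : Measure ℝ, IsFiniteMeasure ν → NullSingletonClass ν → ∀ᵐ t ∂ν, 0 < ν (Iio t) := by
    intro ν _ _
    have h := lintegral_comp_measure_Iio (μ := ν) (φ := fun x => if x = 0 then 1 else 0)
      (Measurable.ite (measurableSet_singleton _) measurable_const measurable_const)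
    have h0 : ∫⁻ s in Ioo 0 (ν univ).toReal, (if ofReal s = 0 then (1:ℝ≥0∞) else 0) = 0 := by
      rw [← lintegral_zero (μ := volume.restrict (Ioo 0 (ν univ).toReal))]
      refine setLIntegral_congr_fun measurableSet_Ioo fun s hs => ?_
      simp [hs.1]
    rw [h0, lintegral_eq_zero_iff] at h
    · filter_upwards [h] with t ht
      by_contra h'
      simp only [not_lt, nonpos_iff_eq_zero] at h'
      simp [h'] at ht
    · exact Measurable.ite (measurable_measure_Iio (measurableSet_singleton (0:ℝ≥0∞)))
        measurable_const measurable_const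
  rw [ae_iff, ← nonpos_iff_eq_zero]
  have hu : {a | ¬0 < μ (Iio a)} ⊆ ⋃ n, ({a | ¬0 < μ (Iio a)} ∩ spanningSets μ n) := by
    rw [← inter_iUnion, iUnion_spanningSets, inter_univ]
  refine (measure_mono hu).trans ((measure_iUnion_null fun n => ?_).le)
  have : IsFiniteMeasure (μ.restrict (spanningSets μ n)) :=
    ⟨by simpa using measure_spanningSets_lt_top μ n⟩
  have h := key (μ.restrict (spanningSets μ n)) inferInstance inferInstance
  rw [ae_iff, Measure.restrict_apply' (measurableSet_spanningSets μ n)] at h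
  refine measure_mono_null (inter_subset_inter_left _ fun a ha => ?_) h
  simp only [not_lt, nonpos_iff_eq_zero, mem_ofPred_eq] at ha ⊢
  exact nonpos_iff_eq_zero.1 ((Measure.restrict_apply_le _ _).trans ha.le)

lemma lintegral_Ioo_measure_Iio_rpow_neg [NullSingletonClass μ] {p z y : ℝ} (hp : 1 < p) (hzy : z ≤ y)
    (hz : μ (Iio z) ≠ 0) (hy : μ (Iio y) ≠ ∞) :
    ofReal (p - 1) * ∫⁻ t in Ioo z y, μ (Iio t) ^ (-p) ∂μ
      = μ (Iio z) ^ (1 - p) - μ (Iio y) ^ (1 - p) := by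
  have : IsFiniteMeasure (μ.restrict (Iio y)) := ⟨by simpa using hy.lt_top⟩
  have hzy' : μ (Iio z) ≤ μ (Iio y) := monotone_measure_Iio hzy
  have hztop : μ (Iio z) ≠ ∞ := ne_top_of_le_ne_top hy hzy'
  set m := μ (Iio z) with hm
  set φ : ℝ≥0∞ → ℝ≥0∞ := fun x => (Ioi m).indicator (fun x => x ^ (-p)) x with hφ
  have hφm : Measurable φ := Measurable.indicator (by fun_prop) measurableSet_Ioi
  have h := lintegral_comp_measure_Iio (μ := μ.restrict (Iio y)) hφm
  have hnull : μ {t | z ≤ t ∧ t < y ∧ μ (Iio t) ≤ m} = 0 := by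
    set N := {t | z ≤ t ∧ t < y ∧ μ (Iio t) ≤ m}
    by_cases hN : N.Nonempty
    · have hb : BddAbove N := ⟨y, fun t ht => ht.2.1.le⟩
      have hsub : N ⊆ Icc z (sSup N) := fun t ht => ⟨ht.1, le_csSup hb ht⟩
      refine measure_mono_null hsub ?_
      have hlim : μ (Iio (sSup N)) ≤ m := by
        obtain ⟨u, hum, hu, huN⟩ := exists_seq_tendsto_sSup hN hb
        have : Iio (sSup N) ⊆ ⋃ n, Iio (u n) := by
          intro x hx
          obtain ⟨n, hn⟩ := (hu.eventually (lt_mem_nhds hx)).exists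
          exact mem_iUnion.2 ⟨n, hn⟩
        refine (measure_mono this).trans ?_
        rw [Monotone.measure_iUnion (fun a b hab => Iio_subset_Iio (hum hab))]
        exact iSup_le fun n => (huN n).2.2
      rw [measure_congr (Ico_ae_eq_Icc (μ := μ)).symm, ← Iio_sdiff_Iio,
        measure_sdiff (Iio_subset_Iio ?_) measurableSet_Iio.nullMeasurableSet hztop]
      · exact tsub_eq_zero_of_le hlim
      · obtain ⟨t, ht⟩ := hN
        exact ht.1.trans (le_csSup hb ht)
    · rw [not_nonempty_iff_eq_empty.1 hN, measure_empty]
  have h1 : ∫⁻ t in Iio y, φ ((μ.restrict (Iio y)) (Iio t)) ∂μ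
      = ∫⁻ t in Ioo z y, μ (Iio t) ^ (-p) ∂μ := by
    have e1 : ∫⁻ t in Iio y, φ ((μ.restrict (Iio y)) (Iio t)) ∂μ
        = ∫⁻ t in Iio y, (Ioo z y).indicator (fun t => μ (Iio t) ^ (-p)) t ∂μ := by
      have hae : ∀ᵐ t ∂μ, ¬ (z ≤ t ∧ t < y ∧ μ (Iio t) ≤ m) := by rw [ae_iff]; simpa using hnull
      refine setLIntegral_congr_fun_ae measurableSet_Iio ?_
      filter_upwards [hae] with t ht hty
      rw [restrict_Iio_Iio (le_of_lt hty)]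
      simp only [hφ, indicator]
      by_cases hzt : z < t
      · have : m < μ (Iio t) := by
          by_contra h'
          exact ht ⟨hzt.le, hty, not_lt.1 h'⟩
        rw [if_pos (mem_Ioi.2 this), if_pos ⟨hzt, hty⟩]
      · have : ¬ (m < μ (Iio t)) := not_lt.2 (monotone_measure_Iio (not_lt.1 hzt))
        rw [if_neg (by simpa using this), if_neg (fun h => hzt h.1)]
    rw [e1, lintegral_indicator measurableSet_Ioo, restrict_restrict measurableSet_Ioo,
      inter_eq_left.2 Ioo_subset_Iio_self]
  rw [h1, restrict_apply_univ] at h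
  have hm0 : 0 < m.toReal := toReal_pos hz hztop
  have h2 : ∫⁻ s in Ioo 0 (μ (Iio y)).toReal, φ (ofReal s)
      = ∫⁻ s in Ioo m.toReal (μ (Iio y)).toReal, ofReal s ^ (-p) := by
    have : ∀ s ∈ Ioo (0:ℝ) (μ (Iio y)).toReal, φ (ofReal s)
        = (Ioo m.toReal (μ (Iio y)).toReal).indicator (fun s => ofReal s ^ (-p)) s := by
      intro s hs
      have : m < ofReal s ↔ m.toReal < s := ENNReal.lt_ofReal_iff_toReal_lt hztop
      simp only [hφ, indicator, mem_Ioi, this, mem_Ioo, hs.2, and_true]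
    rw [setLIntegral_congr_fun measurableSet_Ioo this, lintegral_indicator measurableSet_Ioo,
      restrict_restrict measurableSet_Ioo, inter_eq_left.2 (Ioo_subset_Ioo_left hm0.le)]
  have hM0 : 0 < (μ (Iio y)).toReal := hm0.trans_le (toReal_mono hy hzy')
  rw [h, h2, lintegral_Ioo_rpow_neg hp hm0 (toReal_mono hy hzy'), ENNReal.ofReal_sub _ (by positivity),
    ← ofReal_rpow_of_pos hm0, ← ofReal_rpow_of_pos hM0, ofReal_toReal hztop,
    ofReal_toReal hy]

lemma setLIntegral_Ioi_eq_iSup (g : ℝ → ℝ≥0∞) (z : ℝ) :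
    ∫⁻ t in Ioi z, g t ∂μ = ⨆ n : ℕ, ∫⁻ t in Ioo z (z + n), g t ∂μ := by
  have : Ioi z = ⋃ n : ℕ, Ioo z (z + n) := by
    ext x
    simp only [mem_Ioi, mem_iUnion, mem_Ioo]
    refine ⟨fun h => ?_, fun ⟨n, h⟩ => h.1⟩
    obtain ⟨n, hn⟩ := exists_nat_gt (x - z)
    exact ⟨n, h, by linarith⟩
  rw [this, setLIntegral_iUnion_of_directed]
  exact Monotone.directed_le fun a b hab => Ioo_subset_Ioo_right (by gcongr)

lemma lintegral_Ioi_measure_Iio_rpow_neg_le [NullSingletonClass μ] {p : ℝ} (hp : 1 < p) (z : ℝ)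
    (hfin : ∀ y, μ (Iio y) ≠ ∞) :
    ofReal (p - 1) * ∫⁻ t in Ioi z, μ (Iio t) ^ (-p) ∂μ ≤ μ (Iio z) ^ (1 - p) := by
  rcases eq_or_ne (μ (Iio z)) 0 with h0 | h0
  · rw [h0, ENNReal.zero_rpow_of_neg (by linarith)]
    exact le_top
  rw [setLIntegral_Ioi_eq_iSup, mul_iSup]
  refine iSup_le fun n => ?_
  rw [lintegral_Ioo_measure_Iio_rpow_neg hp (by simp) h0 (hfin _)]
  exact tsub_le_self

lemma inv_measure_Iio_le [NullSingletonClass μ] {z : ℝ} (hfin : ∀ y, μ (Iio y) ≠ ∞) (h0 : μ (Iio z) ≠ 0) :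
    (μ (Iio z))⁻¹ ≤ ∫⁻ t in Ioi z, μ (Iio t) ^ (-2 : ℝ) ∂μ + (μ univ)⁻¹ := by
  have key : ∀ n : ℕ, (μ (Iio z))⁻¹ ≤ ∫⁻ t in Ioi z, μ (Iio t) ^ (-2 : ℝ) ∂μ
      + (μ (Iio (z + n)))⁻¹ := by
    intro n
    have h := lintegral_Ioo_measure_Iio_rpow_neg (μ := μ) (p := 2) (z := z) (y := z + n)
      (by norm_num) (by simp) h0 (hfin _)
    norm_num at h
    rw [rpow_neg_one, rpow_neg_one] at h
    calc (μ (Iio z))⁻¹ ≤ ((μ (Iio z))⁻¹ - (μ (Iio (z + n)))⁻¹) + (μ (Iio (z + n)))⁻¹ :=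
          le_tsub_add
      _ ≤ _ := by
          rw [← h]
          gcongr
          exact Ioo_subset_Ioi_self
  have hlim : Tendsto (fun n : ℕ => ∫⁻ t in Ioi z, μ (Iio t) ^ (-2 : ℝ) ∂μ
      + (μ (Iio (z + n)))⁻¹) atTop
      (𝓝 (∫⁻ t in Ioi z, μ (Iio t) ^ (-2 : ℝ) ∂μ + (μ univ)⁻¹)) := by
    refine tendsto_const_nhds.add (tendsto_inv_iff.2 ?_)
    have he : (⋃ n : ℕ, Iio (z + n : ℝ)) = univ := by
      ext x
      simp only [mem_iUnion, mem_Iio, mem_univ, iff_true]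
      obtain ⟨n, hn⟩ := exists_nat_gt (x - z)
      exact ⟨n, by linarith⟩
    rw [← he]
    exact tendsto_measure_iUnion_atTop fun a b hab => Iio_subset_Iio (by gcongr)
  exact ge_of_tendsto' hlim key

/-! ### Reflection -/

/-- The reflected measure. -/
def refl (μ : Measure ℝ) : Measure ℝ := μ.map Neg.neg

lemma refl_apply (s : Set ℝ) : refl μ s = μ (Neg.neg ⁻¹' s) :=
  (MeasurableEquiv.neg ℝ).map_apply s

lemma refl_Iio (t : ℝ) : refl μ (Iio t) = μ (Ioi (-t)) := by rw [refl_apply]; simp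

lemma refl_Ioi (t : ℝ) : refl μ (Ioi t) = μ (Iio (-t)) := by rw [refl_apply]; simp

instance [NullSingletonClass μ] : NullSingletonClass (refl μ) :=
  ⟨fun x => by rw [refl_apply]; simp⟩

instance [SigmaFinite μ] : SigmaFinite (refl μ) := (MeasurableEquiv.neg ℝ).sigmaFinite_map

instance [IsFiniteMeasure μ] : IsFiniteMeasure (refl μ) := Measure.isFiniteMeasure_map _ _

lemma lintegral_refl (g : ℝ → ℝ≥0∞) : ∫⁻ t, g t ∂(refl μ) = ∫⁻ t, g (-t) ∂μ :=
  (MeasurableEquiv.neg ℝ).measurableEmbedding.lintegral_map _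

lemma setLIntegral_refl_Iio (g : ℝ → ℝ≥0∞) (y : ℝ) :
    ∫⁻ t in Iio y, g t ∂(refl μ) = ∫⁻ t in Ioi (-y), g (-t) ∂μ := by
  rw [← lintegral_indicator measurableSet_Iio, lintegral_refl,
    ← lintegral_indicator measurableSet_Ioi]
  refine lintegral_congr fun t => ?_
  simp [indicator, neg_lt]

lemma lintegral_Ioi_rpow [NullSingletonClass μ] {p y : ℝ} (hp : 0 < p) (hy : μ (Ioi y) ≠ ∞) :
    ofReal p * ∫⁻ t in Ioi y, μ (Ioi t) ^ (p - 1) ∂μ = μ (Ioi y) ^ p := by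
  have h := lintegral_Iio_rpow (μ := refl μ) (y := -y) hp (by rwa [refl_Iio, neg_neg])
  rw [setLIntegral_refl_Iio, refl_Iio, neg_neg] at h
  simpa only [refl_Iio, neg_neg] using h

end Atomless

/-! ### Monotone approximation -/

/-- `F n` increases to `f`. -/
def Appr (F : ℕ → ℝ≥0∞) (f : ℝ≥0∞) : Prop := Monotone F ∧ ⨆ n, F n = f

namespace Appr

variable {F G : ℕ → ℝ≥0∞} {f g : ℝ≥0∞}

lemma const (f : ℝ≥0∞) : Appr (fun _ => f) f := ⟨monotone_const, by simp⟩

lemma le_of_forall_le (h : Appr F f) {B : ℝ≥0∞} (hB : ∀ n, F n ≤ B) : f ≤ B :=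
  h.2 ▸ iSup_le hB

lemma le (h : Appr F f) (n : ℕ) : F n ≤ f := h.2 ▸ le_iSup F n

lemma mul (hF : Appr F f) (hG : Appr G g) : Appr (fun n => F n * G n) (f * g) := by
  refine ⟨fun m n h => mul_le_mul' (hF.1 h) (hG.1 h), le_antisymm ?_ ?_⟩
  · exact iSup_le fun n => mul_le_mul' (hF.le n) (hG.le n)
  · rw [← hF.2, ← hG.2, ENNReal.iSup_mul]
    refine iSup_le fun i => ?_
    rw [mul_iSup]
    refine iSup_le fun j => ?_
    exact (mul_le_mul' (hF.1 (le_max_left i j)) (hG.1 (le_max_right i j))).trans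
      (le_iSup (fun n => F n * G n) (max i j))

lemma rpow (hF : Appr F f) {e : ℝ} (he : 0 ≤ e) : Appr (fun n => F n ^ e) (f ^ e) := by
  rcases he.eq_or_lt with rfl | he
  · simpa using Appr.const 1
  · refine ⟨fun m n h => rpow_le_rpow (hF.1 h) he.le, ?_⟩
    rw [← hF.2]
    exact ((ENNReal.orderIsoRpow e he).map_iSup F).symm

lemma min_nat (f : ℝ≥0∞) : Appr (fun n : ℕ => min f n) f := by
  refine ⟨fun m n h => min_le_min le_rfl (by exact_mod_cast h), ?_⟩
  apply le_antisymm (iSup_le fun n => min_le_left _ _)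
  rcases eq_or_ne f ∞ with rfl | hf
  · simp [ENNReal.iSup_natCast]
  · obtain ⟨n, hn⟩ := ENNReal.exists_nat_gt hf
    exact (le_min le_rfl hn.le).trans (le_iSup (fun n : ℕ => min f n) n)

lemma indicator {α : Type*} {S : ℕ → Set α} (hS : Monotone S) (hU : ⋃ n, S n = univ)
    {F : ℕ → α → ℝ≥0∞} {f : α → ℝ≥0∞} {x : α} (h : Appr (fun n => F n x) (f x)) :
    Appr (fun n => (S n).indicator (F n) x) (f x) := by
  have h1 : Appr (fun n => (S n).indicator (fun _ => (1 : ℝ≥0∞)) x) 1 := by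
    refine ⟨fun m n hmn => ?_, ?_⟩
    · exact indicator_le_indicator_of_subset (hS hmn) (fun _ => zero_le) x
    · apply le_antisymm (iSup_le fun n => indicator_le_self' (fun _ _ => zero_le) x)
      obtain ⟨n, hn⟩ := mem_iUnion.1 (hU ▸ mem_univ x)
      refine le_trans ?_ (le_iSup _ n)
      rw [indicator_of_mem hn]
  have h2 := h1.mul h
  rw [one_mul] at h2
  convert h2 using 2 with n
  by_cases hx : x ∈ S n <;> simp [hx]

variable {α : Type*} [MeasurableSpace α] {μ : Measure α}

lemma lintegral {F : ℕ → α → ℝ≥0∞} {f : α → ℝ≥0∞} (hm : ∀ n, Measurable (F n))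
    (h : ∀ x, Appr (fun n => F n x) (f x)) : Appr (fun n => ∫⁻ x, F n x ∂μ) (∫⁻ x, f x ∂μ) := by
  refine ⟨fun m n hmn => lintegral_mono fun x => (h x).1 hmn, ?_⟩
  rw [← lintegral_iSup hm fun m n hmn x => (h x).1 hmn]
  exact lintegral_congr fun x => (h x).2

lemma lintegral_restrict {S : ℕ → Set α} (hS : Monotone S) (hU : ⋃ n, S n = univ)
    (hSm : ∀ n, MeasurableSet (S n)) {F : ℕ → α → ℝ≥0∞} {f : α → ℝ≥0∞}
    (hm : ∀ n, Measurable (F n)) (h : ∀ x, Appr (fun n => F n x) (f x)) :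
    Appr (fun n => ∫⁻ x in S n, F n x ∂μ) (∫⁻ x, f x ∂μ) := by
  have := Appr.lintegral (μ := μ) (F := fun n => (S n).indicator (F n)) (f := f)
    (fun n => (hm n).indicator (hSm n)) fun x => Appr.indicator hS hU (h x)
  convert this using 2 with n
  rw [lintegral_indicator (hSm n)]

lemma setLIntegral_restrict {S : ℕ → Set α} (hS : Monotone S) (hU : ⋃ n, S n = univ)
    (hSm : ∀ n, MeasurableSet (S n)) {F : ℕ → α → ℝ≥0∞} {f : α → ℝ≥0∞}
    (hm : ∀ n, Measurable (F n)) (h : ∀ x, Appr (fun n => F n x) (f x)) {T : Set α}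
    (hT : MeasurableSet T) :
    Appr (fun n => ∫⁻ x in T, F n x ∂(μ.restrict (S n))) (∫⁻ x in T, f x ∂μ) := by
  have := Appr.lintegral_restrict (μ := μ.restrict T) hS hU hSm hm h
  convert this using 2 with n
  rw [Measure.restrict_comm hT]

lemma measure_restrict {S : ℕ → Set α} (hS : Monotone S) (hU : ⋃ n, S n = univ)
    (hSm : ∀ n, MeasurableSet (S n)) {T : Set α} (hT : MeasurableSet T) :
    Appr (fun n => (μ.restrict (S n)) T) (μ T) := by
  have := Appr.setLIntegral_restrict (μ := μ) hS hU hSm (F := fun _ _ => 1) (f := fun _ => 1)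
    (fun n => measurable_const) (fun x => Appr.const 1) hT
  simpa using this

end Appr

/-! ### Elementary inequalities -/

lemma measurable_mul' {α : Type*} [MeasurableSpace α] {f g : α → ℝ≥0∞} (hf : Measurable f)
    (hg : Measurable g) : Measurable fun x => f x * g x := hf.mul hg

/-- Absorption of a finite quantity. -/
lemma rpow_le_of_le_mul_rpow {X C : ℝ≥0∞} {θ : ℝ} (hX : X ≠ ∞) (hθ : 0 < θ)
    (h : X ≤ C * X ^ (1 - θ)) : X ^ θ ≤ C := by
  rcases eq_or_ne X 0 with rfl | h0
  · rw [zero_rpow_of_pos hθ]; exact zero_le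
  have h1 : X ^ θ * X ^ (1 - θ) ≤ C * X ^ (1 - θ) := by
    rw [← rpow_add _ _ h0 hX]
    simpa using h
  exact (ENNReal.mul_le_mul_iff_left (rpow_pos (pos_iff_ne_zero.2 h0) hX).ne'
    (rpow_ne_top_of_ne_zero h0 hX)).1 h1

lemma lintegral_rpow_mul_le {α : Type*} [MeasurableSpace α] {μ : Measure α} {f g : α → ℝ≥0∞}
    (hf : AEMeasurable f μ) (hg : AEMeasurable g μ) {θ : ℝ} (h0 : 0 ≤ θ) (h1 : θ ≤ 1) :
    ∫⁻ x, f x ^ θ * g x ^ (1 - θ) ∂μ ≤ (∫⁻ x, f x ∂μ) ^ θ * (∫⁻ x, g x ∂μ) ^ (1 - θ) := by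
  have := ENNReal.lintegral_prod_norm_pow_le (μ := μ) (Finset.univ : Finset (Fin 2))
    (f := ![f, g]) (p := ![θ, 1 - θ]) (by simp [Fin.forall_fin_two, hf, hg])
    (by simp [Fin.sum_univ_two]) (by simp [Fin.forall_fin_two, h0, h1])
  simpa [Fin.prod_univ_two] using this

lemma lintegral_rpow_mul_mul_le {α : Type*} [MeasurableSpace α] {μ : Measure α}
    {f g k : α → ℝ≥0∞} (hf : AEMeasurable f μ) (hg : AEMeasurable g μ) (hk : AEMeasurable k μ)
    {a b c : ℝ} (ha : 0 ≤ a) (hb : 0 ≤ b) (hc : 0 ≤ c) (habc : a + b + c = 1) :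
    ∫⁻ x, f x ^ a * g x ^ b * k x ^ c ∂μ
      ≤ (∫⁻ x, f x ∂μ) ^ a * (∫⁻ x, g x ∂μ) ^ b * (∫⁻ x, k x ∂μ) ^ c := by
  have := ENNReal.lintegral_prod_norm_pow_le (μ := μ) (Finset.univ : Finset (Fin 3))
    (f := ![f, g, k]) (p := ![a, b, c])
    (by intro i _; fin_cases i <;> simp [hf, hg, hk])
    (by simp [Fin.sum_univ_three, habc]) (by intro i _; fin_cases i <;> simp [ha, hb, hc])
  simpa [Fin.prod_univ_three] using this

/-- Hölder's inequality in the form `∫ f g ≤ (∫ f^{r'})^{1/r'} (∫ g^r)^{1/r}`. -/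
lemma lintegral_mul_le_conj {α : Type*} [MeasurableSpace α] {μ : Measure α} {f g : α → ℝ≥0∞}
    (hf : AEMeasurable f μ) (hg : AEMeasurable g μ) {r : ℝ} (hr : 1 < r) : ∫⁻ x, f x * g x ∂μ
      ≤ (∫⁻ x, f x ^ (r / (r - 1)) ∂μ) ^ (1 - 1 / r) * (∫⁻ x, g x ^ r ∂μ) ^ (1 / r) := by
  have hr0 : 0 < r := by linarith
  have h := lintegral_rpow_mul_le (μ := μ) (hf.pow_const (r / (r - 1))) (hg.pow_const r)
    (θ := 1 - 1 / r) (by rw [sub_nonneg, div_le_one hr0]; exact hr.le)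
    (by have : 0 < 1 / r := by positivity
        linarith)
  have e1 : r / (r - 1) * (1 - 1 / r) = 1 := by
    have : r - 1 ≠ 0 := by linarith
    field_simp
  have e2 : r * (1 - (1 - 1 / r)) = 1 := by field_simp; ring
  have e3 : 1 - (1 - 1 / r) = 1 / r := by ring
  rw [e3] at h e2
  simpa only [← rpow_mul, e1, e2, rpow_one] using h

/-- Converse of Hölder's inequality. -/
lemma lintegral_rpow_conj_le {α : Type*} [MeasurableSpace α] {μ : Measure α} [SigmaFinite μ]
    {G : α → ℝ≥0∞} (hG : Measurable G) {r : ℝ} (hr : 1 < r) {C : ℝ≥0∞}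
    (h : ∀ E : α → ℝ≥0∞, Measurable E → ∫⁻ x, G x * E x ∂μ ≤ C * (∫⁻ x, E x ^ r ∂μ) ^ (1 / r)) :
    (∫⁻ x, G x ^ (r / (r - 1)) ∂μ) ^ (1 - 1 / r) ≤ C := by
  have hr0 : 0 < r := by linarith
  have hr1 : 0 < r - 1 := by linarith
  have hθ : 0 < 1 - 1 / r := by rw [sub_pos, div_lt_one hr0]; exact hr
  have ha := (Appr.lintegral_restrict (μ := μ) (monotone_spanningSets μ) (iUnion_spanningSets μ)
    (measurableSet_spanningSets μ) (F := fun n x => min (G x) n ^ (r / (r - 1)))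
    (f := fun x => G x ^ (r / (r - 1))) (fun n => (hG.min measurable_const).pow_const _)
    (fun x => (Appr.min_nat (G x)).rpow (by positivity))).rpow hθ.le
  refine ha.le_of_forall_le fun n => ?_
  set S := spanningSets μ n
  have hS : MeasurableSet S := measurableSet_spanningSets μ n
  set X := ∫⁻ x in S, min (G x) n ^ (r / (r - 1)) ∂μ
  have hX : X ≠ ∞ := by
    refine ne_top_of_le_ne_top (b := ∫⁻ x in S, (n : ℝ≥0∞) ^ (r / (r - 1)) ∂μ) ?_ ?_
    · rw [lintegral_const, restrict_apply_univ]
      exact mul_ne_top (rpow_ne_top_of_nonneg (by positivity) (by simp))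
        (measure_spanningSets_lt_top μ n).ne
    · exact lintegral_mono fun x => rpow_le_rpow (min_le_right _ _) (by positivity)
  refine rpow_le_of_le_mul_rpow hX hθ ?_
  have hE := h (S.indicator fun x => min (G x) n ^ (1 / (r - 1)))
    (((hG.min measurable_const).pow_const _).indicator hS)
  have e3 : 1 - (1 - 1 / r) = 1 / r := by ring
  rw [e3]
  have l1 : X ≤ ∫⁻ x, G x * S.indicator (fun x => min (G x) n ^ (1 / (r - 1))) x ∂μ := by
    rw [show X = _ from (lintegral_indicator hS _).symm]
    refine lintegral_mono fun x => ?_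
    by_cases hx : x ∈ S
    · simp only [indicator_of_mem hx]
      have : r / (r - 1) = 1 + 1 / (r - 1) := by field_simp; ring
      rw [this, rpow_add_of_nonneg _ _ (by norm_num) (by positivity), rpow_one]
      gcongr
      exact min_le_left _ _
    · simp [hx]
  have l2 : ∫⁻ x, S.indicator (fun x => min (G x) n ^ (1 / (r - 1))) x ^ r ∂μ = X := by
    rw [show X = _ from (lintegral_indicator hS _).symm]
    refine lintegral_congr fun x => ?_
    by_cases hx : x ∈ S
    · simp only [indicator_of_mem hx, ← rpow_mul]
      congr 1
      field_simp
    · simp [hx, hr0]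
  rw [l2] at hE
  exact l1.trans hE

/-! ### Integrals over half-lines -/

section

variable {μ ω ν : Measure ℝ}

instance {g : ℝ → ℝ≥0∞} [NullSingletonClass μ] : NullSingletonClass (μ.withDensity g) :=
  ⟨fun x => withDensity_absolutelyContinuous μ g (measure_singleton x)⟩

lemma measurable_lintegral_Iio (g : ℝ → ℝ≥0∞) : Measurable fun y => ∫⁻ t in Iio y, g t ∂μ :=
  Monotone.measurable fun _ _ h => lintegral_mono_set (Iio_subset_Iio h)

lemma measurable_lintegral_Ioi (g : ℝ → ℝ≥0∞) : Measurable fun y => ∫⁻ t in Ioi y, g t ∂μ :=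
  Antitone.measurable fun _ _ h => lintegral_mono_set (Ioi_subset_Ioi h)

lemma lintegral_Iio_mul_rpow [NullSingletonClass μ] {g : ℝ → ℝ≥0∞} (hg : Measurable g) {s y : ℝ}
    (hs : 0 < s) (hy : ∫⁻ t in Iio y, g t ∂μ ≠ ∞) :
    ofReal s * ∫⁻ t in Iio y, (∫⁻ u in Iio t, g u ∂μ) ^ (s - 1) * g t ∂μ
      = (∫⁻ t in Iio y, g t ∂μ) ^ s := by
  have h := lintegral_Iio_rpow (μ := μ.withDensity g) (y := y) hs
    (by rwa [withDensity_apply _ measurableSet_Iio])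
  rw [setLIntegral_withDensity_eq_setLIntegral_mul _ hg
    (measurable_measure_Iio.pow_const _) measurableSet_Iio] at h
  simp only [withDensity_apply _ measurableSet_Iio, Pi.mul_apply] at h
  rw [← h]
  simp only [mul_comm]

/-- Tonelli's theorem for the triangle `t < y`. -/
lemma lintegral_lintegral_Iio [SFinite μ] [SFinite ω] {Φ : ℝ → ℝ → ℝ≥0∞}
    (hΦ : Measurable (Function.uncurry Φ)) :
    ∫⁻ y, ∫⁻ t in Iio y, Φ t y ∂μ ∂ω = ∫⁻ t, ∫⁻ y in Ioi t, Φ t y ∂ω ∂μ := by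
  have h1 : ∀ y, ∫⁻ t in Iio y, Φ t y ∂μ
      = ∫⁻ t, {p : ℝ × ℝ | p.1 < p.2}.indicator (Function.uncurry Φ) (t, y) ∂μ := by
    intro y
    rw [← lintegral_indicator measurableSet_Iio]
    rfl
  have h2 : ∀ t, ∫⁻ y in Ioi t, Φ t y ∂ω
      = ∫⁻ y, {p : ℝ × ℝ | p.1 < p.2}.indicator (Function.uncurry Φ) (t, y) ∂ω := by
    intro y
    rw [← lintegral_indicator measurableSet_Ioi]
    rfl
  simp_rw [h1, h2]
  rw [lintegral_lintegral_swap]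
  have hm : Measurable ({p : ℝ × ℝ | p.1 < p.2}.indicator (Function.uncurry Φ)) :=
    hΦ.indicator (measurableSet_lt measurable_fst measurable_snd)
  exact (hm.comp measurable_swap).aemeasurable

lemma lintegral_lintegral_Iio_mul [SFinite μ] [SFinite ω] {φ ψ : ℝ → ℝ≥0∞} (hφ : Measurable φ)
    (hψ : Measurable ψ) :
    ∫⁻ y, (∫⁻ t in Iio y, φ t ∂μ) * ψ y ∂ω = ∫⁻ t, φ t * ∫⁻ y in Ioi t, ψ y ∂ω ∂μ := by
  have h := lintegral_lintegral_Iio (μ := μ) (ω := ω) (Φ := fun t y => φ t * ψ y) (by fun_prop)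
  simp_rw [lintegral_mul_const _ hφ, lintegral_const_mul _ hψ] at h
  exact h

lemma lintegral_lintegral_Ioi_mul [SFinite μ] [SFinite ω] {φ ψ : ℝ → ℝ≥0∞} (hφ : Measurable φ)
    (hψ : Measurable ψ) :
    ∫⁻ y, (∫⁻ t in Ioi y, φ t ∂μ) * ψ y ∂ω = ∫⁻ t, φ t * ∫⁻ y in Iio t, ψ y ∂ω ∂μ := by
  have h := lintegral_lintegral_Iio_mul (μ := ω) (ω := μ) hψ hφ
  simp_rw [mul_comm]
  rw [← h]
  simp_rw [mul_comm]

/-! ### Averages -/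

lemma lintegral_average_rpow_le_of_bdd [IsFiniteMeasure μ] [NullSingletonClass μ] {g : ℝ → ℝ≥0∞}
    (hg : Measurable g) {c : ℝ≥0∞} (hc : c ≠ ∞) (hgc : ∀ t, g t ≤ c) {r : ℝ} (hr : 1 < r) :
    ∫⁻ y, ((∫⁻ t in Iio y, g t ∂μ) * (μ (Iio y))⁻¹) ^ r ∂μ
      ≤ ofReal (r / (r - 1)) ^ r * ∫⁻ t, g t ^ r ∂μ := by
  have hr0 : 0 < r := by linarith
  have hr1 : 0 < r - 1 := by linarith
  set H : ℝ → ℝ≥0∞ := fun y => ∫⁻ t in Iio y, g t ∂μ with hH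
  set M : ℝ → ℝ≥0∞ := fun y => μ (Iio y) with hM
  have hHm : Measurable H := measurable_lintegral_Iio g
  have hMm : Measurable M := measurable_measure_Iio
  have hHM : ∀ y, H y ≤ c * M y := fun y => by
    calc H y ≤ ∫⁻ t in Iio y, c ∂μ := lintegral_mono fun t => hgc t
      _ = c * M y := by simp [hM]
  have hMfin : ∀ y, M y ≠ ∞ := fun y => measure_ne_top _ _
  have hHfin : ∀ y, H y ≠ ∞ := fun y => ne_top_of_le_ne_top (mul_ne_top hc (hMfin y)) (hHM y)
  set X := ∫⁻ y, (H y * (M y)⁻¹) ^ r ∂μ with hX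
  have hXfin : X ≠ ∞ := by
    refine ne_top_of_le_ne_top (b := ∫⁻ y, c ^ r ∂μ) ?_ (lintegral_mono fun y => ?_)
    · rw [lintegral_const]
      exact mul_ne_top (rpow_ne_top_of_nonneg hr0.le hc) (measure_ne_top _ _)
    · gcongr
      exact ENNReal.div_le_of_le_mul (hHM y)
  have hkey : ofReal (r - 1) * X
      ≤ ofReal r * ∫⁻ u, (H u * (M u)⁻¹) ^ (r - 1) * g u ∂μ := by
    have e1 : X = ofReal r * ∫⁻ y, (∫⁻ t in Iio y, H t ^ (r - 1) * g t ∂μ)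
        * (M y) ^ (-r) ∂μ := by
      rw [← lintegral_const_mul _ (measurable_mul' (measurable_lintegral_Iio _) (hMm.pow_const _))]
      refine lintegral_congr fun y => ?_
      rw [← mul_assoc, lintegral_Iio_mul_rpow hg hr0 (hHfin y), mul_rpow_of_nonneg _ _ hr0.le,
        inv_rpow, rpow_neg]
    rw [e1, lintegral_lintegral_Iio_mul (measurable_mul' (hHm.pow_const _) hg) (hMm.pow_const _), mul_left_comm,
      ← lintegral_const_mul _ (measurable_mul' (measurable_mul' (hHm.pow_const _) hg) (measurable_lintegral_Ioi _))]
    gcongr ofReal r * ?_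
    refine lintegral_mono fun u => ?_
    calc ofReal (r - 1) * (H u ^ (r - 1) * g u * ∫⁻ y in Ioi u, M y ^ (-r) ∂μ)
        = H u ^ (r - 1) * g u * (ofReal (r - 1) * ∫⁻ y in Ioi u, M y ^ (-r) ∂μ) := by ring
      _ ≤ H u ^ (r - 1) * g u * M u ^ (1 - r) := by
          gcongr
          exact lintegral_Ioi_measure_Iio_rpow_neg_le hr u hMfin
      _ = (H u * (M u)⁻¹) ^ (r - 1) * g u := by
          rw [mul_rpow_of_nonneg _ _ hr1.le, inv_rpow, ← rpow_neg, neg_sub]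
          ring
  have hhol : ∫⁻ u, (H u * (M u)⁻¹) ^ (r - 1) * g u ∂μ
      ≤ X ^ (1 - 1 / r) * (∫⁻ t, g t ^ r ∂μ) ^ (1 / r) := by
    have h := lintegral_mul_le_conj (μ := μ) ((measurable_mul' hHm hMm.inv).pow_const (r - 1)).aemeasurable
      hg.aemeasurable hr
    have e : (r - 1) * (r / (r - 1)) = r := by field_simp
    simpa only [← rpow_mul, e, Pi.inv_apply] using h
  have h3 : X ≤ (ofReal (r / (r - 1)) * (∫⁻ t, g t ^ r ∂μ) ^ (1 / r)) * X ^ (1 - 1 / r) := by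
    have h4 := hkey.trans (mul_le_mul_right hhol _)
    have h5 : ofReal (r - 1) * ofReal (r / (r - 1)) = ofReal r := by
      rw [← ofReal_mul hr1.le]
      congr 1
      field_simp
    rw [← h5, mul_assoc] at h4
    have h6 := (ENNReal.mul_le_mul_iff_right (by simpa using hr) ofReal_ne_top).1 h4
    refine h6.trans (le_of_eq ?_)
    ring
  have h7 := rpow_le_of_le_mul_rpow hXfin (by positivity) h3
  calc X = (X ^ (1 / r)) ^ r := by rw [← rpow_mul]; simp [hr0.ne']
    _ ≤ (ofReal (r / (r - 1)) * (∫⁻ t, g t ^ r ∂μ) ^ (1 / r)) ^ r := by gcongr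
    _ = _ := by
        rw [mul_rpow_of_nonneg _ _ hr0.le, ← rpow_mul, one_div,
          inv_mul_cancel₀ hr0.ne', rpow_one]

/-- Hardy's inequality for averages with respect to an atomless measure. -/
lemma lintegral_average_rpow_le [SigmaFinite μ] [NullSingletonClass μ] {g : ℝ → ℝ≥0∞}
    (hg : Measurable g) {r : ℝ} (hr : 1 < r) :
    ∫⁻ y, ((∫⁻ t in Iio y, g t ∂μ) * (μ (Iio y))⁻¹) ^ r ∂μ
      ≤ ofReal (r / (r - 1)) ^ r * ∫⁻ t, g t ^ r ∂μ := by
  have hr0 : 0 < r := by linarith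
  have ha := Appr.lintegral_restrict (μ := μ) (monotone_spanningSets μ) (iUnion_spanningSets μ)
    (measurableSet_spanningSets μ)
    (F := fun n y => ((∫⁻ t in Iio y, min (g t) n ∂(μ.restrict (spanningSets μ n)))
      * (μ (Iio y))⁻¹) ^ r)
    (f := fun y => ((∫⁻ t in Iio y, g t ∂μ) * (μ (Iio y))⁻¹) ^ r)
    (fun n => ((measurable_lintegral_Iio _).mul measurable_measure_Iio.inv).pow_const _)
    (fun y => Appr.rpow (Appr.mul (Appr.setLIntegral_restrict (monotone_spanningSets μ)
      (iUnion_spanningSets μ) (measurableSet_spanningSets μ)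
      (fun n => hg.min measurable_const) (fun t => Appr.min_nat (g t)) measurableSet_Iio)
      (Appr.const _)) hr0.le)
  refine ha.le_of_forall_le fun n => ?_
  have : IsFiniteMeasure (μ.restrict (spanningSets μ n)) :=
    ⟨by simpa using measure_spanningSets_lt_top μ n⟩
  refine le_trans (lintegral_mono fun y => ?_) ((lintegral_average_rpow_le_of_bdd
    (μ := μ.restrict (spanningSets μ n)) (g := fun t => min (g t) n) (hg.min measurable_const)
    (c := n) (by simp) (fun t => min_le_right _ _) hr).trans ?_)
  · gcongr
    exact restrict_le_self
  · refine mul_le_mul_right ?_ _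
    refine (lintegral_mono fun t => ?_).trans (lintegral_mono' restrict_le_self le_rfl)
    exact rpow_le_rpow (min_le_left _ _) hr0.le

end

section

variable {μ ω : Measure ℝ}

/-! ### The two-measure Hardy inequality -/

lemma Appr.unique {F : ℕ → ℝ≥0∞} {f g : ℝ≥0∞} (hf : Appr F f) (hg : Appr F g) : f = g :=
  hf.2.symm.trans hg.2

lemma Appr.congr {F G : ℕ → ℝ≥0∞} {f : ℝ≥0∞} (hf : Appr F f) (h : ∀ n, F n = G n) : Appr G f := by
  rwa [show F = G from funext h] at hf

lemma appr_lintegral_Iio [SigmaFinite μ] {g : ℝ → ℝ≥0∞} (hg : Measurable g) (y : ℝ) :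
    Appr (fun n : ℕ => ∫⁻ t in Iio y, min (g t) n ∂(μ.restrict (spanningSets μ n)))
      (∫⁻ t in Iio y, g t ∂μ) :=
  Appr.setLIntegral_restrict (monotone_spanningSets μ) (iUnion_spanningSets μ)
    (measurableSet_spanningSets μ) (fun _ => hg.min measurable_const)
    (fun t => Appr.min_nat (g t)) measurableSet_Iio

lemma appr_lintegral_spanningSets [SigmaFinite μ] {F : ℕ → ℝ → ℝ≥0∞} {f : ℝ → ℝ≥0∞}
    (hm : ∀ n, Measurable (F n)) (h : ∀ x, Appr (fun n => F n x) (f x)) :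
    Appr (fun n => ∫⁻ x in spanningSets μ n, F n x ∂μ) (∫⁻ x, f x ∂μ) :=
  Appr.lintegral_restrict (monotone_spanningSets μ) (iUnion_spanningSets μ)
    (measurableSet_spanningSets μ) hm h

lemma appr_measure_spanningSets [SigmaFinite μ] {T : Set ℝ} (hT : MeasurableSet T) :
    Appr (fun n => (μ.restrict (spanningSets μ n)) T) (μ T) :=
  Appr.measure_restrict (monotone_spanningSets μ) (iUnion_spanningSets μ)
    (measurableSet_spanningSets μ) hT

lemma isFiniteMeasure_restrict_spanningSets [SigmaFinite μ] (n : ℕ) :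
    IsFiniteMeasure (μ.restrict (spanningSets μ n)) :=
  ⟨by simpa using measure_spanningSets_lt_top μ n⟩

lemma lintegral_Iio_ne_top_of_bdd [IsFiniteMeasure μ] {g : ℝ → ℝ≥0∞} {c : ℝ≥0∞} (hc : c ≠ ∞)
    (hgc : ∀ t, g t ≤ c) (y : ℝ) : ∫⁻ t in Iio y, g t ∂μ ≠ ∞ := by
  refine ne_top_of_le_ne_top (b := c * μ (Iio y)) (mul_ne_top hc (measure_ne_top _ _)) ?_
  calc ∫⁻ t in Iio y, g t ∂μ ≤ ∫⁻ t in Iio y, c ∂μ := lintegral_mono fun t => hgc t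
    _ = _ := by simp

/-- Integrated form of the power rule. -/
lemma lintegral_lintegral_Iio_rpow [SigmaFinite μ] [NullSingletonClass μ] [SFinite ω]
    {g : ℝ → ℝ≥0∞} (hg : Measurable g) {s : ℝ} (hs : 1 ≤ s) : ∫⁻ y, (∫⁻ t in Iio y, g t ∂μ) ^ s ∂ω
      = ofReal s * ∫⁻ t, (∫⁻ u in Iio t, g u ∂μ) ^ (s - 1) * g t * ω (Ioi t) ∂μ := by
  have hs0 : 0 < s := by linarith
  have a1 := Appr.lintegral (μ := ω) (fun n => (measurable_lintegral_Iio _).pow_const s)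
    (fun y => (appr_lintegral_Iio (μ := μ) hg y).rpow hs0.le)
  refine a1.unique (Appr.congr (Appr.mul (Appr.const (ofReal s))
    (appr_lintegral_spanningSets (μ := μ) (fun n => measurable_mul'
      (measurable_mul' ((measurable_lintegral_Iio _).pow_const (s - 1)) (hg.min measurable_const))
        measurable_measure_Ioi) (fun t => Appr.mul (Appr.mul
        ((appr_lintegral_Iio (μ := μ) hg t).rpow (sub_nonneg.2 hs)) (Appr.min_nat (g t)))
        (Appr.const (ω (Ioi t)))))) fun n => ?_)
  have := isFiniteMeasure_restrict_spanningSets (μ := μ) n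
  have hm : Measurable fun t => min (g t) n := hg.min measurable_const
  have e := lintegral_lintegral_Iio_mul (μ := μ.restrict (spanningSets μ n)) (ω := ω)
    (φ := fun t => (∫⁻ u in Iio t, min (g u) n ∂(μ.restrict (spanningSets μ n))) ^ (s - 1)
      * min (g t) n) (ψ := fun _ => 1)
    (measurable_mul' ((measurable_lintegral_Iio _).pow_const _) hm) measurable_const
  simp only [mul_one, lintegral_one, Measure.restrict_apply MeasurableSet.univ, univ_inter] at e
  rw [← e, ← lintegral_const_mul _ (measurable_lintegral_Iio _)]
  refine lintegral_congr fun y => ?_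
  rw [lintegral_Iio_mul_rpow hm hs0]
  exact lintegral_Iio_ne_top_of_bdd (c := n) (by simp) (fun t => min_le_right _ _) y

/-- The constant in the sufficiency part of Hardy's inequality. -/
def hardyC (r s e : ℝ) : ℝ≥0∞ := ofReal s * ofReal (r / (r - 1)) ^ e

lemma hardyC_ne_top {r s e : ℝ} (he : 0 ≤ e) : hardyC r s e ≠ ∞ :=
  mul_ne_top ofReal_ne_top (rpow_ne_top_of_nonneg he ofReal_ne_top)

lemma lintegral_Iio_le_holder {g : ℝ → ℝ≥0∞} (hg : Measurable g) {r : ℝ} (hr : 1 < r) (y : ℝ) :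
    ∫⁻ t in Iio y, g t ∂μ ≤ μ (Iio y) ^ (1 - 1 / r) * (∫⁻ t, g t ^ r ∂μ) ^ (1 / r) := by
  have hr0 : 0 < r := by linarith
  have h := lintegral_mul_le_conj (μ := μ.restrict (Iio y)) (f := fun _ => 1)
    aemeasurable_const hg.aemeasurable hr
  simp only [one_mul, one_rpow, lintegral_one, Measure.restrict_apply MeasurableSet.univ,
    univ_inter] at h
  refine h.trans (mul_le_mul_right (rpow_le_rpow ?_ (by positivity)) _)
  exact lintegral_mono' restrict_le_self le_rfl

/-- Sufficiency in Hardy's inequality, `1 < r ≤ s < ∞`. -/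
theorem hardy_le [SigmaFinite μ] [NullSingletonClass μ] [SFinite ω] {r s : ℝ} (hr : 1 < r)
    (hrs : r ≤ s) {A : ℝ≥0∞} (hA : ∀ x, ω (Ioi x) * μ (Iio x) ^ (s * (1 - 1 / r)) ≤ A)
    {g : ℝ → ℝ≥0∞} (hg : Measurable g) : ∫⁻ y, (∫⁻ t in Iio y, g t ∂μ) ^ s ∂ω
      ≤ hardyC r s (r - 1) * A * (∫⁻ t, g t ^ r ∂μ) ^ (s / r) := by
  have hr0 : 0 < r := by linarith
  have hr1 : 0 < r - 1 := by linarith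
  have hs0 : 0 < s := by linarith
  have hθ : 0 ≤ 1 - 1 / r := by rw [sub_nonneg, div_le_one hr0]; exact hr.le
  have a1 := Appr.lintegral (μ := ω) (fun n => (measurable_lintegral_Iio _).pow_const s)
    (fun y => (appr_lintegral_Iio (μ := μ) hg y).rpow hs0.le)
  refine a1.le_of_forall_le fun n => ?_
  set S := spanningSets μ n
  have := isFiniteMeasure_restrict_spanningSets (μ := μ) n
  set gn : ℝ → ℝ≥0∞ := fun t => min (g t) n
  have hm : Measurable gn := hg.min measurable_const
  rw [lintegral_lintegral_Iio_rpow hm (by linarith : (1:ℝ) ≤ s)]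
  set H : ℝ → ℝ≥0∞ := fun y => ∫⁻ t in Iio y, gn t ∂(μ.restrict S) with hH
  set M : ℝ → ℝ≥0∞ := fun y => (μ.restrict S) (Iio y) with hM
  set N := ∫⁻ t, gn t ^ r ∂(μ.restrict S) with hN
  have hHm : Measurable H := measurable_lintegral_Iio _
  have hMm : Measurable M := measurable_measure_Iio
  have hNle : N ≤ ∫⁻ t, g t ^ r ∂μ :=
    (lintegral_mono fun t => rpow_le_rpow (min_le_left _ _) hr0.le).trans
      (lintegral_mono' restrict_le_self le_rfl)
  have hpt : ∀ᵐ t ∂(μ.restrict S), H t ^ (s - 1) * gn t * ω (Ioi t)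
      ≤ A * (N ^ (1 / r)) ^ (s - r) * ((H t * (M t)⁻¹) ^ (r - 1) * gn t) := by
    filter_upwards [ae_measure_Iio_pos (μ := μ.restrict S)] with t ht
    have hMt0 : M t ≠ 0 := ht.ne'
    have hMtt : M t ≠ ∞ := measure_ne_top _ _
    have hω : ω (Ioi t) ≤ A * M t ^ (-(s * (1 - 1 / r))) := by
      rw [rpow_neg, ← div_eq_mul_inv, ENNReal.le_div_iff_mul_le
        (Or.inl ((rpow_pos ht hMtt).ne')) (Or.inl (rpow_ne_top_of_ne_zero hMt0 hMtt))]
      refine le_trans ?_ (hA t)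
      exact mul_le_mul_right (rpow_le_rpow (Measure.restrict_apply_le _ _) (by positivity)) _
    have hHs : H t ^ (s - 1) ≤ H t ^ (r - 1) * (M t ^ (1 - 1 / r) * N ^ (1 / r)) ^ (s - r) := by
      rw [show s - 1 = (r - 1) + (s - r) by ring,
        rpow_add_of_nonneg _ _ hr1.le (by linarith)]
      gcongr
      exact lintegral_Iio_le_holder hm hr t
    calc H t ^ (s - 1) * gn t * ω (Ioi t)
        ≤ (H t ^ (r - 1) * (M t ^ (1 - 1 / r) * N ^ (1 / r)) ^ (s - r)) * gn t
          * (A * M t ^ (-(s * (1 - 1 / r)))) := by gcongr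
      _ = A * (N ^ (1 / r)) ^ (s - r) * (H t ^ (r - 1) * (M t ^ ((1 - 1 / r) * (s - r))
          * M t ^ (-(s * (1 - 1 / r)))) * gn t) := by
          rw [mul_rpow_of_nonneg _ _ (by linarith), ← rpow_mul (M t)]
          ring
      _ = _ := by
          rw [← rpow_add _ _ hMt0 hMtt, mul_rpow_of_nonneg _ _ hr1.le,
            inv_rpow, ← rpow_neg]
          congr 5
          field_simp
          ring
  have hX : ∫⁻ t, (H t * (M t)⁻¹) ^ (r - 1) * gn t ∂(μ.restrict S)
      ≤ ofReal (r / (r - 1)) ^ (r - 1) * N := by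
    have h := lintegral_mul_le_conj (μ := μ.restrict S)
      ((measurable_mul' hHm hMm.inv).pow_const (r - 1)).aemeasurable hm.aemeasurable hr
    have e : (r - 1) * (r / (r - 1)) = r := by field_simp
    simp only [← rpow_mul, e, Pi.inv_apply] at h
    refine h.trans ?_
    calc _ ≤ (ofReal (r / (r - 1)) ^ r * N) ^ (1 - 1 / r) * N ^ (1 / r) := by
          gcongr
          exact lintegral_average_rpow_le hm hr
      _ = _ := by
          rw [mul_rpow_of_nonneg _ _ hθ, ← rpow_mul, mul_assoc,
            ← rpow_add_of_nonneg _ _ hθ (by positivity)]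
          congr 2
          · field_simp
          · simp
  calc ofReal s * ∫⁻ t, H t ^ (s - 1) * gn t * ω (Ioi t) ∂(μ.restrict S)
      ≤ ofReal s * ∫⁻ t, A * (N ^ (1 / r)) ^ (s - r) * ((H t * (M t)⁻¹) ^ (r - 1) * gn t)
          ∂(μ.restrict S) := by
        exact mul_le_mul_right (lintegral_mono_ae hpt) _
    _ ≤ ofReal s * (A * (N ^ (1 / r)) ^ (s - r)
          * (ofReal (r / (r - 1)) ^ (r - 1) * N)) := by
        rw [lintegral_const_mul _ (by fun_prop)]
        gcongr
    _ = hardyC r s (r - 1) * A * ((N ^ (1 / r)) ^ (s - r) * N) := by rw [hardyC]; ring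
    _ = hardyC r s (r - 1) * A * N ^ (s / r) := by
        rw [← rpow_mul]
        conv_lhs => enter [2, 2]; rw [← rpow_one N]
        rw [← rpow_add_of_nonneg _ _ (mul_nonneg (by positivity) (by linarith)) zero_le_one]
        congr 2
        field_simp
        ring
    _ ≤ _ := by gcongr

/-- Sufficiency in Hardy's inequality, `1 ≤ s < r < ∞`. -/
theorem hardy_gt [SigmaFinite μ] [NullSingletonClass μ] [SFinite ω] {r s : ℝ} (hs : 1 ≤ s)
    (hsr : s < r) {g : ℝ → ℝ≥0∞} (hg : Measurable g) : ∫⁻ y, (∫⁻ t in Iio y, g t ∂μ) ^ s ∂ω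
      ≤ hardyC r s (s - 1) *
        (∫⁻ t, ω (Ioi t) ^ (r / (r - s)) * μ (Iio t) ^ (r / (r - s) * (s - 1)) ∂μ) ^ ((r - s) / r)
        * (∫⁻ t, g t ^ r ∂μ) ^ (s / r) := by
  have hr : 1 < r := by linarith
  have hr0 : 0 < r := by linarith
  have hr1 : 0 < r - 1 := by linarith
  have hs0 : 0 < s := by linarith
  have hrs : 0 < r - s := by linarith
  have hs1 : 0 ≤ s - 1 := by linarith
  have a1 := Appr.lintegral (μ := ω) (fun n => (measurable_lintegral_Iio _).pow_const s)
    (fun y => (appr_lintegral_Iio (μ := μ) hg y).rpow hs0.le)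
  refine a1.le_of_forall_le fun n => ?_
  set S := spanningSets μ n
  have := isFiniteMeasure_restrict_spanningSets (μ := μ) n
  set gn : ℝ → ℝ≥0∞ := fun t => min (g t) n
  have hm : Measurable gn := hg.min measurable_const
  rw [lintegral_lintegral_Iio_rpow hm hs]
  set H : ℝ → ℝ≥0∞ := fun y => ∫⁻ t in Iio y, gn t ∂(μ.restrict S) with hH
  set M : ℝ → ℝ≥0∞ := fun y => (μ.restrict S) (Iio y) with hM
  set N := ∫⁻ t, gn t ^ r ∂(μ.restrict S) with hN
  have hHm : Measurable H := measurable_lintegral_Iio _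
  have hMm : Measurable M := measurable_measure_Iio
  have hwm : Measurable fun t => ω (Ioi t) := measurable_measure_Ioi
  have hNle : N ≤ ∫⁻ t, g t ^ r ∂μ :=
    (lintegral_mono fun t => rpow_le_rpow (min_le_left _ _) hr0.le).trans
      (lintegral_mono' restrict_le_self le_rfl)
  set Q := ∫⁻ t, ω (Ioi t) ^ (r / (r - s)) * μ (Iio t) ^ (r / (r - s) * (s - 1)) ∂μ with hQ
  have hpt : ∀ᵐ t ∂(μ.restrict S), H t ^ (s - 1) * gn t * ω (Ioi t)
      = (ω (Ioi t) ^ (r / (r - s)) * M t ^ (r / (r - s) * (s - 1))) ^ ((r - s) / r)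
        * ((H t * (M t)⁻¹) ^ r) ^ ((s - 1) / r) * (gn t ^ r) ^ (1 / r) := by
    filter_upwards [ae_measure_Iio_pos (μ := μ.restrict S)] with t ht
    have hMt0 : M t ≠ 0 := ht.ne'
    have hMtt : M t ≠ ∞ := measure_ne_top _ _
    have e1 : r / (r - s) * ((r - s) / r) = 1 := by field_simp
    have e2 : r / (r - s) * (s - 1) * ((r - s) / r) = s - 1 := by field_simp
    have e3 : r * ((s - 1) / r) = s - 1 := by field_simp
    have e4 : r * (1 / r) = 1 := by field_simp
    rw [mul_rpow_of_nonneg _ _ (by positivity), ← rpow_mul, ← rpow_mul,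
      ← rpow_mul, ← rpow_mul, e1, e2, e3, e4, rpow_one, rpow_one,
      mul_rpow_of_nonneg _ _ hs1, inv_rpow]
    have hc : M t ^ (s - 1) * (M t ^ (s - 1))⁻¹ = 1 := ENNReal.mul_inv_cancel
      ((rpow_pos ht hMtt).ne') (rpow_ne_top_of_ne_zero hMt0 hMtt)
    calc H t ^ (s - 1) * gn t * ω (Ioi t) = H t ^ (s - 1) * gn t * ω (Ioi t) * 1 := by ring
      _ = _ := by rw [← hc]; ring
  rw [lintegral_congr_ae hpt]
  have hhol := lintegral_rpow_mul_mul_le (μ := μ.restrict S)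
    (measurable_mul' (hwm.pow_const (r / (r - s))) (hMm.pow_const (r / (r - s) * (s - 1)))).aemeasurable
    ((measurable_mul' hHm hMm.inv).pow_const r).aemeasurable
    (hm.pow_const r).aemeasurable (a := (r - s) / r) (b := (s - 1) / r) (c := 1 / r)
    (by positivity) (by positivity) (by positivity) (by field_simp; ring)
  calc _ ≤ ofReal s * (Q ^ ((r - s) / r)
        * (ofReal (r / (r - 1)) ^ r * N) ^ ((s - 1) / r) * N ^ (1 / r)) := by
        gcongr ofReal s * ?_
        refine hhol.trans ?_
        gcongr ?_ ^ _ * ?_ ^ _ * _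
        · refine (lintegral_mono fun t => ?_).trans
            (lintegral_mono' restrict_le_self le_rfl)
          gcongr
          exact Measure.restrict_apply_le _ _
        · exact lintegral_average_rpow_le hm hr
    _ = hardyC r s (s - 1) * Q ^ ((r - s) / r) * (N ^ ((s - 1) / r) * N ^ (1 / r)) := by
        rw [mul_rpow_of_nonneg _ _ (by positivity), ← rpow_mul,
          show r * ((s - 1) / r) = s - 1 by field_simp, hardyC]
        ring
    _ = hardyC r s (s - 1) * Q ^ ((r - s) / r) * N ^ (s / r) := by
        rw [← rpow_add_of_nonneg _ _ (by positivity) (by positivity)]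
        congr 2
        field_simp
        ring
    _ ≤ _ := by gcongr

instance [SFinite μ] : SFinite (refl μ) := by unfold refl; infer_instance

/-- Hardy's inequality for the dual operator, `1 < r ≤ s < ∞`. -/
theorem hardy_dual_le [SigmaFinite μ] [NullSingletonClass μ] [SFinite ω] {r s : ℝ} (hr : 1 < r)
    (hrs : r ≤ s) {A : ℝ≥0∞} (hA : ∀ x, ω (Iio x) * μ (Ioi x) ^ (s * (1 - 1 / r)) ≤ A)
    {g : ℝ → ℝ≥0∞} (hg : Measurable g) : ∫⁻ y, (∫⁻ t in Ioi y, g t ∂μ) ^ s ∂ω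
      ≤ hardyC r s (r - 1) * A * (∫⁻ t, g t ^ r ∂μ) ^ (s / r) := by
  have h := hardy_le (μ := refl μ) (ω := refl ω) hr hrs (A := A)
    (fun x => by rw [refl_Ioi, refl_Iio]; exact hA _) (g := fun t => g (-t)) (by fun_prop)
  simpa only [lintegral_refl, setLIntegral_refl_Iio, neg_neg] using h

/-- Hardy's inequality for the dual operator, `1 ≤ s < r < ∞`. -/
theorem hardy_dual_gt [SigmaFinite μ] [NullSingletonClass μ] [SFinite ω] {r s : ℝ} (hs : 1 ≤ s)
    (hsr : s < r) {g : ℝ → ℝ≥0∞} (hg : Measurable g) : ∫⁻ y, (∫⁻ t in Ioi y, g t ∂μ) ^ s ∂ω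
      ≤ hardyC r s (s - 1) *
        (∫⁻ t, ω (Iio t) ^ (r / (r - s)) * μ (Ioi t) ^ (r / (r - s) * (s - 1)) ∂μ) ^ ((r - s) / r)
        * (∫⁻ t, g t ^ r ∂μ) ^ (s / r) := by
  have h := hardy_gt (μ := refl μ) (ω := refl ω) hs hsr (g := fun t => g (-t)) (by fun_prop)
  simpa only [lintegral_refl, setLIntegral_refl_Iio, refl_Iio, refl_Ioi, neg_neg] using h

lemma hardy_necessary_fin [IsFiniteMeasure μ] [NullSingletonClass μ] [IsFiniteMeasure ω]
    [NullSingletonClass ω] {r s : ℝ} (hs : 1 ≤ s) (hsr : s < r) {B : ℝ≥0∞}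
    (h : ∀ g : ℝ → ℝ≥0∞, Measurable g →
      ∫⁻ y, (∫⁻ t in Iio y, g t ∂μ) ^ s ∂ω ≤ B * (∫⁻ t, g t ^ r ∂μ) ^ (s / r)) :
    (∫⁻ t, ω (Ioi t) ^ (r / (r - s)) * μ (Iio t) ^ (r / (r - s) * (s - 1)) ∂μ) ^ ((r - s) / r)
      ≤ ofReal (r / (s * (r - 1))) * ofReal ((r - 1) / (r - s)) ^ s * B := by
  have hr : 1 < r := by linarith
  have hr0 : 0 < r := by linarith
  have hr1 : 0 < r - 1 := by linarith
  have hs0 : 0 < s := by linarith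
  have hrs : 0 < r - s := by linarith
  have hs1 : 0 ≤ s - 1 := by linarith
  set κ := r / (r - s) with hκ
  set e := (r - 1) / (r - s) with he
  have hκ0 : 0 < κ := by positivity
  have he0 : 0 < e := by positivity
  have hes : 0 < e * s := by positivity
  set w : ℝ → ℝ≥0∞ := fun t => ω (Ioi t) with hw
  set M : ℝ → ℝ≥0∞ := fun t => μ (Iio t) with hM
  have hwm : Measurable w := measurable_measure_Ioi
  have hMm : Measurable M := measurable_measure_Iio
  set Q := ∫⁻ t, w t ^ κ * M t ^ (κ * (s - 1)) ∂μ with hQ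
  have hQfin : Q ≠ ∞ := by
    refine ne_top_of_le_ne_top (b := ∫⁻ t, (ω univ) ^ κ * (μ univ) ^ (κ * (s - 1)) ∂μ) ?_ ?_
    · rw [lintegral_const]
      refine mul_ne_top (mul_ne_top ?_ ?_) (measure_ne_top _ _)
      · exact rpow_ne_top_of_nonneg hκ0.le (measure_ne_top _ _)
      · exact rpow_ne_top_of_nonneg (by positivity) (measure_ne_top _ _)
    · refine lintegral_mono fun t => ?_
      gcongr <;> exact measure_mono (subset_univ _)
  have h1 : ofReal (e * s) * Q = ofReal κ * ∫⁻ y, w y ^ (κ - 1) * M y ^ (e * s) ∂ω := by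
    have e1 : Q = ofReal κ * ∫⁻ y, (∫⁻ t in Iio y, M t ^ (κ * (s - 1)) ∂μ)
        * w y ^ (κ - 1) ∂ω := by
      rw [lintegral_lintegral_Iio_mul (hMm.pow_const _) (hwm.pow_const _),
        ← lintegral_const_mul _ (measurable_mul' (hMm.pow_const _) (measurable_lintegral_Ioi _))]
      refine lintegral_congr fun t => ?_
      rw [← mul_assoc, mul_comm (ofReal κ), mul_assoc,
        lintegral_Ioi_rpow hκ0 (measure_ne_top _ _), mul_comm]
    rw [e1, mul_left_comm,
      ← lintegral_const_mul _ (measurable_mul' (measurable_lintegral_Iio _) (hwm.pow_const _))]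
    congr 1
    refine lintegral_congr fun y => ?_
    have e2 : κ * (s - 1) = e * s - 1 := by rw [hκ, he]; field_simp; ring
    rw [e2, ← mul_assoc, lintegral_Iio_rpow hes (measure_ne_top _ _), mul_comm]
  have htest := h (fun t => w t ^ (1 / (r - s)) * M t ^ ((s - 1) / (r - s))) (by fun_prop)
  have h2 : ∫⁻ t, (w t ^ (1 / (r - s)) * M t ^ ((s - 1) / (r - s))) ^ r ∂μ = Q := by
    refine lintegral_congr fun t => ?_
    rw [mul_rpow_of_nonneg _ _ hr0.le, ← rpow_mul, ← rpow_mul]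
    congr 2
    · rw [hκ]; field_simp
    · rw [hκ]; field_simp
  rw [h2] at htest
  have h3 : ∫⁻ y, w y ^ (κ - 1) * M y ^ (e * s) ∂ω
      ≤ ofReal e ^ s * (B * Q ^ (s / r)) := by
    refine le_trans ?_ (mul_le_mul_right htest _)
    rw [← lintegral_const_mul _ ((measurable_lintegral_Iio _).pow_const _)]
    refine lintegral_mono fun y => ?_
    have hlow : w y ^ (1 / (r - s)) * ∫⁻ t in Iio y, M t ^ ((s - 1) / (r - s)) ∂μ
        ≤ ∫⁻ t in Iio y, w t ^ (1 / (r - s)) * M t ^ ((s - 1) / (r - s)) ∂μ := by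
      rw [← lintegral_const_mul _ (hMm.pow_const _)]
      refine setLIntegral_mono' measurableSet_Iio fun t ht => ?_
      gcongr
      exact antitone_measure_Ioi (le_of_lt ht)
    have hpow : ofReal e * ∫⁻ t in Iio y, M t ^ ((s - 1) / (r - s)) ∂μ = M y ^ e := by
      have : (s - 1) / (r - s) = e - 1 := by rw [he]; field_simp; ring
      rw [this]
      exact lintegral_Iio_rpow he0 (measure_ne_top _ _)
    calc w y ^ (κ - 1) * M y ^ (e * s) = (w y ^ (1 / (r - s)) * M y ^ e) ^ s := by
          rw [mul_rpow_of_nonneg _ _ hs0.le, ← rpow_mul, ← rpow_mul]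
          congr 2
          rw [hκ]; field_simp; ring
      _ = (ofReal e * (w y ^ (1 / (r - s)) * ∫⁻ t in Iio y, M t ^ ((s - 1) / (r - s)) ∂μ)) ^ s := by
          rw [← hpow]; ring_nf
      _ ≤ (ofReal e * ∫⁻ t in Iio y, w t ^ (1 / (r - s)) * M t ^ ((s - 1) / (r - s)) ∂μ) ^ s := by
          gcongr
      _ = _ := mul_rpow_of_nonneg _ _ hs0.le
  refine rpow_le_of_le_mul_rpow hQfin (by positivity) ?_
  have e5 : 1 - (r - s) / r = s / r := by field_simp; ring
  rw [e5]
  have h4 : ofReal (e * s) * Q ≤ ofReal (e * s)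
      * (ofReal (r / (s * (r - 1))) * ofReal e ^ s * B * Q ^ (s / r)) := by
    rw [h1]
    refine (mul_le_mul_right h3 _).trans (le_of_eq ?_)
    have : ofReal κ = ofReal (e * s) * ofReal (r / (s * (r - 1))) := by
      rw [← ofReal_mul hes.le]
      congr 1
      rw [hκ, he]; field_simp
    rw [this]
    ring
  exact (ENNReal.mul_le_mul_iff_right (by simpa using hes) ofReal_ne_top).1 h4

/-- Necessity in Hardy's inequality, `1 ≤ s < r < ∞`. -/
theorem hardy_necessary [SigmaFinite μ] [NullSingletonClass μ] [SigmaFinite ω]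
    [NullSingletonClass ω] {r s : ℝ} (hs : 1 ≤ s) (hsr : s < r) {B : ℝ≥0∞}
    (h : ∀ g : ℝ → ℝ≥0∞, Measurable g →
      ∫⁻ y, (∫⁻ t in Iio y, g t ∂μ) ^ s ∂ω ≤ B * (∫⁻ t, g t ^ r ∂μ) ^ (s / r)) :
    (∫⁻ t, ω (Ioi t) ^ (r / (r - s)) * μ (Iio t) ^ (r / (r - s) * (s - 1)) ∂μ) ^ ((r - s) / r)
      ≤ ofReal (r / (s * (r - 1))) * ofReal ((r - 1) / (r - s)) ^ s * B := by
  have hr0 : 0 < r := by linarith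
  have hrs : 0 < r - s := by linarith
  have hs1 : 0 ≤ s - 1 := by linarith
  have ha := (appr_lintegral_spanningSets (μ := μ) (fun n => measurable_mul'
    (measurable_measure_Ioi.pow_const (r / (r - s)))
    (measurable_measure_Iio.pow_const (r / (r - s) * (s - 1))))
    (fun t => Appr.mul ((appr_measure_spanningSets (μ := ω) (T := Ioi t) measurableSet_Ioi).rpow
      (e := r / (r - s)) (by positivity))
      ((appr_measure_spanningSets (μ := μ) (T := Iio t) measurableSet_Iio).rpow
      (e := r / (r - s) * (s - 1)) (by positivity)))).rpow (e := (r - s) / r) (by positivity)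
  refine ha.le_of_forall_le fun n => ?_
  have := isFiniteMeasure_restrict_spanningSets (μ := μ) n
  have := isFiniteMeasure_restrict_spanningSets (μ := ω) n
  refine hardy_necessary_fin (μ := μ.restrict (spanningSets μ n))
    (ω := ω.restrict (spanningSets ω n)) hs hsr fun g hg => ?_
  have hS := measurableSet_spanningSets μ n
  have h1 := h ((spanningSets μ n).indicator g) (hg.indicator hS)
  have e1 : ∀ y, ∫⁻ t in Iio y, (spanningSets μ n).indicator g t ∂μ
      = ∫⁻ t in Iio y, g t ∂(μ.restrict (spanningSets μ n)) := fun y => by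
    rw [lintegral_indicator hS, Measure.restrict_comm hS]
  have e2 : ∫⁻ t, (spanningSets μ n).indicator g t ^ r ∂μ
      = ∫⁻ t in spanningSets μ n, g t ^ r ∂μ := by
    rw [← lintegral_indicator hS]
    refine lintegral_congr fun t => ?_
    by_cases ht : t ∈ spanningSets μ n <;> simp [ht, hr0]
  simp only [e1, e2] at h1
  exact (lintegral_mono' restrict_le_self le_rfl).trans h1

end

section

variable {μ ω η l m : Measure ℝ}

/-! ### Halving points -/

lemma exists_measure_Ioi_eq [IsFiniteMeasure m] [NullSingletonClass m] {c : ℝ≥0∞} (hc0 : 0 < c)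
    (hc : c < m univ) : ∃ x, m (Ioi x) = c := by
  have hu : refl m univ = m univ := by rw [refl_apply]; simp
  obtain ⟨x, hx⟩ := exists_measure_Iio_eq (μ := refl m) hc0 (by rwa [hu])
  exact ⟨-x, by rw [← refl_Iio, hx]⟩

lemma exists_halving [IsFiniteMeasure m] [NullSingletonClass m] :
    ∃ y : ℝ → ℝ, Measurable y ∧ ∀ᵐ x ∂l, 0 < m (Ioi x) →
      2 * m (Ioi (y x)) ≤ m (Ioi x) ∧ ∀ u, u < y x → m (Ioi x) ≤ 2 * m (Ioi u) := by
  set F : ℝ → ℝ≥0∞ := fun x => m (Ioi x) with hF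
  have hFa : Antitone F := antitone_measure_Ioi
  have hFm : Measurable F := measurable_measure_Ioi
  have hFfin : ∀ x, F x ≠ ∞ := fun x => measure_ne_top _ _
  set S : ℝ → Set ℝ := fun x => {u | F x ≤ 2 * F u} with hS
  set P : Set ℝ := {x | 0 < F x} with hP
  have hPm : MeasurableSet P := hFm measurableSet_Ioi
  have hlt : ∀ x ∈ P, ∀ c : ℝ≥0∞, 1 < c → c ≠ ∞ → ∃ u, F u = F x / c := by
    intro x hx c hc hct
    refine exists_measure_Ioi_eq (ENNReal.div_pos (ne_of_gt hx) hct) ?_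
    refine lt_of_lt_of_le ?_ (measure_mono (subset_univ (Ioi x)))
    refine ENNReal.div_lt_of_lt_mul ?_
    calc F x = F x * 1 := (mul_one _).symm
      _ < F x * c := ENNReal.mul_lt_mul_right (ne_of_gt hx) (hFfin x) hc
  have hbdd : ∀ x ∈ P, BddAbove (S x) := by
    intro x hx
    obtain ⟨u, hu⟩ := hlt x hx 4 (by norm_num) (by norm_num)
    refine ⟨u, fun v hv => ?_⟩
    by_contra h
    have h1 : F v ≤ F x / 4 := hu ▸ hFa (not_le.1 h).le
    have h2 : F x ≤ 2 * (F x / 4) := le_trans hv (mul_le_mul_right h1 _)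
    have h3 : (F x).toReal ≤ 2 * ((F x).toReal / 4) := by
      have := toReal_mono (mul_ne_top (by norm_num)
        (ENNReal.div_ne_top (hFfin x) (by norm_num))) h2
      simpa [ENNReal.toReal_mul, ENNReal.toReal_div] using this
    have h4 : 0 < (F x).toReal := toReal_pos (ne_of_gt hx) (hFfin x)
    linarith
  have hne : ∀ x, x ∈ S x := fun x => by
    show F x ≤ 2 * F x
    calc F x = 1 * F x := (one_mul _).symm
      _ ≤ 2 * F x := by gcongr; norm_num
  have hmono : MonotoneOn (fun x => sSup (S x)) P := by
    intro x hx x' hx' h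
    exact csSup_le_csSup (hbdd x' hx') ⟨x, hne x⟩ fun u hu => (hFa h).trans hu
  have hae : AEMeasurable (fun x => sSup (S x)) (l.restrict P) :=
    aemeasurable_restrict_of_monotoneOn hPm hmono
  refine ⟨hae.mk _, hae.measurable_mk, ?_⟩
  have h := (ae_restrict_iff' hPm).1 hae.ae_eq_mk
  filter_upwards [h] with x hx hx0
  rw [← hx hx0]
  constructor
  · obtain ⟨u, hu⟩ := hlt x hx0 2 (by norm_num) (by norm_num)
    have huS : u ∈ S x := by
      show F x ≤ 2 * F u
      rw [hu, ENNReal.mul_div_cancel (by norm_num) (by norm_num)]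
    have := hFa (le_csSup (hbdd x hx0) huS)
    calc 2 * F (sSup (S x)) ≤ 2 * F u := by gcongr
      _ = F x := by rw [hu, ENNReal.mul_div_cancel (by norm_num) (by norm_num)]
  · intro u hu
    obtain ⟨v, hv, huv⟩ := exists_lt_of_lt_csSup ⟨x, hne x⟩ hu
    exact le_trans hv (mul_le_mul_right (hFa huv.le) _)

lemma measure_halving_le [IsFiniteMeasure m] [NullSingletonClass m] {u : ℝ} (hu : m (Ioi u) ≠ 0) :
    m {x | x < u ∧ m (Ioi x) ≤ 2 * m (Ioi u)} ≤ 2 * m (Ioi u) := by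
  have hsplit : ∀ z, z ≤ u → m (Ioc z u) + m (Ioi u) = m (Ioi z) := fun z hz => by
    have hd : Disjoint (Ioc z u) (Ioi u) := disjoint_left.2 fun x hx hx' => not_lt.2 hx.2 hx'
    rw [← measure_union hd measurableSet_Ioi, Ioc_union_Ioi_eq_Ioi hz]
  have hfin : m (Ioi u) ≠ ∞ := measure_ne_top _ _
  rcases lt_or_ge (3 * m (Ioi u)) (m univ) with h | h
  · obtain ⟨z, hz⟩ := exists_measure_Ioi_eq (m := m) (c := 3 * m (Ioi u))
      (pos_iff_ne_zero.2 (mul_ne_zero (by norm_num) hu)) h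
    have hlt : 2 * m (Ioi u) < 3 * m (Ioi u) := by
      gcongr
      norm_num
    have hsub : {x | x < u ∧ m (Ioi x) ≤ 2 * m (Ioi u)} ⊆ Ioc z u := by
      intro x hx
      refine ⟨?_, hx.1.le⟩
      by_contra hzx
      have : m (Ioi z) ≤ m (Ioi x) := antitone_measure_Ioi (not_lt.1 hzx)
      rw [hz] at this
      exact absurd (this.trans hx.2) (not_le.2 hlt)
    refine (measure_mono hsub).trans ?_
    rcases le_total z u with hzu | hzu
    · have := hsplit z hzu
      rw [hz, show (3 : ℝ≥0∞) = 2 + 1 by norm_num, add_mul, one_mul] at this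
      exact ((ENNReal.add_left_inj hfin).1 this).le
    · rw [Ioc_eq_empty (not_lt.2 hzu), measure_empty]; exact zero_le
  · have : m (Iio u) + m (Ioi u) = m univ := by
      have hd : Disjoint (Iic u) (Ioi u) := disjoint_left.2 fun x (hx : x ≤ u) (hx' : u < x) => not_lt.2 hx hx'
      rw [measure_congr (Iio_ae_eq_Iic (μ := m) (a := u)), ← measure_union hd measurableSet_Ioi,
        Iic_union_Ioi]
    have h2 : m (Iio u) + m (Ioi u) ≤ 2 * m (Ioi u) + m (Ioi u) := by
      rw [this]; refine h.trans (le_of_eq ?_); ring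
    exact (measure_mono fun x hx => hx.1).trans ((ENNReal.add_le_add_iff_right hfin).1 h2)

lemma lintegral_halving_le [IsFiniteMeasure l] [NullSingletonClass l] {f : ℝ → ℝ≥0∞}
    (hf : Measurable f) [IsFiniteMeasure (l.withDensity f)] (u : ℝ) :
    ∫⁻ x in {x | x < u ∧ (l.withDensity f) (Ioi x) ≤ 2 * (l.withDensity f) (Ioi u)
      ∧ 0 < (l.withDensity f) (Ioi x)}, f x * ((l.withDensity f) (Ioi x))⁻¹ ∂l ≤ 2 := by
  set m := l.withDensity f with hm
  set E := {x | x < u ∧ m (Ioi x) ≤ 2 * m (Ioi u) ∧ 0 < m (Ioi x)}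
  have hmm : Measurable fun x => m (Ioi x) := measurable_measure_Ioi
  have hE : MeasurableSet E := measurableSet_Iio.inter
    ((measurableSet_le hmm measurable_const).inter (measurableSet_lt measurable_const hmm))
  rcases eq_or_ne (m (Ioi u)) 0 with h0 | h0
  · have : E = ∅ := by
      ext x
      simp only [E, h0, mem_ofPred_eq, mem_empty_iff_false, iff_false]
      rintro ⟨-, h1, h2⟩
      exact absurd h2 (not_lt.2 (by simpa using h1))
    rw [this]; simp
  calc ∫⁻ x in E, f x * (m (Ioi x))⁻¹ ∂l ≤ ∫⁻ x in E, f x * (m (Ioi u))⁻¹ ∂l := by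
        refine setLIntegral_mono' hE fun x hx => ?_
        gcongr
        exact hx.1.le
    _ = m E * (m (Ioi u))⁻¹ := by rw [lintegral_mul_const _ hf, hm, withDensity_apply _ hE]
    _ ≤ (2 * m (Ioi u)) * (m (Ioi u))⁻¹ := by
        gcongr
        have hs : E ⊆ {x | x < u ∧ m (Ioi x) ≤ 2 * m (Ioi u)} := fun x hx => ⟨hx.1, hx.2.1⟩
        exact (measure_mono hs).trans (measure_halving_le h0)
    _ = 2 := by rw [mul_assoc, ENNReal.mul_inv_cancel h0 (measure_ne_top _ _), mul_one]

/-! ### Bounded overlap estimates -/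

lemma measurable_measure_Ioo [IsFiniteMeasure l] [NullSingletonClass l] :
    Measurable fun p : ℝ × ℝ => l (Ioo p.1 p.2) := by
  have h : ∀ p : ℝ × ℝ, l (Ioo p.1 p.2) = l (Iio p.2) - l (Iio p.1) := by
    intro p
    rcases le_or_gt p.2 p.1 with h | h
    · rw [Ioo_eq_empty (not_lt.2 h), measure_empty,
        tsub_eq_zero_of_le (monotone_measure_Iio h)]
    · rw [measure_congr (Ioo_ae_eq_Ico (μ := l)), ← Iio_sdiff_Iio,
        measure_sdiff (Iio_subset_Iio h.le) measurableSet_Iio.nullMeasurableSet (measure_ne_top _ _)]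
  simp_rw [h]
  exact (measurable_measure_Iio.comp measurable_snd).sub (measurable_measure_Iio.comp measurable_fst)

lemma measurable_measure_Ioo_left [IsFiniteMeasure l] [NullSingletonClass l] (u : ℝ) :
    Measurable fun x => l (Ioo x u) := measurable_measure_Ioo.comp (by fun_prop : Measurable fun x : ℝ => (x, u))

lemma measurable_measure_Ioo_right [IsFiniteMeasure l] [NullSingletonClass l] (x : ℝ) :
    Measurable fun u => l (Ioo x u) := measurable_measure_Ioo.comp (by fun_prop : Measurable fun u : ℝ => (x, u))

variable {θ : ℝ → ℝ≥0∞} {y : ℝ → ℝ}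

lemma measurable_setLIntegral_Ioo [SFinite η] {φ : ℝ → ℝ → ℝ≥0∞}
    (hφ : Measurable (Function.uncurry φ)) (hy : Measurable y) :
    Measurable fun x => ∫⁻ u in Ioo x (y x), φ x u ∂η := by
  have hm : Measurable ({p : ℝ × ℝ | p.1 < p.2 ∧ p.2 < y p.1}.indicator (Function.uncurry φ)) :=
    hφ.indicator ((measurableSet_lt measurable_fst measurable_snd).inter
      (measurableSet_lt measurable_snd (hy.comp measurable_fst)))
  convert hm.lintegral_prod_right' (ν := η) using 2 with x
  rw [← lintegral_indicator measurableSet_Ioo]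
  rfl

lemma measurable_setLIntegral_Ioi [SFinite η] {φ : ℝ → ℝ → ℝ≥0∞}
    (hφ : Measurable (Function.uncurry φ)) : Measurable fun x => ∫⁻ u in Ioi x, φ x u ∂η := by
  have hm : Measurable ({p : ℝ × ℝ | p.1 < p.2}.indicator (Function.uncurry φ)) :=
    hφ.indicator (measurableSet_lt measurable_fst measurable_snd)
  convert hm.lintegral_prod_right' (ν := η) using 2 with x
  rw [← lintegral_indicator measurableSet_Ioi]
  rfl

lemma measurable_setLIntegral_Iio [SFinite η] {φ : ℝ → ℝ → ℝ≥0∞}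
    (hφ : Measurable (Function.uncurry φ)) : Measurable fun x => ∫⁻ u in Iio x, φ x u ∂η := by
  have hm : Measurable ({p : ℝ × ℝ | p.2 < p.1}.indicator (Function.uncurry φ)) :=
    hφ.indicator (measurableSet_lt measurable_snd measurable_fst)
  convert hm.lintegral_prod_right' (ν := η) using 2 with x
  rw [← lintegral_indicator measurableSet_Iio]
  rfl

lemma lintegral_overlap_le [SFinite l] [SFinite η] (hθ : Measurable θ) (hy : Measurable y)
    (hov : ∀ u, ∫⁻ x in {x | x < u ∧ u < y x}, θ x ∂l ≤ 2) {h : ℝ → ℝ≥0∞} (hh : Measurable h) :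
    ∫⁻ x, θ x * ∫⁻ u in Ioo x (y x), h u ∂η ∂l ≤ 2 * ∫⁻ u, h u ∂η := by
  set T := {p : ℝ × ℝ | p.1 < p.2 ∧ p.2 < y p.1} with hT
  have hTm : MeasurableSet T := (measurableSet_lt measurable_fst measurable_snd).inter
      (measurableSet_lt measurable_snd (hy.comp measurable_fst))
  have hm : Measurable (T.indicator fun p : ℝ × ℝ => θ p.1 * h p.2) :=
    ((hθ.comp measurable_fst).mul (hh.comp measurable_snd)).indicator hTm
  have e1 : ∀ x, θ x * ∫⁻ u in Ioo x (y x), h u ∂η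
      = ∫⁻ u, T.indicator (fun p : ℝ × ℝ => θ p.1 * h p.2) (x, u) ∂η := fun x => by
    rw [← lintegral_const_mul _ hh, ← lintegral_indicator measurableSet_Ioo]
    rfl
  simp_rw [e1]
  rw [lintegral_lintegral_swap (f := fun x u => T.indicator (fun p : ℝ × ℝ => θ p.1 * h p.2) (x, u))
    hm.aemeasurable, ← lintegral_const_mul _ hh]
  refine lintegral_mono fun u => ?_
  have hset : MeasurableSet {x | x < u ∧ u < y x} := measurableSet_Iio.inter (hy measurableSet_Ioi)
  have e2 : ∫⁻ x, T.indicator (fun p : ℝ × ℝ => θ p.1 * h p.2) (x, u) ∂l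
      = (∫⁻ x in {x | x < u ∧ u < y x}, θ x ∂l) * h u := by
    rw [← lintegral_mul_const _ hθ, ← lintegral_indicator hset]
    rfl
  rw [e2]
  gcongr
  exact hov u

lemma lintegral_overlap_le_of_subset [SFinite l] [SFinite η] (hθ : Measurable θ) (hy : Measurable y)
    (hov : ∀ u, ∫⁻ x in {x | x < u ∧ u < y x}, θ x ∂l ≤ 2) {h : ℝ → ℝ≥0∞} (hh : Measurable h)
    {E J : Set ℝ} (hE : MeasurableSet E) (hJ : MeasurableSet J) (hsub : ∀ x ∈ E, Ioo x (y x) ⊆ J) :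
    ∫⁻ x in E, θ x * ∫⁻ u in Ioo x (y x), h u ∂η ∂l ≤ 2 * ∫⁻ u in J, h u ∂η := by
  rw [← lintegral_indicator hJ]
  refine le_trans ?_ (lintegral_overlap_le hθ hy hov (hh.indicator hJ))
  refine le_trans (setLIntegral_mono' hE fun x hx => ?_)
    (setLIntegral_le_lintegral E _)
  refine mul_le_mul_right ?_ _
  rw [lintegral_indicator hJ, restrict_restrict hJ, inter_eq_right.2 (hsub x hx)]

lemma lintegral_weight_le [IsFiniteMeasure l] [NullSingletonClass l] [SFinite ω]
    (hθ : Measurable θ) (hy : Measurable y)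
    (hov : ∀ u, ∫⁻ x in {x | x < u ∧ u < y x}, θ x ∂l ≤ 2) {s : ℝ} (hs : 1 < s) (z : ℝ) :
    ∫⁻ x in {x | y x < z}, ω (Iio x) * l (Ioo x (y x)) ^ s * θ x ∂l
      ≤ 2 * ∫⁻ ξ in Iio z, l (Ioo ξ z) ^ s ∂ω := by
  have hk : Measurable fun x => l (Ioo x (y x)) :=
    measurable_measure_Ioo.comp (measurable_id.prodMk hy)
  have hset : MeasurableSet {x | y x < z} := hy measurableSet_Iio
  have e1 : ∫⁻ x in {x | y x < z}, ω (Iio x) * l (Ioo x (y x)) ^ s * θ x ∂l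
      = ∫⁻ ξ, ∫⁻ x in Ioi ξ, {x | y x < z}.indicator (fun x => l (Ioo x (y x)) ^ s * θ x) x ∂l ∂ω := by
    have h := lintegral_lintegral_Iio_mul (μ := ω) (ω := l) (φ := fun _ => 1)
      (ψ := {x | y x < z}.indicator (fun x => l (Ioo x (y x)) ^ s * θ x)) measurable_const
      ((measurable_mul' (hk.pow_const _) hθ).indicator hset)
    simp only [one_mul, lintegral_one, Measure.restrict_apply MeasurableSet.univ, univ_inter] at h
    rw [← h, ← lintegral_indicator hset]
    refine lintegral_congr fun x => ?_
    by_cases hx : y x < z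
    · rw [indicator_of_mem (by exact hx), indicator_of_mem (by exact hx), mul_assoc]
    · rw [indicator_of_notMem (by exact hx), indicator_of_notMem (by exact hx), mul_zero]
  rw [e1, ← lintegral_const_mul _ ((measurable_measure_Ioo_left z).pow_const s),
    ← lintegral_indicator measurableSet_Iio]
  refine lintegral_mono fun ξ => ?_
  have hpt : ∀ x, ξ < x → y x < z → l (Ioo x (y x)) ^ s * θ x
      ≤ l (Ioo ξ z) ^ (s - 1) * (θ x * ∫⁻ u in Ioo x (y x), 1 ∂l) := by
    intro x hx hxz
    rw [lintegral_one, Measure.restrict_apply MeasurableSet.univ, univ_inter]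
    calc l (Ioo x (y x)) ^ s * θ x = l (Ioo x (y x)) ^ (s - 1) * l (Ioo x (y x)) * θ x := by
          nth_rewrite 1 [show s = (s - 1) + 1 by ring]
          rw [rpow_add_of_nonneg _ _ (by linarith) (by norm_num), rpow_one]
      _ ≤ l (Ioo ξ z) ^ (s - 1) * l (Ioo x (y x)) * θ x := by
          have : Ioo x (y x) ⊆ Ioo ξ z := Ioo_subset_Ioo hx.le hxz.le
          have := measure_mono (μ := l) this
          have : l (Ioo x (y x)) ^ (s - 1) ≤ l (Ioo ξ z) ^ (s - 1) :=
            rpow_le_rpow this (by linarith)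
          gcongr
      _ = _ := by ring
  have hI : ∫⁻ x in Ioi ξ, {x | y x < z}.indicator (fun x => l (Ioo x (y x)) ^ s * θ x) x ∂l
      ≤ l (Ioo ξ z) ^ (s - 1) * (2 * ∫⁻ u in Ioo ξ z, 1 ∂l) := by
    rw [lintegral_indicator hset, restrict_restrict hset]
    have hm1 : Measurable fun x => ∫⁻ u in Ioo x (y x), (1:ℝ≥0∞) ∂l :=
      measurable_setLIntegral_Ioo (φ := fun _ _ => 1) measurable_const hy
    refine (setLIntegral_mono' (hset.inter measurableSet_Ioi) fun x hx => hpt x hx.2 hx.1).trans ?_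
    rw [lintegral_const_mul _ (measurable_mul' hθ hm1)]
    gcongr
    exact lintegral_overlap_le_of_subset hθ hy hov measurable_const (hset.inter measurableSet_Ioi)
      measurableSet_Ioo fun x hx => Ioo_subset_Ioo (le_of_lt hx.2) (le_of_lt hx.1)
  refine hI.trans ?_
  rw [lintegral_one, Measure.restrict_apply MeasurableSet.univ, univ_inter]
  by_cases hξ : ξ < z
  · rw [indicator_of_mem (by exact hξ)]
    refine le_of_eq ?_
    have e : l (Ioo ξ z) ^ s = l (Ioo ξ z) ^ (s - 1) * l (Ioo ξ z) := by
      conv_lhs => rw [show s = (s - 1) + 1 by ring]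
      rw [rpow_add_of_nonneg _ _ (by linarith) (by norm_num), rpow_one]
    rw [e]
    ring
  · rw [Ioo_eq_empty hξ, measure_empty]; simp

end

section

variable {μ ω η l m : Measure ℝ}

/-! ### Integral operators with an additive kernel -/

lemma lintegral_kernel_Ioi [SFinite l] [SFinite η] {g : ℝ → ℝ≥0∞} (hg : Measurable g) (x : ℝ) :
    ∫⁻ t in Ioi x, ∫⁻ u in Ioi t, g u ∂η ∂l = ∫⁻ u in Ioi x, l (Ioo x u) * g u ∂η := by
  have h := lintegral_lintegral_Ioi_mul (μ := η) (ω := l.restrict (Ioi x)) hg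
    (ψ := fun _ => 1) measurable_const
  simp only [mul_one, lintegral_one, restrict_restrict measurableSet_Iio,
    Measure.restrict_apply MeasurableSet.univ, univ_inter] at h
  rw [h, ← lintegral_indicator measurableSet_Ioi]
  refine lintegral_congr fun u => ?_
  have : Iio u ∩ Ioi x = Ioo x u := by ext; simp [and_comm]
  rw [this]
  by_cases hu : x < u
  · rw [indicator_of_mem (by exact hu), mul_comm]
  · rw [indicator_of_notMem (by exact hu), Ioo_eq_empty hu, measure_empty, mul_zero]

/-- The integral over `(x, ∞)` against the additive kernel is controlled by a local part and a
part with separated variables, at the points `x < y x` where the mass is halved. -/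
lemma exists_kernel_decomposition [IsFiniteMeasure l] [NullSingletonClass l] [IsFiniteMeasure η]
    [NullSingletonClass η] [IsFiniteMeasure ω] [NullSingletonClass ω] {s : ℝ} (hs : 1 < s)
    {g : ℝ → ℝ≥0∞} (hg : Measurable g) {c : ℝ≥0∞} (hc : c ≠ ∞) (hgc : ∀ t, g t ≤ c) :
    ∃ (θ : ℝ → ℝ≥0∞) (y : ℝ → ℝ) (w : Measure ℝ), Measurable θ ∧ Measurable y ∧ SFinite w ∧
      (∀ u, ∫⁻ x in {x | x < u ∧ u < y x}, θ x ∂l ≤ 2) ∧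
      (∀ z, w (Iio z) ≤ 2 * ∫⁻ ξ in Iio z, l (Ioo ξ z) ^ s ∂ω) ∧
      ∫⁻ x, (∫⁻ u in Ioi x, l (Ioo x u) * g u ∂η) ^ s ∂ω ≤ ofReal s * 4 ^ s *
        (∫⁻ x, (∫⁻ u in Ioi x, g u ∂η) ^ s ∂w
          + ∫⁻ x, ω (Iio x) * (∫⁻ u in Ioo x (y x), l (Ioo x u) * g u ∂η) ^ s * θ x ∂l) := by
  have hs0 : 0 < s := by linarith
  set f : ℝ → ℝ≥0∞ := fun t => ∫⁻ u in Ioi t, g u ∂η with hf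
  have hfm : Measurable f := measurable_lintegral_Ioi g
  have hfc : ∀ t, f t ≤ c * η univ := fun t => by
    calc f t ≤ ∫⁻ u in Ioi t, c ∂η := lintegral_mono fun u => hgc u
      _ = c * η (Ioi t) := by simp
      _ ≤ c * η univ := by gcongr; exact subset_univ _
  have hcc : c * η univ ≠ ∞ := mul_ne_top hc (measure_ne_top _ _)
  have hffin : ∀ t, f t ≠ ∞ := fun t => ne_top_of_le_ne_top hcc (hfc t)
  set m := l.withDensity f with hm
  have hmfin : IsFiniteMeasure m := isFiniteMeasure_withDensity (by
    refine ne_top_of_le_ne_top (mul_ne_top hcc (measure_ne_top l univ)) ?_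
    calc ∫⁻ t, f t ∂l ≤ ∫⁻ t, c * η univ ∂l := lintegral_mono hfc
      _ = _ := by simp)
  set F : ℝ → ℝ≥0∞ := fun x => m (Ioi x) with hF
  have hFm : Measurable F := measurable_measure_Ioi
  have hFf : ∀ x, F x = ∫⁻ t in Ioi x, f t ∂l := fun x => withDensity_apply _ measurableSet_Ioi
  have hFk : ∀ x, ∫⁻ u in Ioi x, l (Ioo x u) * g u ∂η = F x := fun x => by
    rw [hFf, ← lintegral_kernel_Ioi hg]
  have hFfin : ∀ x, F x ≠ ∞ := fun x => measure_ne_top _ _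
  obtain ⟨y, hy, hyh⟩ := exists_halving (l := l) (m := m)
  set θ : ℝ → ℝ≥0∞ := {x | 0 < F x}.indicator fun x => f x * (F x)⁻¹ with hθ
  have hpos : MeasurableSet {x | 0 < F x} := hFm measurableSet_Ioi
  have hθm : Measurable θ := (measurable_mul' hfm hFm.inv).indicator hpos
  have hωm : Measurable fun x => ω (Iio x) := measurable_measure_Iio
  have hkm : Measurable fun x => l (Ioo x (y x)) :=
    measurable_measure_Ioo.comp (measurable_id.prodMk hy)
  have hPm : Measurable fun x => ∫⁻ u in Ioo x (y x), l (Ioo x u) * g u ∂η :=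
    measurable_setLIntegral_Ioo (φ := fun x u => l (Ioo x u) * g u)
      (measurable_mul' measurable_measure_Ioo (hg.comp measurable_snd)) hy
  -- pointwise bound
  have hae : ∀ᵐ x ∂l, F x * 1 ≤ 2 * ((∫⁻ u in Ioo x (y x), l (Ioo x u) * g u ∂η)
      + l (Ioo x (y x)) * f (y x)) := by
    filter_upwards [hyh] with x hx
    rcases eq_or_ne (F x) 0 with h0 | h0
    · rw [h0]; simp
    obtain ⟨h1, h2⟩ := hx (pos_iff_ne_zero.2 h0)
    have hxy : x ≤ y x := by
      by_contra h
      have h3 : F x ≤ F (y x) := antitone_measure_Ioi (not_le.1 h).le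
      have h4 : 2 * F x ≤ 1 * F x := by rw [one_mul]; exact (mul_le_mul_right h3 2).trans h1
      exact absurd h4 (not_le.2 (ENNReal.mul_lt_mul_left h0 (hFfin x) (by norm_num)))
    have hd : Disjoint (Ioc x (y x)) (Ioi (y x)) :=
      disjoint_left.2 fun z (hz : z ∈ Ioc x (y x)) (hz' : y x < z) => not_lt.2 hz.2 hz'
    have hsum : m (Ioo x (y x)) + F (y x) = F x := by
      rw [measure_congr (Ioo_ae_eq_Ioc (μ := m)), hF]
      show m (Ioc x (y x)) + m (Ioi (y x)) = m (Ioi x)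
      rw [← measure_union hd measurableSet_Ioi, Ioc_union_Ioi_eq_Ioi hxy]
    have hhalf : F x ≤ 2 * m (Ioo x (y x)) := by
      have : F x + F x ≤ F x + 2 * m (Ioo x (y x)) := by
        calc F x + F x = 2 * m (Ioo x (y x)) + 2 * F (y x) := by rw [← mul_add, hsum, two_mul]
          _ ≤ 2 * m (Ioo x (y x)) + F x := by gcongr
          _ = _ := add_comm _ _
      exact (ENNReal.add_le_add_iff_left (hFfin x)).1 this
    rw [mul_one]
    refine hhalf.trans (mul_le_mul_right ?_ _)
    rw [hm, withDensity_apply _ measurableSet_Ioo]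
    have hsplit : ∀ t ∈ Ioo x (y x), f t ≤ (∫⁻ u in Ioi t, (Ioo x (y x)).indicator g u ∂η)
        + f (y x) := by
      intro t ht
      have e1 : f t = (∫⁻ u in Ioc t (y x), g u ∂η) + f (y x) := by
        rw [hf]
        show ∫⁻ u in Ioi t, g u ∂η = (∫⁻ u in Ioc t (y x), g u ∂η) + ∫⁻ u in Ioi (y x), g u ∂η
        rw [← Ioc_union_Ioi_eq_Ioi ht.2.le, lintegral_union measurableSet_Ioi
          (disjoint_left.2 fun z (hz : z ∈ Ioc t (y x)) (hz' : y x < z) => not_lt.2 hz.2 hz')]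
      rw [e1, setLIntegral_congr (Ioo_ae_eq_Ioc (μ := η)).symm, lintegral_indicator measurableSet_Ioo,
        restrict_restrict measurableSet_Ioo]
      gcongr
      exact fun z hz => ⟨⟨ht.1.trans hz.1, hz.2⟩, hz.1⟩
    calc ∫⁻ t in Ioo x (y x), f t ∂l
        ≤ ∫⁻ t in Ioo x (y x), ((∫⁻ u in Ioi t, (Ioo x (y x)).indicator g u ∂η) + f (y x)) ∂l :=
          setLIntegral_mono' measurableSet_Ioo hsplit
      _ = (∫⁻ t in Ioo x (y x), (∫⁻ u in Ioi t, (Ioo x (y x)).indicator g u ∂η) ∂l)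
          + l (Ioo x (y x)) * f (y x) := by
          rw [lintegral_add_right _ measurable_const]
          simp [mul_comm]
      _ ≤ (∫⁻ t in Ioi x, (∫⁻ u in Ioi t, (Ioo x (y x)).indicator g u ∂η) ∂l)
          + l (Ioo x (y x)) * f (y x) := by
          gcongr
          exact Ioo_subset_Ioi_self
      _ = _ := by
          rw [lintegral_kernel_Ioi (hg.indicator measurableSet_Ioo)]
          congr 1
          have : ∀ u, l (Ioo x u) * (Ioo x (y x)).indicator g u
              = (Ioo x (y x)).indicator (fun u => l (Ioo x u) * g u) u := fun u => by
            by_cases hu : u ∈ Ioo x (y x)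
            · rw [indicator_of_mem hu, indicator_of_mem hu]
            · rw [indicator_of_notMem hu, indicator_of_notMem hu, mul_zero]
          simp_rw [this]
          rw [lintegral_indicator measurableSet_Ioo, restrict_restrict measurableSet_Ioo,
            inter_eq_left.2 Ioo_subset_Ioi_self]
  have hov : ∀ u, ∫⁻ x in {x | x < u ∧ u < y x}, θ x ∂l ≤ 2 := by
    intro u
    have hset : MeasurableSet {x | x < u ∧ u < y x} := measurableSet_Iio.inter (hy measurableSet_Ioi)
    rw [← lintegral_indicator hset]
    refine le_trans ?_ (lintegral_halving_le (l := l) hfm u)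
    have hset2 : MeasurableSet {x | x < u ∧ m (Ioi x) ≤ 2 * m (Ioi u) ∧ 0 < m (Ioi x)} :=
      measurableSet_Iio.inter ((measurableSet_le hFm measurable_const).inter hpos)
    rw [← lintegral_indicator hset2]
    refine lintegral_mono_ae ?_
    filter_upwards [hyh] with x hx
    by_cases h : x < u ∧ u < y x
    · rw [indicator_of_mem (by exact h)]
      by_cases h0 : 0 < F x
      · have hmem : x ∈ {x | x < u ∧ m (Ioi x) ≤ 2 * m (Ioi u) ∧ 0 < m (Ioi x)} :=
          ⟨h.1, (hx h0).2 u h.2, h0⟩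
        rw [indicator_of_mem hmem, hθ, indicator_of_mem (by exact h0)]
      · rw [hθ, indicator_of_notMem (by exact h0)]; exact zero_le
    · rw [indicator_of_notMem (by exact h)]; exact zero_le
  set d : ℝ → ℝ≥0∞ := fun x => ω (Iio x) * l (Ioo x (y x)) ^ s * θ x with hd
  have hdm : Measurable d := measurable_mul' (measurable_mul' hωm (hkm.pow_const s)) hθm
  refine ⟨θ, y, (l.withDensity d).map y, hθm, hy, inferInstance, hov, fun z => ?_, ?_⟩
  · rw [Measure.map_apply hy measurableSet_Iio, withDensity_apply _ (hy measurableSet_Iio)]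
    exact lintegral_weight_le hθm hy hov hs z
  simp_rw [hFk]
  have hwd := lintegral_withDensity_eq_lintegral_mul l hdm (g := fun x => f (y x) ^ s)
    ((hfm.comp hy).pow_const s)
  rw [lintegral_map (hfm.pow_const s) hy, hwd]
  have hrule : ∫⁻ x, F x ^ s ∂ω = ofReal s * ∫⁻ t, F t ^ (s - 1) * f t * ω (Iio t) ∂l := by
    have h := lintegral_lintegral_Iio_rpow (μ := refl l) (ω := refl ω) (g := fun t => f (-t))
      (by fun_prop) hs.le
    simpa only [lintegral_refl, setLIntegral_refl_Iio, refl_Iio, refl_Ioi, neg_neg, ← hFf] using h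
  have hbound : ∀ᵐ x ∂l, F x ^ (s - 1) * f x * ω (Iio x) ≤ 4 ^ s *
      (d x * f (y x) ^ s + ω (Iio x) * (∫⁻ u in Ioo x (y x), l (Ioo x u) * g u ∂η) ^ s * θ x) := by
    filter_upwards [hae] with x hx
    rcases eq_or_ne (F x) 0 with h0 | h0
    · rw [h0, zero_rpow_of_pos (by linarith), zero_mul, zero_mul]; exact zero_le
    have e1 : F x ^ (s - 1) * f x = F x ^ s * θ x := by
      rw [hθ, indicator_of_mem (by exact pos_iff_ne_zero.2 h0), ENNReal.rpow_sub _ _ h0 (hFfin x),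
        rpow_one, div_eq_mul_inv]
      ring
    set P := ∫⁻ u in Ioo x (y x), l (Ioo x u) * g u ∂η
    have h3 : F x ^ s ≤ 4 ^ s * (P ^ s + (l (Ioo x (y x)) * f (y x)) ^ s) := by
      rw [mul_one] at hx
      calc F x ^ s ≤ (2 * (P + l (Ioo x (y x)) * f (y x))) ^ s := rpow_le_rpow hx hs0.le
        _ = 2 ^ s * (P + l (Ioo x (y x)) * f (y x)) ^ s := mul_rpow_of_nonneg _ _ hs0.le
        _ ≤ 2 ^ s * (2 ^ (s - 1) * (P ^ s + (l (Ioo x (y x)) * f (y x)) ^ s)) := by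
            gcongr
            exact ENNReal.rpow_add_le_mul_rpow_add_rpow _ _ hs.le
        _ ≤ 2 ^ s * (2 ^ s * (P ^ s + (l (Ioo x (y x)) * f (y x)) ^ s)) := by
            gcongr
            · norm_num
            · linarith
        _ = _ := by rw [← mul_assoc, ← mul_rpow_of_nonneg _ _ hs0.le]; norm_num
    rw [e1]
    calc F x ^ s * θ x * ω (Iio x)
        ≤ 4 ^ s * (P ^ s + (l (Ioo x (y x)) * f (y x)) ^ s) * θ x * ω (Iio x) := by gcongr
      _ = _ := by rw [mul_rpow_of_nonneg _ _ hs0.le, hd]; ring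
  rw [hrule, mul_assoc]
  refine mul_le_mul_right ?_ _
  refine (lintegral_mono_ae hbound).trans ?_
  have hm1 : Measurable fun x => d x * f (y x) ^ s := measurable_mul' hdm ((hfm.comp hy).pow_const s)
  have hm2 : Measurable fun x => ω (Iio x) * (∫⁻ u in Ioo x (y x), l (Ioo x u) * g u ∂η) ^ s * θ x :=
    measurable_mul' (measurable_mul' hωm (hPm.pow_const s)) hθm
  have hm3 : Measurable fun x => d x * f (y x) ^ s
      + ω (Iio x) * (∫⁻ u in Ioo x (y x), l (Ioo x u) * g u ∂η) ^ s * θ x := hm1.add hm2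
  rw [lintegral_const_mul _ hm3, lintegral_add_left hm1]
  exact le_of_eq rfl

/-- Local part, `r ≤ s`. -/
lemma local_part_le [IsFiniteMeasure l] [NullSingletonClass l] [SFinite η] {r s : ℝ} (hr : 1 < r)
    (hrs : r ≤ s) {θ : ℝ → ℝ≥0∞} {y : ℝ → ℝ} (hθ : Measurable θ) (hy : Measurable y)
    (hov : ∀ u, ∫⁻ x in {x | x < u ∧ u < y x}, θ x ∂l ≤ 2) {g : ℝ → ℝ≥0∞} (hg : Measurable g)
    {A : ℝ≥0∞} (hA : ∀ x, ω (Iio x) *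
      (∫⁻ u in Ioi x, l (Ioo x u) ^ (r / (r - 1)) ∂η) ^ (s * (1 - 1 / r)) ≤ A) :
    ∫⁻ x, ω (Iio x) * (∫⁻ u in Ioo x (y x), l (Ioo x u) * g u ∂η) ^ s * θ x ∂l
      ≤ 2 * A * (∫⁻ u, g u ^ r ∂η) ^ (s / r) := by
  have hr0 : 0 < r := by linarith
  have hs0 : 0 < s := by linarith
  have hsr : 0 ≤ s / r - 1 := by rw [sub_nonneg, le_div_iff₀ hr0]; linarith
  have hθr : 0 ≤ s * (1 - 1 / r) := by
    have : 1 / r ≤ 1 := by rw [div_le_one hr0]; exact hr.le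
    exact mul_nonneg hs0.le (by linarith)
  set N := ∫⁻ u, g u ^ r ∂η with hN
  have hpt : ∀ x, ω (Iio x) * (∫⁻ u in Ioo x (y x), l (Ioo x u) * g u ∂η) ^ s * θ x
      ≤ A * N ^ (s / r - 1) * (θ x * ∫⁻ u in Ioo x (y x), g u ^ r ∂η) := by
    intro x
    set n := ∫⁻ u in Ioo x (y x), g u ^ r ∂η
    have hnN : n ≤ N := setLIntegral_le_lintegral _ _
    have h1 := lintegral_mul_le_conj (μ := η.restrict (Ioo x (y x)))
      (measurable_measure_Ioo_right (l := l) x).aemeasurable hg.aemeasurable hr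
    have h2 : (∫⁻ u in Ioo x (y x), l (Ioo x u) * g u ∂η) ^ s
        ≤ (∫⁻ u in Ioi x, l (Ioo x u) ^ (r / (r - 1)) ∂η) ^ (s * (1 - 1 / r))
          * (N ^ (s / r - 1) * n) := by
      calc _ ≤ ((∫⁻ u in Ioo x (y x), l (Ioo x u) ^ (r / (r - 1)) ∂η) ^ (1 - 1 / r)
            * n ^ (1 / r)) ^ s := rpow_le_rpow h1 hs0.le
        _ = (∫⁻ u in Ioo x (y x), l (Ioo x u) ^ (r / (r - 1)) ∂η) ^ (s * (1 - 1 / r))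
            * (n ^ (s / r - 1) * n) := by
            rw [mul_rpow_of_nonneg _ _ hs0.le, ← rpow_mul, ← rpow_mul,
              mul_comm s (1 - 1 / r)]
            congr 1
            conv_lhs => rw [show 1 / r * s = (s / r - 1) + 1 by ring]
            rw [rpow_add_of_nonneg _ _ hsr (by norm_num), rpow_one]
        _ ≤ _ := by
            gcongr
            exact Ioo_subset_Ioi_self
    calc _ ≤ ω (Iio x) * ((∫⁻ u in Ioi x, l (Ioo x u) ^ (r / (r - 1)) ∂η) ^ (s * (1 - 1 / r))
          * (N ^ (s / r - 1) * n)) * θ x := by gcongr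
      _ = (ω (Iio x) * (∫⁻ u in Ioi x, l (Ioo x u) ^ (r / (r - 1)) ∂η) ^ (s * (1 - 1 / r)))
          * (N ^ (s / r - 1) * (θ x * n)) := by ring
      _ ≤ A * (N ^ (s / r - 1) * (θ x * n)) := by gcongr; exact hA x
      _ = _ := by ring
  have hnm : Measurable fun x => ∫⁻ u in Ioo x (y x), g u ^ r ∂η :=
    measurable_setLIntegral_Ioo (φ := fun _ u => g u ^ r)
      ((hg.pow_const r).comp measurable_snd) hy
  calc _ ≤ ∫⁻ x, A * N ^ (s / r - 1) * (θ x * ∫⁻ u in Ioo x (y x), g u ^ r ∂η) ∂l :=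
        lintegral_mono hpt
    _ = A * N ^ (s / r - 1) * ∫⁻ x, (θ x * ∫⁻ u in Ioo x (y x), g u ^ r ∂η) ∂l :=
        lintegral_const_mul _ (measurable_mul' hθ hnm)
    _ ≤ A * N ^ (s / r - 1) * (2 * N) := by
        gcongr
        exact lintegral_overlap_le hθ hy hov (hg.pow_const r)
    _ = 2 * A * N ^ (s / r) := by
        conv_rhs => rw [show s / r = (s / r - 1) + 1 by ring]
        rw [rpow_add_of_nonneg _ _ hsr (by norm_num), rpow_one]
        ring

/-- Local part, `s < r`. -/
lemma local_part_gt [IsFiniteMeasure l] [NullSingletonClass l] [SFinite η] [IsFiniteMeasure ω]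
    [NullSingletonClass ω] {r s : ℝ} (hs : 1 < s)
    (hsr : s < r) {θ : ℝ → ℝ≥0∞} {y : ℝ → ℝ} (hθ : Measurable θ) (hy : Measurable y)
    (hov : ∀ u, ∫⁻ x in {x | x < u ∧ u < y x}, θ x ∂l ≤ 2) {g : ℝ → ℝ≥0∞} (hg : Measurable g) :
    ∫⁻ x, ω (Iio x) * (∫⁻ u in Ioo x (y x), l (Ioo x u) * g u ∂η) ^ s * θ x ∂l
      ≤ (ofReal (r / (r - s)) * 2 * ∫⁻ ξ, ω (Iio ξ) ^ (r / (r - s) - 1) *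
          (∫⁻ u in Ioi ξ, l (Ioo ξ u) ^ (r / (r - 1)) ∂η) ^ (s * (r - 1) / (r - s)) ∂ω)
            ^ ((r - s) / r) * (2 * ∫⁻ u, g u ^ r ∂η) ^ (s / r) := by
  have hr0 : 0 < r := by linarith
  have hr1 : 0 < r - 1 := by linarith
  have hs0 : 0 < s := by linarith
  have hrs : 0 < r - s := by linarith
  set κ := r / (r - s) with hκ
  have hκ0 : 0 < κ := by positivity
  set δ := s * (r - 1) / (r - s) with hδ
  have hδ1 : 0 ≤ δ - 1 := by rw [hδ, sub_nonneg, le_div_iff₀ hrs]; nlinarith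
  set Ψ : ℝ → ℝ≥0∞ := fun x => ∫⁻ u in Ioo x (y x), l (Ioo x u) ^ (r / (r - 1)) ∂η with hΨ
  set n : ℝ → ℝ≥0∞ := fun x => ∫⁻ u in Ioo x (y x), g u ^ r ∂η with hn
  set D : ℝ → ℝ≥0∞ := fun ξ => ∫⁻ u in Ioi ξ, l (Ioo ξ u) ^ (r / (r - 1)) ∂η with hD
  have hΨm : Measurable Ψ := measurable_setLIntegral_Ioo
    (φ := fun x u => l (Ioo x u) ^ (r / (r - 1))) (measurable_measure_Ioo.pow_const _) hy
  have hnm : Measurable n := measurable_setLIntegral_Ioo (φ := fun _ u => g u ^ r)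
      ((hg.pow_const r).comp measurable_snd) hy
  have hωm : Measurable fun x => ω (Iio x) := measurable_measure_Iio
  have hκθ : (r - s) / r + s / r = 1 := by field_simp; ring
  have hκi : (r - s) / r = 1 / κ := by rw [hκ]; field_simp
  have he0 : 0 < (r - s) / r := by positivity
  have he1 : 1 - (r - s) / r = s / r := by linarith
  have hpt : ∀ x, ω (Iio x) * (∫⁻ u in Ioo x (y x), l (Ioo x u) * g u ∂η) ^ s * θ x
      ≤ (ω (Iio x) ^ κ * Ψ x ^ δ * θ x) ^ ((r - s) / r) * (θ x * n x) ^ (1 - (r - s) / r) := by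
    intro x
    have h1 := lintegral_mul_le_conj (μ := η.restrict (Ioo x (y x)))
      (measurable_measure_Ioo_right (l := l) x).aemeasurable hg.aemeasurable (hs.trans hsr)
    calc _ ≤ ω (Iio x) * (Ψ x ^ (1 - 1 / r) * n x ^ (1 / r)) ^ s * θ x := by
          gcongr
      _ = _ := by
          rw [mul_rpow_of_nonneg _ _ hs0.le, mul_rpow_of_nonneg _ _ he0.le,
            mul_rpow_of_nonneg _ _ he0.le, he1, mul_rpow_of_nonneg _ _ (by positivity),
            ← rpow_mul, ← rpow_mul, ← rpow_mul, ← rpow_mul,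
            show κ * ((r - s) / r) = 1 by rw [hκi]; field_simp, rpow_one,
            show δ * ((r - s) / r) = (1 - 1 / r) * s by rw [hδ]; field_simp,
            show 1 / r * s = s / r by ring]
          have : θ x = θ x ^ ((r - s) / r) * θ x ^ (s / r) := by
            rw [← rpow_add_of_nonneg _ _ he0.le (by positivity), hκθ, rpow_one]
          conv_lhs => rw [this]
          ring
  have hm1 : Measurable fun x => ω (Iio x) ^ κ * Ψ x ^ δ * θ x :=
    measurable_mul' (measurable_mul' (hωm.pow_const κ) (hΨm.pow_const δ)) hθ
  refine (lintegral_mono hpt).trans ((lintegral_rpow_mul_le hm1.aemeasurable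
    (measurable_mul' hθ hnm).aemeasurable he0.le (by rw [div_le_one hr0]; linarith)).trans ?_)
  rw [he1]
  refine mul_le_mul' (rpow_le_rpow ?_ he0.le)
    (rpow_le_rpow (lintegral_overlap_le hθ hy hov (hg.pow_const r)) (by positivity))
  have hω : ∀ x, ω (Iio x) ^ κ * Ψ x ^ δ * θ x
      = ofReal κ * ((∫⁻ ξ in Iio x, ω (Iio ξ) ^ (κ - 1) ∂ω) * (Ψ x ^ δ * θ x)) := fun x => by
    rw [← lintegral_Iio_rpow hκ0 (measure_ne_top _ _)]; ring
  simp_rw [hω]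
  have hψm : Measurable fun x => Ψ x ^ δ * θ x := measurable_mul' (hΨm.pow_const δ) hθ
  have hDm : Measurable D := measurable_setLIntegral_Ioi
    (φ := fun x u => l (Ioo x u) ^ (r / (r - 1))) (measurable_measure_Ioo.pow_const _)
  rw [lintegral_const_mul _ (measurable_mul' (measurable_lintegral_Iio _) hψm),
    lintegral_lintegral_Iio_mul (hωm.pow_const _) hψm, mul_assoc]
  refine mul_le_mul_right ?_ _
  rw [← lintegral_const_mul _ (measurable_mul' (hωm.pow_const _) (hDm.pow_const δ))]
  refine lintegral_mono fun ξ => ?_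
  rw [mul_left_comm]
  refine mul_le_mul_right ?_ _
  set J : ℝ → ℝ≥0∞ := fun x => ∫⁻ u in Ioo x (y x), l (Ioo ξ u) ^ (r / (r - 1)) ∂η with hJ
  have hJm : Measurable J := measurable_setLIntegral_Ioo (φ := fun _ u => l (Ioo ξ u) ^ (r / (r - 1)))
    (((measurable_measure_Ioo_right (l := l) ξ).pow_const _).comp measurable_snd) hy
  have hΨJ : ∀ x ∈ Ioi ξ, Ψ x ^ δ * θ x ≤ D ξ ^ (δ - 1) * (θ x * J x) := by
    intro x hx
    have e1 : Ψ x ≤ J x := lintegral_mono fun u => rpow_le_rpow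
      (measure_mono (Ioo_subset_Ioo_left (le_of_lt hx))) (by positivity)
    have e2 : J x ≤ D ξ := lintegral_mono_set fun u hu => lt_trans hx hu.1
    calc Ψ x ^ δ * θ x = Ψ x ^ (δ - 1) * Ψ x * θ x := by
          conv_lhs => rw [show δ = (δ - 1) + 1 by ring]
          rw [rpow_add_of_nonneg _ _ hδ1 (by norm_num), rpow_one]
      _ ≤ D ξ ^ (δ - 1) * J x * θ x := by
          have := rpow_le_rpow (e1.trans e2) hδ1
          gcongr
      _ = _ := by ring
  calc ∫⁻ x in Ioi ξ, Ψ x ^ δ * θ x ∂l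
      ≤ ∫⁻ x in Ioi ξ, D ξ ^ (δ - 1) * (θ x * J x) ∂l := setLIntegral_mono' measurableSet_Ioi hΨJ
    _ = D ξ ^ (δ - 1) * ∫⁻ x in Ioi ξ, θ x * J x ∂l := lintegral_const_mul _ (measurable_mul' hθ hJm)
    _ ≤ D ξ ^ (δ - 1) * (2 * D ξ) := by
        gcongr
        exact lintegral_overlap_le_of_subset hθ hy hov
          ((measurable_measure_Ioo_right (l := l) ξ).pow_const _) measurableSet_Ioi measurableSet_Ioi
          fun x hx u hu => lt_trans hx hu.1
    _ = 2 * D ξ ^ δ := by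
        conv_rhs => rw [show δ = (δ - 1) + 1 by ring]
        rw [rpow_add_of_nonneg _ _ hδ1 (by norm_num), rpow_one]
        ring

/-- Truncation for the kernel operator. -/
lemma kernel_le_of_truncations [SigmaFinite l] [NullSingletonClass l] [SigmaFinite η]
    [SigmaFinite ω] {r s : ℝ} (hr : 0 < r) (hs : 0 < s) {C : ℝ≥0∞}
    (h : ∀ n, ∀ g : ℝ → ℝ≥0∞, Measurable g → ∀ c : ℝ≥0∞, c ≠ ∞ → (∀ t, g t ≤ c) →
      ∫⁻ x, (∫⁻ u in Ioi x, (l.restrict (spanningSets l n)) (Ioo x u) * g u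
        ∂(η.restrict (spanningSets η n))) ^ s ∂(ω.restrict (spanningSets ω n))
      ≤ C * (∫⁻ u, g u ^ r ∂(η.restrict (spanningSets η n))) ^ (s / r))
    {g : ℝ → ℝ≥0∞} (hg : Measurable g) :
    ∫⁻ x, (∫⁻ u in Ioi x, l (Ioo x u) * g u ∂η) ^ s ∂ω ≤ C * (∫⁻ u, g u ^ r ∂η) ^ (s / r) := by
  have hfl := fun n => isFiniteMeasure_restrict_spanningSets (μ := l) n
  have hfη := fun n => isFiniteMeasure_restrict_spanningSets (μ := η) n
  have a1 : ∀ x, Appr (fun n : ℕ => ∫⁻ u in Ioi x, (l.restrict (spanningSets l n)) (Ioo x u)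
      * min (g u) n ∂(η.restrict (spanningSets η n))) (∫⁻ u in Ioi x, l (Ioo x u) * g u ∂η) :=
    fun x => Appr.setLIntegral_restrict (monotone_spanningSets η) (iUnion_spanningSets η)
      (measurableSet_spanningSets η)
      (fun n => measurable_mul' (measurable_measure_Ioo_right x) (hg.min measurable_const))
      (fun u => (appr_measure_spanningSets measurableSet_Ioo).mul (Appr.min_nat _)) measurableSet_Ioi
  have a2 := appr_lintegral_spanningSets (μ := ω) (fun n => (measurable_setLIntegral_Ioi
    (η := η.restrict (spanningSets η n)) (φ := fun x u => (l.restrict (spanningSets l n)) (Ioo x u)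
      * min (g u) n) (measurable_mul' measurable_measure_Ioo
        ((hg.min measurable_const).comp measurable_snd))).pow_const s) (fun x => (a1 x).rpow hs.le)
  refine a2.le_of_forall_le fun n => ?_
  refine (h n _ (hg.min measurable_const) n (by simp) fun t => min_le_right _ _).trans ?_
  refine mul_le_mul_right (rpow_le_rpow ?_ (by positivity)) _
  exact lintegral_mono' restrict_le_self
    fun t => rpow_le_rpow (min_le_left _ _) hr.le

/-- Weighted inequality for the additive kernel, `r ≤ s`. -/
theorem kernel_le [SigmaFinite l] [NullSingletonClass l] [SigmaFinite η]
    [NullSingletonClass η] [SigmaFinite ω] [NullSingletonClass ω] {r s : ℝ} (hr : 1 < r)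
    (hrs : r ≤ s) {A₁ A₂ : ℝ≥0∞}
    (hA₁ : ∀ z, (∫⁻ ξ in Iio z, l (Ioo ξ z) ^ s ∂ω) * η (Ioi z) ^ (s * (1 - 1 / r)) ≤ A₁)
    (hA₂ : ∀ x, ω (Iio x) *
      (∫⁻ u in Ioi x, l (Ioo x u) ^ (r / (r - 1)) ∂η) ^ (s * (1 - 1 / r)) ≤ A₂)
    {g : ℝ → ℝ≥0∞} (hg : Measurable g) : ∫⁻ x, (∫⁻ u in Ioi x, l (Ioo x u) * g u ∂η) ^ s ∂ω
      ≤ ofReal s * 4 ^ s * (hardyC r s (r - 1) * (2 * A₁) + 2 * A₂)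
        * (∫⁻ u, g u ^ r ∂η) ^ (s / r) := by
  have hr0 : 0 < r := by linarith
  have hs0 : 0 < s := by linarith
  have hθr : 0 ≤ s * (1 - 1 / r) := by
    have : 1 / r ≤ 1 := by rw [div_le_one hr0]; exact hr.le
    exact mul_nonneg hs0.le (by linarith)
  have hr1 : 0 < r - 1 := by linarith
  refine kernel_le_of_truncations hr0 hs0 (fun n g hg c hc hgc => ?_) hg
  have hfl := isFiniteMeasure_restrict_spanningSets (μ := l) n
  have hfη := isFiniteMeasure_restrict_spanningSets (μ := η) n
  have hfω := isFiniteMeasure_restrict_spanningSets (μ := ω) n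
  have hl : l.restrict (spanningSets l n) ≤ l := restrict_le_self
  have hη : η.restrict (spanningSets η n) ≤ η := restrict_le_self
  have hω : ω.restrict (spanningSets ω n) ≤ ω := restrict_le_self
  set l' := l.restrict (spanningSets l n)
  set η' := η.restrict (spanningSets η n)
  set ω' := ω.restrict (spanningSets ω n)
  obtain ⟨θ, y, w, hθ, hy, hw, hov, hwK, hdec⟩ :=
    exists_kernel_decomposition (l := l') (η := η') (ω := ω') (by linarith : 1 < s) hg hc hgc
  refine hdec.trans ?_
  rw [mul_assoc _ (_ + _), add_mul]
  refine mul_le_mul_right (add_le_add ?_ ?_) _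
  · refine hardy_dual_le hr hrs (fun z => ?_) hg
    calc w (Iio z) * η' (Ioi z) ^ (s * (1 - 1 / r))
        ≤ (2 * ∫⁻ ξ in Iio z, l (Ioo ξ z) ^ s ∂ω) * η (Ioi z) ^ (s * (1 - 1 / r)) := by
          refine mul_le_mul' ((hwK z).trans (mul_le_mul_right ?_ _))
            (rpow_le_rpow (hη _) hθr)
          exact lintegral_mono' (restrict_mono_measure hω _)
            fun ξ => rpow_le_rpow (hl _) hs0.le
      _ ≤ 2 * A₁ := by rw [mul_assoc]; exact mul_le_mul_right (hA₁ z) _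
  · refine local_part_le hr hrs hθ hy hov hg fun x => (mul_le_mul' (hω _)
      (rpow_le_rpow ?_ hθr)).trans (hA₂ x)
    exact lintegral_mono' (restrict_mono_measure hη _)
      fun ξ => rpow_le_rpow (hl _) (by positivity)

/-- Weighted inequality for the additive kernel, `s < r`. -/
theorem kernel_gt [SigmaFinite l] [NullSingletonClass l] [SigmaFinite η]
    [NullSingletonClass η] [SigmaFinite ω] [NullSingletonClass ω] {r s : ℝ} (hs : 1 < s)
    (hsr : s < r) {g : ℝ → ℝ≥0∞} (hg : Measurable g) :
    ∫⁻ x, (∫⁻ u in Ioi x, l (Ioo x u) * g u ∂η) ^ s ∂ω ≤ ofReal s * 4 ^ s *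
        (hardyC r s (s - 1) * (∫⁻ z, (2 * ∫⁻ ξ in Iio z, l (Ioo ξ z) ^ s ∂ω) ^ (r / (r - s))
            * η (Ioi z) ^ (r / (r - s) * (s - 1)) ∂η) ^ ((r - s) / r)
          + 2 ^ (s / r) * (ofReal (r / (r - s)) * 2 * ∫⁻ ξ, ω (Iio ξ) ^ (r / (r - s) - 1) *
          (∫⁻ u in Ioi ξ, l (Ioo ξ u) ^ (r / (r - 1)) ∂η) ^ (s * (r - 1) / (r - s)) ∂ω)
            ^ ((r - s) / r)) * (∫⁻ u, g u ^ r ∂η) ^ (s / r) := by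
  have hr0 : 0 < r := by linarith
  have hs0 : 0 < s := by linarith
  have hr1 : 0 < r - 1 := by linarith
  have hs1 : 0 < s - 1 := by linarith
  have hrs : 0 < r - s := by linarith
  have hκ1 : 0 ≤ r / (r - s) - 1 := by rw [sub_nonneg, le_div_iff₀ hrs]; linarith
  refine kernel_le_of_truncations hr0 hs0 (fun n g hg c hc hgc => ?_) hg
  have hfl := isFiniteMeasure_restrict_spanningSets (μ := l) n
  have hfη := isFiniteMeasure_restrict_spanningSets (μ := η) n
  have hfω := isFiniteMeasure_restrict_spanningSets (μ := ω) n
  have hl : l.restrict (spanningSets l n) ≤ l := restrict_le_self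
  have hη : η.restrict (spanningSets η n) ≤ η := restrict_le_self
  have hω : ω.restrict (spanningSets ω n) ≤ ω := restrict_le_self
  set l' := l.restrict (spanningSets l n)
  set η' := η.restrict (spanningSets η n)
  set ω' := ω.restrict (spanningSets ω n)
  obtain ⟨θ, y, w, hθ, hy, hw, hov, hwK, hdec⟩ :=
    exists_kernel_decomposition (l := l') (η := η') (ω := ω') hs hg hc hgc
  refine hdec.trans ?_
  rw [mul_assoc _ (_ + _), add_mul]
  refine mul_le_mul_right (add_le_add ?_ ?_) _
  · refine (hardy_dual_gt hs.le hsr hg).trans ?_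
    refine mul_le_mul_left (mul_le_mul_right (rpow_le_rpow ?_ (by positivity)) _) _
    refine lintegral_mono' hη fun z => mul_le_mul' (rpow_le_rpow
      ((hwK z).trans (mul_le_mul_right ?_ _)) (by positivity))
      (rpow_le_rpow (hη _) (by positivity))
    exact lintegral_mono' (restrict_mono_measure hω _)
      fun ξ => rpow_le_rpow (hl _) hs0.le
  · refine (local_part_gt hs hsr hθ hy hov hg).trans ?_
    rw [mul_rpow_of_nonneg _ _ (by positivity : 0 ≤ s / r), ← mul_assoc, mul_comm (_ ^ _) (2 ^ _)]
    refine mul_le_mul_left (mul_le_mul_right (rpow_le_rpow (mul_le_mul_right ?_ _)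
      (by positivity)) _) _
    refine lintegral_mono' hω fun z => mul_le_mul' (rpow_le_rpow (hω _) hκ1)
      (rpow_le_rpow ?_ (by positivity))
    exact lintegral_mono' (restrict_mono_measure hη _)
      fun ξ => rpow_le_rpow (hl _) (by positivity)

end

section

variable {μ ω η l ν : Measure ℝ}

/-! ### Necessary conditions for the additive kernel -/

lemma rpow_lintegral_Iio [SigmaFinite μ] [NullSingletonClass μ] {g : ℝ → ℝ≥0∞}
    (hg : Measurable g) {s : ℝ} (hs : 1 ≤ s) (y : ℝ) : (∫⁻ t in Iio y, g t ∂μ) ^ s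
      = ofReal s * ∫⁻ t in Iio y, (∫⁻ u in Iio t, g u ∂μ) ^ (s - 1) * g t ∂μ := by
  have h := lintegral_lintegral_Iio_rpow (μ := μ) (ω := Measure.dirac y) hg hs
  rw [lintegral_dirac' _ ((measurable_lintegral_Iio g).pow_const s)] at h
  rw [h, ← lintegral_indicator measurableSet_Iio]
  congr 1
  refine lintegral_congr fun t => ?_
  rw [Measure.dirac_apply' _ measurableSet_Ioi]
  by_cases ht : t < y
  · rw [indicator_of_mem (by exact ht), indicator_of_mem (by exact ht), Pi.one_apply, mul_one]
  · rw [indicator_of_notMem (by exact ht), indicator_of_notMem (by exact ht), mul_zero]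

lemma measurable_measure_Ioo' [SigmaFinite l] [NullSingletonClass l] :
    Measurable fun p : ℝ × ℝ => l (Ioo p.1 p.2) := by
  have h : (fun p : ℝ × ℝ => l (Ioo p.1 p.2))
      = fun p => ⨆ n, (l.restrict (spanningSets l n)) (Ioo p.1 p.2) := by
    ext p
    exact (appr_measure_spanningSets (μ := l) measurableSet_Ioo).2.symm
  rw [h]
  refine Measurable.iSup fun n => ?_
  have := isFiniteMeasure_restrict_spanningSets (μ := l) n
  exact measurable_measure_Ioo

lemma measurable_kernel_right [SigmaFinite l] [NullSingletonClass l] (x : ℝ) :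
    Measurable fun u => l (Ioo x u) :=
  measurable_measure_Ioo'.comp (by fun_prop : Measurable fun u : ℝ => (x, u))

lemma measurable_kernel_left [SigmaFinite l] [NullSingletonClass l] (u : ℝ) :
    Measurable fun x => l (Ioo x u) :=
  measurable_measure_Ioo'.comp (by fun_prop : Measurable fun x : ℝ => (x, u))

lemma measurable_kernel_lintegral [SigmaFinite l] [NullSingletonClass l] [SFinite η]
    {g : ℝ → ℝ≥0∞} (hg : Measurable g) : Measurable fun x => ∫⁻ u in Ioi x, l (Ioo x u) * g u ∂η :=
  measurable_setLIntegral_Ioi (φ := fun x u => l (Ioo x u) * g u)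
    (measurable_mul' measurable_measure_Ioo' (hg.comp measurable_snd))

/-- Converse Hölder inequality for the kernel at a fixed point. -/
lemma kernel_conj_le [SigmaFinite l] [NullSingletonClass l] [SigmaFinite η] {r : ℝ} (hr : 1 < r)
    {x : ℝ} {c C : ℝ≥0∞} (h : ∀ g : ℝ → ℝ≥0∞, Measurable g →
      c * ∫⁻ u in Ioi x, l (Ioo x u) * g u ∂η ≤ C * (∫⁻ u, g u ^ r ∂η) ^ (1 / r)) :
    c * (∫⁻ u in Ioi x, l (Ioo x u) ^ (r / (r - 1)) ∂η) ^ (1 - 1 / r) ≤ C := by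
  have hr0 : 0 < r := by linarith
  have hr1 : 0 < r - 1 := by linarith
  have hθ : 0 < 1 - 1 / r := by rw [sub_pos, div_lt_one hr0]; exact hr
  have hkm := measurable_kernel_right (l := l) x
  have h1 := lintegral_rpow_conj_le (μ := η)
    (G := fun u => c * (Ioi x).indicator (fun u => l (Ioo x u)) u)
    (measurable_const.mul (hkm.indicator measurableSet_Ioi)) hr (C := C) (fun E hE => by
      refine le_trans (le_of_eq ?_) (h E hE)
      rw [← lintegral_const_mul _ (measurable_mul' hkm hE), ← lintegral_indicator measurableSet_Ioi]
      refine lintegral_congr fun u => ?_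
      by_cases hu : x < u
      · rw [indicator_of_mem (by exact hu), indicator_of_mem (by exact hu), mul_assoc]
      · rw [indicator_of_notMem (by exact hu), indicator_of_notMem (by exact hu), mul_zero, zero_mul])
  refine le_trans (le_of_eq ?_) h1
  have e : ∀ u, (c * (Ioi x).indicator (fun u => l (Ioo x u)) u) ^ (r / (r - 1))
      = c ^ (r / (r - 1)) * (Ioi x).indicator (fun u => l (Ioo x u) ^ (r / (r - 1))) u := fun u => by
    rw [mul_rpow_of_nonneg _ _ (by positivity)]
    by_cases hu : x < u
    · rw [indicator_of_mem (by exact hu), indicator_of_mem (by exact hu)]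
    · rw [indicator_of_notMem (by exact hu), indicator_of_notMem (by exact hu),
        zero_rpow_of_pos (by positivity)]
  simp_rw [e]
  rw [lintegral_const_mul _ ((hkm.pow_const _).indicator measurableSet_Ioi),
    lintegral_indicator measurableSet_Ioi, mul_rpow_of_nonneg _ _ hθ.le, ← rpow_mul,
    show r / (r - 1) * (1 - 1 / r) = 1 by field_simp, rpow_one]

/-- Tonelli's theorem for the additive kernel. -/
lemma lintegral_kernel_swap [SigmaFinite l] [NullSingletonClass l] [SFinite η] [SFinite ω]
    {g φ : ℝ → ℝ≥0∞} (hg : Measurable g) (hφ : Measurable φ) {h : ℝ≥0∞ → ℝ≥0∞} (hh : Measurable h) :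
    ∫⁻ x, φ x * ∫⁻ u in Ioi x, h (l (Ioo x u)) * g u ∂η ∂ω
      = ∫⁻ u, (∫⁻ x in Iio u, h (l (Ioo x u)) * φ x ∂ω) * g u ∂η := by
  have hk : Measurable fun p : ℝ × ℝ => h (l (Ioo p.1 p.2)) := hh.comp measurable_measure_Ioo'
  have h1 := lintegral_lintegral_Iio (μ := ω) (ω := η) (Φ := fun x u => h (l (Ioo x u)) * φ x * g u)
    (measurable_mul' (measurable_mul' hk (hφ.comp measurable_fst)) (hg.comp measurable_snd))
  have e1 : ∀ u, ∫⁻ x in Iio u, h (l (Ioo x u)) * φ x * g u ∂ω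
      = (∫⁻ x in Iio u, h (l (Ioo x u)) * φ x ∂ω) * g u := fun u =>
    lintegral_mul_const _ (measurable_mul' (hk.comp (by fun_prop : Measurable fun x : ℝ => (x, u))) hφ)
  have e2 : ∀ x, ∫⁻ u in Ioi x, h (l (Ioo x u)) * φ x * g u ∂η
      = φ x * ∫⁻ u in Ioi x, h (l (Ioo x u)) * g u ∂η := fun x => by
    have hku : Measurable fun u => h (l (Ioo x u)) := hh.comp (measurable_kernel_right x)
    rw [← lintegral_const_mul _ (measurable_mul' hku hg)]
    exact lintegral_congr fun u => by ring
  simp_rw [e1, e2] at h1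
  exact h1.symm

/-- The dual form of a kernel inequality. -/
lemma kernel_dual [SigmaFinite l] [NullSingletonClass l] [SigmaFinite η] [SFinite ω]
    {r s : ℝ} (hr : 1 < r) (hs : 1 < s) {C : ℝ≥0∞} (h : ∀ g : ℝ → ℝ≥0∞, Measurable g →
      ∫⁻ x, (∫⁻ u in Ioi x, l (Ioo x u) * g u ∂η) ^ s ∂ω ≤ C * (∫⁻ u, g u ^ r ∂η) ^ (s / r))
    {φ : ℝ → ℝ≥0∞} (hφ : Measurable φ) :
    (∫⁻ u, (∫⁻ x in Iio u, l (Ioo x u) * φ x ∂ω) ^ (r / (r - 1)) ∂η) ^ (1 - 1 / r)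
      ≤ C ^ (1 / s) * (∫⁻ x, φ x ^ (s / (s - 1)) ∂ω) ^ (1 - 1 / s) := by
  have hr0 : 0 < r := by linarith
  have hs0 : 0 < s := by linarith
  refine lintegral_rpow_conj_le (measurable_setLIntegral_Iio (φ := fun u x => l (Ioo x u) * φ x)
    (measurable_mul' (measurable_measure_Ioo'.comp measurable_swap) (hφ.comp measurable_snd))) hr
    fun g hg => ?_
  have h1 := lintegral_kernel_swap (l := l) (η := η) (ω := ω) hg hφ measurable_id
  simp only [id] at h1
  rw [← h1]
  refine (lintegral_mul_le_conj hφ.aemeasurable (measurable_kernel_lintegral hg).aemeasurable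
    hs).trans ?_
  rw [mul_comm (C ^ _), mul_assoc]
  refine mul_le_mul_right ?_ _
  refine (rpow_le_rpow (h g hg) (by positivity)).trans (le_of_eq ?_)
  rw [mul_rpow_of_nonneg _ _ (by positivity), ← rpow_mul,
    show s / r * (1 / s) = 1 / r by field_simp]

theorem kernel_necessary_gt [SigmaFinite l] [NullSingletonClass l] [SigmaFinite η]
    [SigmaFinite ω] [NullSingletonClass ω] {r s : ℝ} (hs : 1 < s) (hsr : s < r) {C : ℝ≥0∞}
    (h : ∀ g : ℝ → ℝ≥0∞, Measurable g →
      ∫⁻ x, (∫⁻ u in Ioi x, l (Ioo x u) * g u ∂η) ^ s ∂ω ≤ C * (∫⁻ u, g u ^ r ∂η) ^ (s / r)) :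
    (∫⁻ ξ, ω (Iio ξ) ^ (r / (r - s) - 1) *
        (∫⁻ u in Ioi ξ, l (Ioo ξ u) ^ (r / (r - 1)) ∂η) ^ (s * (r - 1) / (r - s)) ∂ω)
          ^ ((r - s) / (s * (r - 1)))
      ≤ ofReal ((r - 1) / (r - s)) ^ (1 / (r - 1)) * C ^ (r / (s * (r - 1))) := by
  have hr0 : 0 < r := by linarith
  have hr1 : 0 < r - 1 := by linarith
  have hs0 : 0 < s := by linarith
  have hs1 : 0 < s - 1 := by linarith
  have hrs : 0 < r - s := by linarith
  have hκ1 : 0 ≤ r / (r - s) - 1 := by rw [sub_nonneg, le_div_iff₀ hrs]; linarith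
  set D : ℝ → ℝ≥0∞ := fun ξ => ∫⁻ u in Ioi ξ, l (Ioo ξ u) ^ (r / (r - 1)) ∂η with hD
  have hDa : Antitone D := fun x x' hx => lintegral_mono' (restrict_mono_set _
    (Ioi_subset_Ioi hx)) fun u => rpow_le_rpow (measure_mono (Ioo_subset_Ioo_left hx))
      (by positivity)
  have hDm : Measurable D := hDa.measurable
  have ha := appr_lintegral_spanningSets (μ := ω) (F := fun n x =>
      (ω.restrict (spanningSets ω n)) (Iio x) ^ (r / (r - s) - 1) * (min (D x) n) ^ (s * (r - 1) / (r - s)))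
    (fun n => measurable_mul' (measurable_measure_Iio.pow_const _)
      ((hDm.min measurable_const).pow_const _))
    (fun x => ((appr_measure_spanningSets measurableSet_Iio).rpow hκ1).mul
      ((Appr.min_nat (D x)).rpow (by positivity)))
  refine (ha.rpow (by positivity)).le_of_forall_le fun n => ?_
  have hfin := isFiniteMeasure_restrict_spanningSets (μ := ω) n
  have hωle : ω.restrict (spanningSets ω n) ≤ ω := restrict_le_self
  set w := ω.restrict (spanningSets ω n)
  set Dn : ℝ → ℝ≥0∞ := fun x => min (D x) n with hDn
  have hDna : Antitone Dn := fun x x' hx => min_le_min (hDa hx) le_rfl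
  have hDnm : Measurable Dn := hDna.measurable
  have hwm : Measurable fun x => w (Iio x) := measurable_measure_Iio
  set X := ∫⁻ x, w (Iio x) ^ (r / (r - s) - 1) * Dn x ^ (s * (r - 1) / (r - s)) ∂w with hX
  have hXfin : X ≠ ∞ := by
    refine ne_top_of_le_ne_top (b := w univ ^ (r / (r - s) - 1) * (n : ℝ≥0∞) ^ (s * (r - 1) / (r - s))
      * w univ) (mul_ne_top (mul_ne_top (rpow_ne_top_of_nonneg hκ1
        (measure_ne_top _ _)) (rpow_ne_top_of_nonneg (by positivity) (by simp)))
        (measure_ne_top _ _)) ?_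
    rw [← lintegral_const]
    exact lintegral_mono fun x => mul_le_mul' (rpow_le_rpow (measure_mono (subset_univ _)) hκ1)
      (rpow_le_rpow (min_le_right _ _) (by positivity))
  set e₁ := (s - 1) / (r - s) with he₁
  set e₂ := (r - 1) * (s - 1) / (r - s) with he₂
  have he₁0 : 0 < e₁ := by positivity
  have he₂0 : 0 < e₂ := by positivity
  set φ : ℝ → ℝ≥0∞ := fun x => w (Iio x) ^ e₁ * Dn x ^ e₂ with hφ
  have hφm : Measurable φ := measurable_mul' (hwm.pow_const _) (hDnm.pow_const _)
  have hdual := kernel_dual (l := l) (η := η) (ω := w) (by linarith : 1 < r) hs (fun g hg =>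
    (lintegral_mono' hωle le_rfl).trans (h g hg)) hφm
  have hφs : ∫⁻ x, φ x ^ (s / (s - 1)) ∂w = X := by
    refine lintegral_congr fun x => ?_
    rw [hφ, mul_rpow_of_nonneg _ _ (by positivity), ← rpow_mul, ← rpow_mul]
    congr 2
    · rw [he₁]; field_simp; ring
    · rw [he₂]; field_simp
  rw [hφs] at hdual
  -- lower bound for the dual integral
  set q := r / (r - 1) with hq
  have hq1 : 1 ≤ q := by rw [hq, le_div_iff₀ hr1]; linarith
  set c := ofReal ((r - 1) / (r - s)) with hc
  have hc0 : c ≠ 0 := by rw [hc]; exact (ENNReal.ofReal_pos.2 (by positivity)).ne'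
  have hct : c ≠ ∞ := ofReal_ne_top
  have hΦ : ∀ x, c⁻¹ * (w (Iio x) ^ (e₁ + 1) * Dn x ^ e₂) ≤ ∫⁻ t in Iio x, φ t ∂w := by
    intro x
    have hrule := lintegral_Iio_rpow (μ := w) (p := e₁ + 1) (y := x) (by positivity)
      (measure_ne_top _ _)
    have hce : ofReal (e₁ + 1) = c := by rw [hc, he₁]; congr 1; field_simp; ring
    rw [hce, show e₁ + 1 - 1 = e₁ by ring] at hrule
    rw [← hrule, mul_assoc, ← mul_assoc, ENNReal.inv_mul_cancel hc0 hct, one_mul,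
      ← lintegral_mul_const _ (hwm.pow_const _)]
    exact setLIntegral_mono' measurableSet_Iio fun t ht => mul_le_mul_right
      (rpow_le_rpow (hDna (le_of_lt ht)) he₂0.le) _
  have hJ : ∀ u, ∫⁻ x in Iio u, l (Ioo x u) ^ q * ((c⁻¹) ^ (q - 1) * ((w (Iio x) ^ (e₁ + 1) * Dn x ^ e₂)
      ^ (q - 1) * φ x)) ∂w ≤ (∫⁻ x in Iio u, l (Ioo x u) * φ x ∂w) ^ q := by
    intro u
    have hkφ : Measurable fun x => l (Ioo x u) * φ x := measurable_mul' (measurable_kernel_left u) hφm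
    rw [rpow_lintegral_Iio hkφ hq1]
    have h1q : 1 ≤ ofReal q := by rw [← ofReal_one]; exact ofReal_le_ofReal hq1
    refine le_trans ?_ (le_mul_of_one_le_left' h1q)
    refine setLIntegral_mono' measurableSet_Iio fun x hx => ?_
    have h2 : l (Ioo x u) * (c⁻¹ * (w (Iio x) ^ (e₁ + 1) * Dn x ^ e₂))
        ≤ ∫⁻ t in Iio x, l (Ioo t u) * φ t ∂w := by
      refine (mul_le_mul_right (hΦ x) _).trans ?_
      rw [← lintegral_const_mul _ hφm]
      exact setLIntegral_mono' measurableSet_Iio fun t ht => mul_le_mul_left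
        (measure_mono (Ioo_subset_Ioo_left (le_of_lt ht))) _
    have hq0 : 0 ≤ q - 1 := by linarith
    calc _ = (l (Ioo x u) * (c⁻¹ * (w (Iio x) ^ (e₁ + 1) * Dn x ^ e₂))) ^ (q - 1)
          * (l (Ioo x u) * φ x) := by
          simp only [mul_rpow_of_nonneg _ _ hq0]
          have : l (Ioo x u) ^ q = l (Ioo x u) ^ (q - 1) * l (Ioo x u) := by
            conv_lhs => rw [show q = (q - 1) + 1 by ring]
            rw [rpow_add_of_nonneg _ _ hq0 (by norm_num), rpow_one]
          rw [this]; ring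
      _ ≤ _ := by gcongr
  have hψm : Measurable fun x => (c⁻¹) ^ (q - 1) * ((w (Iio x) ^ (e₁ + 1) * Dn x ^ e₂)
      ^ (q - 1) * φ x) := measurable_const.mul (measurable_mul' ((measurable_mul'
        (hwm.pow_const _) (hDnm.pow_const _)).pow_const _) hφm)
  have hlow : (c⁻¹) ^ (q - 1) * X ≤ ∫⁻ u, (∫⁻ x in Iio u, l (Ioo x u) * φ x ∂w) ^ q ∂η := by
    refine le_trans ?_ (lintegral_mono hJ)
    have hsw := lintegral_kernel_swap (l := l) (η := η) (ω := w) (g := fun _ => 1) measurable_const hψm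
      (h := fun t => t ^ q) (measurable_id.pow_const q)
    simp only [mul_one] at hsw
    rw [← hsw, hX, ← lintegral_const_mul _ (measurable_mul' (hwm.pow_const _) (hDnm.pow_const _))]
    refine lintegral_mono fun x => ?_
    show _ ≤ _ * D x
    rw [mul_assoc]
    refine mul_le_mul_right ?_ _
    have hq0 : 0 ≤ q - 1 := by linarith
    calc w (Iio x) ^ (r / (r - s) - 1) * Dn x ^ (s * (r - 1) / (r - s))
        = (w (Iio x) ^ (e₁ + 1) * Dn x ^ e₂) ^ (q - 1) * φ x * Dn x := by
          rw [mul_rpow_of_nonneg _ _ hq0, hφ, ← rpow_mul, ← rpow_mul]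
          have a1 : w (Iio x) ^ (r / (r - s) - 1)
              = w (Iio x) ^ ((e₁ + 1) * (q - 1)) * w (Iio x) ^ e₁ := by
            rw [← rpow_add_of_nonneg _ _ (by positivity) he₁0.le]
            congr 1
            rw [he₁, hq]; field_simp; ring
          have a2 : Dn x ^ (s * (r - 1) / (r - s)) = Dn x ^ (e₂ * (q - 1)) * Dn x ^ e₂ * Dn x := by
            conv_rhs => rw [← rpow_one (Dn x), ← rpow_mul, ← rpow_mul]
            rw [← rpow_add_of_nonneg _ _ (by positivity) (by positivity),
              ← rpow_add_of_nonneg _ _ (by positivity) (by positivity)]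
            congr 1
            rw [he₂, hq]; field_simp; ring
          rw [a1, a2]; ring
      _ ≤ _ := by gcongr; exact min_le_left _ _
  have hθ : 0 ≤ 1 - 1 / r := by rw [sub_nonneg, div_le_one hr0]; linarith
  have hfinal := (rpow_le_rpow hlow hθ).trans hdual
  rw [mul_rpow_of_nonneg _ _ hθ, ← rpow_mul] at hfinal
  have hci : ((c⁻¹) ^ ((q - 1) * (1 - 1 / r))) * c ^ (1 / r) = 1 := by
    rw [show (q - 1) * (1 - 1 / r) = 1 / r by rw [hq]; field_simp; ring, inv_rpow,
      ENNReal.inv_mul_cancel]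
    · exact (rpow_pos (pos_iff_ne_zero.2 hc0) hct).ne'
    · exact rpow_ne_top_of_nonneg (by positivity) hct
  have h5 : X ^ (1 - 1 / r) ≤ c ^ (1 / r) * C ^ (1 / s) * X ^ (1 - 1 / s) := by
    calc X ^ (1 - 1 / r) = c ^ (1 / r) * ((c⁻¹) ^ ((q - 1) * (1 - 1 / r)) * X ^ (1 - 1 / r)) := by
          rw [← mul_assoc, mul_comm (c ^ _), hci, one_mul]
      _ ≤ c ^ (1 / r) * (C ^ (1 / s) * X ^ (1 - 1 / s)) := by gcongr
      _ = _ := by ring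
  have h6 := rpow_le_rpow h5 (by positivity : 0 ≤ r / (r - 1))
  have hs' : 0 ≤ 1 - 1 / s := by rw [sub_nonneg, div_le_one hs0]; linarith
  rw [mul_rpow_of_nonneg _ _ (by positivity), mul_rpow_of_nonneg _ _ (by positivity),
    ← rpow_mul, ← rpow_mul, ← rpow_mul, ← rpow_mul,
    show (1 - 1 / r) * (r / (r - 1)) = 1 by field_simp, rpow_one,
    show 1 / r * (r / (r - 1)) = 1 / (r - 1) by field_simp,
    show 1 / s * (r / (r - 1)) = r / (s * (r - 1)) by field_simp,
    show (1 - 1 / s) * (r / (r - 1)) = 1 - (r - s) / (s * (r - 1)) by field_simp; ring] at h6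
  exact rpow_le_of_le_mul_rpow hXfin (by positivity) h6

end

section

variable {μ ω η l ν : Measure ℝ}

/-! ### The weight `V^{-q}` -/

/-- The measure `V^{-q} dν`, where `V` is the distribution function of `ν`. -/
def tailWeight (ν : Measure ℝ) (q : ℝ) : Measure ℝ := ν.withDensity fun t => ν (Iio t) ^ (-q)

lemma measurable_measure_Iio_rpow (q : ℝ) : Measurable fun t => ν (Iio t) ^ q :=
  measurable_measure_Iio.pow_const q

instance [NullSingletonClass ν] (q : ℝ) : NullSingletonClass (tailWeight ν q) := by
  unfold tailWeight; infer_instance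

lemma sigmaFinite_tailWeight [SigmaFinite ν] [NullSingletonClass ν] {q : ℝ} (hq : 0 < q) :
    SigmaFinite (tailWeight ν q) := by
  refine SigmaFinite.withDensity_of_ne_top ?_
  filter_upwards [ae_measure_Iio_pos (μ := ν)] with t ht
  rw [rpow_neg]
  exact ENNReal.inv_ne_top.2 (ENNReal.rpow_pos_of_nonneg ht hq.le).ne'

lemma setLIntegral_tailWeight {q : ℝ} {g : ℝ → ℝ≥0∞} (hg : Measurable g) {S : Set ℝ}
    (hS : MeasurableSet S) :
    ∫⁻ t in S, g t ∂(tailWeight ν q) = ∫⁻ t in S, ν (Iio t) ^ (-q) * g t ∂ν :=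
  setLIntegral_withDensity_eq_setLIntegral_mul _ (measurable_measure_Iio_rpow _) hg hS

lemma lintegral_tailWeight {q : ℝ} {g : ℝ → ℝ≥0∞} (hg : Measurable g) :
    ∫⁻ t, g t ∂(tailWeight ν q) = ∫⁻ t, ν (Iio t) ^ (-q) * g t ∂ν :=
  lintegral_withDensity_eq_lintegral_mul _ (measurable_measure_Iio_rpow _) hg

lemma tailWeight_Ioi_le [NullSingletonClass ν] (hV : ∀ z, ν (Iio z) ≠ ∞) {q : ℝ} (hq : 1 < q) (z : ℝ) :
    tailWeight ν q (Ioi z) ≤ (ofReal (q - 1))⁻¹ * ν (Iio z) ^ (1 - q) := by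
  have h := lintegral_Ioi_measure_Iio_rpow_neg_le (μ := ν) hq z hV
  have hc : ofReal (q - 1) ≠ 0 := (ENNReal.ofReal_pos.2 (by linarith)).ne'
  rw [tailWeight, withDensity_apply _ measurableSet_Ioi]
  calc _ = (ofReal (q - 1))⁻¹ * (ofReal (q - 1) *
        ∫⁻ t in Ioi z, ν (Iio t) ^ (-q) ∂ν) := by
        rw [← mul_assoc, ENNReal.inv_mul_cancel hc ofReal_ne_top, one_mul]
    _ ≤ _ := by gcongr

lemma ae_measure_Iio_rpow [SigmaFinite ν] [NullSingletonClass ν] (hV : ∀ z, ν (Iio z) ≠ ∞) :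
    ∀ᵐ t ∂ν, ∀ a b : ℝ, ν (Iio t) ^ a * ν (Iio t) ^ b = ν (Iio t) ^ (a + b) := by
  filter_upwards [ae_measure_Iio_pos (μ := ν)] with t ht a b
  rw [rpow_add _ _ ht.ne' (hV t)]

/-- Dual averaging inequality. -/
lemma exists_lintegral_tail_rpow_le [SigmaFinite ν] [NullSingletonClass ν]
    (hV : ∀ z, ν (Iio z) ≠ ∞) {p : ℝ} (hp : 1 < p) :
    ∃ C : ℝ≥0∞, C ≠ ∞ ∧ ∀ g : ℝ → ℝ≥0∞, Measurable g →
      ∫⁻ t, (∫⁻ u in Ioi t, g u ∂(tailWeight ν (p / (p - 1)))) ^ p ∂ν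
        ≤ C * ∫⁻ u, g u ^ p ∂(tailWeight ν (p / (p - 1))) := by
  have hp0 : 0 < p := by linarith
  have hp1 : 0 < p - 1 := by linarith
  have hq : 1 < p / (p - 1) := by rw [lt_div_iff₀ hp1]; linarith
  have := sigmaFinite_tailWeight (ν := ν) (by linarith : 0 < p / (p - 1))
  set c := ofReal (p / (p - 1) - 1) with hc
  have hc0 : c ≠ 0 := (ENNReal.ofReal_pos.2 (by linarith)).ne'
  have hA : ∀ x, ν (Iio x) * tailWeight ν (p / (p - 1)) (Ioi x) ^ (p * (1 - 1 / p))
      ≤ c⁻¹ ^ (p - 1) := by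
    intro x
    rcases eq_or_ne (ν (Iio x)) 0 with h0 | h0
    · rw [h0, zero_mul]; exact zero_le
    calc _ ≤ ν (Iio x) * (c⁻¹ * ν (Iio x) ^ (1 - p / (p - 1))) ^ (p * (1 - 1 / p)) := by
          gcongr
          · have : 1 / p ≤ 1 := by rw [div_le_one hp0]; exact hp.le
            exact mul_nonneg hp0.le (by linarith)
          · exact tailWeight_Ioi_le hV hq x
      _ = c⁻¹ ^ (p - 1) * (ν (Iio x) * ν (Iio x) ^ (-1 : ℝ)) := by
          rw [show p * (1 - 1 / p) = p - 1 by field_simp, mul_rpow_of_nonneg _ _ hp1.le,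
            ← rpow_mul, show (1 - p / (p - 1)) * (p - 1) = -1 by field_simp; ring]
          ring
      _ = c⁻¹ ^ (p - 1) := by rw [rpow_neg_one, ENNReal.mul_inv_cancel h0 (hV x), mul_one]
  refine ⟨hardyC p p (p - 1) * c⁻¹ ^ (p - 1), mul_ne_top (hardyC_ne_top hp1.le)
    (rpow_ne_top_of_nonneg hp1.le (ENNReal.inv_ne_top.2 hc0)), fun g hg => ?_⟩
  have h := hardy_dual_le hp le_rfl hA hg
  rwa [div_self hp0.ne', rpow_one] at h

/-- A decreasing function is controlled by the tail integral of its averages. -/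
lemma antitone_le_tail [SigmaFinite ν] [NullSingletonClass ν] (hV : ∀ z, ν (Iio z) ≠ ∞)
    {f : ℝ → ℝ≥0∞} (hf : Antitone f) {q : ℝ} {z : ℝ} (hz : ν (Iio z) ≠ 0) :
    f z ≤ (∫⁻ t in Ioi z, ((∫⁻ u in Iio t, f u ∂ν) * (ν (Iio t))⁻¹) * ν (Iio t) ^ (q - 1)
        ∂(tailWeight ν q)) + (ν univ)⁻¹ * ∫⁻ u, f u ∂ν := by
  have hfm : Measurable f := hf.measurable
  have hMm : Measurable fun t => (∫⁻ u in Iio t, f u ∂ν) * (ν (Iio t))⁻¹ :=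
    measurable_mul' (measurable_lintegral_Iio f) measurable_measure_Iio.inv
  have h1 : f z * ν (Iio z) ≤ ∫⁻ u in Iio z, f u ∂ν := by
    calc _ = ∫⁻ u in Iio z, f z ∂ν := by simp
      _ ≤ _ := setLIntegral_mono' measurableSet_Iio fun u hu => hf (le_of_lt hu)
  calc f z = f z * ν (Iio z) * (ν (Iio z))⁻¹ := by
        rw [mul_assoc, ENNReal.mul_inv_cancel hz (hV z), mul_one]
    _ ≤ (∫⁻ u in Iio z, f u ∂ν) * (ν (Iio z))⁻¹ := by gcongr
    _ ≤ (∫⁻ u in Iio z, f u ∂ν) * (∫⁻ t in Ioi z, ν (Iio t) ^ (-2 : ℝ) ∂ν + (ν univ)⁻¹) :=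
        mul_le_mul_right (inv_measure_Iio_le hV hz) _
    _ ≤ _ := by
        rw [mul_add]
        refine add_le_add ?_ ?_
        · rw [setLIntegral_tailWeight (measurable_mul' hMm (measurable_measure_Iio_rpow _))
            measurableSet_Ioi, ← lintegral_const_mul _ (measurable_measure_Iio_rpow _)]
          have hae := ae_restrict_of_ae (s := Ioi z) (ae_measure_Iio_rpow (ν := ν) hV)
          refine lintegral_mono_ae ?_
          filter_upwards [hae, ae_restrict_mem measurableSet_Ioi] with t ht htz
          calc _ ≤ (∫⁻ u in Iio t, f u ∂ν) * ν (Iio t) ^ (-2 : ℝ) := by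
                gcongr
                exact le_of_lt htz
            _ = (∫⁻ u in Iio t, f u ∂ν) * (ν (Iio t) ^ (-q) * (ν (Iio t) ^ (-1 : ℝ)
                  * ν (Iio t) ^ (q - 1))) := by
                rw [ht, ht]; congr 2; ring
            _ = _ := by rw [rpow_neg_one]; ring
        · rw [mul_comm]
          gcongr
          exact restrict_le_self

lemma lintegral_average_tailWeight_le [SigmaFinite ν] [NullSingletonClass ν]
    (hV : ∀ z, ν (Iio z) ≠ ∞) {f : ℝ → ℝ≥0∞} (hf : Measurable f) {r : ℝ} (hr : 1 < r) :
    ∫⁻ t, (((∫⁻ u in Iio t, f u ∂ν) * (ν (Iio t))⁻¹) * ν (Iio t) ^ (r / (r - 1) - 1)) ^ r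
        ∂(tailWeight ν (r / (r - 1))) ≤ ofReal (r / (r - 1)) ^ r * ∫⁻ t, f t ^ r ∂ν := by
  have hr0 : 0 < r := by linarith
  have hr1 : 0 < r - 1 := by linarith
  have hMm : Measurable fun t => (∫⁻ u in Iio t, f u ∂ν) * (ν (Iio t))⁻¹ :=
    measurable_mul' (measurable_lintegral_Iio f) measurable_measure_Iio.inv
  rw [lintegral_tailWeight ((measurable_mul' hMm (measurable_measure_Iio_rpow _)).pow_const r)]
  refine le_trans (lintegral_mono_ae ?_) (lintegral_average_rpow_le hf hr)
  filter_upwards [ae_measure_Iio_rpow (ν := ν) hV] with t ht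
  rw [mul_rpow_of_nonneg _ (ν (Iio t) ^ _) hr0.le, ← rpow_mul, mul_left_comm, ht,
    show -(r / (r - 1)) + (r / (r - 1) - 1) * r = 0 by field_simp; ring, rpow_zero, mul_one]

lemma const_term_le {f : ℝ → ℝ≥0∞} (hf : Measurable f) {r s : ℝ} (hr : 1 < r) (hs : 0 < s) :
    ((ν univ)⁻¹ * ∫⁻ u, f u ∂ν) ^ s ≤ ν univ ^ (-(s / r)) * (∫⁻ u, f u ^ r ∂ν) ^ (s / r) := by
  have hr0 : 0 < r := by linarith
  rcases eq_or_ne (ν univ) 0 with h0 | h0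
  · have : ν = 0 := Measure.measure_univ_eq_zero.1 h0
    rw [this]; simp [hs]
  rcases eq_or_ne (ν univ) ∞ with ht | ht
  · rw [ht]; simp [hs]
  have h := lintegral_mul_le_conj (μ := ν) (f := fun _ => 1) aemeasurable_const hf.aemeasurable hr
  simp only [one_mul, one_rpow, lintegral_one] at h
  calc _ ≤ ((ν univ)⁻¹ * (ν univ ^ (1 - 1 / r) * (∫⁻ u, f u ^ r ∂ν) ^ (1 / r))) ^ s := by gcongr
    _ = (ν univ ^ (-(1 / r)) * (∫⁻ u, f u ^ r ∂ν) ^ (1 / r)) ^ s := by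
        rw [← mul_assoc, ← rpow_neg_one, ← rpow_add _ _ h0 ht]
        congr 3; ring
    _ = _ := by
        rw [mul_rpow_of_nonneg _ _ hs.le, ← rpow_mul, ← rpow_mul]
        congr 2 <;> ring

lemma lintegral_Ioi_antitone_le [SFinite l] [SigmaFinite ν] [NullSingletonClass ν]
    (hV : ∀ z, ν (Iio z) ≠ ∞) (hV0 : ∀ᵐ z ∂l, ν (Iio z) ≠ 0) {f : ℝ → ℝ≥0∞} (hf : Antitone f)
    {q : ℝ} (hq : 0 < q) (x : ℝ) : ∫⁻ z in Ioi x, f z ∂l ≤ (∫⁻ u in Ioi x, l (Ioo x u) *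
      (((∫⁻ t in Iio u, f t ∂ν) * (ν (Iio u))⁻¹) * ν (Iio u) ^ (q - 1)) ∂(tailWeight ν q))
      + l (Ioi x) * ((ν univ)⁻¹ * ∫⁻ u, f u ∂ν) := by
  have := sigmaFinite_tailWeight (ν := ν) hq
  have hMm : Measurable fun t => (∫⁻ u in Iio t, f u ∂ν) * (ν (Iio t))⁻¹ * ν (Iio t) ^ (q - 1) :=
    measurable_mul' (measurable_mul' (measurable_lintegral_Iio f) measurable_measure_Iio.inv)
      (measurable_measure_Iio_rpow _)
  rw [← lintegral_kernel_Ioi hMm]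
  calc _ ≤ ∫⁻ z in Ioi x, ((∫⁻ t in Ioi z, ((∫⁻ u in Iio t, f u ∂ν) * (ν (Iio t))⁻¹)
        * ν (Iio t) ^ (q - 1) ∂(tailWeight ν q)) + (ν univ)⁻¹ * ∫⁻ u, f u ∂ν) ∂l := by
        refine lintegral_mono_ae ?_
        filter_upwards [ae_restrict_of_ae hV0] with z hz
        exact antitone_le_tail hV hf hz
    _ = _ := by
        rw [lintegral_add_right _ measurable_const]
        simp [mul_comm]

/-- A kernel inequality gives an inequality for decreasing functions. -/
theorem decreasing_of_kernel [SigmaFinite l] [NullSingletonClass l] [SigmaFinite ν]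
    [NullSingletonClass ν] (hV : ∀ z, ν (Iio z) ≠ ∞) (hV0 : ∀ᵐ z ∂l, ν (Iio z) ≠ 0) {r s : ℝ}
    (hr : 1 < r) (hs : 1 ≤ s) {C B : ℝ≥0∞} (hC : C ≠ ∞) (hB : B ≠ ∞)
    (hk : ∀ g : ℝ → ℝ≥0∞, Measurable g →
      ∫⁻ x, (∫⁻ u in Ioi x, l (Ioo x u) * g u ∂(tailWeight ν (r / (r - 1)))) ^ s ∂ω
        ≤ C * (∫⁻ u, g u ^ r ∂(tailWeight ν (r / (r - 1)))) ^ (s / r))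
    (hB' : (∫⁻ x, l (Ioi x) ^ s ∂ω) * ν univ ^ (-(s / r)) ≤ B) :
    ∃ K : ℝ≥0∞, K ≠ ∞ ∧ ∀ f : ℝ → ℝ≥0∞, Antitone f →
      ∫⁻ x, (∫⁻ z in Ioi x, f z ∂l) ^ s ∂ω ≤ K * (∫⁻ z, f z ^ r ∂ν) ^ (s / r) := by
  have hr0 : 0 < r := by linarith
  have hr1 : 0 < r - 1 := by linarith
  have hs0 : 0 < s := by linarith
  have hq : 0 < r / (r - 1) := by positivity
  have := sigmaFinite_tailWeight (ν := ν) hq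
  set c := ofReal (r / (r - 1)) with hc
  refine ⟨2 ^ (s - 1) * (C * (c ^ r) ^ (s / r) + B), ?_, fun f hf => ?_⟩
  · refine mul_ne_top (rpow_ne_top_of_nonneg (by linarith) (by norm_num))
      (ENNReal.add_ne_top.2 ⟨mul_ne_top hC (rpow_ne_top_of_nonneg (by positivity)
        (rpow_ne_top_of_nonneg hr0.le ofReal_ne_top)), hB⟩)
  have hfm := hf.measurable
  set g : ℝ → ℝ≥0∞ := fun u => ((∫⁻ t in Iio u, f t ∂ν) * (ν (Iio u))⁻¹)
    * ν (Iio u) ^ (r / (r - 1) - 1) with hg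
  have hgm : Measurable g := measurable_mul' (measurable_mul' (measurable_lintegral_Iio f)
    measurable_measure_Iio.inv) (measurable_measure_Iio_rpow _)
  set N := ∫⁻ z, f z ^ r ∂ν with hN
  set c₀ := (ν univ)⁻¹ * ∫⁻ u, f u ∂ν with hc₀
  have hlm : Measurable fun x => l (Ioi x) := measurable_measure_Ioi
  calc _ ≤ ∫⁻ x, 2 ^ (s - 1) * ((∫⁻ u in Ioi x, l (Ioo x u) * g u ∂(tailWeight ν (r / (r - 1)))) ^ s
        + l (Ioi x) ^ s * c₀ ^ s) ∂ω := by
        refine lintegral_mono fun x => ?_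
        rw [← mul_rpow_of_nonneg _ _ hs0.le]
        exact (rpow_le_rpow (lintegral_Ioi_antitone_le hV hV0 hf hq x) hs0.le).trans
          (ENNReal.rpow_add_le_mul_rpow_add_rpow _ _ hs)
    _ = 2 ^ (s - 1) * ((∫⁻ x, (∫⁻ u in Ioi x, l (Ioo x u) * g u ∂(tailWeight ν (r / (r - 1)))) ^ s ∂ω)
        + (∫⁻ x, l (Ioi x) ^ s ∂ω) * c₀ ^ s) := by
        have h1 : Measurable fun x => l (Ioi x) ^ s * c₀ ^ s := (hlm.pow_const s).mul_const _
        have h2 : Measurable fun x =>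
          (∫⁻ u in Ioi x, l (Ioo x u) * g u ∂(tailWeight ν (r / (r - 1)))) ^ s :=
          (measurable_kernel_lintegral hgm).pow_const s
        have h3 : Measurable fun x => (∫⁻ u in Ioi x, l (Ioo x u) * g u
          ∂(tailWeight ν (r / (r - 1)))) ^ s + l (Ioi x) ^ s * c₀ ^ s := h2.add h1
        rw [lintegral_const_mul _ h3, lintegral_add_left h2, lintegral_mul_const _ (hlm.pow_const s)]
    _ ≤ 2 ^ (s - 1) * (C * ((c ^ r) * N) ^ (s / r) + B * N ^ (s / r)) := by
        refine mul_le_mul_right (add_le_add ((hk g hgm).trans (mul_le_mul_right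
          (rpow_le_rpow (lintegral_average_tailWeight_le hV hfm hr) (by positivity)) _)) ?_) _
        refine (mul_le_mul_right (const_term_le hfm hr hs0) _).trans ?_
        rw [← mul_assoc]
        exact mul_le_mul_left hB' _
    _ = _ := by
        rw [mul_rpow_of_nonneg _ _ (by positivity : 0 ≤ s / r)]
        ring

/-- An inequality for decreasing functions gives a kernel inequality. -/
theorem kernel_of_decreasing [SigmaFinite l] [NullSingletonClass l] [SigmaFinite ν]
    [NullSingletonClass ν] (hV : ∀ z, ν (Iio z) ≠ ∞) {r s : ℝ} (hr : 1 < r) (hs : 0 < s) {C : ℝ≥0∞}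
    (hC : C ≠ ∞) (h : ∀ f : ℝ → ℝ≥0∞, Antitone f →
      ∫⁻ x, (∫⁻ z in Ioi x, f z ∂l) ^ s ∂ω ≤ C * (∫⁻ z, f z ^ r ∂ν) ^ (s / r)) :
    ∃ K : ℝ≥0∞, K ≠ ∞ ∧ ∀ g : ℝ → ℝ≥0∞, Measurable g →
      ∫⁻ x, (∫⁻ u in Ioi x, l (Ioo x u) * g u ∂(tailWeight ν (r / (r - 1)))) ^ s ∂ω
        ≤ K * (∫⁻ u, g u ^ r ∂(tailWeight ν (r / (r - 1)))) ^ (s / r) := by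
  have hr0 : 0 < r := by linarith
  have hr1 : 0 < r - 1 := by linarith
  have := sigmaFinite_tailWeight (ν := ν) (by positivity : 0 < r / (r - 1))
  obtain ⟨c, hc, hcg⟩ := exists_lintegral_tail_rpow_le (ν := ν) hV hr
  refine ⟨C * c ^ (s / r), mul_ne_top hC (rpow_ne_top_of_nonneg (by positivity) hc),
    fun g hg => ?_⟩
  have h1 := h (fun t => ∫⁻ u in Ioi t, g u ∂(tailWeight ν (r / (r - 1))))
    (fun _ _ hx => lintegral_mono_set (Ioi_subset_Ioi hx))
  simp_rw [lintegral_kernel_Ioi hg] at h1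
  refine h1.trans ?_
  rw [mul_assoc, ← mul_rpow_of_nonneg _ _ (by positivity)]
  exact mul_le_mul_right (rpow_le_rpow (hcg g hg) (by positivity)) _

/-- Lower bound for powers of the integral of a decreasing function. -/
lemma kernel_rpow_le_lintegral_rpow [SigmaFinite l] [NullSingletonClass l] {f : ℝ → ℝ≥0∞}
    (hf : Antitone f) {s : ℝ} (hs : 1 ≤ s) (x : ℝ) :
    ofReal s * ∫⁻ t in Ioi x, l (Ioo x t) ^ (s - 1) * f t ^ s ∂l ≤ (∫⁻ z in Ioi x, f z ∂l) ^ s := by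
  have hfm := hf.measurable
  have hm : Measurable fun t => l (Ioo x t) ^ (s - 1) * f t ^ s :=
    measurable_mul' ((measurable_kernel_right x).pow_const _) (hfm.pow_const s)
  have ha := Appr.lintegral_restrict (μ := l.restrict (Ioi x)) (S := fun n : ℕ => Iio (n : ℝ))
    (fun _ _ h => Iio_subset_Iio (by exact_mod_cast h))
    (by ext t; simpa using exists_nat_gt t) (fun n => measurableSet_Iio)
    (F := fun _ t => l (Ioo x t) ^ (s - 1) * f t ^ s) (fun n => hm) (fun t => Appr.const _)
  refine (Appr.mul (Appr.const (ofReal s)) ha).le_of_forall_le fun n => ?_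
  refine le_trans ?_ (rpow_le_rpow (lintegral_mono' (restrict_le_self
    (s := Iio (n : ℝ))) (le_refl f)) (by linarith))
  rw [rpow_lintegral_Iio hfm hs]
  refine mul_le_mul_right (setLIntegral_mono' measurableSet_Iio fun t ht => ?_) _
  have h1 : l (Ioo x t) * f t ≤ ∫⁻ u in Iio t, f u ∂(l.restrict (Ioi x)) := by
    calc _ = ∫⁻ u in Iio t, f t ∂(l.restrict (Ioi x)) := by
          simp [inter_comm (Iio t), Ioi_inter_Iio, mul_comm]
      _ ≤ _ := setLIntegral_mono' measurableSet_Iio fun u hu => hf (le_of_lt hu)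
  have hs1 : 0 ≤ s - 1 := by linarith
  calc _ = (l (Ioo x t) * f t) ^ (s - 1) * f t := by
        rw [mul_rpow_of_nonneg _ _ hs1, mul_assoc]
        congr 1
        conv_lhs => rw [show s = (s - 1) + 1 by ring]
        rw [rpow_add_of_nonneg _ _ hs1 (by norm_num), rpow_one]
    _ ≤ _ := by gcongr

lemma kernel_rpow_eq [SigmaFinite l] [NullSingletonClass l] {s : ℝ} (hs : 1 ≤ s) (x u : ℝ) :
    ofReal s * ∫⁻ t in Ioo x u, l (Ioo x t) ^ (s - 1) ∂l = l (Ioo x u) ^ s := by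
  have h := rpow_lintegral_Iio (μ := l.restrict (Ioi x)) (g := fun _ => 1) measurable_const hs u
  simp only [mul_one, lintegral_one, restrict_restrict measurableSet_Iio,
    Measure.restrict_apply MeasurableSet.univ, univ_inter] at h
  have e : ∀ t, Iio t ∩ Ioi x = Ioo x t := fun t => by rw [inter_comm, Ioi_inter_Iio]
  simp_rw [e] at h
  exact h.symm

/-- Necessary condition for decreasing functions, `s < r`. -/
theorem decreasing_necessary_gt [SigmaFinite l] [NullSingletonClass l] [SigmaFinite ν]
    [NullSingletonClass ν] [SFinite ω] (hV : ∀ z, ν (Iio z) ≠ ∞) {r s : ℝ} (hs : 1 ≤ s)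
    (hsr : s < r) {C : ℝ≥0∞} (hC : C ≠ ∞) (h : ∀ f : ℝ → ℝ≥0∞, Antitone f →
      ∫⁻ x, (∫⁻ z in Ioi x, f z ∂l) ^ s ∂ω ≤ C * (∫⁻ z, f z ^ r ∂ν) ^ (s / r)) :
    ∫⁻ z, ν (Iio z) ^ (-(r / (r - s))) * (∫⁻ ξ in Iio z, l (Ioo ξ z) ^ s ∂ω) ^ (r / (r - s)) ∂ν ≠ ∞ := by
  have hs0 : 0 < s := by linarith
  have hr0 : 0 < r := by linarith
  have hrs : 0 < r - s := by linarith
  have hp : 1 < r / s := by rw [lt_div_iff₀ hs0]; linarith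
  have hconj : r / s / (r / s - 1) = r / (r - s) := by field_simp
  have hκ : 0 < r / (r - s) := by positivity
  have := sigmaFinite_tailWeight (ν := ν) hκ
  obtain ⟨c, hc, hcg⟩ := exists_lintegral_tail_rpow_le (ν := ν) hV hp
  rw [hconj] at hcg
  have hKm : Measurable fun z => ∫⁻ ξ in Iio z, l (Ioo ξ z) ^ s ∂ω :=
    measurable_setLIntegral_Iio (φ := fun z ξ => l (Ioo ξ z) ^ s)
      ((measurable_measure_Ioo'.comp measurable_swap).pow_const s)
  rw [← lintegral_tailWeight (hKm.pow_const _)]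
  have key := lintegral_rpow_conj_le (μ := tailWeight ν (r / (r - s))) hKm hp
    (C := C * c ^ (s / r)) (fun g hg => by
      have h1 := h (fun t => (∫⁻ u in Ioi t, g u ∂(tailWeight ν (r / (r - s)))) ^ (1 / s))
        (fun _ _ hx => rpow_le_rpow (lintegral_mono_set (Ioi_subset_Ioi hx)) (by positivity))
      have e1 : ∀ t, ((∫⁻ u in Ioi t, g u ∂(tailWeight ν (r / (r - s)))) ^ (1 / s)) ^ r
          = (∫⁻ u in Ioi t, g u ∂(tailWeight ν (r / (r - s)))) ^ (r / s) := fun t => by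
        rw [← rpow_mul]; congr 1; ring
      simp_rw [e1] at h1
      have h2 : C * (∫⁻ t, (∫⁻ u in Ioi t, g u ∂(tailWeight ν (r / (r - s)))) ^ (r / s) ∂ν) ^ (s / r)
          ≤ C * c ^ (s / r) * (∫⁻ u, g u ^ (r / s) ∂(tailWeight ν (r / (r - s)))) ^ (1 / (r / s)) := by
        rw [mul_assoc, show 1 / (r / s) = s / r by field_simp,
          ← mul_rpow_of_nonneg _ _ (by positivity)]
        exact mul_le_mul_right (rpow_le_rpow (hcg g hg) (by positivity)) _
      refine le_trans ?_ (h1.trans h2)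
      have h3 := lintegral_kernel_swap (l := l) (η := tailWeight ν (r / (r - s))) (ω := ω) hg
        (φ := fun _ => 1) measurable_const (h := fun t => t ^ s) (measurable_id.pow_const s)
      simp only [mul_one, one_mul] at h3
      rw [← h3]
      refine lintegral_mono fun x => ?_
      refine le_trans (le_of_eq ?_) (kernel_rpow_le_lintegral_rpow (fun _ _ hx => rpow_le_rpow
        (lintegral_mono_set (Ioi_subset_Ioi hx)) (by positivity)) hs x)
      have e2 : ∀ t, ((∫⁻ u in Ioi t, g u ∂(tailWeight ν (r / (r - s)))) ^ (1 / s)) ^ s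
          = ∫⁻ u in Ioi t, g u ∂(tailWeight ν (r / (r - s))) := fun t => by
        rw [← rpow_mul, one_div, inv_mul_cancel₀ hs0.ne', rpow_one]
      simp_rw [e2, mul_comm (l (Ioo x _) ^ (s - 1))]
      have h4 := lintegral_lintegral_Ioi_mul (μ := tailWeight ν (r / (r - s)))
        (ω := l.restrict (Ioi x)) hg (ψ := fun t => l (Ioo x t) ^ (s - 1))
        ((measurable_kernel_right x).pow_const _)
      rw [h4, ← lintegral_indicator measurableSet_Ioi, ← lintegral_const_mul _ (by
        refine measurable_mul' hg (measurable_lintegral_Iio _))]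
      refine lintegral_congr fun u => ?_
      rw [restrict_restrict measurableSet_Iio, inter_comm, Ioi_inter_Iio]
      by_cases hu : x < u
      · rw [indicator_of_mem (by exact hu), ← kernel_rpow_eq hs]; ring
      · rw [indicator_of_notMem (by exact hu), Ioo_eq_empty hu]; simp)
  rw [hconj] at key
  have hC' : C * c ^ (s / r) ≠ ∞ :=
    mul_ne_top hC (rpow_ne_top_of_nonneg (by positivity) hc)
  intro htop
  rw [htop, top_rpow_of_pos] at key
  · exact hC' (top_le_iff.1 key)
  · rw [show 1 / (r / s) = s / r by field_simp, sub_pos, div_lt_one hr0]; exact hsr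

end

section

variable {μ ω η l ν : Measure ℝ}

/-! ### Sufficient conditions for decreasing functions -/

lemma appr_measure_Iio_nat (m : Measure ℝ) : Appr (fun n : ℕ => m (Iio (n : ℝ))) (m univ) := by
  have hmono : Monotone fun n : ℕ => Iio (n : ℝ) := fun _ _ h => Iio_subset_Iio (by exact_mod_cast h)
  refine ⟨fun _ _ h => measure_mono (hmono h), ?_⟩
  rw [← hmono.measure_iUnion]
  congr 1
  ext t; simpa using exists_nat_gt t

lemma setLIntegral_kernel_eq {s : ℝ} (hs : 0 < s) (z : ℝ) :
    ∫⁻ ξ in Iio z, l (Ioo ξ z) ^ s ∂ω = ∫⁻ ξ, l (Ioo ξ z) ^ s ∂ω := by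
  rw [← lintegral_indicator measurableSet_Iio]
  refine lintegral_congr fun ξ => ?_
  by_cases hξ : ξ < z
  · rw [indicator_of_mem (by exact hξ)]
  · rw [indicator_of_notMem (by exact hξ), Ioo_eq_empty hξ, measure_empty, zero_rpow_of_pos hs]

lemma lintegral_measure_Ioi_le [SigmaFinite l] [NullSingletonClass l] {s e : ℝ} (hs : 0 < s)
    (he : 0 ≤ e) {A : ℝ≥0∞} (hA : ∀ z, ∫⁻ ξ in Iio z, l (Ioo ξ z) ^ s ∂ω ≤ A * ν (Iio z) ^ e) :
    ∫⁻ x, l (Ioi x) ^ s ∂ω ≤ A * ν univ ^ e := by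
  have h1 : ∀ x, Appr (fun n : ℕ => l (Ioo x (n : ℝ))) (l (Ioi x)) := fun x => by
    have := appr_measure_Iio_nat (l.restrict (Ioi x))
    simp only [Measure.restrict_apply measurableSet_Iio, Measure.restrict_apply MeasurableSet.univ,
      univ_inter, inter_comm (Iio _), Ioi_inter_Iio] at this
    exact this
  have h2 := Appr.lintegral (μ := ω) (fun n : ℕ => (measurable_kernel_left (l := l) (n : ℝ)).pow_const s)
    (fun x => (h1 x).rpow hs.le)
  refine h2.le_of_forall_le fun n => ?_
  rw [← setLIntegral_kernel_eq hs]
  refine (hA n).trans (mul_le_mul_right (rpow_le_rpow (measure_mono (subset_univ _)) he) _)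

lemma mul_rpow_neg_le {a A v : ℝ≥0∞} {e : ℝ} (he : 0 < e) (h : a ≤ A * v ^ e) : a * v ^ (-e) ≤ A := by
  rcases eq_or_ne v 0 with h0 | h0
  · rw [h0, zero_rpow_of_pos he, mul_zero] at h
    rw [le_zero_iff.1 h, zero_mul]; exact zero_le
  rcases eq_or_ne v ∞ with ht | ht
  · rw [ht, ENNReal.top_rpow_of_neg (by linarith), mul_zero]; exact zero_le
  calc a * v ^ (-e) ≤ A * v ^ e * v ^ (-e) := by gcongr
    _ = A := by rw [mul_assoc, ← rpow_add _ _ h0 ht]; simp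

theorem decreasing_sufficient_le [SigmaFinite l] [NullSingletonClass l] [SigmaFinite ν]
    [NullSingletonClass ν] [SigmaFinite ω] [NullSingletonClass ω] (hV : ∀ z, ν (Iio z) ≠ ∞)
    (hV0 : ∀ᵐ z ∂l, ν (Iio z) ≠ 0) {r s : ℝ} (hr : 1 < r) (hrs : r ≤ s) {A₁ A₂ : ℝ≥0∞}
    (hA₁t : A₁ ≠ ∞) (hA₂t : A₂ ≠ ∞)
    (hA₁ : ∀ z, ∫⁻ ξ in Iio z, l (Ioo ξ z) ^ s ∂ω ≤ A₁ * ν (Iio z) ^ (s / r))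
    (hA₂ : ∀ x, ω (Iio x) * (∫⁻ u in Ioi x, l (Ioo x u) ^ (r / (r - 1))
      ∂(tailWeight ν (r / (r - 1)))) ^ (s * (1 - 1 / r)) ≤ A₂) :
    ∃ K : ℝ≥0∞, K ≠ ∞ ∧ ∀ f : ℝ → ℝ≥0∞, Antitone f →
      ∫⁻ x, (∫⁻ z in Ioi x, f z ∂l) ^ s ∂ω ≤ K * (∫⁻ z, f z ^ r ∂ν) ^ (s / r) := by
  have hr0 : 0 < r := by linarith
  have hr1 : 0 < r - 1 := by linarith
  have hs0 : 0 < s := by linarith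
  have hθ : 0 < 1 - 1 / r := by rw [sub_pos, div_lt_one hr0]; exact hr
  have hq : 1 < r / (r - 1) := by rw [lt_div_iff₀ hr1]; linarith
  have := sigmaFinite_tailWeight (ν := ν) (by linarith : 0 < r / (r - 1))
  set c := (ofReal (r / (r - 1) - 1))⁻¹ with hc
  have hct : c ≠ ∞ := ENNReal.inv_ne_top.2 (ENNReal.ofReal_pos.2 (by linarith)).ne'
  have hk : ∀ z, (∫⁻ ξ in Iio z, l (Ioo ξ z) ^ s ∂ω)
      * tailWeight ν (r / (r - 1)) (Ioi z) ^ (s * (1 - 1 / r)) ≤ c ^ (s * (1 - 1 / r)) * A₁ := by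
    intro z
    calc _ ≤ (∫⁻ ξ in Iio z, l (Ioo ξ z) ^ s ∂ω)
          * (c * ν (Iio z) ^ (1 - r / (r - 1))) ^ (s * (1 - 1 / r)) := by
          gcongr
          exact tailWeight_Ioi_le hV hq z
      _ = c ^ (s * (1 - 1 / r)) * ((∫⁻ ξ in Iio z, l (Ioo ξ z) ^ s ∂ω) * ν (Iio z) ^ (-(s / r))) := by
          rw [mul_rpow_of_nonneg _ _ (by positivity), ← rpow_mul,
            show (1 - r / (r - 1)) * (s * (1 - 1 / r)) = -(s / r) by field_simp; ring]
          ring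
      _ ≤ _ := by
          gcongr
          exact mul_rpow_neg_le (by positivity) (hA₁ z)
  refine decreasing_of_kernel hV hV0 hr (by linarith) (B := A₁) ?_ hA₁t
    (fun g hg => kernel_le hr hrs hk hA₂ hg)
    (mul_rpow_neg_le (by positivity) (lintegral_measure_Ioi_le hs0 (by positivity) hA₁))
  refine mul_ne_top (mul_ne_top ofReal_ne_top
    (rpow_ne_top_of_nonneg hs0.le (by norm_num))) (ENNReal.add_ne_top.2 ⟨?_, ?_⟩)
  · exact mul_ne_top (hardyC_ne_top hr1.le) (mul_ne_top (by norm_num)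
      (mul_ne_top (rpow_ne_top_of_nonneg (by positivity) hct) hA₁t))
  · exact mul_ne_top (by norm_num) hA₂t

theorem decreasing_sufficient_gt [SigmaFinite l] [NullSingletonClass l] [SigmaFinite ν]
    [NullSingletonClass ν] [SigmaFinite ω] [NullSingletonClass ω] (hV : ∀ z, ν (Iio z) ≠ ∞)
    (hV0 : ∀ᵐ z ∂l, ν (Iio z) ≠ 0) {r s : ℝ} (hs : 1 < s) (hsr : s < r)
    (hA₁ : ∫⁻ z, ν (Iio z) ^ (-(r / (r - s))) * (∫⁻ ξ in Iio z, l (Ioo ξ z) ^ s ∂ω) ^ (r / (r - s)) ∂ν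
      ≠ ∞) (hA₂ : ∫⁻ ξ, ω (Iio ξ) ^ (r / (r - s) - 1) * (∫⁻ u in Ioi ξ, l (Ioo ξ u) ^ (r / (r - 1))
      ∂(tailWeight ν (r / (r - 1)))) ^ (s * (r - 1) / (r - s)) ∂ω ≠ ∞)
    (hB : (∫⁻ x, l (Ioi x) ^ s ∂ω) * ν univ ^ (-(s / r)) ≠ ∞) :
    ∃ K : ℝ≥0∞, K ≠ ∞ ∧ ∀ f : ℝ → ℝ≥0∞, Antitone f →
      ∫⁻ x, (∫⁻ z in Ioi x, f z ∂l) ^ s ∂ω ≤ K * (∫⁻ z, f z ^ r ∂ν) ^ (s / r) := by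
  have hr0 : 0 < r := by linarith
  have hr1 : 0 < r - 1 := by linarith
  have hs0 : 0 < s := by linarith
  have hs1 : 0 < s - 1 := by linarith
  have hrs : 0 < r - s := by linarith
  have hq : 1 < r / (r - 1) := by rw [lt_div_iff₀ hr1]; linarith
  have := sigmaFinite_tailWeight (ν := ν) (by linarith : 0 < r / (r - 1))
  set c := (ofReal (r / (r - 1) - 1))⁻¹ with hc
  have hct : c ≠ ∞ := ENNReal.inv_ne_top.2 (ENNReal.ofReal_pos.2 (by linarith)).ne'
  set κ := r / (r - s) with hκ
  have hκ0 : 0 < κ := by positivity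
  have hKm : Measurable fun z => ∫⁻ ξ in Iio z, l (Ioo ξ z) ^ s ∂ω :=
    measurable_setLIntegral_Iio (φ := fun z ξ => l (Ioo ξ z) ^ s)
      ((measurable_measure_Ioo'.comp measurable_swap).pow_const s)
  have hB1 : ∫⁻ z, (2 * ∫⁻ ξ in Iio z, l (Ioo ξ z) ^ s ∂ω) ^ κ
      * tailWeight ν (r / (r - 1)) (Ioi z) ^ (κ * (s - 1)) ∂(tailWeight ν (r / (r - 1))) ≠ ∞ := by
    rw [lintegral_tailWeight (measurable_mul' ((hKm.const_mul 2).pow_const κ)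
      (measurable_measure_Ioi.pow_const _))]
    refine ne_top_of_le_ne_top (b := 2 ^ κ * c ^ (κ * (s - 1)) * ∫⁻ z, ν (Iio z) ^ (-κ)
      * (∫⁻ ξ in Iio z, l (Ioo ξ z) ^ s ∂ω) ^ κ ∂ν) (mul_ne_top (mul_ne_top
        (rpow_ne_top_of_nonneg hκ0.le (by norm_num))
        (rpow_ne_top_of_nonneg (by positivity) hct)) hA₁) ?_
    rw [← lintegral_const_mul _ (measurable_mul' (measurable_measure_Iio_rpow _) (hKm.pow_const κ))]
    refine lintegral_mono_ae ?_
    filter_upwards [ae_measure_Iio_rpow (ν := ν) hV] with z hz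
    calc _ ≤ ν (Iio z) ^ (-(r / (r - 1))) * ((2 * ∫⁻ ξ in Iio z, l (Ioo ξ z) ^ s ∂ω) ^ κ
          * (c * ν (Iio z) ^ (1 - r / (r - 1))) ^ (κ * (s - 1))) := by
          gcongr
          exact tailWeight_Ioi_le hV hq z
      _ = 2 ^ κ * c ^ (κ * (s - 1)) * ((ν (Iio z) ^ (-(r / (r - 1)))
          * ν (Iio z) ^ ((1 - r / (r - 1)) * (κ * (s - 1))))
          * (∫⁻ ξ in Iio z, l (Ioo ξ z) ^ s ∂ω) ^ κ) := by
          rw [mul_rpow_of_nonneg _ _ hκ0.le, mul_rpow_of_nonneg _ _ (by positivity),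
            ← rpow_mul]
          ring
      _ = _ := by
          rw [hz, show -(r / (r - 1)) + (1 - r / (r - 1)) * (κ * (s - 1)) = -κ by
            rw [hκ]; field_simp; ring]
  refine decreasing_of_kernel hV hV0 (by linarith) hs.le ?_ hB
    (fun g hg => kernel_gt hs hsr hg) le_rfl
  refine mul_ne_top (mul_ne_top ofReal_ne_top
    (rpow_ne_top_of_nonneg hs0.le (by norm_num))) (ENNReal.add_ne_top.2 ⟨?_, ?_⟩)
  · exact mul_ne_top (hardyC_ne_top hs1.le) (rpow_ne_top_of_nonneg (by positivity) hB1)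
  · exact mul_ne_top (rpow_ne_top_of_nonneg (by positivity) (by norm_num))
      (rpow_ne_top_of_nonneg (by positivity) (mul_ne_top
        (mul_ne_top ofReal_ne_top (by norm_num)) hA₂))

theorem decreasing_sufficient_one [SigmaFinite l] [NullSingletonClass l] [SigmaFinite ν]
    [NullSingletonClass ν] [SFinite ω] (hV : ∀ z, ν (Iio z) ≠ ∞)
    (hV0 : ∀ᵐ z ∂l, ν (Iio z) ≠ 0) {r : ℝ} (hr : 1 < r) (hA₁ : ∫⁻ z, ν (Iio z) ^ (-(r / (r - 1)))
      * (∫⁻ ξ in Iio z, l (Ioo ξ z) ^ (1 : ℝ) ∂ω) ^ (r / (r - 1)) ∂ν ≠ ∞)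
    (hB : (∫⁻ x, l (Ioi x) ^ (1 : ℝ) ∂ω) * ν univ ^ (-(1 / r)) ≠ ∞) :
    ∃ K : ℝ≥0∞, K ≠ ∞ ∧ ∀ f : ℝ → ℝ≥0∞, Antitone f →
      ∫⁻ x, (∫⁻ z in Ioi x, f z ∂l) ^ (1 : ℝ) ∂ω ≤ K * (∫⁻ z, f z ^ r ∂ν) ^ (1 / r) := by
  have hr0 : 0 < r := by linarith
  have hr1 : 0 < r - 1 := by linarith
  have hθ : 0 < 1 - 1 / r := by rw [sub_pos, div_lt_one hr0]; exact hr
  have := sigmaFinite_tailWeight (ν := ν) (by positivity : 0 < r / (r - 1))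
  have hKm : Measurable fun z => ∫⁻ ξ in Iio z, l (Ioo ξ z) ^ (1 : ℝ) ∂ω :=
    measurable_setLIntegral_Iio (φ := fun z ξ => l (Ioo ξ z) ^ (1 : ℝ))
      ((measurable_measure_Ioo'.comp measurable_swap).pow_const 1)
  refine decreasing_of_kernel hV hV0 hr le_rfl
    (rpow_ne_top_of_nonneg hθ.le hA₁) hB (fun g hg => ?_) le_rfl
  rw [← lintegral_tailWeight (hKm.pow_const _)]
  refine le_trans (le_of_eq ?_) (lintegral_mul_le_conj hKm.aemeasurable hg.aemeasurable hr)
  have h3 := lintegral_kernel_swap (l := l) (η := tailWeight ν (r / (r - 1))) (ω := ω) hg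
    (φ := fun _ => 1) measurable_const (h := fun t => t) measurable_id
  simpa only [mul_one, one_mul, rpow_one] using h3

/-- Pointwise estimate for decreasing functions. -/
lemma lintegral_Ioi_antitone_le_rpow [SigmaFinite l] [NullSingletonClass l] [SigmaFinite ν]
    [NullSingletonClass ν] (hV : ∀ z, ν (Iio z) ≠ ∞) (hV0 : ∀ᵐ z ∂l, ν (Iio z) ≠ 0) {r : ℝ}
    (hr : 1 < r) {f : ℝ → ℝ≥0∞} (hf : Antitone f) (x : ℝ) :
    ∫⁻ z in Ioi x, f z ∂l ≤ (ofReal (r / (r - 1)) * (∫⁻ u in Ioi x, l (Ioo x u) ^ (r / (r - 1))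
      ∂(tailWeight ν (r / (r - 1)))) ^ (1 - 1 / r) + l (Ioi x) * ν univ ^ (-(1 / r)))
        * (∫⁻ z, f z ^ r ∂ν) ^ (1 / r) := by
  have hr0 : 0 < r := by linarith
  have hr1 : 0 < r - 1 := by linarith
  have hfm := hf.measurable
  have := sigmaFinite_tailWeight (ν := ν) (by positivity : 0 < r / (r - 1))
  have hgm : Measurable fun u => ((∫⁻ t in Iio u, f t ∂ν) * (ν (Iio u))⁻¹)
    * ν (Iio u) ^ (r / (r - 1) - 1) := measurable_mul' (measurable_mul' (measurable_lintegral_Iio f)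
      measurable_measure_Iio.inv) (measurable_measure_Iio_rpow _)
  refine (lintegral_Ioi_antitone_le hV hV0 hf (by positivity : 0 < r / (r - 1)) x).trans ?_
  rw [add_mul]
  refine add_le_add ?_ ?_
  · refine (lintegral_mul_le_conj (measurable_kernel_right x).aemeasurable hgm.aemeasurable hr).trans ?_
    rw [mul_comm (ofReal _), mul_assoc]
    refine mul_le_mul_right ?_ _
    have h1 := lintegral_average_tailWeight_le hV hfm hr
    have h2 := rpow_le_rpow ((lintegral_mono' (restrict_le_self (s := Ioi x)) le_rfl).trans h1)
      (by positivity : 0 ≤ 1 / r)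
    refine h2.trans (le_of_eq ?_)
    rw [mul_rpow_of_nonneg _ _ (by positivity), ← rpow_mul, mul_one_div_cancel hr0.ne',
      rpow_one]
  · rw [mul_assoc]
    have := const_term_le (ν := ν) hfm hr one_pos
    rw [rpow_one] at this
    exact mul_le_mul_right this _

/-- Necessity of the pointwise estimate. -/
lemma decreasing_necessary_pointwise [SigmaFinite l] [NullSingletonClass l] [SigmaFinite ν]
    [NullSingletonClass ν] (hV : ∀ z, ν (Iio z) ≠ ∞) {r : ℝ} (hr : 1 < r) :
    ∃ K : ℝ≥0∞, K ≠ ∞ ∧ ∀ x (w C : ℝ≥0∞), (∀ f : ℝ → ℝ≥0∞, Antitone f →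
      w * ∫⁻ z in Ioi x, f z ∂l ≤ C * (∫⁻ z, f z ^ r ∂ν) ^ (1 / r)) →
      w * (∫⁻ u in Ioi x, l (Ioo x u) ^ (r / (r - 1)) ∂(tailWeight ν (r / (r - 1)))) ^ (1 - 1 / r)
        ≤ C * K := by
  have hr0 : 0 < r := by linarith
  have hr1 : 0 < r - 1 := by linarith
  have := sigmaFinite_tailWeight (ν := ν) (by positivity : 0 < r / (r - 1))
  obtain ⟨c, hc, hcg⟩ := exists_lintegral_tail_rpow_le (ν := ν) hV hr
  refine ⟨c ^ (1 / r), rpow_ne_top_of_nonneg (by positivity) hc, fun x w C h => ?_⟩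
  refine kernel_conj_le hr fun g hg => ?_
  have h1 := h (fun t => ∫⁻ u in Ioi t, g u ∂(tailWeight ν (r / (r - 1))))
    (fun _ _ hx => lintegral_mono_set (Ioi_subset_Ioi hx))
  rw [lintegral_kernel_Ioi hg] at h1
  refine h1.trans ?_
  rw [mul_assoc, ← mul_rpow_of_nonneg _ _ (by positivity)]
  exact mul_le_mul_right (rpow_le_rpow (hcg g hg) (by positivity)) _

/-! ### The case `r = 1` -/

lemma lowerSet_cases {S : Set ℝ} (hS : IsLowerSet S) :
    S = ∅ ∨ S = univ ∨ ∃ z, Iio z ⊆ S ∧ S ⊆ Iic z := by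
  rcases S.eq_empty_or_nonempty with h | hne
  · exact Or.inl h
  by_cases hb : BddAbove S
  · refine Or.inr (Or.inr ⟨sSup S, fun x hx => ?_, fun x hx => le_csSup hb hx⟩)
    obtain ⟨y, hy, hxy⟩ := exists_lt_of_lt_csSup hne hx
    exact hS hxy.le hy
  · refine Or.inr (Or.inl (eq_univ_of_forall fun x => ?_))
    obtain ⟨y, hy, hxy⟩ := not_bddAbove_iff.1 hb x
    exact hS hxy.le hy

lemma lintegral_Ioi_ofReal_lt (c : ℝ≥0∞) :
    ∫⁻ h in Ioi (0 : ℝ), {h : ℝ | ofReal h < c}.indicator (fun _ => 1) h = c := by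
  have hm : MeasurableSet {h : ℝ | ofReal h < c} :=
    measurableSet_lt measurable_ofReal measurable_const
  rw [lintegral_indicator_const hm, one_mul, Measure.restrict_apply hm]
  rcases eq_or_ne c ∞ with rfl | hc
  · have : {h : ℝ | ofReal h < ∞} ∩ Ioi 0 = Ioi 0 := by ext; simp
    rw [this, Real.volume_Ioi]
  · have : {h : ℝ | ofReal h < c} ∩ Ioi 0 = Ioo 0 c.toReal := by
      ext h
      simp only [mem_inter_iff, mem_ofPred_eq, mem_Ioi, mem_Ioo]
      constructor
      · rintro ⟨h1, h2⟩
        refine ⟨h2, ?_⟩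
        rwa [← ofReal_toReal hc, ENNReal.ofReal_lt_ofReal_iff_of_nonneg h2.le] at h1
      · rintro ⟨h1, h2⟩
        refine ⟨?_, h1⟩
        rwa [← ofReal_toReal hc, ENNReal.ofReal_lt_ofReal_iff_of_nonneg h1.le]
    rw [this, Real.volume_Ioo, sub_zero, ofReal_toReal hc]

lemma measurableSet_level {f : ℝ → ℝ≥0∞} (hf : Measurable f) :
    MeasurableSet {p : ℝ × ℝ | ofReal p.1 < f p.2} :=
  measurableSet_lt (ENNReal.measurable_ofReal.comp measurable_fst) (hf.comp measurable_snd)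

lemma lintegral_eq_lintegral_level {m : Measure ℝ} [SFinite m] {f : ℝ → ℝ≥0∞} (hf : Measurable f) :
    ∫⁻ t, f t ∂m = ∫⁻ h in Ioi (0 : ℝ), m {t | ofReal h < f t} := by
  have hm := measurableSet_level hf
  have h1 : ∀ t, f t = ∫⁻ h in Ioi (0 : ℝ),
      {p : ℝ × ℝ | ofReal p.1 < f p.2}.indicator (fun _ => (1 : ℝ≥0∞)) (h, t) := fun t =>
    (lintegral_Ioi_ofReal_lt (f t)).symm
  rw [lintegral_congr h1, lintegral_lintegral_swap (f := fun t h =>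
    {p : ℝ × ℝ | ofReal p.1 < f p.2}.indicator (fun _ => (1 : ℝ≥0∞)) (h, t))
    ((measurable_const.indicator hm).comp measurable_swap).aemeasurable]
  refine lintegral_congr fun h => ?_
  have hmh : MeasurableSet {t | ofReal h < f t} := measurableSet_lt measurable_const hf
  have h2 : ∫⁻ t, {t | ofReal h < f t}.indicator (fun _ => (1 : ℝ≥0∞)) t ∂m
      = m {t | ofReal h < f t} := by rw [lintegral_indicator_const hmh, one_mul]
  exact h2

/-- Minkowski's integral inequality. -/
lemma minkowski_lintegral {α β : Type*} [MeasurableSpace α] [MeasurableSpace β] {P : Measure α}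
    {Q : Measure β} [SFinite P] [SigmaFinite Q] {G : α → β → ℝ≥0∞}
    (hG : Measurable (Function.uncurry G)) {s : ℝ} (hs : 1 ≤ s) :
    (∫⁻ x, (∫⁻ h, G h x ∂P) ^ s ∂Q) ^ (1 / s) ≤ ∫⁻ h, (∫⁻ x, G h x ^ s ∂Q) ^ (1 / s) ∂P := by
  rcases hs.eq_or_lt with rfl | hs
  · simp only [rpow_one, div_one]
    exact (lintegral_lintegral_swap hG.aemeasurable).symm.le
  have hs0 : 0 < s := by linarith
  have hs1 : 0 < s - 1 := by linarith
  have hconj : s / (s - 1) / (s / (s - 1) - 1) = s := by field_simp; ring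
  have hexp : 1 - 1 / (s / (s - 1)) = 1 / s := by field_simp; ring
  have h := lintegral_rpow_conj_le (μ := Q) (G := fun x => ∫⁻ h, G h x ∂P) (r := s / (s - 1))
    (C := ∫⁻ h, (∫⁻ x, G h x ^ s ∂Q) ^ (1 / s) ∂P)
    (hG.lintegral_prod_left') (by rw [lt_div_iff₀ hs1]; linarith) (fun E hE => by
      have e1 : ∀ x, (∫⁻ h, G h x ∂P) * E x = ∫⁻ h, G h x * E x ∂P := fun x =>
        (lintegral_mul_const _ (hG.comp (by fun_prop : Measurable fun h : α => (h, x)))).symm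
      simp_rw [e1]
      have hGE : Measurable (Function.uncurry fun h x => G h x * E x) :=
        measurable_mul' hG (hE.comp measurable_snd)
      rw [← lintegral_lintegral_swap hGE.aemeasurable]
      have hn : Measurable fun h => (∫⁻ x, G h x ^ s ∂Q) ^ (1 / s) :=
        ((hG.pow_const s).lintegral_prod_right').pow_const _
      rw [← lintegral_mul_const _ hn]
      refine lintegral_mono fun h => ?_
      have h2 := lintegral_mul_le_conj (μ := Q) (f := fun x => G h x) (g := E)
        (hG.comp (by fun_prop : Measurable fun x : β => (h, x))).aemeasurable hE.aemeasurable
        (r := s / (s - 1)) (by rw [lt_div_iff₀ hs1]; linarith)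
      rwa [hconj, hexp] at h2)
  rwa [hconj, hexp] at h

/-- The case `r = 1`. -/
theorem decreasing_sufficient_of_one [SigmaFinite l] [NullSingletonClass l] [SFinite ν]
    [SigmaFinite ω] {s : ℝ} (hs : 1 ≤ s) {A : ℝ≥0∞}
    (hA : ∀ z, ∫⁻ ξ in Iio z, l (Ioo ξ z) ^ s ∂ω ≤ A * ν (Iio z) ^ s)
    {f : ℝ → ℝ≥0∞} (hf : Antitone f) :
    ∫⁻ x, (∫⁻ z in Ioi x, f z ∂l) ^ s ∂ω ≤ A * (∫⁻ z, f z ∂ν) ^ s := by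
  have hs0 : 0 < s := by linarith
  have hfm := hf.measurable
  set S : ℝ → Set ℝ := fun h => {t | ofReal h < f t} with hS
  have hSm : ∀ h, MeasurableSet (S h) := fun h => measurableSet_lt measurable_const hfm
  have hlow : ∀ h, IsLowerSet (S h) := fun h a b hab (ha : _ < f a) => lt_of_lt_of_le ha (hf hab)
  have hcase : ∀ T : Set ℝ, IsLowerSet T → ∫⁻ x, l (Ioi x ∩ T) ^ s ∂ω ≤ A * ν T ^ s := by
    intro T hT
    rcases lowerSet_cases hT with rfl | rfl | ⟨z, h1, h2⟩
    · simp [hs0]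
    · simpa using lintegral_measure_Ioi_le (ν := ν) hs0 hs0.le hA
    · calc _ ≤ ∫⁻ x, l (Ioo x z) ^ s ∂ω := by
            refine lintegral_mono fun x => rpow_le_rpow ?_ hs0.le
            rw [measure_congr (Ioo_ae_eq_Ioc (μ := l))]
            exact measure_mono fun t ht => ⟨ht.1, h2 ht.2⟩
        _ ≤ A * ν (Iio z) ^ s := by rw [← setLIntegral_kernel_eq hs0]; exact hA z
        _ ≤ _ := by gcongr
  have hFx : ∀ x, ∫⁻ z in Ioi x, f z ∂l = ∫⁻ h in Ioi (0 : ℝ), l (Ioi x ∩ S h) := fun x => by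
    rw [lintegral_eq_lintegral_level hfm]
    refine lintegral_congr fun h => ?_
    rw [Measure.restrict_apply (hSm h), inter_comm]
  have hGm : Measurable (Function.uncurry fun h x : ℝ => l (Ioi x ∩ S h)) := by
    have hset : MeasurableSet {p : (ℝ × ℝ) × ℝ | p.1.2 < p.2 ∧ ofReal p.1.1 < f p.2} :=
      (measurableSet_lt (measurable_snd.comp measurable_fst) measurable_snd).inter
        (measurableSet_lt (ENNReal.measurable_ofReal.comp (measurable_fst.comp measurable_fst))
          (hfm.comp measurable_snd))
    exact measurable_measure_prodMk_left hset
  have hM := minkowski_lintegral (P := volume.restrict (Ioi (0 : ℝ))) (Q := ω) hGm hs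
  simp_rw [← hFx] at hM
  have hM2 : (∫⁻ x, (∫⁻ z in Ioi x, f z ∂l) ^ s ∂ω) ^ (1 / s) ≤ A ^ (1 / s) * ∫⁻ z, f z ∂ν := by
    refine hM.trans ?_
    rw [lintegral_eq_lintegral_level (m := ν) hfm]
    have hνm : Measurable fun h => ν (S h) := measurable_measure_prodMk_left (measurableSet_level hfm)
    rw [← lintegral_const_mul _ hνm]
    refine lintegral_mono fun h => ?_
    refine (rpow_le_rpow (hcase _ (hlow h)) (by positivity)).trans (le_of_eq ?_)
    rw [mul_rpow_of_nonneg _ _ (by positivity), ← rpow_mul, mul_one_div_cancel hs0.ne',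
      rpow_one]
  have h3 := rpow_le_rpow hM2 hs0.le
  rwa [mul_rpow_of_nonneg _ _ hs0.le, ← rpow_mul, ← rpow_mul,
    one_div_mul_cancel hs0.ne', rpow_one, rpow_one] at h3

/-- The case `r = 1`, `s = ∞`. -/
lemma decreasing_pointwise_of_one [SigmaFinite l] [NullSingletonClass l] [SFinite ν]
    {x : ℝ} {w A : ℝ≥0∞} (hA : ∀ z, w * l (Ioo x z) ≤ A * ν (Iio z)) {f : ℝ → ℝ≥0∞}
    (hf : Antitone f) : w * ∫⁻ z in Ioi x, f z ∂l ≤ A * ∫⁻ z, f z ∂ν := by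
  have hfm := hf.measurable
  have hcase : ∀ T : Set ℝ, IsLowerSet T → w * l (Ioi x ∩ T) ≤ A * ν T := by
    intro T hT
    rcases lowerSet_cases hT with rfl | rfl | ⟨z, h1, h2⟩
    · simp
    · have h1 := (Appr.const w).mul (appr_measure_Iio_nat (l.restrict (Ioi x)))
      simp only [Measure.restrict_apply measurableSet_Iio, Measure.restrict_apply MeasurableSet.univ,
        inter_comm (Iio _), Ioi_inter_Iio] at h1
      rw [inter_comm]
      exact h1.le_of_forall_le fun n => (hA n).trans
        (mul_le_mul_right (measure_mono (subset_univ _)) _)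
    · refine le_trans (mul_le_mul_right ?_ _) ((hA z).trans (mul_le_mul_right (measure_mono h1) _))
      rw [measure_congr (Ioo_ae_eq_Ioc (μ := l))]
      exact measure_mono fun t ht => ⟨ht.1, h2 ht.2⟩
  have hSm : ∀ h : ℝ, MeasurableSet {t | ofReal h < f t} :=
    fun h => measurableSet_lt measurable_const hfm
  have hm₁ : Measurable fun h : ℝ => (l.restrict (Ioi x)) {t | ofReal h < f t} :=
    measurable_measure_prodMk_left (measurableSet_level hfm)
  have hm₂ : Measurable fun h : ℝ => ν {t | ofReal h < f t} :=
    measurable_measure_prodMk_left (measurableSet_level hfm)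
  rw [lintegral_eq_lintegral_level hfm, lintegral_eq_lintegral_level (m := ν) hfm,
    ← lintegral_const_mul _ hm₁, ← lintegral_const_mul _ hm₂]
  refine lintegral_mono fun h => ?_
  rw [Measure.restrict_apply (hSm h), inter_comm]
  exact hcase _ fun a b hab (ha : _ < f a) => lt_of_lt_of_le ha (hf hab)

end

/-! ### The multiplicative Haar measure -/

/-- The measure `dt/t` on `(0,∞)`. -/
def haar : Measure ℝ := (volume : Measure ℝ).map Real.exp

lemma lintegral_haar {F : ℝ → ℝ≥0∞} (hF : Measurable F) :
    ∫⁻ t, F t ∂haar = ∫⁻ u, F (Real.exp u) := lintegral_map hF Real.measurable_exp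

lemma lintegral_volume_Ioi {F : ℝ → ℝ≥0∞} :
    ∫⁻ t in Ioi (0 : ℝ), F t = ∫⁻ u, ofReal (Real.exp u) * F (Real.exp u) := by
  have h := lintegral_image_eq_lintegral_abs_deriv_mul (s := univ) (f := Real.exp) (f' := Real.exp)
    MeasurableSet.univ (fun x _ => (Real.hasDerivAt_exp x).hasDerivWithinAt)
    (Real.exp_injective.injOn) F
  rw [image_univ, Real.range_exp] at h
  simpa [abs_of_pos (Real.exp_pos _)] using h

lemma pow_ne_zero {α t : ℝ} (ht : 0 < t) : pow α t ≠ 0 :=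
  (rpow_pos (ENNReal.ofReal_pos.2 ht) ofReal_ne_top).ne'

lemma pow_ne_top {α t : ℝ} (ht : 0 < t) : pow α t ≠ ∞ := by
  rw [pow, ofReal_rpow_of_pos ht]; exact ofReal_ne_top

lemma pow_eq_ofReal {α t : ℝ} (ht : 0 < t) : pow α t = ofReal (t ^ α) :=
  ofReal_rpow_of_pos ht

lemma pow_add {α β t : ℝ} (ht : 0 < t) : pow α t * pow β t = pow (α + β) t :=
  (rpow_add _ _ (ENNReal.ofReal_pos.2 ht).ne' ofReal_ne_top).symm

lemma pow_zero' (t : ℝ) : pow 0 t = 1 := rpow_zero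

lemma pow_rpow {α e t : ℝ} : pow α t ^ e = pow (α * e) t := (rpow_mul _ _ _).symm

lemma measurable_pow (α : ℝ) : Measurable (pow α) := ENNReal.measurable_ofReal.pow_const α

lemma haar_eq_withDensity : haar = (volume.restrict (Ioi (0 : ℝ))).withDensity (pow (-1)) := by
  refine Measure.ext_of_lintegral _ fun F hF => ?_
  rw [lintegral_haar hF, lintegral_withDensity_eq_lintegral_mul _ (measurable_pow _) hF]
  rw [lintegral_volume_Ioi]
  refine lintegral_congr fun u => ?_
  have : ofReal (Real.exp u) = pow 1 (Real.exp u) := (rpow_one _).symm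
  rw [Pi.mul_apply, ← mul_assoc, this, pow_add (Real.exp_pos u)]
  norm_num [pow_zero']

instance : SigmaFinite haar := by
  rw [haar_eq_withDensity]
  refine SigmaFinite.withDensity_of_ne_top ?_
  filter_upwards [ae_restrict_mem measurableSet_Ioi] with t ht
  exact pow_ne_top ht

instance : NullSingletonClass haar := by rw [haar_eq_withDensity]; infer_instance

lemma haar_Ioi_zero_compl : ∀ᵐ t ∂haar, 0 < t := by
  rw [haar_eq_withDensity]
  exact (withDensity_absolutelyContinuous _ _).ae_le (ae_restrict_mem measurableSet_Ioi)

lemma haar_absolutelyContinuous : haar ≪ volume.restrict (Ioi (0 : ℝ)) := by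
  rw [haar_eq_withDensity]; exact withDensity_absolutelyContinuous _ _

lemma absolutelyContinuous_haar : volume.restrict (Ioi (0 : ℝ)) ≪ haar := by
  rw [haar_eq_withDensity]
  refine withDensity_absolutelyContinuous' (measurable_pow _).aemeasurable ?_
  filter_upwards [ae_restrict_mem measurableSet_Ioi] with t ht
  exact pow_ne_zero ht

lemma haar_Ioo {x y : ℝ} (hx : 0 < x) (hy : 0 < y) :
    haar (Ioo x y) = ofReal (Real.log (y / x)) := by
  rw [haar, Measure.map_apply Real.measurable_exp measurableSet_Ioo]
  have : Real.exp ⁻¹' Ioo x y = Ioo (Real.log x) (Real.log y) := by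
    ext u; simp [Real.log_lt_iff_lt_exp hx, Real.lt_log_iff_exp_lt hy]
  rw [this, Real.volume_Ioo, Real.log_div hy.ne' hx.ne']

lemma setLIntegral_haar {J : Set ℝ} (hJ : MeasurableSet J) (hJ0 : J ⊆ Ioi 0) (F : ℝ → ℝ≥0∞) :
    ∫⁻ t in J, F t ∂haar = ∫⁻ t in J, pow (-1) t * F t := by
  rw [haar_eq_withDensity, restrict_withDensity hJ, restrict_restrict hJ,
    inter_eq_left.2 hJ0, lintegral_withDensity_eq_lintegral_mul_non_measurable _ (measurable_pow _)]
  · rfl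
  · filter_upwards [ae_restrict_mem hJ] with t ht
    exact (pow_ne_top (hJ0 ht)).lt_top

/-! ### Norms -/

/-- The norm of `L^s`. -/
def nrm (s : ℝ≥0∞) (m : Measure ℝ) (F : ℝ → ℝ≥0∞) : ℝ≥0∞ := eLpNorm F s m

section

variable {m : Measure ℝ} {s : ℝ≥0∞} {F G : ℝ → ℝ≥0∞}

lemma nrm_eq (hs0 : s ≠ 0) (hs : s ≠ ∞) :
    nrm s m F = (∫⁻ t, F t ^ s.toReal ∂m) ^ (1 / s.toReal) := by
  rw [nrm, eLpNorm_eq_lintegral_rpow_enorm_toReal hs0 hs]; simp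

lemma nrm_top : nrm ∞ m F = essSup F m := by rw [nrm, eLpNorm_exponent_top]; rfl

lemma nrm_mono (h : ∀ᵐ t ∂m, F t ≤ G t) : nrm s m F ≤ nrm s m G :=
  eLpNorm_mono_enorm_ae (by simpa using h)

lemma nrm_congr (h : F =ᵐ[m] G) : nrm s m F = nrm s m G := eLpNorm_congr_ae h

lemma nrm_mono_measure {m' : Measure ℝ} (h : m ≤ m') : nrm s m F ≤ nrm s m' F :=
  eLpNorm_mono_measure _ h

lemma nrm_add_le (hs : 1 ≤ s) (hF : AEMeasurable F m) (hG : AEMeasurable G m) :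
    nrm s m (fun t => F t + G t) ≤ nrm s m F + nrm s m G := by
  exact eLpNorm_add_le hF.aestronglyMeasurable hG.aestronglyMeasurable hs

lemma nrm_const_mul (hs0 : s ≠ 0) (c : ℝ≥0∞) (hF : AEMeasurable F m) :
    nrm s m (fun t => c * F t) = c * nrm s m F := by
  rcases eq_or_ne s ∞ with rfl | hs
  · rw [nrm_top, nrm_top]; exact ENNReal.essSup_const_mul
  · have hs' : 0 < s.toReal := toReal_pos hs0 hs
    rw [nrm_eq hs0 hs, nrm_eq hs0 hs]
    simp_rw [mul_rpow_of_nonneg _ _ hs'.le]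
    rw [lintegral_const_mul'' _ (hF.pow_const _), mul_rpow_of_nonneg _ _ (by positivity),
      ← rpow_mul, mul_one_div_cancel hs'.ne', rpow_one]

lemma lp_eq_nrm {J : Set ℝ} (hJ : MeasurableSet J) (hJ0 : J ⊆ Ioi 0) (hs0 : s ≠ 0) :
    lp s J (fun t => pow (-recip s) t * F t) = nrm s (haar.restrict J) F := by
  rcases eq_or_ne s ∞ with rfl | hs
  · rw [lp, nrm]
    have : (fun t => pow (-recip ∞) t * F t) = F := by ext t; simp [recip, pow_zero']
    rw [this]
    have h1 : volume.restrict J ≪ haar.restrict J := by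
      have := absolutelyContinuous_haar.restrict J
      rwa [restrict_restrict hJ, inter_eq_left.2 hJ0] at this
    have h2 : haar.restrict J ≪ volume.restrict J := by
      have := haar_absolutelyContinuous.restrict J
      rwa [restrict_restrict hJ, inter_eq_left.2 hJ0] at this
    rw [eLpNorm_exponent_top, eLpNorm_exponent_top]
    exact le_antisymm (essSup_mono_measure h1) (essSup_mono_measure h2)
  · have hs' : 0 < s.toReal := toReal_pos hs0 hs
    have hr : recip s = 1 / s.toReal := by rw [recip, ENNReal.toReal_inv, one_div]
    rw [nrm_eq hs0 hs, lp, eLpNorm_eq_lintegral_rpow_enorm_toReal hs0 hs, setLIntegral_haar hJ hJ0]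
    congr 1
    refine lintegral_congr fun t => ?_
    rw [enorm_eq_self, mul_rpow_of_nonneg _ _ hs'.le, pow_rpow, hr]
    congr 2
    field_simp

lemma lp_congr {J : Set ℝ} (h : ∀ᵐ t ∂(volume.restrict J), F t = G t) : lp s J F = lp s J G :=
  eLpNorm_congr_ae h

/-- Change of variables `y = x^m`. -/
lemma map_rpow_haar {e : ℝ} (he : e ≠ 0) : haar.map (fun x => x ^ e) = ofReal |e⁻¹| • haar := by
  have hm : Measurable fun x : ℝ => x ^ e := by fun_prop
  rw [haar, Measure.map_map hm Real.measurable_exp]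
  have : ((fun x : ℝ => x ^ e) ∘ Real.exp) = Real.exp ∘ (fun u => e * u) := by
    ext u
    simp only [Function.comp]
    rw [mul_comm, Real.exp_mul]
  rw [this, ← Measure.map_map Real.measurable_exp (measurable_const_mul e),
    Real.map_volume_mul_left he, Measure.map_smul]

lemma nrm_comp_rpow {e : ℝ} (he : e ≠ 0) {J J' : Set ℝ} (hJ' : MeasurableSet J')
    (hJJ : ∀ x, 0 < x → (x ∈ J ↔ x ^ e ∈ J')) (hF : Measurable F) :
    nrm s (haar.restrict J) (fun x => F (x ^ e)) = nrm s (ofReal |e⁻¹| • (haar.restrict J')) F := by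
  have hm : Measurable fun x : ℝ => x ^ e := by fun_prop
  have hres : haar.restrict J = haar.restrict ((fun x : ℝ => x ^ e) ⁻¹' J') := by
    refine Measure.restrict_congr_set ?_
    filter_upwards [haar_Ioi_zero_compl] with x hx
    exact propext (hJJ x hx)
  rw [← Measure.restrict_smul, ← map_rpow_haar he, Measure.restrict_map hm hJ', hres]
  exact (eLpNorm_map_measure hF.aestronglyMeasurable hm.aemeasurable).symm

lemma nrm_smul_measure_le {c : ℝ≥0∞} (hs : 1 ≤ s) : nrm s (c • m) F ≤ (1 + c) * nrm s m F := by
  rcases eq_or_ne s ∞ with rfl | hst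
  · rw [nrm_top, nrm_top]
    exact (essSup_mono_measure Measure.smul_absolutelyContinuous).trans
      (le_mul_of_one_le_left' le_self_add)
  · rw [nrm, nrm, eLpNorm_smul_measure_of_ne_top hst, smul_eq_mul]
    refine mul_le_mul_left ?_ _
    have h1 : (s⁻¹).toReal ≤ 1 := by
      have : s⁻¹ ≤ 1 := ENNReal.inv_le_one.2 hs
      simpa using toReal_mono one_ne_top this
    have h2 : (1 / s).toReal ≤ 1 := by rwa [one_div]
    rcases le_total c 1 with hc | hc
    · exact (ENNReal.rpow_le_one hc toReal_nonneg).trans le_self_add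
    · calc c ^ (1 / s).toReal ≤ c ^ (1 : ℝ) := ENNReal.rpow_le_rpow_of_exponent_le hc h2
        _ ≤ _ := by rw [rpow_one]; exact le_add_self

/-! ### Essential suprema over half lines -/

lemma ae_forall_rat_le_essSup_Iio (F : ℝ → ℝ≥0∞) (m : Measure ℝ) :
    ∀ᵐ t : ℝ ∂m, ∀ q : ℚ, t < (q : ℝ) → F t ≤ essSup F (m.restrict (Iio (q : ℝ))) := by
  rw [ae_all_iff]
  intro q
  have h := ae_le_essSup (μ := m.restrict (Iio (q : ℝ))) (f := F)
  rw [ae_restrict_iff' measurableSet_Iio] at h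
  exact h

lemma ae_forall_rat_le_essSup_Ioi (F : ℝ → ℝ≥0∞) (m : Measure ℝ) :
    ∀ᵐ t : ℝ ∂m, ∀ q : ℚ, (q : ℝ) < t → F t ≤ essSup F (m.restrict (Ioi (q : ℝ))) := by
  rw [ae_all_iff]
  intro q
  have h := ae_le_essSup (μ := m.restrict (Ioi (q : ℝ))) (f := F)
  rw [ae_restrict_iff' measurableSet_Ioi] at h
  exact h

lemma monotone_essSup_Iio (F : ℝ → ℝ≥0∞) (m : Measure ℝ) :
    Monotone fun t => essSup F (m.restrict (Iio t)) := fun _ _ h =>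
  essSup_mono_measure (Measure.absolutelyContinuous_of_le
    (restrict_mono_set _ (Iio_subset_Iio h)))

lemma ae_le_essSup_Iio (F : ℝ → ℝ≥0∞) (m : Measure ℝ) [NullSingletonClass m] :
    ∀ᵐ t ∂m, F t ≤ essSup F (m.restrict (Iio t)) := by
  have hc := (monotone_essSup_Iio F m).countable_not_continuousAt
  filter_upwards [ae_forall_rat_le_essSup_Iio F m, hc.ae_notMem m] with t h1 h2
  have hcont : ContinuousAt (fun t => essSup F (m.restrict (Iio t))) t := not_not.1 h2
  obtain ⟨u, -, hu, hlim⟩ := Real.exists_seq_rat_strictAnti_tendsto t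
  exact ge_of_tendsto' (hcont.tendsto.comp hlim) fun n => h1 _ (hu n)

/-! ### Schur test -/

lemma nrm_schur_le {m : Measure ℝ} [SFinite m] {k : ℝ → ℝ → ℝ≥0∞}
    (hk : Measurable (Function.uncurry k)) {M : ℝ≥0∞} (h1 : ∀ y, ∫⁻ u, k y u ∂m ≤ M)
    (h2 : ∀ u, ∫⁻ y, k y u ∂m ≤ M) {s : ℝ≥0∞} (hs : 1 ≤ s) {G : ℝ → ℝ≥0∞} (hG : Measurable G) :
    nrm s m (fun y => ∫⁻ u, k y u * G u ∂m) ≤ M * nrm s m G := by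
  have hky : ∀ y, Measurable fun u => k y u := fun y =>
    hk.comp (by fun_prop : Measurable fun u : ℝ => (y, u))
  have hku : ∀ u, Measurable fun y => k y u := fun u =>
    hk.comp (by fun_prop : Measurable fun y : ℝ => (y, u))
  rcases eq_or_ne s ∞ with rfl | hst
  · rw [nrm_top, nrm_top]
    refine essSup_le_of_ae_le _ (ae_of_all _ fun y => ?_)
    calc ∫⁻ u, k y u * G u ∂m ≤ ∫⁻ u, k y u * essSup G m ∂m := by
          refine lintegral_mono_ae ?_
          filter_upwards [ae_le_essSup (μ := m) (f := G)] with u hu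
          exact mul_le_mul_right hu _
      _ ≤ _ := by
          rw [lintegral_mul_const _ (hky y)]
          exact mul_le_mul_left (h1 y) _
  · have hs0 : s ≠ 0 := (zero_lt_one.trans_le hs).ne'
    set p := s.toReal with hp
    have hp1 : 1 ≤ p := by rw [hp, ← toReal_one]; exact toReal_mono hst hs
    have hp0 : 0 < p := by linarith
    have hθ : 0 ≤ 1 - 1 / p := by rw [sub_nonneg, div_le_one hp0]; exact hp1
    rw [nrm_eq hs0 hst, nrm_eq hs0 hst]
    have hpt : ∀ y, (∫⁻ u, k y u * G u ∂m) ^ p ≤ M ^ (p - 1) * ∫⁻ u, k y u * G u ^ p ∂m := by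
      intro y
      have h := lintegral_rpow_mul_le (μ := m) (hky y).aemeasurable
        (measurable_mul' (hky y) (hG.pow_const p)).aemeasurable hθ (by
          have : 0 ≤ 1 / p := by positivity
          linarith)
      have e : ∀ u, k y u ^ (1 - 1 / p) * (k y u * G u ^ p) ^ (1 - (1 - 1 / p)) = k y u * G u := by
        intro u
        rw [show 1 - (1 - 1 / p) = 1 / p by ring, mul_rpow_of_nonneg _ _ (by positivity),
          ← rpow_mul, mul_one_div_cancel hp0.ne', rpow_one, ← mul_assoc,
          ← rpow_add_of_nonneg _ _ hθ (by positivity)]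
        simp
      simp_rw [e] at h
      refine (rpow_le_rpow h hp0.le).trans ?_
      rw [mul_rpow_of_nonneg _ _ hp0.le, ← rpow_mul, ← rpow_mul,
        show (1 - 1 / p) * p = p - 1 by field_simp, show (1 - (1 - 1 / p)) * p = 1 by field_simp; ring,
        rpow_one]
      gcongr
      exact h1 y
    have hkG : Measurable (Function.uncurry fun y u => k y u * G u ^ p) :=
      measurable_mul' hk ((hG.pow_const p).comp measurable_snd)
    have hsum : ∫⁻ y, (∫⁻ u, k y u * G u ∂m) ^ p ∂m ≤ M ^ p * ∫⁻ u, G u ^ p ∂m := by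
      calc _ ≤ ∫⁻ y, M ^ (p - 1) * ∫⁻ u, k y u * G u ^ p ∂m ∂m := lintegral_mono hpt
        _ = M ^ (p - 1) * ∫⁻ u, (∫⁻ y, k y u ∂m) * G u ^ p ∂m := by
            have hm : Measurable fun y => ∫⁻ u, k y u * G u ^ p ∂m := hkG.lintegral_prod_right'
            rw [lintegral_const_mul _ hm, lintegral_lintegral_swap hkG.aemeasurable]
            congr 1
            exact lintegral_congr fun u => lintegral_mul_const _ (hku u)
        _ ≤ M ^ (p - 1) * ∫⁻ u, M * G u ^ p ∂m := by
            gcongr with u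
            exact h2 u
        _ = _ := by
            rw [lintegral_const_mul _ (hG.pow_const p), ← mul_assoc]
            congr 1
            conv_rhs => rw [show p = (p - 1) + 1 by ring]
            rw [rpow_add_of_nonneg _ _ (by linarith) (by norm_num), rpow_one]
    refine (rpow_le_rpow hsum (by positivity)).trans (le_of_eq ?_)
    rw [mul_rpow_of_nonneg _ _ (by positivity), ← rpow_mul,
      mul_one_div_cancel hp0.ne', rpow_one]

/-! ### Power functions -/

lemma setLIntegral_Ioi_pow {γ y : ℝ} (hγ : 0 < γ) (hy : 0 < y) :
    ∫⁻ t in Ioi y, pow (-γ) t ∂haar = ofReal γ⁻¹ * pow (-γ) y := by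
  rw [setLIntegral_haar measurableSet_Ioi (Ioi_subset_Ioi hy.le)]
  have h1 : ∫⁻ t in Ioi y, pow (-1) t * pow (-γ) t = ∫⁻ t in Ioi y, ofReal (t ^ (-1 - γ)) :=
    setLIntegral_congr_fun measurableSet_Ioi fun t ht => by
      have ht0 : 0 < t := hy.trans ht
      show pow (-1) t * pow (-γ) t = _
      rw [pow_add ht0, pow_eq_ofReal ht0]; rfl
  rw [h1, ← ofReal_integral_eq_lintegral_ofReal (integrableOn_Ioi_rpow_of_lt (by linarith) hy)
    (by
      filter_upwards [ae_restrict_mem measurableSet_Ioi] with t ht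
      exact Real.rpow_nonneg (hy.trans ht).le _),
    integral_Ioi_rpow_of_lt (by linarith) hy, pow_eq_ofReal hy,
    ← ofReal_mul (by positivity)]
  congr 1
  rw [show -1 - γ + 1 = -γ by ring]
  field_simp

lemma haar_map_inv : haar.map (fun t => t⁻¹) = haar := by
  have h := map_rpow_haar (e := -1) (by norm_num)
  simpa [Real.rpow_neg_one] using h

lemma setLIntegral_Iio_pow {γ y : ℝ} (hγ : 0 < γ) (hy : 0 < y) :
    ∫⁻ t in Iio y, pow γ t ∂haar = ofReal γ⁻¹ * pow γ y := by
  have h1 : ∫⁻ t in Iio y, pow γ t ∂haar = ∫⁻ t in Ioi y⁻¹, pow (-γ) t ∂haar := by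
    conv_rhs => rw [← haar_map_inv]
    rw [setLIntegral_map measurableSet_Ioi (measurable_pow _) measurable_inv,
      ← lintegral_indicator measurableSet_Iio,
      ← lintegral_indicator (measurable_inv measurableSet_Ioi)]
    refine lintegral_congr_ae ?_
    filter_upwards [haar_Ioi_zero_compl] with t ht
    have e : pow (-γ) t⁻¹ = pow γ t := by
      rw [pow_eq_ofReal (inv_pos.2 ht), pow_eq_ofReal ht, Real.inv_rpow ht.le, Real.rpow_neg ht.le,
        inv_inv]
    by_cases h : t < y
    · rw [indicator_of_mem (by exact h), indicator_of_mem (show t ∈ _ from by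
        simpa using (inv_lt_inv₀ hy ht).2 h), e]
    · rw [indicator_of_notMem (by exact h), indicator_of_notMem (show t ∉ _ from by
        simpa using (inv_le_inv₀ ht hy).2 (not_lt.1 h))]
  rw [h1, setLIntegral_Ioi_pow hγ (inv_pos.2 hy), pow_eq_ofReal (inv_pos.2 hy), pow_eq_ofReal hy,
    Real.inv_rpow hy.le, Real.rpow_neg hy.le, inv_inv]

end

/-! ### Regular weights -/

/-- Measurable weights, positive and finite on `(0,∞)`, which vary slowly. -/
structure Regular (a : ℝ → ℝ≥0∞) : Prop where
  measurable : Measurable a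
  ne_zero : ∀ t, 0 < t → a t ≠ 0
  ne_top : ∀ t, 0 < t → a t ≠ ∞
  bound : ∀ ε : ℝ, 0 < ε → ∃ C : ℝ≥0, ∀ t u, 0 < t → t ≤ u →
    a u ≤ C * pow ε (u / t) * a t ∧ a t ≤ C * pow ε (u / t) * a u

lemma pow_div {α t u : ℝ} (ht : 0 < t) (hu : 0 < u) : pow α (u / t) = pow α u * pow (-α) t := by
  rw [pow_eq_ofReal (div_pos hu ht), pow_eq_ofReal hu, pow_eq_ofReal ht,
    ← ofReal_mul (Real.rpow_nonneg hu.le _), Real.div_rpow hu.le ht.le, Real.rpow_neg ht.le]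
  rfl

lemma pow_mul_neg {α t : ℝ} (ht : 0 < t) : pow α t * pow (-α) t = 1 := by
  rw [pow_add ht, add_neg_cancel, pow_zero']

lemma exists_bound_of_equivOn_mono {a g : ℝ → ℝ≥0∞} {ε : ℝ} (hg : MonotoneOn g (Ioi 0))
    (h : EquivOn (Ioi 0) (fun t => pow ε t * a t) g) :
    ∃ C : ℝ≥0, ∀ t u, 0 < t → t ≤ u → a t ≤ C * pow ε (u / t) * a u := by
  obtain ⟨c₁, c₂, h₁, h₂, hE⟩ := h
  refine ⟨c₁⁻¹ * c₂, fun t u ht htu => ?_⟩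
  have hu : 0 < u := ht.trans_le htu
  have hc : (c₁ : ℝ≥0∞) ≠ 0 := by exact_mod_cast h₁.ne'
  have h3 : pow ε t * a t ≤ c₂ * ((c₁ : ℝ≥0∞)⁻¹ * (pow ε u * a u)) := by
    calc pow ε t * a t ≤ c₂ * g t := (hE t ht).2
      _ ≤ c₂ * g u := by gcongr; exact hg ht hu htu
      _ = c₂ * ((c₁ : ℝ≥0∞)⁻¹ * (c₁ * g u)) := by
          rw [← mul_assoc (c₁ : ℝ≥0∞)⁻¹, ENNReal.inv_mul_cancel hc coe_ne_top, one_mul]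
      _ ≤ _ := mul_le_mul_right (mul_le_mul_right (hE u hu).1 _) _
  calc a t = pow (-ε) t * (pow ε t * a t) := by
        rw [← mul_assoc, mul_comm (pow (-ε) t), pow_mul_neg ht, one_mul]
    _ ≤ pow (-ε) t * (c₂ * ((c₁ : ℝ≥0∞)⁻¹ * (pow ε u * a u))) := by gcongr
    _ = _ := by
        rw [pow_div ht hu, coe_mul, coe_inv h₁.ne']; ring

lemma exists_bound_of_equivOn_anti {a g : ℝ → ℝ≥0∞} {ε : ℝ} (hg : AntitoneOn g (Ioi 0))
    (h : EquivOn (Ioi 0) (fun t => pow (-ε) t * a t) g) :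
    ∃ C : ℝ≥0, ∀ t u, 0 < t → t ≤ u → a u ≤ C * pow ε (u / t) * a t := by
  obtain ⟨c₁, c₂, h₁, h₂, hE⟩ := h
  refine ⟨c₁⁻¹ * c₂, fun t u ht htu => ?_⟩
  have hu : 0 < u := ht.trans_le htu
  have hc : (c₁ : ℝ≥0∞) ≠ 0 := by exact_mod_cast h₁.ne'
  have h3 : pow (-ε) u * a u ≤ c₂ * ((c₁ : ℝ≥0∞)⁻¹ * (pow (-ε) t * a t)) := by
    calc pow (-ε) u * a u ≤ c₂ * g u := (hE u hu).2
      _ ≤ c₂ * g t := by gcongr; exact hg ht hu htu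
      _ = c₂ * ((c₁ : ℝ≥0∞)⁻¹ * (c₁ * g t)) := by
          rw [← mul_assoc (c₁ : ℝ≥0∞)⁻¹, ENNReal.inv_mul_cancel hc coe_ne_top, one_mul]
      _ ≤ _ := mul_le_mul_right (mul_le_mul_right (hE t ht).1 _) _
  calc a u = pow ε u * (pow (-ε) u * a u) := by
        rw [← mul_assoc, pow_mul_neg hu, one_mul]
    _ ≤ pow ε u * (c₂ * ((c₁ : ℝ≥0∞)⁻¹ * (pow (-ε) t * a t))) := by gcongr
    _ = _ := by
        rw [pow_div ht hu, coe_mul, coe_inv h₁.ne']; ring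

/-- A slowly varying function agrees almost everywhere with a regular weight. -/
lemma SlowlyVarying.exists_regular {a : ℝ → ℝ≥0∞} (ha : SlowlyVarying (Ioi 0) a) :
    ∃ a' : ℝ → ℝ≥0∞, Regular a' ∧ a =ᵐ[volume.restrict (Ioi 0)] a' := by
  obtain ⟨g, hg, c₁, c₂, h₁, h₂, hE⟩ := ha.anti 1 one_pos
  obtain ⟨G, hG, hGg⟩ := AntitoneOn.exists_antitone_extension hg (OrderBot.bddBelow _)
    (OrderTop.bddAbove _)
  set e : ℝ → ℝ≥0∞ := fun t => pow 1 t * G t with he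
  have hem : Measurable e := measurable_mul' (measurable_pow 1) hG.measurable
  have hea : ∀ t, 0 < t → c₁ * e t ≤ a t ∧ a t ≤ c₂ * e t := by
    intro t ht
    have h := hE t ht
    have e1 : a t = pow 1 t * (pow (-1) t * a t) := by rw [← mul_assoc, pow_mul_neg ht, one_mul]
    have e2 : e t = pow 1 t * g t := by
      show pow 1 t * G t = _
      rw [← hGg ht]
    constructor
    · rw [e2, e1, mul_left_comm]; exact mul_le_mul_right h.1 _
    · rw [e2, mul_left_comm]; conv_lhs => rw [e1]
      exact mul_le_mul_right h.2 _
  set b := ha.aemeasurable.mk a with hb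
  have hbm : Measurable b := ha.aemeasurable.measurable_mk
  have hab : a =ᵐ[volume.restrict (Ioi 0)] b := ha.aemeasurable.ae_eq_mk
  set S : Set ℝ := {t | c₁ * e t ≤ b t ∧ b t ≤ c₂ * e t} with hS
  have hSm : MeasurableSet S := (measurableSet_le (hem.const_mul _) hbm).inter
    (measurableSet_le hbm (hem.const_mul _))
  set a' : ℝ → ℝ≥0∞ := S.piecewise b (fun t => c₁ * e t) with ha'
  have ham : Measurable a' := hbm.piecewise hSm (hem.const_mul _)
  have hc₁ : (c₁ : ℝ≥0∞) ≠ 0 := by exact_mod_cast h₁.ne'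
  have hc₂ : (c₂ : ℝ≥0∞) ≠ 0 := by exact_mod_cast h₂.ne'
  have hcc : ∀ t, 0 < t → (c₁ : ℝ≥0∞) * e t ≤ c₂ * e t := fun t ht => (hea t ht).1.trans (hea t ht).2
  have ha'e : ∀ t, 0 < t → c₁ * e t ≤ a' t ∧ a' t ≤ c₂ * e t := by
    intro t ht
    by_cases h : t ∈ S
    · rw [ha', piecewise_eq_of_mem _ _ _ h]; exact h
    · rw [ha', piecewise_eq_of_notMem _ _ _ h]; exact ⟨le_rfl, hcc t ht⟩
  -- two-sided comparison of `a` and `a'`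
  set k : ℝ≥0 := c₂ * c₁⁻¹ with hk
  have hkk : ∀ x : ℝ≥0∞, (c₂ : ℝ≥0∞) * x = k * (c₁ * x) := fun x => by
    rw [hk, coe_mul, coe_inv h₁.ne', mul_assoc, ← mul_assoc _ (c₁ : ℝ≥0∞),
      ENNReal.inv_mul_cancel hc₁ coe_ne_top, one_mul]
  have h1 : ∀ t, 0 < t → a t ≤ k * a' t := fun t ht =>
    ((hea t ht).2.trans (hkk _).le).trans (by gcongr; exact (ha'e t ht).1)
  have h2 : ∀ t, 0 < t → a' t ≤ k * a t := fun t ht =>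
    ((ha'e t ht).2.trans (hkk _).le).trans (by gcongr; exact (hea t ht).1)
  have hbound : ∀ ε : ℝ, 0 < ε → ∃ C : ℝ≥0, ∀ t u, 0 < t → t ≤ u →
      a' u ≤ C * pow ε (u / t) * a' t ∧ a' t ≤ C * pow ε (u / t) * a' u := by
    intro ε hε
    obtain ⟨g₁, hg₁, hE₁⟩ := ha.mono ε hε
    obtain ⟨g₂, hg₂, hE₂⟩ := ha.anti ε hε
    obtain ⟨C₁, hC₁⟩ := exists_bound_of_equivOn_mono hg₁ hE₁
    obtain ⟨C₂, hC₂⟩ := exists_bound_of_equivOn_anti hg₂ hE₂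
    refine ⟨k * k * (C₁ + C₂), fun t u ht htu => ?_⟩
    have hu := ht.trans_le htu
    have l1 : (C₁ : ℝ≥0∞) ≤ C₁ + C₂ := le_self_add
    have l2 : (C₂ : ℝ≥0∞) ≤ C₁ + C₂ := le_add_self
    push_cast
    constructor
    · calc a' u ≤ k * (C₂ * pow ε (u / t) * (k * a' t)) := by
            refine (h2 u hu).trans ?_
            gcongr
            refine (hC₂ t u ht htu).trans ?_
            gcongr
            exact h1 t ht
        _ ≤ k * ((C₁ + C₂) * pow ε (u / t) * (k * a' t)) := by gcongr
        _ = _ := by ring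
    · calc a' t ≤ k * (C₁ * pow ε (u / t) * (k * a' u)) := by
            refine (h2 t ht).trans ?_
            gcongr
            refine (hC₁ t u ht htu).trans ?_
            gcongr
            exact h1 u hu
        _ ≤ k * ((C₁ + C₂) * pow ε (u / t) * (k * a' u)) := by gcongr
        _ = _ := by ring
  refine ⟨a', ⟨ham, ?_, ?_, hbound⟩, ?_⟩
  · obtain ⟨t₀, ht₀, hne⟩ := ha.ne_zero
    obtain ⟨C, hC⟩ := hbound 1 one_pos
    intro t ht h0
    have : a' t₀ = 0 := by
      rcases le_total t t₀ with h | h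
      · have := (hC t t₀ ht h).1; rw [h0, mul_zero] at this; exact le_zero_iff.1 this
      · have := (hC t₀ t ht₀ h).2; rw [h0, mul_zero] at this; exact le_zero_iff.1 this
    exact hne (le_zero_iff.1 ((h1 t₀ ht₀).trans (by rw [this, mul_zero])))
  · obtain ⟨t₀, ht₀, hne⟩ := ha.ne_top
    have ht₀' : a' t₀ ≠ ∞ := ne_top_of_le_ne_top (mul_ne_top coe_ne_top hne) (h2 t₀ ht₀)
    obtain ⟨C, hC⟩ := hbound 1 one_pos
    intro t ht
    rcases le_total t t₀ with h | h
    · exact ne_top_of_le_ne_top (mul_ne_top (mul_ne_top coe_ne_top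
        (pow_ne_top (div_pos ht₀ ht))) ht₀') (hC t t₀ ht h).2
    · exact ne_top_of_le_ne_top (mul_ne_top (mul_ne_top coe_ne_top
        (pow_ne_top (div_pos ht ht₀))) ht₀') (hC t₀ t ht₀ h).1
  · filter_upwards [hab, ae_restrict_mem measurableSet_Ioi] with t ht ht0
    have : t ∈ S := by
      show c₁ * e t ≤ b t ∧ b t ≤ c₂ * e t
      rw [← ht]; exact hea t ht0
    rw [ha', piecewise_eq_of_mem _ _ _ this, ht]

namespace Regular

variable {a : ℝ → ℝ≥0∞}

lemma inv (ha : Regular a) : Regular fun t => (a t)⁻¹ where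
  measurable := ha.measurable.inv
  ne_zero t ht := ENNReal.inv_ne_zero.2 (ha.ne_top t ht)
  ne_top t ht := ENNReal.inv_ne_top.2 (ha.ne_zero t ht)
  bound ε hε := by
    obtain ⟨C, hC⟩ := ha.bound ε hε
    have key : ∀ x y c : ℝ≥0∞, c ≠ ∞ → x ≠ 0 → y ≠ 0 → x ≠ ∞ → y ≠ ∞ → x ≤ c * y → y⁻¹ ≤ c * x⁻¹ := by
      intro x y c hc hx hy hxt hyt h
      calc y⁻¹ = x * x⁻¹ * y⁻¹ := by rw [ENNReal.mul_inv_cancel hx hxt, one_mul]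
        _ ≤ c * y * x⁻¹ * y⁻¹ := by gcongr
        _ = c * x⁻¹ * (y * y⁻¹) := by ring
        _ = _ := by rw [ENNReal.mul_inv_cancel hy hyt, mul_one]
    refine ⟨C, fun t u ht htu => ?_⟩
    have hu := ht.trans_le htu
    have hc : (C : ℝ≥0∞) * pow ε (u / t) ≠ ∞ :=
      mul_ne_top coe_ne_top (pow_ne_top (div_pos hu ht))
    exact ⟨key _ _ _ hc (ha.ne_zero t ht) (ha.ne_zero u hu) (ha.ne_top t ht) (ha.ne_top u hu)
      (hC t u ht htu).2, key _ _ _ hc (ha.ne_zero u hu) (ha.ne_zero t ht) (ha.ne_top u hu)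
      (ha.ne_top t ht) (hC t u ht htu).1⟩

lemma star (ha : Regular a) {m : ℝ} (hm : m ≠ 0) : Regular (LK.star m a) where
  measurable := ha.measurable.comp (by fun_prop)
  ne_zero t ht := ha.ne_zero _ (Real.rpow_pos_of_pos ht _)
  ne_top t ht := ha.ne_top _ (Real.rpow_pos_of_pos ht _)
  bound ε hε := by
    have hm' : 0 < |m| := abs_pos.2 hm
    obtain ⟨C, hC⟩ := ha.bound (ε * |m|) (by positivity)
    refine ⟨C, fun t u ht htu => ?_⟩
    have hu := ht.trans_le htu
    have hmono : ∀ x y : ℝ, 0 < x → 0 < y → ∀ e : ℝ, e * (ε * |m|) = ε →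
        pow (ε * |m|) (y ^ e / x ^ e) = pow ε (y / x) := by
      intro x y hx hy e he
      rw [← Real.div_rpow hy.le hx.le, pow_eq_ofReal (Real.rpow_pos_of_pos (div_pos hy hx) _),
        pow_eq_ofReal (div_pos hy hx), ← Real.rpow_mul (div_pos hy hx).le, he]
    have hpt := Real.rpow_pos_of_pos ht (1 / m)
    have hpu := Real.rpow_pos_of_pos hu (1 / m)
    rcases lt_or_gt_of_ne hm with hneg | hpos
    · have hle : u ^ (1 / m) ≤ t ^ (1 / m) :=
        Real.rpow_le_rpow_of_nonpos ht htu (by rw [one_div]; exact (inv_lt_zero.2 hneg).le)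
      have h := hC (u ^ (1 / m)) (t ^ (1 / m)) hpu hle
      have e : pow (ε * |m|) (t ^ (1 / m) / u ^ (1 / m)) = pow ε (u / t) := by
        rw [← hmono t u ht hu (-(1 / m)) (by rw [abs_of_neg hneg]; field_simp),
          Real.rpow_neg hu.le, Real.rpow_neg ht.le]
        congr 1; field_simp
      rw [e] at h
      exact ⟨h.2, h.1⟩
    · have hle : t ^ (1 / m) ≤ u ^ (1 / m) := Real.rpow_le_rpow ht.le htu (by positivity)
      have h := hC (t ^ (1 / m)) (u ^ (1 / m)) hpt hle
      rw [hmono t u ht hu (1 / m) (by rw [abs_of_pos hpos]; field_simp)] at h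
      exact h

lemma exists_le_on (ha : Regular a) {c d : ℝ} (hc : 0 < c) :
    ∃ C : ℝ≥0∞, C ≠ ∞ ∧ ∀ t ∈ Icc c d, a t ≤ C := by
  obtain ⟨C, hC⟩ := ha.bound 1 one_pos
  refine ⟨C * pow 1 (d / c) * a c, ?_, fun t ht => ?_⟩
  · rcases le_or_gt d 0 with hd | hd
    · have : pow 1 (d / c) ≠ ∞ := by
        rw [pow, rpow_one]; exact ofReal_ne_top
      exact mul_ne_top (mul_ne_top coe_ne_top this) (ha.ne_top c hc)
    · exact mul_ne_top (mul_ne_top coe_ne_top (pow_ne_top (div_pos hd hc)))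
        (ha.ne_top c hc)
  · refine (hC c t hc ht.1).1.trans ?_
    gcongr
    rw [pow, pow, rpow_one, rpow_one]
    exact ofReal_le_ofReal (by gcongr; exact ht.2)

end Regular

/-! ### Exponents -/

section Exponents

variable {r s : ℝ≥0∞}

lemma recip_top : recip ∞ = 0 := by simp [recip]

lemma recip_eq (r : ℝ≥0∞) : recip r = 1 / r.toReal := by rw [recip, ENNReal.toReal_inv, one_div]

lemma conjExponent_one : conjExponent 1 = ∞ := by simp [conjExponent]

lemma conjExponent_top : conjExponent ∞ = 1 := by simp [conjExponent]

lemma recip_conjExponent (hr : 1 ≤ r) : recip (conjExponent r) = 1 - recip r := by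
  have h := (ENNReal.HolderConjugate.conjExponent hr).inv_add_inv_eq_one
  have h1 : r⁻¹ ≠ ∞ := ENNReal.inv_ne_top.2 (one_pos.trans_le hr).ne'
  have h2 : (conjExponent r)⁻¹ ≠ ∞ := ne_top_of_le_ne_top one_ne_top (h ▸ le_add_self)
  have := congrArg ENNReal.toReal h
  rw [ENNReal.toReal_add h1 h2, toReal_one] at this
  rw [recip, recip]; linarith

lemma conjExponent_ne_zero : conjExponent r ≠ 0 := by simp [conjExponent]

lemma conjExponent_ne_top (hr : 1 < r) : conjExponent r ≠ ∞ := by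
  rw [conjExponent]
  refine ENNReal.add_ne_top.2 ⟨one_ne_top, ENNReal.inv_ne_top.2 ?_⟩
  exact (tsub_pos_of_lt hr).ne'

lemma one_lt_toReal (hr : 1 < r) (hr' : r ≠ ∞) : 1 < r.toReal := by
  rw [← toReal_one]; exact (toReal_lt_toReal one_ne_top hr').2 hr

lemma one_le_toReal (hr : 1 ≤ r) (hr' : r ≠ ∞) : 1 ≤ r.toReal := by
  rw [← toReal_one]; exact toReal_mono hr' hr

lemma toReal_conjExponent (hr : 1 < r) (hr' : r ≠ ∞) :
    (conjExponent r).toReal = r.toReal / (r.toReal - 1) := by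
  have h := recip_conjExponent hr.le
  have h1 := one_lt_toReal hr hr'
  rw [recip_eq, recip_eq] at h
  have : (conjExponent r).toReal = 1 / (1 / (conjExponent r).toReal) := by rw [one_div_one_div]
  rw [this, h]; field_simp

lemma recip_rho (hs : 1 ≤ s) (hsr : s < r) : recip (rho r s) = recip s - recip r := by
  rw [recip, rho, inv_inv, ENNReal.toReal_sub_of_le (ENNReal.inv_le_inv.2 hsr.le)
    (ENNReal.inv_ne_top.2 (one_pos.trans_le hs).ne')]
  rfl

lemma rho_ne_zero (hs : 1 ≤ s) : rho r s ≠ 0 := by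
  rw [rho]
  exact ENNReal.inv_ne_zero.2 (ne_top_of_le_ne_top
    (ENNReal.inv_ne_top.2 (one_pos.trans_le hs).ne') tsub_le_self)

lemma rho_ne_top (hsr : s < r) : rho r s ≠ ∞ := by
  rw [rho, inv_ne_top]; exact (tsub_pos_of_lt (ENNReal.inv_lt_inv.2 hsr)).ne'

lemma toReal_rho (hs : 1 ≤ s) (hsr : s < r) (hr : r ≠ ∞) :
    (rho r s).toReal = r.toReal * s.toReal / (r.toReal - s.toReal) := by
  have h := recip_rho hs hsr
  have h1 := one_le_toReal hs hsr.ne_top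
  have h2 := (toReal_lt_toReal hsr.ne_top hr).2 hsr
  rw [recip_eq, recip_eq, recip_eq] at h
  have : (rho r s).toReal = 1 / (1 / (rho r s).toReal) := by rw [one_div_one_div]
  rw [this, h]
  have h3 : r.toReal - s.toReal ≠ 0 := by linarith
  have : (0:ℝ) < s.toReal := by linarith
  have : (0:ℝ) < r.toReal := by linarith
  have h4 : 1 / s.toReal - 1 / r.toReal ≠ 0 := by
    have : 1 / s.toReal - 1 / r.toReal = (r.toReal - s.toReal) / (r.toReal * s.toReal) := by
      field_simp
    rw [this]; positivity
  field_simp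

lemma rho_top_left : rho ∞ s = s := by simp [rho]

end Exponents

/-! ### Duality for the norms -/

section Duality

variable {m : Measure ℝ} {r s : ℝ≥0∞} {F G : ℝ → ℝ≥0∞}

lemma nrm_one : nrm 1 m F = ∫⁻ t, F t ∂m := by rw [nrm_eq one_ne_zero one_ne_top]; simp

lemma nrm_rpow (hs0 : s ≠ 0) (hs : s ≠ ∞) : nrm s m F ^ s.toReal = ∫⁻ t, F t ^ s.toReal ∂m := by
  have := toReal_pos hs0 hs
  rw [nrm_eq hs0 hs, ← rpow_mul, one_div_mul_cancel this.ne', rpow_one]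

lemma lintegral_mul_le_nrm (hr : 1 ≤ r) (hF : AEMeasurable F m) (hG : AEMeasurable G m) :
    ∫⁻ t, F t * G t ∂m ≤ nrm (conjExponent r) m F * nrm r m G := by
  have hle : ∀ {P Q : ℝ → ℝ≥0∞}, AEMeasurable Q m →
      ∫⁻ t, P t * Q t ∂m ≤ nrm ∞ m P * nrm 1 m Q := fun {P Q} hQ => by
    rw [nrm_top, nrm_one, ← lintegral_const_mul'' _ hQ]
    exact lintegral_mono_ae ((ae_le_essSup (f := P)).mono fun t ht => mul_le_mul_left ht _)
  rcases hr.eq_or_lt with rfl | hr1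
  · rw [conjExponent_one]; exact hle hG
  rcases eq_or_ne r ∞ with rfl | hr'
  · rw [conjExponent_top, mul_comm]; simp_rw [mul_comm (F _)]; exact hle hF
  rw [nrm_eq conjExponent_ne_zero (conjExponent_ne_top hr1), nrm_eq (one_pos.trans hr1).ne' hr',
    ← recip_eq (conjExponent r), recip_conjExponent hr, recip_eq, toReal_conjExponent hr1 hr']
  exact lintegral_mul_le_conj hF hG (one_lt_toReal hr1 hr')

lemma nrm_conj_le [SigmaFinite m] (hr : 1 ≤ r) (hG : Measurable G) {C : ℝ≥0∞}
    (h : ∀ E, Measurable E → ∫⁻ t, G t * E t ∂m ≤ C * nrm r m E) :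
    nrm (conjExponent r) m G ≤ C := by
  rcases hr.eq_or_lt with rfl | hr1
  · rw [conjExponent_one, nrm_top]
    refine essSup_le_of_ae_le _ (ae_le_of_forall_setLIntegral_le_of_sigmaFinite₀ hG.aemeasurable
      fun S hS _ => ?_)
    have := h (S.indicator 1) (measurable_one.indicator hS)
    rw [nrm_one, lintegral_indicator_one hS] at this
    calc ∫⁻ t in S, G t ∂m = ∫⁻ t, G t * S.indicator 1 t ∂m := by
          rw [← lintegral_indicator hS]
          exact lintegral_congr fun t => by by_cases ht : t ∈ S <;> simp [ht]
      _ ≤ _ := this.trans (by simp)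
  rcases eq_or_ne r ∞ with rfl | hr'
  · rw [conjExponent_top, nrm_one]
    have := h (fun _ => 1) measurable_const
    rw [nrm_top] at this
    simp only [mul_one] at this
    exact this.trans ((mul_le_mul_right (essSup_le_of_ae_le 1 (ae_of_all _ fun _ => le_rfl)) C).trans
      (mul_one C).le)
  rw [nrm_eq conjExponent_ne_zero (conjExponent_ne_top hr1),
    ← recip_eq (conjExponent r), recip_conjExponent hr, recip_eq, toReal_conjExponent hr1 hr']
  refine lintegral_rpow_conj_le hG (one_lt_toReal hr1 hr') fun E hE => ?_
  rw [← nrm_eq (one_pos.trans hr1).ne' hr']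
  exact h E hE

lemma ae_le_nrm_top : ∀ᵐ t ∂m, F t ≤ nrm ∞ m F := by rw [nrm_top]; exact ae_le_essSup

lemma nrm_top_le {c : ℝ≥0∞} (h : ∀ᵐ t ∂m, F t ≤ c) : nrm ∞ m F ≤ c := by
  rw [nrm_top]; exact essSup_le_of_ae_le _ h

end Duality

/-! ### The weighted Hardy inequality -/

section Hardy

/-- The Hardy inequality for `∫_{t<x}` with weights `b` and `a` and norms of exponents `s`, `r`. -/
def HardyBound (r s : ℝ≥0∞) (a b : ℝ → ℝ≥0∞) (l : Measure ℝ) : Prop :=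
  ∃ C : ℝ≥0∞, C ≠ ∞ ∧ ∀ F : ℝ → ℝ≥0∞, Measurable F →
    nrm s l (fun x => b x * ∫⁻ t in Iio x, F t ∂l) ≤ C * nrm r l (fun t => a t * F t)

variable {l : Measure ℝ} {r s : ℝ≥0∞} {a b : ℝ → ℝ≥0∞}

lemma HardyBound.tail_mul_head_le [SigmaFinite l] (hr : 1 ≤ r) (hs : 1 ≤ s) (ha : Measurable a)
    (hb : Measurable b) (ha0 : ∀ᵐ t ∂l, a t ≠ 0 ∧ a t ≠ ∞) {C : ℝ≥0∞}
    (hC : ∀ F : ℝ → ℝ≥0∞, Measurable F →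
      nrm s l (fun x => b x * ∫⁻ t in Iio x, F t ∂l) ≤ C * nrm r l (fun t => a t * F t)) (x : ℝ) :
    nrm s (l.restrict (Ioi x)) b * nrm (conjExponent r) (l.restrict (Iio x)) (fun t => (a t)⁻¹)
      ≤ C := by
  have hs0 : s ≠ 0 := (one_pos.trans_le hs).ne'
  have hai : Measurable fun t => (a t)⁻¹ := ha.inv
  rw [← nrm_const_mul conjExponent_ne_zero _ hai.aemeasurable]
  refine nrm_conj_le hr (ha.inv.const_mul _) fun E hE => ?_
  have hm : Measurable fun t => (a t)⁻¹ * E t := measurable_mul' ha.inv hE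
  have hmi : Measurable ((Iio x).indicator fun t => (a t)⁻¹ * E t) := hm.indicator measurableSet_Iio
  have e0 : ∫⁻ t in Iio x, nrm s (l.restrict (Ioi x)) b * (a t)⁻¹ * E t ∂l
      = nrm s (l.restrict (Ioi x)) b * ∫⁻ t in Iio x, (a t)⁻¹ * E t ∂l := by
    rw [← lintegral_const_mul _ hm]
    exact lintegral_congr fun t => mul_assoc _ _ _
  refine e0.trans_le ?_
  have hle : nrm s (l.restrict (Ioi x)) b * ∫⁻ t in Iio x, (a t)⁻¹ * E t ∂l
      ≤ nrm s l (fun y => b y * ∫⁻ t in Iio y, (Iio x).indicator (fun t => (a t)⁻¹ * E t) t ∂l) := by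
    rw [mul_comm, ← nrm_const_mul hs0 _ hb.aemeasurable]
    refine le_trans (nrm_mono ?_) (nrm_mono_measure (m := l.restrict (Ioi x)) restrict_le_self)
    filter_upwards [ae_restrict_mem measurableSet_Ioi] with y hy
    rw [mul_comm, setLIntegral_indicator measurableSet_Iio, Iio_inter_Iio, min_eq_left (le_of_lt hy)]
  refine hle.trans ((hC _ hmi).trans (mul_le_mul_right ?_ _))
  have e : nrm r (l.restrict (Iio x)) E = nrm r l ((Iio x).indicator E) :=
    (eLpNorm_indicator_eq_eLpNorm_restrict measurableSet_Iio).symm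
  rw [e]
  refine nrm_mono (ha0.mono fun t ht => ?_)
  by_cases h : t ∈ Iio x
  · rw [indicator_of_mem h, indicator_of_mem h, ← mul_assoc, ENNReal.mul_inv_cancel ht.1 ht.2, one_mul]
  · rw [indicator_of_notMem h, mul_zero]; exact zero_le

lemma withDensity_sigmaFinite_rpow [SigmaFinite l] {e : ℝ} (ha0 : ∀ᵐ t ∂l, a t ≠ 0 ∧ a t ≠ ∞) :
    SigmaFinite (l.withDensity fun t => a t ^ e) :=
  SigmaFinite.withDensity_of_ne_top (ha0.mono fun _ ht => rpow_ne_top_of_ne_zero ht.1 ht.2)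

lemma withDensity_null [NullSingletonClass l] {g : ℝ → ℝ≥0∞} : NullSingletonClass (l.withDensity g) :=
  ⟨fun x => withDensity_absolutelyContinuous _ _ (measure_singleton x)⟩

lemma lintegral_density {g F : ℝ → ℝ≥0∞} (hg : Measurable g) (hF : Measurable F) :
    ∫⁻ t, F t ∂(l.withDensity g) = ∫⁻ t, g t * F t ∂l :=
  lintegral_withDensity_eq_lintegral_mul _ hg hF

lemma setLIntegral_density {g F : ℝ → ℝ≥0∞} (hg : Measurable g) (hF : Measurable F) {S : Set ℝ}
    (hS : MeasurableSet S) : ∫⁻ t in S, F t ∂(l.withDensity g) = ∫⁻ t in S, g t * F t ∂l :=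
  setLIntegral_withDensity_eq_setLIntegral_mul _ hg hF hS

lemma density_apply_eq_nrm (hs0 : s ≠ 0) (hs : s ≠ ∞) {S : Set ℝ} (hS : MeasurableSet S) :
    (l.withDensity fun t => b t ^ s.toReal) S = nrm s (l.restrict S) b ^ s.toReal := by
  rw [nrm_rpow hs0 hs, withDensity_apply _ hS]

lemma nrm_rpow_density (hs0 : s ≠ 0) (hs : s ≠ ∞) (hb : Measurable b) {H : ℝ → ℝ≥0∞}
    (hH : Measurable H) : ∫⁻ x, H x ^ s.toReal ∂(l.withDensity fun t => b t ^ s.toReal)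
      = nrm s l (fun x => b x * H x) ^ s.toReal := by
  rw [nrm_rpow hs0 hs, lintegral_density (hb.pow_const _) (hH.pow_const _)]
  exact lintegral_congr fun t => (mul_rpow_of_nonneg _ _ toReal_nonneg).symm

/-- For `1 < r < ∞` and `s < ∞` the Hardy inequality is the one of the measures
`a^{-r'} l` and `b^s l`. -/
lemma hardyBound_iff_measures [SigmaFinite l] (hr1 : 1 < r) (hr' : r ≠ ∞) (hs : 1 ≤ s)
    (hs' : s ≠ ∞) (ha : Measurable a) (hb : Measurable b) (ha0 : ∀ᵐ t ∂l, a t ≠ 0 ∧ a t ≠ ∞) :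
    HardyBound r s a b l ↔ ∃ C : ℝ≥0∞, C ≠ ∞ ∧ ∀ g : ℝ → ℝ≥0∞, Measurable g →
      ∫⁻ y, (∫⁻ t in Iio y, g t ∂(l.withDensity fun t => (a t)⁻¹ ^ (conjExponent r).toReal)) ^ s.toReal
          ∂(l.withDensity fun t => b t ^ s.toReal)
        ≤ C * (∫⁻ t, g t ^ r.toReal ∂(l.withDensity fun t => (a t)⁻¹ ^ (conjExponent r).toReal))
          ^ (s.toReal / r.toReal) := by
  have hs0 : s ≠ 0 := (one_pos.trans_le hs).ne'
  have hr0 : r ≠ 0 := (one_pos.trans hr1).ne'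
  have hR := one_lt_toReal hr1 hr'
  have hS := one_le_toReal hs hs'
  set p := (conjExponent r).toReal with hp
  have hp' : p = r.toReal / (r.toReal - 1) := toReal_conjExponent hr1 hr'
  have ham : Measurable fun t => (a t)⁻¹ ^ p := ha.inv.pow_const _
  have key : ∀ g, Measurable g →
      ∫⁻ y, (∫⁻ t in Iio y, g t ∂(l.withDensity fun t => (a t)⁻¹ ^ p)) ^ s.toReal
          ∂(l.withDensity fun t => b t ^ s.toReal)
        = nrm s l (fun x => b x * ∫⁻ t in Iio x, (a t)⁻¹ ^ p * g t ∂l) ^ s.toReal ∧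
      (∫⁻ t, g t ^ r.toReal ∂(l.withDensity fun t => (a t)⁻¹ ^ p)) ^ (s.toReal / r.toReal)
        = nrm r l (fun t => a t * ((a t)⁻¹ ^ p * g t)) ^ s.toReal := by
    intro g hg
    have hgm : Measurable fun t => (a t)⁻¹ ^ p * g t := measurable_mul' ham hg
    constructor
    · rw [← nrm_rpow_density (l := l) hs0 hs' hb (measurable_lintegral_Iio _)]
      simp_rw [setLIntegral_density ham hg measurableSet_Iio]
    · have hRp : s.toReal / r.toReal = 1 / r.toReal * s.toReal := by ring
      rw [hRp, rpow_mul, nrm_eq hr0 hr', lintegral_density ham (hg.pow_const _)]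
      congr 2
      refine lintegral_congr_ae (ha0.mono fun t ht => ?_)
      show (a t)⁻¹ ^ p * g t ^ r.toReal = (a t * ((a t)⁻¹ ^ p * g t)) ^ r.toReal
      rw [← mul_assoc, mul_rpow_of_nonneg _ _ toReal_nonneg]
      congr 1
      rw [inv_rpow, ← rpow_neg]
      rw [show a t * a t ^ (-p) = a t ^ (1 + -p) by rw [rpow_add _ _ ht.1 ht.2, rpow_one],
        ← rpow_mul]
      congr 1
      have : r.toReal - 1 ≠ 0 := by linarith
      rw [hp']; field_simp; ring
  constructor
  · rintro ⟨C, hC, h⟩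
    refine ⟨C ^ s.toReal, rpow_ne_top_of_nonneg toReal_nonneg hC, fun g hg => ?_⟩
    rw [(key g hg).1, (key g hg).2, ← mul_rpow_of_nonneg _ _ toReal_nonneg]
    exact rpow_le_rpow (h _ (measurable_mul' ham hg)) toReal_nonneg
  · rintro ⟨C, hC, h⟩
    refine ⟨C ^ (1 / s.toReal), rpow_ne_top_of_nonneg (by positivity) hC, fun F hF => ?_⟩
    have hgm : Measurable fun t => a t ^ p * F t := measurable_mul' (ha.pow_const _) hF
    have h' := h _ hgm
    rw [(key _ hgm).1, (key _ hgm).2] at h'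
    have hF' : ∀ᵐ t ∂l, (a t)⁻¹ ^ p * (a t ^ p * F t) = F t := ha0.mono fun t ht => by
      rw [← mul_assoc, inv_rpow, ← rpow_neg, ← rpow_add _ _ ht.1 ht.2,
        neg_add_cancel, rpow_zero, one_mul]
    have e1 : (fun x => b x * ∫⁻ t in Iio x, (a t)⁻¹ ^ p * (a t ^ p * F t) ∂l)
        = fun x => b x * ∫⁻ t in Iio x, F t ∂l := by
      ext x; rw [lintegral_congr_ae (ae_restrict_of_ae hF')]
    have e2 : nrm r l (fun t => a t * ((a t)⁻¹ ^ p * (a t ^ p * F t)))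
        = nrm r l fun t => a t * F t := nrm_congr (hF'.mono fun t ht => by simp only [ht])
    rw [e1, e2, ← ENNReal.rpow_le_rpow_iff (z := 1 / s.toReal) (by positivity),
      mul_rpow_of_nonneg _ _ (by positivity), ← rpow_mul, ← rpow_mul,
      mul_one_div_cancel (by positivity), rpow_one, rpow_one] at h'
    exact h'

lemma mul_setLIntegral_Iio_le {x : ℝ} {w B : ℝ≥0∞} {F : ℝ → ℝ≥0∞}
    (h : ∀ q : ℚ, (q : ℝ) < x → w * ∫⁻ t in Iio (q : ℝ), F t ∂l ≤ B) :
    w * ∫⁻ t in Iio x, F t ∂l ≤ B := by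
  have hU : Iio x = ⋃ q : {q : ℚ // (q : ℝ) < x}, Iio ((q : ℚ) : ℝ) := by
    ext t
    simp only [mem_Iio, mem_iUnion, Subtype.exists, exists_prop]
    exact ⟨fun ht => (exists_rat_btwn ht).imp fun q hq => ⟨hq.2, hq.1⟩,
      fun ⟨q, hq, hn⟩ => hn.trans hq⟩
  rw [hU, setLIntegral_iUnion_of_directed, mul_iSup]
  · exact iSup_le fun q => h q q.2
  · exact Monotone.directed_le fun p q hpq => Iio_subset_Iio (by exact_mod_cast hpq)

theorem hardyBound_of_le [SigmaFinite l] [NullSingletonClass l] (hr : 1 ≤ r) (hrs : r ≤ s)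
    (ha : Measurable a) (hb : Measurable b) (ha0 : ∀ᵐ t ∂l, a t ≠ 0 ∧ a t ≠ ∞)
    (hb0 : ∀ᵐ t ∂l, b t ≠ 0 ∧ b t ≠ ∞) {A : ℝ≥0∞} (hA : A ≠ ∞)
    (h : ∀ x, nrm s (l.restrict (Ioi x)) b
      * nrm (conjExponent r) (l.restrict (Iio x)) (fun t => (a t)⁻¹) ≤ A) :
    HardyBound r s a b l := by
  have hs := hr.trans hrs
  have hs0 : s ≠ 0 := (one_pos.trans_le hs).ne'
  rcases eq_or_ne s ∞ with rfl | hs'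
  · refine ⟨A, hA, fun F hF => nrm_top_le ?_⟩
    filter_upwards [ae_forall_rat_le_essSup_Ioi b l] with x hx
    have hm : Measurable fun t => a t * F t := measurable_mul' ha hF
    have hq : ∀ q : ℚ, (q : ℝ) < x →
        b x * ∫⁻ t in Iio (q : ℝ), F t ∂l ≤ A * nrm r l (fun t => a t * F t) := by
      intro q hq
      calc b x * ∫⁻ t in Iio (q : ℝ), F t ∂l
          ≤ nrm ∞ (l.restrict (Ioi (q : ℝ))) b
            * ∫⁻ t in Iio (q : ℝ), (a t)⁻¹ * (a t * F t) ∂l := by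
            refine mul_le_mul' (by rw [nrm_top]; exact hx q hq)
              (lintegral_mono_ae (ae_restrict_of_ae (ha0.mono fun t ht => ?_)))
            rw [← mul_assoc, ENNReal.inv_mul_cancel ht.1 ht.2, one_mul]
        _ ≤ nrm ∞ (l.restrict (Ioi (q : ℝ))) b * (nrm (conjExponent r) (l.restrict (Iio (q : ℝ)))
              (fun t => (a t)⁻¹) * nrm r (l.restrict (Iio (q : ℝ))) (fun t => a t * F t)) :=
            mul_le_mul_right (lintegral_mul_le_nrm hr ha.inv.aemeasurable hm.aemeasurable) _
        _ ≤ A * nrm r l (fun t => a t * F t) := by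
            rw [← mul_assoc]
            exact mul_le_mul' (h q) (nrm_mono_measure restrict_le_self)
    exact mul_setLIntegral_Iio_le hq
  rcases hr.eq_or_lt with rfl | hr1
  · refine ⟨A, hA, fun F hF => ?_⟩
    have hm : Measurable fun t => a t * F t := measurable_mul' ha hF
    set G : ℝ → ℝ → ℝ≥0∞ := fun t x => F t * (Ioi t).indicator b x with hG
    have hGm : Measurable (Function.uncurry G) := by
      refine measurable_mul' (hF.comp measurable_fst) ?_
      have : (fun p : ℝ × ℝ => (Ioi p.1).indicator b p.2)
          = {p : ℝ × ℝ | p.1 < p.2}.indicator fun p => b p.2 := rfl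
      rw [this]
      exact (hb.comp measurable_snd).indicator (measurableSet_lt measurable_fst measurable_snd)
    have e1 : nrm s l (fun x => b x * ∫⁻ t in Iio x, F t ∂l)
        = (∫⁻ x, (∫⁻ t, G t x ∂l) ^ s.toReal ∂l) ^ (1 / s.toReal) := by
      rw [nrm_eq hs0 hs']
      congr 2 with x
      rw [← lintegral_const_mul _ hF, ← lintegral_indicator measurableSet_Iio]
      congr 1
      refine lintegral_congr fun t => ?_
      by_cases htx : t < x
      · rw [indicator_of_mem (by exact htx), hG]
        show _ = F t * (Ioi t).indicator b x
        rw [indicator_of_mem (by exact htx), mul_comm]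
      · rw [indicator_of_notMem (by exact htx), hG]
        show _ = F t * (Ioi t).indicator b x
        rw [indicator_of_notMem (by exact htx), mul_zero]
    have e2 : ∀ t, (∫⁻ x, G t x ^ s.toReal ∂l) ^ (1 / s.toReal)
        = F t * nrm s (l.restrict (Ioi t)) b := fun t => by
      rw [← nrm_eq hs0 hs']
      show nrm s l (fun x => F t * (Ioi t).indicator b x) = _
      rw [nrm_const_mul hs0 _ (hb.indicator measurableSet_Ioi).aemeasurable]
      exact congrArg _ (eLpNorm_indicator_eq_eLpNorm_restrict measurableSet_Ioi)
    rw [e1, nrm_one, ← lintegral_const_mul _ hm]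
    refine (minkowski_lintegral hGm (one_le_toReal hs hs')).trans (lintegral_mono_ae ?_)
    filter_upwards [ha0, ae_le_essSup_Iio (fun t => (a t)⁻¹) l] with t h1 h2
    rw [e2]
    have h3 := h t
    rw [conjExponent_one, nrm_top] at h3
    calc F t * nrm s (l.restrict (Ioi t)) b
        = nrm s (l.restrict (Ioi t)) b * (a t)⁻¹ * (a t * F t) := by
          rw [mul_assoc, ← mul_assoc _ (a t), ENNReal.inv_mul_cancel h1.1 h1.2, one_mul, mul_comm]
      _ ≤ _ := mul_le_mul_left ((mul_le_mul_right h2 _).trans h3) _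
  have hr' : r ≠ ∞ := ne_top_of_le_ne_top hs' hrs
  rw [hardyBound_iff_measures hr1 hr' hs hs' ha hb ha0]
  have := withDensity_sigmaFinite_rpow (e := s.toReal) hb0
  have := withDensity_sigmaFinite_rpow (l := l) (a := fun t => (a t)⁻¹) (e := (conjExponent r).toReal)
    (ha0.mono fun t ht => ⟨ENNReal.inv_ne_zero.2 ht.2, ENNReal.inv_ne_top.2 ht.1⟩)
  have := withDensity_null (l := l) (g := fun t => (a t)⁻¹ ^ (conjExponent r).toReal)
  have hR := one_lt_toReal hr1 hr'
  refine ⟨_, mul_ne_top (hardyC_ne_top (r := r.toReal) (s := s.toReal)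
    (e := r.toReal - 1) (by linarith)) (rpow_ne_top_of_nonneg
    (toReal_nonneg (a := s)) hA), fun g hg => hardy_le hR (toReal_mono hs' hrs)
    (fun x => ?_) hg⟩
  rw [density_apply_eq_nrm hs0 hs' measurableSet_Ioi,
    density_apply_eq_nrm (b := fun t => (a t)⁻¹) conjExponent_ne_zero (conjExponent_ne_top hr1)
      measurableSet_Iio, ← rpow_mul,
    show (conjExponent r).toReal * (s.toReal * (1 - 1 / r.toReal)) = s.toReal by
      have : r.toReal - 1 ≠ 0 := by linarith
      rw [toReal_conjExponent hr1 hr']; field_simp,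
    ← mul_rpow_of_nonneg _ _ toReal_nonneg]
  exact rpow_le_rpow (h x) toReal_nonneg

/-- The quantity which characterizes the Hardy inequality for `s < r`. -/
def hardyQuant (r s : ℝ≥0∞) (a b : ℝ → ℝ≥0∞) (l : Measure ℝ) : ℝ≥0∞ :=
  nrm (rho r s) l fun x => a x ^ (-((conjExponent r).toReal * recip (rho r s))) *
    (nrm s (l.restrict (Ioi x)) b * nrm (conjExponent r) (l.restrict (Iio x)) (fun t => (a t)⁻¹)
      ^ ((conjExponent r).toReal * recip (conjExponent s)))

theorem hardyBound_iff_of_gt [SigmaFinite l] [NullSingletonClass l] (hs : 1 ≤ s) (hsr : s < r)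
    (ha : Measurable a) (hb : Measurable b) (ha0 : ∀ᵐ t ∂l, a t ≠ 0 ∧ a t ≠ ∞)
    (hb0 : ∀ᵐ t ∂l, b t ≠ 0 ∧ b t ≠ ∞) : HardyBound r s a b l ↔ hardyQuant r s a b l ≠ ∞ := by
  have hs0 : s ≠ 0 := (one_pos.trans_le hs).ne'
  have hs' := hsr.ne_top
  have hr1 := hs.trans_lt hsr
  have hS := one_le_toReal hs hs'
  have hai : Measurable fun t => (a t)⁻¹ := ha.inv
  have := withDensity_sigmaFinite_rpow (e := s.toReal) hb0
  rcases eq_or_ne r ∞ with rfl | hr'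
  · have hU : ∀ x, nrm (conjExponent ∞) (l.restrict (Iio x)) (fun t => (a t)⁻¹)
        = ∫⁻ t in Iio x, (a t)⁻¹ ∂l := fun x => by rw [conjExponent_top, nrm_one]
    have hi1 : (∫⁻ x, (∫⁻ t in Iio x, (a t)⁻¹ ∂l) ^ s.toReal ∂(l.withDensity fun t => b t ^ s.toReal))
        = ofReal s.toReal * hardyQuant ∞ s a b l ^ s.toReal := by
      have := withDensity_sigmaFinite_rpow (l := l) (a := fun t => (a t)⁻¹) (e := 1)
        (ha0.mono fun t ht => ⟨ENNReal.inv_ne_zero.2 ht.2, ENNReal.inv_ne_top.2 ht.1⟩)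
      rw [lintegral_lintegral_Iio_rpow hai hS, hardyQuant, rho_top_left, nrm_rpow hs0 hs']
      congr 1
      refine lintegral_congr fun t => ?_
      rw [density_apply_eq_nrm hs0 hs' measurableSet_Ioi, hU, mul_rpow_of_nonneg _ _ (by linarith),
        mul_rpow_of_nonneg _ _ (by linarith), ← rpow_mul, ← rpow_mul,
        conjExponent_top, toReal_one, one_mul, one_mul, recip_conjExponent hs, recip_eq,
        show -(1 / s.toReal) * s.toReal = -1 by field_simp, rpow_neg_one,
        show (1 - 1 / s.toReal) * s.toReal = s.toReal - 1 by field_simp]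
      ring
    have hi2 := nrm_rpow_density (l := l) hs0 hs' hb (measurable_lintegral_Iio (μ := l) fun t => (a t)⁻¹)
    rw [hi1] at hi2
    constructor
    · rintro ⟨C, hC, h⟩ htop
      have h1 := h _ hai
      have h2 : nrm ∞ l (fun t => a t * (a t)⁻¹) ≤ 1 := nrm_top_le (ha0.mono fun t ht =>
        (ENNReal.mul_inv_cancel ht.1 ht.2).le)
      rw [htop, top_rpow_of_pos (by linarith), mul_top (by simp; linarith)] at hi2
      refine rpow_ne_top_of_nonneg (y := s.toReal) (by linarith)
        (ne_top_of_le_ne_top hC (h1.trans ((mul_le_mul_right h2 _).trans (mul_one C).le))) hi2.symm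
    · intro hQ
      refine ⟨nrm s l fun x => b x * ∫⁻ t in Iio x, (a t)⁻¹ ∂l, fun htop => ?_, fun F hF => ?_⟩
      · rw [htop, top_rpow_of_pos (by linarith)] at hi2
        exact mul_ne_top ofReal_ne_top (rpow_ne_top_of_nonneg (by linarith) hQ) hi2
      · rw [mul_comm, ← nrm_const_mul hs0 _ (measurable_mul' hb (measurable_lintegral_Iio _)).aemeasurable]
        refine nrm_mono (ae_of_all _ fun x => ?_)
        rw [mul_left_comm, ← lintegral_const_mul _ hai]
        refine mul_le_mul_right (lintegral_mono_ae (ae_restrict_of_ae ?_)) _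
        filter_upwards [ha0, ae_le_nrm_top (m := l) (F := fun t => a t * F t)] with t h1 h2
        calc F t = a t * F t * (a t)⁻¹ := by
              rw [mul_comm (a t), mul_assoc, ENNReal.mul_inv_cancel h1.1 h1.2, mul_one]
          _ ≤ _ := mul_le_mul_left h2 _
  rw [hardyBound_iff_measures hr1 hr' hs hs' ha hb ha0]
  have := withDensity_sigmaFinite_rpow (l := l) (a := fun t => (a t)⁻¹) (e := (conjExponent r).toReal)
    (ha0.mono fun t ht => ⟨ENNReal.inv_ne_zero.2 ht.2, ENNReal.inv_ne_top.2 ht.1⟩)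
  have := withDensity_null (l := l) (g := fun t => (a t)⁻¹ ^ (conjExponent r).toReal)
  have := withDensity_null (l := l) (g := fun t => b t ^ s.toReal)
  have hSR := (toReal_lt_toReal hs' hr').2 hsr
  set R := r.toReal with hRdef
  set S := s.toReal with hSdef
  have hRS : 0 < R - S := by linarith
  have hrho : (rho r s).toReal = R * S / (R - S) := toReal_rho hs hsr hr'
  have hS0 : 0 < S := by linarith
  have hR0 : 0 < R := by linarith
  have hQ : ∫⁻ t, (l.withDensity fun t => b t ^ S) (Ioi t) ^ (R / (R - S))
      * (l.withDensity fun t => (a t)⁻¹ ^ (conjExponent r).toReal) (Iio t) ^ (R / (R - S) * (S - 1))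
        ∂(l.withDensity fun t => (a t)⁻¹ ^ (conjExponent r).toReal)
      = hardyQuant r s a b l ^ (rho r s).toReal := by
    rw [hardyQuant, nrm_rpow (rho_ne_zero hs) (rho_ne_top hsr), lintegral_density (hai.pow_const _)
      (measurable_mul' (measurable_measure_Ioi.pow_const _) (measurable_measure_Iio.pow_const _))]
    refine lintegral_congr fun t => ?_
    rw [density_apply_eq_nrm hs0 hs' measurableSet_Ioi,
      density_apply_eq_nrm (b := fun t => (a t)⁻¹) conjExponent_ne_zero (conjExponent_ne_top hr1)
      measurableSet_Iio, mul_rpow_of_nonneg _ _ toReal_nonneg,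
      mul_rpow_of_nonneg _ _ toReal_nonneg, ← rpow_mul, ← rpow_mul,
      ← rpow_mul, ← rpow_mul, recip_conjExponent hs, recip_eq, recip_eq, inv_rpow,
      ← rpow_neg, hrho]
    congr 2
    · field_simp
    · rw [← hSdef]; field_simp
    · rw [← hSdef]; field_simp
  have hrp : 0 < (rho r s).toReal := by rw [hrho]; positivity
  have hiff : hardyQuant r s a b l ≠ ∞ ↔ hardyQuant r s a b l ^ (rho r s).toReal ≠ ∞ := by
    rw [Ne, Ne, ENNReal.rpow_eq_top_iff_of_pos hrp]
  rw [hiff, ← hQ]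
  constructor
  · rintro ⟨C, hC, h⟩ htop
    have := hardy_necessary hS hSR h
    rw [htop, top_rpow_of_pos (by positivity), top_le_iff] at this
    exact mul_ne_top (mul_ne_top ofReal_ne_top
      (rpow_ne_top_of_nonneg (by linarith) ofReal_ne_top)) hC this
  · intro h
    exact ⟨_, mul_ne_top (hardyC_ne_top (r := R) (s := S) (e := S - 1) (by linarith))
      (rpow_ne_top_of_nonneg (by positivity) h), fun g hg => hardy_gt hS hSR hg⟩

end Hardy

/-! ### Hardy inequalities with power weights -/

section PowerHardy

variable {γ : ℝ} {s : ℝ≥0∞} {a G : ℝ → ℝ≥0∞} {J : Set ℝ}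

/-- The kernel `(y/u)^γ` on `0 < y < u`. -/
def powKernel (γ y u : ℝ) : ℝ≥0∞ :=
  {p : ℝ × ℝ | 0 < p.1 ∧ p.1 < p.2}.indicator (fun p => pow γ p.1 * pow (-γ) p.2) (y, u)

lemma measurable_powKernel (γ : ℝ) : Measurable (Function.uncurry (powKernel γ)) :=
  (measurable_mul' ((measurable_pow γ).comp measurable_fst)
    ((measurable_pow (-γ)).comp measurable_snd)).indicator
    ((measurableSet_lt measurable_const measurable_fst).inter
      (measurableSet_lt measurable_fst measurable_snd))

lemma powKernel_of_lt {y u : ℝ} (hy : 0 < y) (hyu : y < u) :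
    powKernel γ y u = pow γ y * pow (-γ) u := indicator_of_mem (by exact ⟨hy, hyu⟩) _

lemma lintegral_powKernel_right (hγ : 0 < γ) (y : ℝ) :
    ∫⁻ u, powKernel γ y u ∂haar ≤ ofReal γ⁻¹ := by
  rcases le_or_gt y 0 with hy | hy
  · have : ∀ u, powKernel γ y u = 0 := fun u => indicator_of_notMem (fun h => hy.not_gt h.1) _
    simp [this]
  have : ∀ u, powKernel γ y u = (Ioi y).indicator (fun u => pow γ y * pow (-γ) u) u := fun u => by
    by_cases h : y < u
    · rw [powKernel_of_lt hy h, indicator_of_mem (by exact h)]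
    · rw [indicator_of_notMem (by exact h)]; exact indicator_of_notMem (fun h' => h h'.2) _
  simp_rw [this]
  rw [lintegral_indicator measurableSet_Ioi, lintegral_const_mul _ (measurable_pow _),
    setLIntegral_Ioi_pow hγ hy, mul_left_comm, pow_mul_neg hy, mul_one]

lemma lintegral_powKernel_left (hγ : 0 < γ) (u : ℝ) : ∫⁻ y, powKernel γ y u ∂haar ≤ ofReal γ⁻¹ := by
  rcases le_or_gt u 0 with hu | hu
  · have : ∀ y, powKernel γ y u = 0 := fun y =>
      indicator_of_notMem (fun h => hu.not_gt (h.1.trans h.2)) _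
    simp [this]
  have : ∀ y, powKernel γ y u ≤ (Iio u).indicator (fun y => pow (-γ) u * pow γ y) y := fun y => by
    by_cases h : 0 < y ∧ y < u
    · rw [powKernel_of_lt h.1 h.2, indicator_of_mem (by exact h.2), mul_comm]
    · rw [powKernel, indicator_of_notMem (by exact h)]; exact zero_le
  refine (lintegral_mono this).trans ?_
  rw [lintegral_indicator measurableSet_Iio, lintegral_const_mul _ (measurable_pow _),
    setLIntegral_Iio_pow hγ hu, mul_left_comm, mul_comm (pow _ _), pow_mul_neg hu, mul_one]

lemma ae_haar_restrict_pos : ∀ᵐ t ∂(haar.restrict J), 0 < t :=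
  ae_restrict_of_ae haar_Ioi_zero_compl

lemma Regular.ae (ha : Regular a) : ∀ᵐ t ∂(haar.restrict J), a t ≠ 0 ∧ a t ≠ ∞ :=
  ae_haar_restrict_pos.mono fun t ht => ⟨ha.ne_zero t ht, ha.ne_top t ht⟩

theorem Regular.hardy_Ioi (ha : Regular a) (hγ : 0 < γ) :
    ∃ C : ℝ≥0∞, C ≠ ∞ ∧ ∀ J : Set ℝ, ∀ s : ℝ≥0∞, 1 ≤ s → ∀ G : ℝ → ℝ≥0∞, Measurable G →
      nrm s (haar.restrict J) (fun y => a y * (pow γ y * ∫⁻ u in Ioi y, pow (-γ) u * G u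
        ∂(haar.restrict J))) ≤ C * nrm s (haar.restrict J) (fun y => a y * G y) := by
  obtain ⟨C, hC⟩ := ha.bound (γ / 2) (by positivity)
  refine ⟨ofReal (γ / 2)⁻¹ * C, mul_ne_top ofReal_ne_top coe_ne_top,
    fun J s hs G hG => ?_⟩
  have hs0 : s ≠ 0 := (one_pos.trans_le hs).ne'
  have hm : Measurable fun y => a y * G y := measurable_mul' ha.measurable hG
  have hmG : Measurable fun u => pow (-γ) u * G u := measurable_mul' (measurable_pow _) hG
  have hle : ∀ φ : ℝ → ℝ≥0∞, ∫⁻ u, φ u ∂(haar.restrict J) ≤ ∫⁻ u, φ u ∂haar :=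
    fun φ => lintegral_mono' restrict_le_self le_rfl
  have key := nrm_schur_le (m := haar.restrict J) (measurable_powKernel (γ / 2))
    (fun y => (hle _).trans (lintegral_powKernel_right (by positivity) y))
    (fun u => (hle _).trans (lintegral_powKernel_left (by positivity) u)) hs (hm.const_mul (C : ℝ≥0∞))
  rw [nrm_const_mul hs0 _ hm.aemeasurable, ← mul_assoc] at key
  refine (nrm_mono ?_).trans key
  filter_upwards [ae_haar_restrict_pos] with y hy
  rw [← lintegral_const_mul _ hmG, ← lintegral_const_mul _ (hmG.const_mul _),
    ← lintegral_indicator measurableSet_Ioi]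
  refine lintegral_mono fun u => ?_
  by_cases hyu : y < u
  · have hu := hy.trans hyu
    rw [indicator_of_mem (by exact hyu), powKernel_of_lt hy hyu]
    calc a y * (pow γ y * (pow (-γ) u * G u))
        ≤ C * pow (γ / 2) (u / y) * a u * (pow γ y * (pow (-γ) u * G u)) :=
          mul_le_mul_left (hC y u hy hyu.le).2 _
      _ = C * (pow (γ / 2) u * pow (-γ) u) * (pow (-(γ / 2)) y * pow γ y) * (a u * G u) := by
          rw [pow_div hy hu]; ring
      _ = _ := by
          rw [pow_add hu, pow_add hy, show γ / 2 + -γ = -(γ / 2) by ring,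
            show -(γ / 2) + γ = γ / 2 by ring]
          ring
  · rw [indicator_of_notMem (by exact hyu)]; exact zero_le

theorem Regular.hardy_Iio (ha : Regular a) (hγ : 0 < γ) :
    ∃ C : ℝ≥0∞, C ≠ ∞ ∧ ∀ J : Set ℝ, ∀ s : ℝ≥0∞, 1 ≤ s → ∀ G : ℝ → ℝ≥0∞, Measurable G →
      nrm s (haar.restrict J) (fun y => a y * (pow (-γ) y * ∫⁻ u in Iio y, pow γ u * G u
        ∂(haar.restrict J))) ≤ C * nrm s (haar.restrict J) (fun y => a y * G y) := by
  obtain ⟨C, hC⟩ := ha.bound (γ / 2) (by positivity)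
  refine ⟨ofReal (γ / 2)⁻¹ * C, mul_ne_top ofReal_ne_top coe_ne_top,
    fun J s hs G hG => ?_⟩
  have hs0 : s ≠ 0 := (one_pos.trans_le hs).ne'
  have hm : Measurable fun y => a y * G y := measurable_mul' ha.measurable hG
  have hmG : Measurable fun u => pow γ u * G u := measurable_mul' (measurable_pow _) hG
  have hle : ∀ φ : ℝ → ℝ≥0∞, ∫⁻ u, φ u ∂(haar.restrict J) ≤ ∫⁻ u, φ u ∂haar :=
    fun φ => lintegral_mono' restrict_le_self le_rfl
  have key := nrm_schur_le (m := haar.restrict J) (k := fun y u => powKernel (γ / 2) u y)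
    ((measurable_powKernel (γ / 2)).comp measurable_swap)
    (fun y => (hle _).trans (lintegral_powKernel_left (by positivity) y))
    (fun u => (hle _).trans (lintegral_powKernel_right (by positivity) u)) hs
    (hm.const_mul (C : ℝ≥0∞))
  rw [nrm_const_mul hs0 _ hm.aemeasurable, ← mul_assoc] at key
  refine (nrm_mono ?_).trans key
  filter_upwards [ae_haar_restrict_pos] with y hy
  rw [← lintegral_const_mul _ hmG, ← lintegral_const_mul _ (hmG.const_mul _),
    ← lintegral_indicator measurableSet_Iio]
  refine lintegral_mono_ae ?_
  filter_upwards [ae_haar_restrict_pos] with u hu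
  by_cases hyu : u < y
  · rw [indicator_of_mem (by exact hyu), powKernel_of_lt hu hyu]
    calc a y * (pow (-γ) y * (pow γ u * G u))
        ≤ C * pow (γ / 2) (y / u) * a u * (pow (-γ) y * (pow γ u * G u)) :=
          mul_le_mul_left (hC u y hu hyu.le).1 _
      _ = C * (pow (γ / 2) y * pow (-γ) y) * (pow (-(γ / 2)) u * pow γ u) * (a u * G u) := by
          rw [pow_div hu hy]; ring
      _ = _ := by
          rw [pow_add hu, pow_add hy, show γ / 2 + -γ = -(γ / 2) by ring,
            show -(γ / 2) + γ = γ / 2 by ring]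
          ring
  · rw [indicator_of_notMem (by exact hyu)]; exact zero_le

lemma nrm_ne_top_of_le_pow {l : Measure ℝ} (hs0 : s ≠ 0) {e : ℝ} {c : ℝ≥0∞} (hc : c ≠ ∞)
    {F : ℝ → ℝ≥0∞} (h : ∀ᵐ t ∂l, F t ≤ c * pow e t) (hb : ∀ᵐ t ∂l, pow e t ≤ 1)
    (hi : ∀ p : ℝ, 0 < p → ∫⁻ t, pow (e * p) t ∂l ≠ ∞) : nrm s l F ≠ ∞ := by
  refine ne_top_of_le_ne_top ?_ (nrm_mono h)
  rw [nrm_const_mul hs0 _ (measurable_pow _).aemeasurable]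
  refine mul_ne_top hc ?_
  rcases eq_or_ne s ∞ with rfl | hs
  · exact ne_top_of_le_ne_top one_ne_top (nrm_top_le hb)
  · rw [nrm_eq hs0 hs]
    simp_rw [pow_rpow]
    exact rpow_ne_top_of_nonneg (by positivity) (hi _ (toReal_pos hs0 hs))

lemma Regular.nrm_pow_Ioi_ne_top (ha : Regular a) (hγ : 0 < γ) (hs0 : s ≠ 0) :
    nrm s (haar.restrict (Ioi 1)) (fun t => pow (-γ) t * a t) ≠ ∞ := by
  obtain ⟨C, hC⟩ := ha.bound (γ / 2) (by positivity)
  refine nrm_ne_top_of_le_pow hs0 (e := -(γ / 2)) (mul_ne_top coe_ne_top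
    (ha.ne_top 1 one_pos)) (c := C * a 1) ?_ ?_ fun p hp => ?_
  · filter_upwards [ae_restrict_mem measurableSet_Ioi] with t ht
    have ht0 : 0 < t := one_pos.trans ht
    have := (hC 1 t one_pos (le_of_lt ht)).1
    rw [div_one] at this
    calc pow (-γ) t * a t ≤ pow (-γ) t * (C * pow (γ / 2) t * a 1) := by gcongr
      _ = C * a 1 * (pow (-γ) t * pow (γ / 2) t) := by ring
      _ = _ := by rw [pow_add ht0]; congr 2; ring
  · filter_upwards [ae_restrict_mem measurableSet_Ioi] with t ht
    rw [pow_eq_ofReal (one_pos.trans ht)]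
    exact ENNReal.ofReal_le_one.2 (Real.rpow_le_one_of_one_le_of_nonpos (le_of_lt ht) (by linarith))
  · rw [neg_mul, setLIntegral_Ioi_pow (by positivity) one_pos]
    exact mul_ne_top ofReal_ne_top (pow_ne_top one_pos)

lemma Regular.nrm_pow_Ioo_ne_top (ha : Regular a) (hγ : 0 < γ) (hs0 : s ≠ 0) :
    nrm s (haar.restrict (Ioo 0 1)) (fun t => pow γ t * a t) ≠ ∞ := by
  obtain ⟨C, hC⟩ := ha.bound (γ / 2) (by positivity)
  refine nrm_ne_top_of_le_pow hs0 (e := γ / 2) (mul_ne_top coe_ne_top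
    (ha.ne_top 1 one_pos)) (c := C * a 1) ?_ ?_ fun p hp => ?_
  · filter_upwards [ae_restrict_mem measurableSet_Ioo] with t ht
    have := (hC t 1 ht.1 ht.2.le).2
    rw [pow_div ht.1 one_pos] at this
    calc pow γ t * a t ≤ pow γ t * (C * (pow (γ / 2) 1 * pow (-(γ / 2)) t) * a 1) := by gcongr
      _ = C * a 1 * (pow γ t * pow (-(γ / 2)) t) := by simp only [pow, ofReal_one, one_rpow]; ring
      _ = _ := by rw [pow_add ht.1]; congr 2; ring
  · filter_upwards [ae_restrict_mem measurableSet_Ioo] with t ht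
    rw [pow_eq_ofReal ht.1]
    exact ENNReal.ofReal_le_one.2 (Real.rpow_le_one ht.1.le ht.2.le (by linarith))
  · refine ne_top_of_le_ne_top ?_ (lintegral_mono_set (Ioo_subset_Iio_self))
    rw [setLIntegral_Iio_pow (by positivity) one_pos]
    exact mul_ne_top ofReal_ne_top (pow_ne_top one_pos)

lemma nrm_const_ne_top {l : Measure ℝ} {F : ℝ → ℝ≥0∞} {c : ℝ≥0∞} (hs0 : s ≠ 0) (hl : l univ ≠ ∞)
    (hc : c ≠ ∞) (h : ∀ᵐ t ∂l, F t ≤ c) : nrm s l F ≠ ∞ := by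
  refine ne_top_of_le_ne_top ?_ (nrm_mono h)
  rcases eq_or_ne s ∞ with rfl | hs
  · exact ne_top_of_le_ne_top hc (nrm_top_le (ae_of_all _ fun _ => le_rfl))
  · rw [nrm_eq hs0 hs, lintegral_const]
    exact rpow_ne_top_of_nonneg (by positivity) (mul_ne_top
      (rpow_ne_top_of_nonneg toReal_nonneg hc) hl)

lemma Regular.nrm_Ioo_ne_top (ha : Regular a) {c d : ℝ} (hc : 0 < c) (hs0 : s ≠ 0) :
    nrm s (haar.restrict (Ioo c d)) a ≠ ∞ := by
  rcases le_or_gt d c with h | h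
  · rw [Ioo_eq_empty h.not_gt, Measure.restrict_empty]
    simp [nrm]
  obtain ⟨C, hC, hle⟩ := ha.exists_le_on (d := d) hc
  refine nrm_const_ne_top hs0 ?_ hC ((ae_restrict_mem measurableSet_Ioo).mono fun t ht =>
    hle t ⟨ht.1.le, ht.2.le⟩)
  rw [restrict_apply_univ, haar_Ioo hc (hc.trans h)]
  exact ofReal_ne_top

lemma nrm_pos_of_Ioo_subset {F : ℝ → ℝ≥0∞} {c d : ℝ} (hs0 : s ≠ 0) (hc : 0 < c) (hcd : c < d)
    (hJ : Ioo c d ⊆ J) (hF : Measurable F) (h0 : ∀ t ∈ Ioo c d, F t ≠ 0) :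
    nrm s (haar.restrict J) F ≠ 0 := by
  intro h
  have h1 : nrm s (haar.restrict (Ioo c d)) F = 0 :=
    le_zero_iff.1 ((nrm_mono_measure (restrict_mono_set _ hJ)).trans h.le)
  have h2 := (eLpNorm_eq_zero_iff hF.aestronglyMeasurable hs0).1 h1
  have h3 : ∀ᵐ t ∂(haar.restrict (Ioo c d)), False := by
    filter_upwards [h2, ae_restrict_mem measurableSet_Ioo] with t ht ht'
    exact h0 t ht' ht
  rw [ae_iff, show {a : ℝ | ¬False} = univ by simp, restrict_apply_univ,
    haar_Ioo hc (hc.trans hcd), ofReal_eq_zero] at h3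
  exact absurd h3 (not_le.2 (Real.log_pos ((one_lt_div hc).2 hcd)))

end PowerHardy

/-! ### The quantity `L` -/

section QuantL

variable {r s : ℝ≥0∞} {a b : ℝ → ℝ≥0∞} {I : Set ℝ}

lemma lp_inter_Ioi (hI : MeasurableSet I) (hI0 : I ⊆ Ioi 0) (hs0 : s ≠ 0) (x : ℝ) :
    lp s (I ∩ Ioi x) (fun t => pow (-recip s) t * b t) = nrm s ((haar.restrict I).restrict (Ioi x)) b := by
  rw [lp_eq_nrm (hI.inter measurableSet_Ioi) (inter_subset_left.trans hI0) hs0,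
    restrict_restrict measurableSet_Ioi, inter_comm]

lemma lp_inter_Iio (hI : MeasurableSet I) (hI0 : I ⊆ Ioi 0) (hs0 : s ≠ 0) (x : ℝ) :
    lp s (I ∩ Iio x) (fun t => pow (-recip s) t * b t) = nrm s ((haar.restrict I).restrict (Iio x)) b := by
  rw [lp_eq_nrm (hI.inter measurableSet_Iio) (inter_subset_left.trans hI0) hs0,
    restrict_restrict measurableSet_Iio, inter_comm]

lemma nrm_restrict_Ioi_eq_zero {x : ℝ} (h : ∀ t ∈ I, t ≤ x) :
    nrm s ((haar.restrict I).restrict (Ioi x)) b = 0 := by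
  rw [restrict_restrict measurableSet_Ioi, show Ioi x ∩ I = ∅ from
    eq_empty_of_forall_notMem fun t ht => (h t ht.2).not_gt ht.1]
  simp [nrm]

lemma nrm_restrict_Iio_eq_zero {x : ℝ} (h : ∀ t ∈ I, x ≤ t) :
    nrm s ((haar.restrict I).restrict (Iio x)) b = 0 := by
  rw [restrict_restrict measurableSet_Iio, show Iio x ∩ I = ∅ from
    eq_empty_of_forall_notMem fun t ht => (h t ht.2).not_gt ht.1]
  simp [nrm]

lemma OrdConnected.forall_le_or (hI : I.OrdConnected) {x : ℝ} (hx : x ∉ I) :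
    (∀ t ∈ I, t ≤ x) ∨ ∀ t ∈ I, x ≤ t := by
  by_contra! h
  obtain ⟨⟨t, ht, h1⟩, u, hu, h2⟩ := h
  exact hx (hI.out hu ht ⟨h2.le, h1.le⟩)

theorem hardyBound_iff_quantL (hI : MeasurableSet I) (hI0 : I ⊆ Ioi 0) (hIc : I.OrdConnected)
    (hr : 1 ≤ r) (hs : 1 ≤ s) (ha : Regular a) (hb : Regular b) :
    HardyBound r s a b (haar.restrict I) ↔ quantL r s a b I ≠ ∞ := by
  have hs0 : s ≠ 0 := (one_pos.trans_le hs).ne'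
  rw [quantL]
  dsimp only
  simp_rw [lp_inter_Ioi hI hI0 hs0, lp_inter_Iio hI hI0 conjExponent_ne_zero]
  split_ifs with hrs
  · constructor
    · rintro ⟨C, hC, h⟩
      exact ne_top_of_le_ne_top hC (iSup₂_le fun x _ =>
        HardyBound.tail_mul_head_le hr hs ha.measurable hb.measurable ha.ae h x)
    · intro h
      refine hardyBound_of_le hr hrs ha.measurable hb.measurable ha.ae hb.ae h fun x => ?_
      by_cases hx : x ∈ I
      · exact le_iSup₂ (f := fun x (_ : x ∈ I) => nrm s ((haar.restrict I).restrict (Ioi x)) b *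
          nrm (conjExponent r) ((haar.restrict I).restrict (Iio x)) fun t => (a t)⁻¹) x hx
      · rcases OrdConnected.forall_le_or hIc hx with h' | h'
        · rw [nrm_restrict_Ioi_eq_zero h', zero_mul]; exact zero_le
        · rw [nrm_restrict_Iio_eq_zero h', mul_zero]; exact zero_le
  · rw [hardyBound_iff_of_gt hs (not_le.1 hrs) ha.measurable hb.measurable ha.ae hb.ae, hardyQuant]
    simp_rw [mul_assoc (pow _ _)]
    rw [lp_eq_nrm hI hI0 (rho_ne_zero hs)]

end QuantL

/-! ### The weighted inequality for decreasing functions -/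

section Decreasing

/-- The inequality for `∫_{t>x}` restricted to decreasing functions. -/
def DecBound (r s : ℝ≥0∞) (a b : ℝ → ℝ≥0∞) (l : Measure ℝ) : Prop :=
  ∃ C : ℝ≥0∞, C ≠ ∞ ∧ ∀ f : ℝ → ℝ≥0∞, Antitone f →
    nrm s l (fun x => b x * ∫⁻ t in Ioi x, f t ∂l) ≤ C * nrm r l (fun t => a t * f t)

/-- The norm of `b(ξ) l(ξ,z)` over `ξ < z`. -/
def kerHead (s : ℝ≥0∞) (b : ℝ → ℝ≥0∞) (l : Measure ℝ) (z : ℝ) : ℝ≥0∞ :=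
  nrm s (l.restrict (Iio z)) fun ξ => b ξ * l (Ioo ξ z)

/-- The dual norm of `a(u)^{r/r'} V(u)^{-1} l(x,u)` over `u > x`. -/
def kerTail (r : ℝ≥0∞) (a : ℝ → ℝ≥0∞) (l : Measure ℝ) (x : ℝ) : ℝ≥0∞ :=
  nrm (conjExponent r) (l.restrict (Ioi x)) fun u =>
    a u ^ (r.toReal * recip (conjExponent r)) *
      ((l.withDensity fun t => a t ^ r.toReal) (Iio u))⁻¹ * l (Ioo x u)

/-- The measure `w^p l`. -/
def wMeasure (p : ℝ≥0∞) (w : ℝ → ℝ≥0∞) (l : Measure ℝ) : Measure ℝ :=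
  l.withDensity fun t => w t ^ p.toReal

variable {l : Measure ℝ} {r s : ℝ≥0∞} {a b : ℝ → ℝ≥0∞}

instance [NullSingletonClass l] : NullSingletonClass (wMeasure r a l) := withDensity_null

lemma wMeasure_sigmaFinite [SigmaFinite l] (ha0 : ∀ᵐ t ∂l, a t ≠ 0 ∧ a t ≠ ∞) :
    SigmaFinite (wMeasure r a l) := withDensity_sigmaFinite_rpow ha0

lemma decBound_iff_measures (hr0 : r ≠ 0) (hr' : r ≠ ∞) (hs0 : s ≠ 0) (hs' : s ≠ ∞)
    (ha : Measurable a) (hb : Measurable b) :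
    DecBound r s a b l ↔ ∃ C : ℝ≥0∞, C ≠ ∞ ∧ ∀ f : ℝ → ℝ≥0∞, Antitone f →
      ∫⁻ x, (∫⁻ z in Ioi x, f z ∂l) ^ s.toReal ∂(wMeasure s b l)
        ≤ C * (∫⁻ z, f z ^ r.toReal ∂(wMeasure r a l)) ^ (s.toReal / r.toReal) := by
  have hS := toReal_pos hs0 hs'
  have key : ∀ f : ℝ → ℝ≥0∞, Antitone f →
      ∫⁻ x, (∫⁻ z in Ioi x, f z ∂l) ^ s.toReal ∂(wMeasure s b l)
        = nrm s l (fun x => b x * ∫⁻ t in Ioi x, f t ∂l) ^ s.toReal ∧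
      (∫⁻ z, f z ^ r.toReal ∂(wMeasure r a l)) ^ (s.toReal / r.toReal)
        = nrm r l (fun t => a t * f t) ^ s.toReal := fun f hf => by
    constructor
    · exact nrm_rpow_density hs0 hs' hb (measurable_lintegral_Ioi _)
    · rw [wMeasure, nrm_rpow_density hr0 hr' ha hf.measurable, ← rpow_mul,
        mul_div_cancel₀ _ (toReal_pos hr0 hr').ne']
  constructor
  · rintro ⟨C, hC, h⟩
    refine ⟨C ^ s.toReal, rpow_ne_top_of_nonneg hS.le hC, fun f hf => ?_⟩
    rw [(key f hf).1, (key f hf).2, ← mul_rpow_of_nonneg _ _ hS.le]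
    exact rpow_le_rpow (h f hf) hS.le
  · rintro ⟨C, hC, h⟩
    refine ⟨C ^ (1 / s.toReal), rpow_ne_top_of_nonneg (by positivity) hC, fun f hf => ?_⟩
    have h' := h f hf
    rw [(key f hf).1, (key f hf).2, ← ENNReal.rpow_le_rpow_iff (z := 1 / s.toReal) (by positivity),
      mul_rpow_of_nonneg _ _ (by positivity), ← rpow_mul, ← rpow_mul,
      mul_one_div_cancel hS.ne', rpow_one, rpow_one] at h'
    exact h'

variable [SigmaFinite l] [NullSingletonClass l]

lemma kerHead_rpow (hs0 : s ≠ 0) (hs' : s ≠ ∞) (hb : Measurable b) (z : ℝ) :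
    ∫⁻ ξ in Iio z, l (Ioo ξ z) ^ s.toReal ∂(wMeasure s b l) = kerHead s b l z ^ s.toReal := by
  have hm : Measurable fun ξ => l (Ioo ξ z) := measurable_kernel_left z
  rw [kerHead, wMeasure, restrict_withDensity measurableSet_Iio, ← nrm_rpow_density hs0 hs' hb hm]

lemma wMeasure_Iio (hr0 : r ≠ 0) (hr' : r ≠ ∞) (z : ℝ) :
    wMeasure r a l (Iio z) = nrm r (l.restrict (Iio z)) a ^ r.toReal :=
  density_apply_eq_nrm hr0 hr' measurableSet_Iio

lemma kerTail_eq (hr1 : 1 < r) (hr' : r ≠ ∞) (ha : Measurable a) (x : ℝ) :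
    kerTail r a l x = (∫⁻ u in Ioi x, l (Ioo x u) ^ (r.toReal / (r.toReal - 1))
      ∂(tailWeight (wMeasure r a l) (r.toReal / (r.toReal - 1)))) ^ (1 - 1 / r.toReal) := by
  have hm : Measurable fun u => l (Ioo x u) := measurable_kernel_right x
  have hR := one_lt_toReal hr1 hr'
  have hR1 : r.toReal - 1 ≠ 0 := by linarith
  rw [setLIntegral_tailWeight (hm.pow_const _) measurableSet_Ioi, wMeasure, setLIntegral_density
    (ha.pow_const _) (measurable_mul' (measurable_measure_Iio_rpow _) (hm.pow_const _))
    measurableSet_Ioi, kerTail, nrm_eq conjExponent_ne_zero (conjExponent_ne_top hr1),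
    ← recip_eq (conjExponent r), recip_conjExponent hr1.le, recip_eq, toReal_conjExponent hr1 hr']
  congr 1
  refine lintegral_congr fun u => ?_
  have hp : 0 ≤ r.toReal / (r.toReal - 1) := div_nonneg (by linarith) (by linarith)
  rw [mul_rpow_of_nonneg _ _ hp, mul_rpow_of_nonneg _ _ hp, ← rpow_mul,
    inv_rpow, ← rpow_neg, mul_assoc]
  congr 2
  field_simp

/-! ### Necessity -/

lemma DecBound.kerHead_le {C : ℝ≥0∞} (h : ∀ f : ℝ → ℝ≥0∞, Antitone f →
      nrm s l (fun x => b x * ∫⁻ t in Ioi x, f t ∂l) ≤ C * nrm r l (fun t => a t * f t)) (z : ℝ) :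
    kerHead s b l z ≤ C * nrm r (l.restrict (Iio z)) a := by
  have hf : Antitone ((Iio z).indicator (1 : ℝ → ℝ≥0∞)) := fun x y hxy => by
    by_cases hy : y < z
    · rw [indicator_of_mem (by exact hy), indicator_of_mem (by exact hxy.trans_lt hy)]; rfl
    · rw [indicator_of_notMem (by exact hy)]; exact zero_le
  have e1 : ∀ x, ∫⁻ t in Ioi x, (Iio z).indicator (1 : ℝ → ℝ≥0∞) t ∂l = l (Ioo x z) := fun x => by
    rw [lintegral_indicator_one measurableSet_Iio, Measure.restrict_apply measurableSet_Iio,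
      Iio_inter_Ioi]
  have e2 : nrm r l (fun t => a t * (Iio z).indicator (1 : ℝ → ℝ≥0∞) t)
      = nrm r (l.restrict (Iio z)) a := by
    rw [nrm, nrm, ← eLpNorm_indicator_eq_eLpNorm_restrict measurableSet_Iio]
    congr 1 with t
    by_cases ht : t < z
    · rw [indicator_of_mem (by exact ht), indicator_of_mem (by exact ht)]; exact mul_one _
    · rw [indicator_of_notMem (by exact ht), indicator_of_notMem (by exact ht), mul_zero]
  have h' := h _ hf
  simp_rw [e1] at h'
  rw [e2] at h'
  exact (nrm_mono_measure restrict_le_self).trans h'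

lemma DecBound.exists_kerTail_le (hr1 : 1 < r) (hr' : r ≠ ∞)
    (hs0 : s ≠ 0) (ha : Measurable a) (hb : Measurable b) (ha0 : ∀ᵐ t ∂l, a t ≠ 0 ∧ a t ≠ ∞)
    (hV : ∀ z, nrm r (l.restrict (Iio z)) a ≠ ∞) (h : DecBound r s a b l) :
    ∃ A : ℝ≥0∞, A ≠ ∞ ∧ ∀ x, nrm s (l.restrict (Iio x)) b * kerTail r a l x ≤ A := by
  obtain ⟨C, hC, h⟩ := h
  have hr0 : r ≠ 0 := (one_pos.trans hr1).ne'
  have := wMeasure_sigmaFinite (r := r) ha0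
  obtain ⟨K, hK, hKx⟩ := decreasing_necessary_pointwise (l := l) (ν := wMeasure r a l) (fun z => by
    rw [wMeasure_Iio hr0 hr']; exact rpow_ne_top_of_nonneg toReal_nonneg (hV z))
    (one_lt_toReal hr1 hr')
  refine ⟨C * K, mul_ne_top hC hK, fun x => ?_⟩
  rw [kerTail_eq hr1 hr' ha]
  refine hKx x _ C fun f hf => ?_
  have e : (∫⁻ z, f z ^ r.toReal ∂(wMeasure r a l)) ^ (1 / r.toReal) = nrm r l (fun t => a t * f t) := by
    have := toReal_pos hr0 hr'
    rw [wMeasure, nrm_rpow_density hr0 hr' ha hf.measurable, ← rpow_mul,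
      mul_one_div_cancel this.ne', rpow_one]
  rw [e, mul_comm, ← nrm_const_mul hs0 _ hb.aemeasurable]
  refine le_trans ?_ (h f hf)
  refine le_trans (nrm_mono ?_) (nrm_mono_measure (m := l.restrict (Iio x)) restrict_le_self)
  filter_upwards [ae_restrict_mem measurableSet_Iio] with y hy
  rw [mul_comm]
  exact mul_le_mul_right (lintegral_mono_set (Ioi_subset_Ioi (le_of_lt hy))) _

/-- The first quantity for `s < r`. -/
def decQuant₁ (r s : ℝ≥0∞) (a b : ℝ → ℝ≥0∞) (l : Measure ℝ) : ℝ≥0∞ :=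
  nrm (rho r s) l fun x => a x ^ (r.toReal * recip (rho r s)) *
    (kerHead s b l x * nrm r (l.restrict (Iio x)) a ^ (-(r.toReal * recip s)))

/-- The second quantity for `s < r`. -/
def decQuant₂ (r s : ℝ≥0∞) (a b : ℝ → ℝ≥0∞) (l : Measure ℝ) : ℝ≥0∞ :=
  nrm (rho r s) l fun x => b x ^ (s.toReal * recip (rho r s)) *
    (nrm s (l.restrict (Iio x)) b ^ (s.toReal * recip r) * kerTail r a l x)

lemma decQuant₁_rpow (hs : 1 ≤ s) (hsr : s < r) (hr' : r ≠ ∞) (ha : Measurable a)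
    (hb : Measurable b) : decQuant₁ r s a b l ^ (rho r s).toReal
      = ∫⁻ z, wMeasure r a l (Iio z) ^ (-(r.toReal / (r.toReal - s.toReal))) *
        (∫⁻ ξ in Iio z, l (Ioo ξ z) ^ s.toReal ∂(wMeasure s b l)) ^ (r.toReal / (r.toReal - s.toReal))
          ∂(wMeasure r a l) := by
  have hs0 : s ≠ 0 := (one_pos.trans_le hs).ne'
  have hs' := hsr.ne_top
  have hr0 : r ≠ 0 := (hs0.bot_lt.trans hsr).ne'
  have hSR := (toReal_lt_toReal hs' hr').2 hsr
  have hrho := toReal_rho hs hsr hr'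
  have hS := one_le_toReal hs hs'
  have hm : Measurable fun z => kerHead s b l z ^ s.toReal := by
    have e0 : (fun z => kerHead s b l z ^ s.toReal)
        = fun z => ∫⁻ ξ, b ξ ^ s.toReal * l (Ioo ξ z) ^ s.toReal ∂l := by
      ext z
      rw [← kerHead_rpow hs0 hs' hb, setLIntegral_kernel_eq (toReal_pos hs0 hs'), wMeasure,
        lintegral_density (hb.pow_const _) ((measurable_kernel_left z).pow_const _)]
    rw [e0]
    exact Measurable.lintegral_prod_right' (f := fun p : ℝ × ℝ => b p.2 ^ s.toReal *
      l (Ioo p.2 p.1) ^ s.toReal) (measurable_mul' ((hb.comp measurable_snd).pow_const _)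
        (((measurable_measure_Ioo' (l := l)).comp measurable_swap).pow_const _))
  simp_rw [kerHead_rpow hs0 hs' hb]
  rw [decQuant₁, nrm_rpow (rho_ne_zero hs) (rho_ne_top hsr)]
  conv_rhs => rw [wMeasure]
  rw [lintegral_density (ha.pow_const _) (measurable_mul' (measurable_measure_Iio_rpow _)
    (hm.pow_const _))]
  refine lintegral_congr fun t => ?_
  have e : (l.withDensity fun t => a t ^ r.toReal) (Iio t) = nrm r (l.restrict (Iio t)) a ^ r.toReal :=
    wMeasure_Iio hr0 hr' t
  rw [e, mul_rpow_of_nonneg _ _ toReal_nonneg,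
    mul_rpow_of_nonneg _ _ toReal_nonneg, ← rpow_mul, ← rpow_mul,
    ← rpow_mul, ← rpow_mul, recip_eq, recip_eq, hrho, mul_comm (kerHead _ _ _ _ ^ _)]
  have h1 : r.toReal - s.toReal ≠ 0 := by linarith
  have h2 : s.toReal ≠ 0 := by linarith
  have h3 : r.toReal ≠ 0 := by linarith
  congr 2
  · field_simp
  · congr 1; field_simp
  · congr 1; field_simp

lemma decQuant₂_rpow (hs : 1 ≤ s) (hsr : s < r) (hr' : r ≠ ∞) (ha : Measurable a)
    (hb : Measurable b) (ha0 : ∀ᵐ t ∂l, a t ≠ 0 ∧ a t ≠ ∞) : decQuant₂ r s a b l ^ (rho r s).toReal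
      = ∫⁻ ξ, wMeasure s b l (Iio ξ) ^ (r.toReal / (r.toReal - s.toReal) - 1) *
        (∫⁻ u in Ioi ξ, l (Ioo ξ u) ^ (r.toReal / (r.toReal - 1))
          ∂(tailWeight (wMeasure r a l) (r.toReal / (r.toReal - 1))))
            ^ (s.toReal * (r.toReal - 1) / (r.toReal - s.toReal)) ∂(wMeasure s b l) := by
  have hs0 : s ≠ 0 := (one_pos.trans_le hs).ne'
  have hs' := hsr.ne_top
  have hr1 := hs.trans_lt hsr
  have hSR := (toReal_lt_toReal hs' hr').2 hsr
  have hrho := toReal_rho hs hsr hr'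
  have hS := one_le_toReal hs hs'
  have hR := one_lt_toReal hr1 hr'
  have h1 : r.toReal - s.toReal ≠ 0 := by linarith
  have h2 : s.toReal ≠ 0 := by linarith
  have h3 : r.toReal ≠ 0 := by linarith
  have := wMeasure_sigmaFinite (r := r) ha0
  have := sigmaFinite_tailWeight (ν := wMeasure r a l) (q := r.toReal / (r.toReal - 1))
    (div_pos (by linarith) (by linarith))
  have hm : Measurable fun ξ => ∫⁻ u in Ioi ξ, l (Ioo ξ u) ^ (r.toReal / (r.toReal - 1))
      ∂(tailWeight (wMeasure r a l) (r.toReal / (r.toReal - 1))) := by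
    have e : ∀ ξ, ∫⁻ u in Ioi ξ, l (Ioo ξ u) ^ (r.toReal / (r.toReal - 1))
        ∂(tailWeight (wMeasure r a l) (r.toReal / (r.toReal - 1)))
        = ∫⁻ u, l (Ioo ξ u) ^ (r.toReal / (r.toReal - 1))
          ∂(tailWeight (wMeasure r a l) (r.toReal / (r.toReal - 1))) := fun ξ => by
      refine setLIntegral_eq_of_support_subset fun u hu => ?_
      by_contra hle
      exact hu (by
        show l (Ioo ξ u) ^ _ = 0
        rw [Ioo_eq_empty (by exact hle), measure_empty, zero_rpow_of_pos
        (div_pos (by linarith) (by linarith))])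
    simp_rw [e]
    exact Measurable.lintegral_prod_right' (f := fun p : ℝ × ℝ =>
      l (Ioo p.1 p.2) ^ (r.toReal / (r.toReal - 1))) ((measurable_measure_Ioo' (l := l)).pow_const _)
  rw [decQuant₂, nrm_rpow (rho_ne_zero hs) (rho_ne_top hsr)]
  conv_rhs => rw [wMeasure]
  rw [lintegral_density (hb.pow_const _) (measurable_mul' (measurable_measure_Iio_rpow _)
    (hm.pow_const _))]
  refine lintegral_congr fun t => ?_
  have e : (l.withDensity fun t => b t ^ s.toReal) (Iio t) = nrm s (l.restrict (Iio t)) b ^ s.toReal :=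
    wMeasure_Iio hs0 hs' t
  rw [e, kerTail_eq hr1 hr' ha, mul_rpow_of_nonneg _ _ toReal_nonneg,
    mul_rpow_of_nonneg _ _ toReal_nonneg, ← rpow_mul, ← rpow_mul,
    ← rpow_mul, ← rpow_mul, recip_eq, recip_eq, hrho]
  congr 2
  · field_simp
  · congr 1; field_simp; ring
  · congr 1; field_simp

lemma rpow_rho_ne_top_iff (hs : 1 ≤ s) (hsr : s < r) {x : ℝ≥0∞} :
    x ^ (rho r s).toReal ≠ ∞ ↔ x ≠ ∞ := by
  rw [Ne, Ne, ENNReal.rpow_eq_top_iff_of_pos (toReal_pos (rho_ne_zero hs) (rho_ne_top hsr))]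

lemma DecBound.decQuant₁_ne_top (hs : 1 ≤ s) (hsr : s < r) (hr' : r ≠ ∞) (ha : Measurable a)
    (hb : Measurable b) (ha0 : ∀ᵐ t ∂l, a t ≠ 0 ∧ a t ≠ ∞) (hb0 : ∀ᵐ t ∂l, b t ≠ 0 ∧ b t ≠ ∞)
    (hV : ∀ z, wMeasure r a l (Iio z) ≠ ∞) (h : DecBound r s a b l) : decQuant₁ r s a b l ≠ ∞ := by
  have := wMeasure_sigmaFinite (r := r) ha0
  have := wMeasure_sigmaFinite (r := s) hb0
  rw [← rpow_rho_ne_top_iff hs hsr, decQuant₁_rpow hs hsr hr' ha hb]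
  obtain ⟨C, hC, h⟩ := (decBound_iff_measures (hs.trans_lt hsr).ne_bot hr' (one_pos.trans_le hs).ne'
    hsr.ne_top ha hb).1 h
  exact decreasing_necessary_gt hV (one_le_toReal hs hsr.ne_top)
    ((toReal_lt_toReal hsr.ne_top hr').2 hsr) hC h

lemma DecBound.decQuant₂_ne_top (hs : 1 < s) (hsr : s < r) (hr' : r ≠ ∞) (ha : Measurable a)
    (hb : Measurable b) (ha0 : ∀ᵐ t ∂l, a t ≠ 0 ∧ a t ≠ ∞) (hb0 : ∀ᵐ t ∂l, b t ≠ 0 ∧ b t ≠ ∞)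
    (hV : ∀ z, wMeasure r a l (Iio z) ≠ ∞) (h : DecBound r s a b l) : decQuant₂ r s a b l ≠ ∞ := by
  have := wMeasure_sigmaFinite (r := r) ha0
  have := wMeasure_sigmaFinite (r := s) hb0
  have hR := one_lt_toReal (hs.trans hsr) hr'
  have hS := one_lt_toReal hs hsr.ne_top
  have hSR := (toReal_lt_toReal hsr.ne_top hr').2 hsr
  have hRS : 0 < r.toReal - s.toReal := by linarith
  have := sigmaFinite_tailWeight (ν := wMeasure r a l) (q := r.toReal / (r.toReal - 1))
    (div_pos (by linarith) (by linarith))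
  rw [← rpow_rho_ne_top_iff hs.le hsr, decQuant₂_rpow hs.le hsr hr' ha hb ha0]
  obtain ⟨C, hC, h⟩ := (decBound_iff_measures (hs.trans hsr).ne_bot hr' (one_pos.trans hs).ne'
    hsr.ne_top ha hb).1 h
  obtain ⟨K, hK, hk⟩ := kernel_of_decreasing hV hR (by linarith) hC h
  have := kernel_necessary_gt hS hSR hk
  intro htop
  have hp : 0 < (r.toReal - s.toReal) / (s.toReal * (r.toReal - 1)) :=
    div_pos hRS (mul_pos (by linarith) (by linarith))
  rw [htop, top_rpow_of_pos hp, top_le_iff] at this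
  exact mul_ne_top (rpow_ne_top_of_nonneg (one_div_nonneg.2 (by linarith))
    ofReal_ne_top) (rpow_ne_top_of_nonneg (div_nonneg (by linarith)
    (mul_nonneg (by linarith) (by linarith))) hK) this

/-! ### Sufficiency -/

lemma decBound_of_one (hs : 1 ≤ s) (ha : Measurable a) (hb : Measurable b)
    (hb0 : ∀ᵐ t ∂l, b t ≠ 0 ∧ b t ≠ ∞) {A : ℝ≥0∞} (hA : A ≠ ∞)
    (h : ∀ z, kerHead s b l z ≤ A * nrm 1 (l.restrict (Iio z)) a) : DecBound 1 s a b l := by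
  have hs0 : s ≠ 0 := (one_pos.trans_le hs).ne'
  have hν : ∀ z, nrm 1 (l.restrict (Iio z)) a = (l.withDensity a) (Iio z) := fun z => by
    rw [nrm_one, withDensity_apply _ measurableSet_Iio]
  have := withDensity_sigmaFinite_rpow (e := s.toReal) hb0
  rcases eq_or_ne s ∞ with rfl | hs'
  · refine ⟨A, hA, fun f hf => nrm_top_le ?_⟩
    have h1 : ∀ᵐ x ∂l, ∀ q : ℚ, x < (q : ℝ) → b x * l (Ioo x q) ≤ A * (l.withDensity a) (Iio (q : ℝ)) := by
      rw [ae_all_iff]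
      intro q
      have h2 := h q
      rw [kerHead, hν] at h2
      have h3 := ae_le_nrm_top (m := l.restrict (Iio (q : ℝ))) (F := fun ξ => b ξ * l (Ioo ξ q))
      rw [ae_restrict_iff' measurableSet_Iio] at h3
      exact h3.mono fun x hx hxq => (hx hxq).trans h2
    filter_upwards [h1] with x hx
    have e : nrm 1 l (fun t => a t * f t) = ∫⁻ z, f z ∂(l.withDensity a) := by
      rw [nrm_one, lintegral_density ha hf.measurable]
    rw [e]
    refine decreasing_pointwise_of_one (fun z => ?_) hf
    have hz := mul_setLIntegral_Iio_le (l := l) (x := z) (w := b x)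
      (B := A * (l.withDensity a) (Iio z)) (F := (Ioi x).indicator 1) fun q hq => by
        rw [lintegral_indicator_one measurableSet_Ioi, Measure.restrict_apply measurableSet_Ioi,
          Ioi_inter_Iio]
        rcases lt_or_ge x q with hxq | hxq
        · exact (hx q hxq).trans (mul_le_mul_right (measure_mono (Iio_subset_Iio hq.le)) _)
        · rw [Ioo_eq_empty hxq.not_gt, measure_empty, mul_zero]; exact zero_le
    rwa [lintegral_indicator_one measurableSet_Ioi, Measure.restrict_apply measurableSet_Ioi,
      Ioi_inter_Iio] at hz
  · rw [decBound_iff_measures one_ne_zero one_ne_top hs0 hs' ha hb]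
    have hS := one_le_toReal hs hs'
    refine ⟨A ^ s.toReal, rpow_ne_top_of_nonneg (by linarith) hA, fun f hf => ?_⟩
    have hw : wMeasure 1 a l = l.withDensity a := by simp [wMeasure]
    have : SigmaFinite (wMeasure s b l) := wMeasure_sigmaFinite hb0
    have key := decreasing_sufficient_of_one (l := l) (ν := l.withDensity a) (ω := wMeasure s b l) hS
      (A := A ^ s.toReal) (fun z => by
        rw [kerHead_rpow hs0 hs' hb, ← hν, ← mul_rpow_of_nonneg _ _ (by linarith)]
        exact rpow_le_rpow (h z) (by linarith)) hf
    rw [hw]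
    simpa using key

lemma decBound_of_le (hr1 : 1 < r) (hrs : r ≤ s) (hs' : s ≠ ∞) (ha : Measurable a)
    (hb : Measurable b) (ha0 : ∀ᵐ t ∂l, a t ≠ 0 ∧ a t ≠ ∞) (hb0 : ∀ᵐ t ∂l, b t ≠ 0 ∧ b t ≠ ∞)
    (hV : ∀ z, wMeasure r a l (Iio z) ≠ ∞) (hV0 : ∀ᵐ z ∂l, wMeasure r a l (Iio z) ≠ 0)
    {A₁ A₂ : ℝ≥0∞} (hA₁ : A₁ ≠ ∞) (hA₂ : A₂ ≠ ∞)
    (h₁ : ∀ z, kerHead s b l z ≤ A₁ * nrm r (l.restrict (Iio z)) a)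
    (h₂ : ∀ x, nrm s (l.restrict (Iio x)) b * kerTail r a l x ≤ A₂) : DecBound r s a b l := by
  have hs0 : s ≠ 0 := (one_pos.trans (hr1.trans_le hrs)).ne'
  have hr0 : r ≠ 0 := (one_pos.trans hr1).ne'
  have hr' := ne_top_of_le_ne_top hs' hrs
  have := wMeasure_sigmaFinite (r := r) ha0
  have := wMeasure_sigmaFinite (r := s) hb0
  have hR := one_lt_toReal hr1 hr'
  have hRS := toReal_mono hs' hrs
  have hS0 : 0 ≤ s.toReal := toReal_nonneg
  rw [decBound_iff_measures hr0 hr' hs0 hs' ha hb]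
  refine decreasing_sufficient_le hV hV0 hR hRS
    (rpow_ne_top_of_nonneg hS0 hA₁) (rpow_ne_top_of_nonneg hS0 hA₂)
    (fun z => ?_) fun x => ?_
  · rw [kerHead_rpow hs0 hs' hb, wMeasure_Iio hr0 hr', ← rpow_mul,
      mul_div_cancel₀ _ (by linarith), ← mul_rpow_of_nonneg _ _ hS0]
    exact rpow_le_rpow (h₁ z) hS0
  · rw [mul_comm s.toReal, rpow_mul, ← kerTail_eq hr1 hr' ha, wMeasure_Iio hs0 hs',
      ← mul_rpow_of_nonneg _ _ hS0]
    exact rpow_le_rpow (h₂ x) hS0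

lemma boundary_ne_top (hr0 : r ≠ 0) (hr' : r ≠ ∞) (hs0 : s ≠ 0) (hs' : s ≠ ∞) (hb : Measurable b)
    (hB : nrm s l (fun x => b x * l (Ioi x)) * (nrm r l a)⁻¹ ≠ ∞) :
    (∫⁻ x, l (Ioi x) ^ s.toReal ∂(wMeasure s b l)) * wMeasure r a l univ ^ (-(s.toReal / r.toReal)) ≠ ∞ := by
  have e : wMeasure r a l univ = nrm r l a ^ r.toReal := by
    rw [wMeasure, density_apply_eq_nrm hr0 hr' MeasurableSet.univ, Measure.restrict_univ]
  have hR := toReal_pos hr0 hr'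
  rw [wMeasure, nrm_rpow_density hs0 hs' hb measurable_measure_Ioi, e, ← rpow_mul,
    show r.toReal * -(s.toReal / r.toReal) = -s.toReal by field_simp, rpow_neg,
    ← inv_rpow, ← mul_rpow_of_nonneg _ _ toReal_nonneg]
  exact rpow_ne_top_of_nonneg toReal_nonneg hB

lemma decBound_of_gt (hs : 1 ≤ s) (hsr : s < r) (hr' : r ≠ ∞) (ha : Measurable a)
    (hb : Measurable b) (ha0 : ∀ᵐ t ∂l, a t ≠ 0 ∧ a t ≠ ∞) (hb0 : ∀ᵐ t ∂l, b t ≠ 0 ∧ b t ≠ ∞)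
    (hV : ∀ z, wMeasure r a l (Iio z) ≠ ∞) (hV0 : ∀ᵐ z ∂l, wMeasure r a l (Iio z) ≠ 0)
    (h₁ : decQuant₁ r s a b l ≠ ∞) (h₂ : s ≠ 1 → decQuant₂ r s a b l ≠ ∞)
    (hB : nrm s l (fun x => b x * l (Ioi x)) * (nrm r l a)⁻¹ ≠ ∞) : DecBound r s a b l := by
  have hs0 : s ≠ 0 := (one_pos.trans_le hs).ne'
  have hs' := hsr.ne_top
  have hr0 : r ≠ 0 := (hs0.bot_lt.trans hsr).ne'
  have := wMeasure_sigmaFinite (r := r) ha0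
  have := wMeasure_sigmaFinite (r := s) hb0
  have hB' := boundary_ne_top hr0 hr' hs0 hs' hb hB
  rw [← rpow_rho_ne_top_iff hs hsr, decQuant₁_rpow hs hsr hr' ha hb] at h₁
  rw [decBound_iff_measures hr0 hr' hs0 hs' ha hb]
  rcases hs.eq_or_lt with rfl | hs1
  · rw [toReal_one] at h₁ hB' ⊢
    exact decreasing_sufficient_one hV hV0 (one_lt_toReal hsr hr') h₁ hB'
  · have h₂ := h₂ hs1.ne'
    rw [← rpow_rho_ne_top_iff hs hsr, decQuant₂_rpow hs hsr hr' ha hb ha0] at h₂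
    exact decreasing_sufficient_gt hV hV0 (one_lt_toReal hs1 hs')
      ((toReal_lt_toReal hs' hr').2 hsr) h₁ h₂ hB'

lemma decBound_of_top (hr1 : 1 < r) (hr' : r ≠ ∞) (ha : Measurable a)
    (ha0 : ∀ᵐ t ∂l, a t ≠ 0 ∧ a t ≠ ∞)
    (hV : ∀ z, wMeasure r a l (Iio z) ≠ ∞) (hV0 : ∀ᵐ z ∂l, wMeasure r a l (Iio z) ≠ 0)
    {A : ℝ≥0∞} (hA : A ≠ ∞) (h : ∀ x, nrm ∞ (l.restrict (Iio x)) b * kerTail r a l x ≤ A)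
    (hcont : ∀ᵐ x ∂l, b x ≤ nrm ∞ (l.restrict (Iio x)) b)
    (hB : nrm ∞ l (fun x => b x * l (Ioi x)) * (nrm r l a)⁻¹ ≠ ∞) : DecBound r ∞ a b l := by
  have hr0 : r ≠ 0 := (one_pos.trans hr1).ne'
  have := wMeasure_sigmaFinite (r := r) ha0
  have hR := one_lt_toReal hr1 hr'
  refine ⟨ofReal (r.toReal / (r.toReal - 1)) * A
    + nrm ∞ l (fun x => b x * l (Ioi x)) * (nrm r l a)⁻¹,
    ENNReal.add_ne_top.2 ⟨mul_ne_top ofReal_ne_top hA, hB⟩, fun f hf => nrm_top_le ?_⟩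
  have e : (∫⁻ z, f z ^ r.toReal ∂(wMeasure r a l)) ^ (1 / r.toReal) = nrm r l (fun t => a t * f t) := by
    rw [wMeasure, nrm_rpow_density hr0 hr' ha hf.measurable, ← rpow_mul,
      mul_one_div_cancel (by linarith), rpow_one]
  have e2 : wMeasure r a l univ ^ (-(1 / r.toReal)) = (nrm r l a)⁻¹ := by
    rw [wMeasure, density_apply_eq_nrm hr0 hr' MeasurableSet.univ, Measure.restrict_univ,
      ← rpow_mul, show r.toReal * -(1 / r.toReal) = -1 by field_simp, rpow_neg_one]
  filter_upwards [hcont, ae_le_nrm_top (m := l) (F := fun x => b x * l (Ioi x))] with x h1 h2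
  have key := lintegral_Ioi_antitone_le_rpow (l := l) hV hV0 hR hf x
  rw [← kerTail_eq hr1 hr' ha, e, e2] at key
  calc b x * ∫⁻ t in Ioi x, f t ∂l
      ≤ b x * ((ofReal (r.toReal / (r.toReal - 1)) * kerTail r a l x
        + l (Ioi x) * (nrm r l a)⁻¹) * nrm r l (fun t => a t * f t)) := mul_le_mul_right key _
    _ = (ofReal (r.toReal / (r.toReal - 1)) * (b x * kerTail r a l x)
        + b x * l (Ioi x) * (nrm r l a)⁻¹) * nrm r l (fun t => a t * f t) := by ring
    _ ≤ _ := by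
        refine mul_le_mul_left (add_le_add (mul_le_mul_right ?_ _) (mul_le_mul_left h2 _)) _
        exact (mul_le_mul_left h1 _).trans (h x)

/-! ### The exponent `r = ∞` -/

lemma decBound_top_iff (hs : 1 ≤ s) (ha : Measurable a) (hb : Measurable b)
    (hV0 : ∀ᵐ z ∂l, nrm ∞ (l.restrict (Iio z)) a ≠ 0) : DecBound ∞ s a b l ↔
      nrm s l (fun x => b x * ∫⁻ t in Ioi x, (nrm ∞ (l.restrict (Iio t)) a)⁻¹ ∂l) ≠ ∞ := by
  have hs0 : s ≠ 0 := (one_pos.trans_le hs).ne'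
  have hmono : Antitone fun t => (nrm ∞ (l.restrict (Iio t)) a)⁻¹ := fun x y hxy =>
    ENNReal.inv_le_inv.2 (nrm_mono_measure (restrict_mono_set _ (Iio_subset_Iio hxy)))
  constructor
  · rintro ⟨C, hC, h⟩
    refine ne_top_of_le_ne_top hC ((h _ hmono).trans ((mul_le_mul_right (nrm_top_le ?_) _).trans
      (mul_one C).le))
    filter_upwards [ae_le_essSup_Iio a l] with t ht
    rw [← nrm_top] at ht
    exact (mul_le_mul_left ht _).trans (ENNReal.mul_inv_le_one _)
  · intro h
    set Q := nrm s l (fun x => b x * ∫⁻ t in Ioi x, (nrm ∞ (l.restrict (Iio t)) a)⁻¹ ∂l) with hQ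
    refine ⟨Q + 1, ENNReal.add_ne_top.2 ⟨h, one_ne_top⟩, fun f hf => ?_⟩
    set N := nrm ∞ l (fun t => a t * f t) with hN
    rcases eq_or_ne N ∞ with hNt | hNt
    · rw [hNt, mul_top (by simp)]; exact le_top
    have hm : Measurable fun x => b x * ∫⁻ t in Ioi x, (nrm ∞ (l.restrict (Iio t)) a)⁻¹ ∂l :=
      measurable_mul' hb (measurable_lintegral_Ioi _)
    refine le_trans ?_ (mul_le_mul_left (le_self_add : Q ≤ Q + 1) N)
    rw [mul_comm, hQ, ← nrm_const_mul hs0 _ hm.aemeasurable]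
    refine nrm_mono (ae_of_all _ fun x => ?_)
    rw [mul_left_comm, ← lintegral_const_mul _ hmono.measurable]
    refine mul_le_mul_right (lintegral_mono_ae (ae_restrict_of_ae ?_)) _
    filter_upwards [hV0] with t ht
    rw [← div_eq_mul_inv, ENNReal.le_div_iff_mul_le (Or.inl ht) (Or.inr hNt), mul_comm]
    have h1 : nrm ∞ (l.restrict (Iio t)) (fun u => f t * a u) ≤ N := by
      refine le_trans (nrm_mono ?_) (nrm_mono_measure (m := l.restrict (Iio t)) restrict_le_self)
      filter_upwards [ae_restrict_mem measurableSet_Iio] with u hu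
      rw [mul_comm]
      exact mul_le_mul_right (hf (le_of_lt hu)) _
    rwa [nrm_const_mul (by simp) _ ha.aemeasurable, mul_comm] at h1

end Decreasing

/-! ### The quantity `R_∞` -/

section QuantR

variable {r s : ℝ≥0∞} {a b : ℝ → ℝ≥0∞} {I : Set ℝ}

lemma haar_restrict_Ioo (hI0 : I ⊆ Ioi 0) (hIc : I.OrdConnected) {x y : ℝ} (hx : x ∈ I)
    (hy : y ∈ I) : (haar.restrict I) (Ioo x y) = logRatio y x := by
  rw [Measure.restrict_eq_self _ (Ioo_subset_Icc_self.trans (hIc.out hx hy)), haar_Ioo (hI0 hx) (hI0 hy)]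
  rfl

lemma lp_eq_kerHead (hI : MeasurableSet I) (hI0 : I ⊆ Ioi 0) (hIc : I.OrdConnected) (hs0 : s ≠ 0)
    {x : ℝ} (hx : x ∈ I) : lp s (I ∩ Iio x) (fun t => pow (-recip s) t * b t * logRatio x t)
      = kerHead s b (haar.restrict I) x := by
  simp_rw [mul_assoc]
  rw [lp_inter_Iio hI hI0 hs0, kerHead]
  refine nrm_congr (ae_restrict_of_ae ((ae_restrict_mem hI).mono fun t ht => ?_))
  show _ = b t * _
  rw [haar_restrict_Ioo hI0 hIc ht hx]

lemma primV_eq (hI : MeasurableSet I) (hI0 : I ⊆ Ioi 0) (t : ℝ) :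
    primV r a I t = wMeasure r a (haar.restrict I) (Iio t) := by
  rw [wMeasure, withDensity_apply _ measurableSet_Iio, restrict_restrict measurableSet_Iio,
    setLIntegral_haar (measurableSet_Iio.inter hI) (inter_subset_right.trans hI0), inter_comm, primV]

lemma lp_eq_kerTail (hI : MeasurableSet I) (hI0 : I ⊆ Ioi 0) (hIc : I.OrdConnected) {x : ℝ}
    (hx : x ∈ I) : lp (conjExponent r) (I ∩ Ioi x) (fun t => pow (-recip (conjExponent r)) t *
      a t ^ (r.toReal * recip (conjExponent r)) * (primV r a I t)⁻¹ * logRatio t x)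
      = kerTail r a (haar.restrict I) x := by
  simp_rw [mul_assoc, primV_eq hI hI0]
  rw [lp_inter_Ioi hI hI0 conjExponent_ne_zero, kerTail]
  refine nrm_congr (ae_restrict_of_ae ((ae_restrict_mem hI).mono fun t ht => ?_))
  show _ = _ * _ * _
  rw [haar_restrict_Ioo hI0 hIc hx ht, mul_assoc, wMeasure]

lemma quantR₁_eq (hI : MeasurableSet I) (hI0 : I ⊆ Ioi 0) (hIc : I.OrdConnected) (hs : 1 ≤ s)
    (hr0 : r ≠ 0) : quantR₁ r s a b I = if r ≤ s then ⨆ x ∈ I, kerHead s b (haar.restrict I) x *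
      (nrm r ((haar.restrict I).restrict (Iio x)) a)⁻¹ else decQuant₁ r s a b (haar.restrict I) := by
  have hs0 : s ≠ 0 := (one_pos.trans_le hs).ne'
  rw [quantR₁]
  simp_rw [lp_inter_Iio hI hI0 hr0]
  split_ifs with h
  · exact iSup_congr fun x => iSup_congr fun hx => by rw [lp_eq_kerHead hI hI0 hIc hs0 hx]
  · rw [decQuant₁, ← lp_eq_nrm hI hI0 (rho_ne_zero hs)]
    refine lp_congr ((ae_restrict_mem hI).mono fun x hx => ?_)
    rw [lp_eq_kerHead hI hI0 hIc hs0 hx, mul_assoc]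

lemma quantR₂_eq (hI : MeasurableSet I) (hI0 : I ⊆ Ioi 0) (hIc : I.OrdConnected) (hs : 1 ≤ s) :
    quantR₂ r s a b I = if r ≤ s then ⨆ x ∈ I, nrm s ((haar.restrict I).restrict (Iio x)) b *
      kerTail r a (haar.restrict I) x else decQuant₂ r s a b (haar.restrict I) := by
  have hs0 : s ≠ 0 := (one_pos.trans_le hs).ne'
  rw [quantR₂]
  simp_rw [lp_inter_Iio hI hI0 hs0]
  split_ifs with h
  · exact iSup_congr fun x => iSup_congr fun hx => by rw [lp_eq_kerTail hI hI0 hIc hx]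
  · rw [decQuant₂, ← lp_eq_nrm hI hI0 (rho_ne_zero hs)]
    refine lp_congr ((ae_restrict_mem hI).mono fun x hx => ?_)
    rw [lp_eq_kerTail hI hI0 hIc hx, mul_assoc]

lemma quantR₃_eq (hI : MeasurableSet I) (hI0 : I ⊆ Ioi 0) (hs0 : s ≠ 0) :
    quantR₃ s a b I = nrm s (haar.restrict I) (fun x => b x *
      ∫⁻ t in Ioi x, (nrm ∞ ((haar.restrict I).restrict (Iio t)) a)⁻¹ ∂(haar.restrict I)) := by
  have h1 : ∀ t, lp ∞ (I ∩ Iio t) a = nrm ∞ ((haar.restrict I).restrict (Iio t)) a := fun t => by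
    rw [← lp_inter_Iio hI hI0 (by simp)]
    simp [recip_top, pow_zero']
  rw [quantR₃, ← lp_eq_nrm hI hI0 hs0]
  congr 1 with x
  rw [mul_assoc, restrict_restrict measurableSet_Ioi,
    setLIntegral_haar (measurableSet_Ioi.inter hI) (inter_subset_right.trans hI0), inter_comm]
  simp_rw [h1]

lemma nrm_Iio_ne_zero (ha : Regular a) (hr0 : r ≠ 0) {z c d : ℝ} (hc : 0 < c) (hcd : c < d)
    (h : Ioo c d ⊆ I ∩ Iio z) : nrm r ((haar.restrict I).restrict (Iio z)) a ≠ 0 := by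
  rw [restrict_restrict measurableSet_Iio, inter_comm]
  exact nrm_pos_of_Ioo_subset hr0 hc hcd h ha.measurable fun t ht => ha.ne_zero t (hc.trans ht.1)

/-- On an interval, the inequality for decreasing functions holds if and only if `R_∞ < ∞`, up to a
boundary condition. -/
theorem decBound_iff_quantRInf (hI : MeasurableSet I) (hI0 : I ⊆ Ioi 0) (hIc : I.OrdConnected)
    (hIn : I.Nonempty) (hlow : ∀ z ∈ I, ∃ c d, 0 < c ∧ c < d ∧ Ioo c d ⊆ I ∩ Iio z)
    (hr : 1 ≤ r) (hs : 1 ≤ s) (ha : Regular a) (hb : Regular b)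
    (hV : r ≠ ∞ → ∀ z, nrm r ((haar.restrict I).restrict (Iio z)) a ≠ ∞)
    (hB : r ≠ ∞ → quantRInf r s a b I ≠ ∞ →
      nrm s (haar.restrict I) (fun x => b x * (haar.restrict I) (Ioi x)) *
        (nrm r (haar.restrict I) a)⁻¹ ≠ ∞) :
    DecBound r s a b (haar.restrict I) ↔ quantRInf r s a b I ≠ ∞ := by
  have hs0 : s ≠ 0 := (one_pos.trans_le hs).ne'
  have hr0 : r ≠ 0 := (one_pos.trans_le hr).ne'
  have ham := ha.measurable
  have hbm := hb.measurable
  have ha0 := ha.ae (J := I)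
  have hb0 := hb.ae (J := I)
  have hpos : ∀ z ∈ I, nrm r ((haar.restrict I).restrict (Iio z)) a ≠ 0 := fun z hz => by
    obtain ⟨c, d, hc, hcd, h⟩ := hlow z hz
    exact nrm_Iio_ne_zero ha hr0 hc hcd h
  rcases eq_or_ne r ∞ with rfl | hr'
  · rw [decBound_top_iff hs ham hbm ((ae_restrict_mem hI).mono hpos), quantRInf, if_pos rfl,
      quantR₃_eq hI hI0 hs0]
  have hV := hV hr'
  have hB := hB hr'
  have hVw : ∀ z, wMeasure r a (haar.restrict I) (Iio z) ≠ ∞ := fun z => by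
    rw [wMeasure_Iio hr0 hr']; exact rpow_ne_top_of_nonneg toReal_nonneg (hV z)
  have hVw0 : ∀ᵐ z ∂(haar.restrict I), wMeasure r a (haar.restrict I) (Iio z) ≠ 0 :=
    (ae_restrict_mem hI).mono fun z hz => by
      rw [wMeasure_Iio hr0 hr']
      exact (rpow_pos (pos_iff_ne_zero.2 (hpos z hz)) (hV z)).ne'
  have nec₁ : DecBound r s a b (haar.restrict I) → quantR₁ r s a b I ≠ ∞ := by
    intro h
    rw [quantR₁_eq hI hI0 hIc hs hr0]
    split_ifs with hrs
    · obtain ⟨C, hC, h⟩ := h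
      refine ne_top_of_le_ne_top hC (iSup₂_le fun x hx => ?_)
      rw [← div_eq_mul_inv]
      exact ENNReal.div_le_of_le_mul (DecBound.kerHead_le h x)
    · exact h.decQuant₁_ne_top hs (not_le.1 hrs) hr' ham hbm ha0 hb0 hVw
  have nec₂ : 1 < r → s ≠ 1 → DecBound r s a b (haar.restrict I) → quantR₂ r s a b I ≠ ∞ := by
    intro hr1 hs1 h
    rw [quantR₂_eq hI hI0 hIc hs]
    split_ifs with hrs
    · obtain ⟨A, hA, h⟩ := h.exists_kerTail_le hr1 hr' hs0 ham hbm ha0 hV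
      exact ne_top_of_le_ne_top hA (iSup₂_le fun x _ => h x)
    · exact h.decQuant₂_ne_top (lt_of_le_of_ne hs (Ne.symm hs1)) (not_le.1 hrs) hr' ham hbm ha0 hb0 hVw
  constructor
  · intro h
    rw [quantRInf, if_neg hr']
    split_ifs with h1 h2
    · exact nec₁ h
    · exact nec₂ (lt_of_le_of_ne hr fun e => h1 (Or.inl e.symm)) (fun e => h1 (Or.inr e)) h
    · exact ENNReal.add_ne_top.2 ⟨nec₁ h,
        nec₂ (lt_of_le_of_ne hr fun e => h1 (Or.inl e.symm)) (fun e => h1 (Or.inr e)) h⟩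
  · intro hQ
    have hB := hB hQ
    have suf₁ : r ≤ s → quantR₁ r s a b I ≠ ∞ → ∃ A : ℝ≥0∞, A ≠ ∞ ∧ ∀ z,
        kerHead s b (haar.restrict I) z ≤ A * nrm r ((haar.restrict I).restrict (Iio z)) a := by
      intro hrs h
      rw [quantR₁_eq hI hI0 hIc hs hr0, if_pos hrs] at h
      refine ⟨_, ENNReal.add_ne_top.2 ⟨h, hB⟩, fun z => ?_⟩
      by_cases hz : z ∈ I
      · refine le_trans ?_ (mul_le_mul_left le_self_add _)
        have h' := le_iSup₂ (f := fun x (_ : x ∈ I) => kerHead s b (haar.restrict I) x *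
          (nrm r ((haar.restrict I).restrict (Iio x)) a)⁻¹) z hz
        rw [← div_eq_mul_inv] at h'
        exact (ENNReal.div_le_iff_le_mul (Or.inl (hpos z hz)) (Or.inl (hV z))).1 h'
      rcases OrdConnected.forall_le_or hIc hz with h' | h'
      · have e : (haar.restrict I).restrict (Iio z) = haar.restrict I := by
          rw [restrict_restrict measurableSet_Iio, inter_eq_right.2]
          exact fun t ht => lt_of_le_of_ne (h' t ht) fun e => hz (e ▸ ht)
        obtain ⟨w, hw⟩ := hIn
        have h0 : nrm r (haar.restrict I) a ≠ 0 := fun h0 => hpos w hw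
          (le_zero_iff.1 ((nrm_mono_measure restrict_le_self).trans h0.le))
        have h1 : nrm r (haar.restrict I) a ≠ ∞ := e ▸ hV z
        refine le_trans ?_ (mul_le_mul_left le_add_self _)
        rw [e, mul_assoc, ENNReal.inv_mul_cancel h0 h1, mul_one, kerHead, e]
        exact nrm_mono (ae_of_all _ fun x => mul_le_mul_right (measure_mono Ioo_subset_Ioi_self) _)
      · rw [kerHead, nrm_restrict_Iio_eq_zero h']; exact zero_le
    have suf₂ : r ≤ s → quantR₂ r s a b I ≠ ∞ → ∃ A : ℝ≥0∞, A ≠ ∞ ∧ ∀ x,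
        nrm s ((haar.restrict I).restrict (Iio x)) b * kerTail r a (haar.restrict I) x ≤ A := by
      intro hrs h
      rw [quantR₂_eq hI hI0 hIc hs, if_pos hrs] at h
      refine ⟨_, h, fun x => ?_⟩
      by_cases hx : x ∈ I
      · exact le_iSup₂ (f := fun x (_ : x ∈ I) => nrm s ((haar.restrict I).restrict (Iio x)) b *
          kerTail r a (haar.restrict I) x) x hx
      rcases OrdConnected.forall_le_or hIc hx with h' | h'
      · rw [kerTail, nrm_restrict_Ioi_eq_zero h', mul_zero]; exact zero_le
      · rw [nrm_restrict_Iio_eq_zero h', zero_mul]; exact zero_le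
    rw [quantRInf, if_neg hr'] at hQ
    rcases hr.eq_or_lt with rfl | hr1
    · rw [if_pos (Or.inl rfl)] at hQ
      obtain ⟨A, hA, h⟩ := suf₁ hs hQ
      exact decBound_of_one hs ham hbm hb0 hA h
    rcases eq_or_ne s ∞ with rfl | hs'
    · rw [if_neg (by rintro (h | h); exacts [hr1.ne' h, by simp at h]), if_pos rfl] at hQ
      obtain ⟨A, hA, h⟩ := suf₂ le_top hQ
      exact decBound_of_top hr1 hr' ham ha0 hVw hVw0 hA h
        (by simpa only [nrm_top] using ae_le_essSup_Iio b _) hB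
    rcases le_or_gt r s with hrs | hsr
    · rw [if_neg (by rintro (h | h); exacts [hr1.ne' h, (hr1.trans_le hrs).ne' h]), if_neg hs'] at hQ
      obtain ⟨hQ₁, hQ₂⟩ := ENNReal.add_ne_top.1 hQ
      obtain ⟨A₁, hA₁, h₁⟩ := suf₁ hrs hQ₁
      obtain ⟨A₂, hA₂, h₂⟩ := suf₂ hrs hQ₂
      exact decBound_of_le hr1 hrs hs' ham hbm ha0 hb0 hVw hVw0 hA₁ hA₂ h₁ h₂
    · have hQ' : quantR₁ r s a b I ≠ ∞ ∧ (s ≠ 1 → quantR₂ r s a b I ≠ ∞) := by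
        split_ifs at hQ with h1
        · exact ⟨hQ, fun h => absurd h1 (by rintro (h' | h'); exacts [hr1.ne' h', h h'])⟩
        · exact ⟨(ENNReal.add_ne_top.1 hQ).1, fun _ => (ENNReal.add_ne_top.1 hQ).2⟩
      rw [quantR₁_eq hI hI0 hIc hs hr0, quantR₂_eq hI hI0 hIc hs, if_neg hsr.not_ge,
        if_neg hsr.not_ge] at hQ'
      exact decBound_of_gt hs hsr hr' ham hbm ha0 hb0 hVw hVw0 hQ'.1 hQ'.2 hB

theorem decBound_Ioi_iff (hr : 1 ≤ r) (hs : 1 ≤ s) (ha : Regular a) (hb : Regular b)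
    (htop : nrm r (haar.restrict (Ioi 1)) a = ∞) :
    DecBound r s a b (haar.restrict (Ioi 1)) ↔ quantRInf r s a b (Ioi 1) ≠ ∞ := by
  refine decBound_iff_quantRInf measurableSet_Ioi (Ioi_subset_Ioi zero_le_one) ordConnected_Ioi
    ⟨2, by simp⟩ (fun z hz => ⟨1, z, one_pos, hz, fun t ht => ht⟩) hr hs ha hb (fun _ z => ?_) ?_
  · rw [restrict_restrict measurableSet_Iio, inter_comm, Ioi_inter_Iio]
    exact ha.nrm_Ioo_ne_top one_pos (one_pos.trans_le hr).ne'
  · intro _ _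
    rw [htop, ENNReal.inv_top, mul_zero]
    exact ENNReal.zero_ne_top

lemma log_inv_le_two_mul {x z : ℝ} (hx : 0 < x) (hx4 : x ≤ 1 / 4) (hz : 1 / 2 ≤ z) :
    ofReal (Real.log (1 / x)) ≤ 2 * ofReal (Real.log (z / x)) := by
  rw [show (2 : ℝ≥0∞) = ofReal 2 by simp, ← ofReal_mul (by norm_num)]
  refine ofReal_le_ofReal ?_
  rw [← Real.log_rpow (div_pos (by linarith) hx)]
  refine Real.log_le_log (by positivity) ?_
  rw [Real.rpow_two, div_pow, div_le_div_iff₀ hx (by positivity)]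
  nlinarith [mul_nonneg hx.le (by nlinarith : 0 ≤ z ^ 2 - x)]

lemma haar_restrict_Ioi {x : ℝ} (hx : x ∈ Ioo (0 : ℝ) 1) :
    (haar.restrict (Ioo 0 1)) (Ioi x) = ofReal (Real.log (1 / x)) := by
  rw [Measure.restrict_apply measurableSet_Ioi, show Ioi x ∩ Ioo 0 1 = Ioo x 1 by
    ext t; exact ⟨fun h => ⟨h.1, h.2.2⟩, fun h => ⟨h.1, hx.1.trans h.1, h.2⟩⟩, haar_Ioo hx.1 one_pos]

lemma boundary_of_near_zero (hs : 1 ≤ s) (hb : Regular b) {F : ℝ → ℝ≥0∞} (hF : Measurable F)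
    (hFt : nrm s (haar.restrict (Ioo 0 1)) F ≠ ∞)
    (h : ∀ᵐ x ∂(haar.restrict (Ioo 0 1)), x ≤ 1 / 4 → b x * ofReal (Real.log (1 / x)) ≤ F x) :
    nrm s (haar.restrict (Ioo 0 1)) (fun x => b x * (haar.restrict (Ioo 0 1)) (Ioi x)) ≠ ∞ := by
  have hs0 : s ≠ 0 := (one_pos.trans_le hs).ne'
  have hm : Measurable fun x => ofReal (Real.log 4) * (Ioo (1 / 8) 1).indicator b x :=
    (hb.measurable.indicator measurableSet_Ioo).const_mul _
  refine ne_top_of_le_ne_top (ENNReal.add_ne_top.2 ⟨hFt, ?_⟩) ((nrm_mono ?_).trans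
    (nrm_add_le hs hF.aemeasurable hm.aemeasurable))
  · rw [nrm_const_mul hs0 _ (hb.measurable.indicator measurableSet_Ioo).aemeasurable]
    refine mul_ne_top ofReal_ne_top (ne_top_of_le_ne_top
      (hb.nrm_Ioo_ne_top (c := 1 / 8) (d := 1) (by norm_num) hs0)
      ((nrm_mono_measure restrict_le_self).trans
        (eLpNorm_indicator_eq_eLpNorm_restrict measurableSet_Ioo).le))
  · filter_upwards [h, ae_restrict_mem measurableSet_Ioo] with x hx hx1
    rw [haar_restrict_Ioi hx1]
    rcases le_or_gt x (1 / 4) with h4 | h4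
    · exact (hx h4).trans le_self_add
    · refine le_trans ?_ le_add_self
      rw [indicator_of_mem (by exact ⟨by linarith, hx1.2⟩), mul_comm]
      refine mul_le_mul_left (ofReal_le_ofReal (Real.log_le_log (by have := hx1.1; positivity) ?_)) _
      rw [div_le_iff₀ hx1.1]; linarith

theorem decBound_Ioo_iff (hr : 1 ≤ r) (hs : 1 ≤ s) (ha : Regular a) (hb : Regular b)
    (hfin : nrm r (haar.restrict (Ioo 0 1)) a ≠ ∞) :
    DecBound r s a b (haar.restrict (Ioo 0 1)) ↔ quantRInf r s a b (Ioo 0 1) ≠ ∞ := by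
  have hs0 : s ≠ 0 := (one_pos.trans_le hs).ne'
  have hr0 : r ≠ 0 := (one_pos.trans_le hr).ne'
  have hI0 : Ioo (0 : ℝ) 1 ⊆ Ioi 0 := Ioo_subset_Ioi_self
  have hV : ∀ z, nrm r ((haar.restrict (Ioo 0 1)).restrict (Iio z)) a ≠ ∞ := fun z =>
    ne_top_of_le_ne_top hfin (nrm_mono_measure restrict_le_self)
  have h0 : nrm r (haar.restrict (Ioo 0 1)) a ≠ 0 :=
    nrm_pos_of_Ioo_subset hr0 (c := 1 / 2) (d := 1) (by norm_num) (by norm_num)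
      (Ioo_subset_Ioo_left (by norm_num)) ha.measurable fun t ht => ha.ne_zero t (by linarith [ht.1])
  refine decBound_iff_quantRInf measurableSet_Ioo hI0 ordConnected_Ioo
    ⟨1 / 2, by norm_num, by norm_num⟩ (fun z hz => ⟨z / 2, z, by linarith [hz.1], by linarith [hz.1],
      fun t ht => ⟨⟨by linarith [hz.1, ht.1], ht.2.trans hz.2⟩, ht.2⟩⟩) hr hs ha hb (fun _ => hV) ?_
  intro hr' hQ
  refine mul_ne_top ?_ (ENNReal.inv_ne_top.2 h0)
  have ofHead : ∀ z ∈ Ioo (1 / 2 : ℝ) 1, kerHead s b (haar.restrict (Ioo 0 1)) z ≠ ∞ →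
      nrm s (haar.restrict (Ioo 0 1)) (fun x => b x * (haar.restrict (Ioo 0 1)) (Ioi x)) ≠ ∞ := by
    intro z hz hk
    have hm : Measurable fun x => b x * (haar.restrict (Ioo 0 1)) (Ioo x z) :=
      measurable_mul' hb.measurable (measurable_kernel_left z)
    refine boundary_of_near_zero hs hb ((hm.indicator (measurableSet_Iio (a := z))).const_mul 2) ?_ ?_
    · rw [nrm_const_mul hs0 _ (hm.indicator measurableSet_Iio).aemeasurable]
      exact mul_ne_top (by simp)
        ((eLpNorm_indicator_eq_eLpNorm_restrict measurableSet_Iio).trans_ne hk)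
    · filter_upwards [ae_restrict_mem measurableSet_Ioo] with x hx hx4
      rw [indicator_of_mem (by show x < z; linarith [hz.1]), mul_left_comm,
        haar_restrict_Ioo hI0 ordConnected_Ioo hx ⟨by linarith [hz.1], hz.2⟩]
      exact mul_le_mul_right (log_inv_le_two_mul hx.1 hx4 hz.1.le) _
  have ofR₁ : quantR₁ r s a b (Ioo 0 1) ≠ ∞ →
      nrm s (haar.restrict (Ioo 0 1)) (fun x => b x * (haar.restrict (Ioo 0 1)) (Ioi x)) ≠ ∞ := by
    intro h
    rw [quantR₁_eq measurableSet_Ioo hI0 ordConnected_Ioo hs hr0] at h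
    split_ifs at h with hrs
    · refine ofHead (3 / 4) (by norm_num) fun ht => h (top_le_iff.1 ?_)
      refine le_trans ?_ (le_iSup₂ (f := fun x (_ : x ∈ Ioo (0 : ℝ) 1) =>
        kerHead s b (haar.restrict (Ioo 0 1)) x *
          (nrm r ((haar.restrict (Ioo 0 1)).restrict (Iio x)) a)⁻¹) (3 / 4) (by norm_num))
      rw [ht, top_mul (ENNReal.inv_ne_zero.2 (hV _))]
    · have hsr := not_le.1 hrs
      by_contra hcon
      have hk : ∀ z ∈ Ioo (1 / 2 : ℝ) 1, kerHead s b (haar.restrict (Ioo 0 1)) z = ∞ :=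
        fun z hz => by_contra fun hz' => ofHead z hz hz' hcon
      refine h (top_le_iff.1 ?_)
      have hle : nrm (rho r s) (haar.restrict (Ioo (1 / 2) 1)) (fun _ => ∞)
          ≤ decQuant₁ r s a b (haar.restrict (Ioo 0 1)) := by
        refine (nrm_mono ?_).trans (nrm_mono_measure (m := haar.restrict (Ioo (1 / 2) 1))
          (restrict_mono_set _ (Ioo_subset_Ioo_left (by norm_num))))
        filter_upwards [ae_restrict_mem measurableSet_Ioo] with z hz
        have hz0 : 0 < z := by linarith [hz.1]
        rw [hk z hz, top_mul, mul_top]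
        · exact (rpow_pos (pos_iff_ne_zero.2 (ha.ne_zero z hz0)) (ha.ne_top z hz0)).ne'
        · rw [rpow_neg]
          exact ENNReal.inv_ne_zero.2 (rpow_ne_top_of_nonneg (by rw [recip]; positivity) (hV z))
      refine le_trans ?_ hle
      have := nrm_const_mul (m := haar.restrict (Ioo (1 / 2) 1)) (rho_ne_zero hs (r := r)) ∞
        (F := fun _ => 1) aemeasurable_const
      simp only [mul_one] at this
      rw [this, top_mul]
      exact nrm_pos_of_Ioo_subset (rho_ne_zero hs) (c := 1 / 2) (d := 1) (by norm_num) (by norm_num)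
        le_rfl measurable_const fun t _ => one_ne_zero
  rw [quantRInf, if_neg hr'] at hQ
  split_ifs at hQ with h1 h2
  · exact ofR₁ hQ
  · subst h2
    rw [quantR₂_eq measurableSet_Ioo hI0 ordConnected_Ioo hs, if_pos le_top] at hQ
    set A := ⨆ x ∈ Ioo (0 : ℝ) 1, nrm ∞ ((haar.restrict (Ioo 0 1)).restrict (Iio x)) b *
      kerTail r a (haar.restrict (Ioo 0 1)) x with hA
    set φ : ℝ → ℝ≥0∞ := fun u => a u ^ (r.toReal * recip (conjExponent r)) *
      (wMeasure r a (haar.restrict (Ioo 0 1)) (Iio u))⁻¹ with hφ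
    have hφm : Measurable φ := measurable_mul' (ha.measurable.pow_const _) measurable_measure_Iio.inv
    set c := nrm (conjExponent r) (haar.restrict (Ioo (1 / 2) 1)) φ with hc
    have hc0 : c ≠ 0 := nrm_pos_of_Ioo_subset conjExponent_ne_zero (c := 1 / 2) (d := 1) (by norm_num)
      (by norm_num) le_rfl hφm fun t ht => mul_ne_zero
        (rpow_pos (pos_iff_ne_zero.2 (ha.ne_zero t (by linarith [ht.1])))
          (ha.ne_top t (by linarith [ht.1]))).ne' (ENNReal.inv_ne_zero.2 (by
            rw [wMeasure_Iio hr0 hr']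
            exact rpow_ne_top_of_nonneg toReal_nonneg (hV t)))
    refine boundary_of_near_zero hs hb (F := fun _ => 2 * A / c) measurable_const
      (ne_top_of_le_ne_top (ENNReal.div_ne_top (mul_ne_top (by simp) hQ) hc0)
        (nrm_top_le (ae_of_all _ fun _ => le_rfl))) ?_
    filter_upwards [ae_restrict_mem measurableSet_Ioo, ae_le_essSup_Iio b (haar.restrict (Ioo 0 1))]
      with x hx hbx hx4
    rw [ENNReal.le_div_iff_mul_le (Or.inl hc0) (Or.inr (mul_ne_top (by simp) hQ))]
    have h3 : ofReal (Real.log (1 / x)) * c ≤ 2 * kerTail r a (haar.restrict (Ioo 0 1)) x := by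
      have hkm : Measurable fun u => φ u * (haar.restrict (Ioo 0 1)) (Ioo x u) :=
        measurable_mul' hφm (measurable_kernel_right x)
      have e : kerTail r a (haar.restrict (Ioo 0 1)) x
        = nrm (conjExponent r) ((haar.restrict (Ioo 0 1)).restrict (Ioi x))
          (fun u => φ u * (haar.restrict (Ioo 0 1)) (Ioo x u)) := rfl
      rw [e, hc, ← nrm_const_mul conjExponent_ne_zero _ hφm.aemeasurable,
        ← nrm_const_mul conjExponent_ne_zero _ hkm.aemeasurable]
      refine (nrm_mono ?_).trans (nrm_mono_measure (m := haar.restrict (Ioo (1 / 2) 1)) ?_)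
      · filter_upwards [ae_restrict_mem measurableSet_Ioo] with u hu
        rw [haar_restrict_Ioo hI0 ordConnected_Ioo hx ⟨by linarith [hu.1], hu.2⟩]
        exact (mul_comm _ _).trans_le ((mul_le_mul_right (log_inv_le_two_mul hx.1 hx4 hu.1.le)
          (φ u)).trans_eq (mul_left_comm _ _ _))
      · rw [restrict_restrict measurableSet_Ioi]
        exact restrict_mono_set _ fun u hu =>
          ⟨by show x < u; linarith [hu.1], by linarith [hu.1], hu.2⟩
    calc b x * ofReal (Real.log (1 / x)) * c
        ≤ nrm ∞ ((haar.restrict (Ioo 0 1)).restrict (Iio x)) b *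
          (2 * kerTail r a (haar.restrict (Ioo 0 1)) x) := by
          rw [mul_assoc, nrm_top]
          exact mul_le_mul' hbx h3
      _ ≤ 2 * A := by
          rw [mul_left_comm]
          exact mul_le_mul_right (le_iSup₂ (f := fun x (_ : x ∈ Ioo (0 : ℝ) 1) =>
            nrm ∞ ((haar.restrict (Ioo 0 1)).restrict (Iio x)) b *
              kerTail r a (haar.restrict (Ioo 0 1)) x) x hx) _
  · exact ofR₁ (ENNReal.add_ne_top.1 hQ).1

end QuantR

/-! ### Domination of functionals of decreasing functions -/

section Dom

/-- `P f ≲ X f` for decreasing `f`. -/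
def Dom (P X : (ℝ → ℝ≥0∞) → ℝ≥0∞) : Prop :=
  ∃ C : ℝ≥0∞, C ≠ ∞ ∧ ∀ f : ℝ → ℝ≥0∞, Antitone f → P f ≤ C * X f

variable {P Q X : (ℝ → ℝ≥0∞) → ℝ≥0∞}

lemma Dom.of_le (h : ∀ f, Antitone f → P f ≤ X f) : Dom P X :=
  ⟨1, one_ne_top, fun f hf => (h f hf).trans (one_mul _).ge⟩

lemma Dom.trans (h : Dom P Q) (h' : Dom Q X) : Dom P X := by
  obtain ⟨C, hC, h⟩ := h
  obtain ⟨D, hD, h'⟩ := h'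
  exact ⟨C * D, mul_ne_top hC hD, fun f hf => (h f hf).trans
    ((mul_le_mul_right (h' f hf) C).trans (mul_assoc C D _).ge)⟩

lemma Dom.add (h : Dom P X) (h' : Dom Q X) : Dom (fun f => P f + Q f) X := by
  obtain ⟨C, hC, h⟩ := h
  obtain ⟨D, hD, h'⟩ := h'
  exact ⟨C + D, ENNReal.add_ne_top.2 ⟨hC, hD⟩, fun f hf =>
    (add_le_add (h f hf) (h' f hf)).trans (add_mul C D _).ge⟩

lemma Dom.mul_const {c : ℝ≥0∞} (h : Dom P X) (hc : c ≠ ∞) : Dom (fun f => P f * c) X := by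
  obtain ⟨C, hC, h⟩ := h
  exact ⟨C * c, mul_ne_top hC hc, fun f hf => (mul_le_mul_left (h f hf) c).trans
    (by rw [mul_right_comm])⟩

lemma Dom.of_mul_const {c : ℝ≥0∞} (hc0 : c ≠ 0) (hc : c ≠ ∞) (h : Dom (fun f => P f * c) X) :
    Dom P X := by
  refine Dom.trans (Dom.of_le fun f _ => ?_) (h.mul_const (ENNReal.inv_ne_top.2 hc0))
  rw [mul_assoc, ENNReal.mul_inv_cancel hc0 hc, mul_one]

end Dom

/-! ### The two parts of the Calderón operator -/

/-- `∫_0^y t^α f(t) dt/t`. -/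
def headOp (α : ℝ) (f : ℝ → ℝ≥0∞) (y : ℝ) : ℝ≥0∞ := ∫⁻ t in Iio y, pow α t * f t ∂haar

/-- `∫_y^∞ f(t) dt/t`. -/
def tailOp (f : ℝ → ℝ≥0∞) (y : ℝ) : ℝ≥0∞ := ∫⁻ t in Ioi y, f t ∂haar

/-- The functional of the sum, for decreasing functions. -/
def sumDec (r₁ r₂ : ℝ≥0∞) (α : ℝ) (a f : ℝ → ℝ≥0∞) : ℝ≥0∞ :=
  nrm r₁ (haar.restrict (Ioo 0 1)) (fun t => a t * (pow α t * f t))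
    + nrm r₂ (haar.restrict (Ioi 1)) (fun t => a t * f t)

/-- The functional of the intersection, for decreasing functions. -/
def interDec (r₁ r₂ : ℝ≥0∞) (α : ℝ) (a f : ℝ → ℝ≥0∞) : ℝ≥0∞ :=
  nrm r₂ (haar.restrict (Ioo 0 1)) (fun t => a t * f t)
    + nrm r₁ (haar.restrict (Ioi 1)) (fun t => a t * (pow α t * f t))

section Components

variable {r s : ℝ≥0∞} {a b f : ℝ → ℝ≥0∞} {α : ℝ} {J : Set ℝ}

lemma measurable_headOp : Measurable (headOp α f) := measurable_lintegral_Iio _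

lemma measurable_tailOp : Measurable (tailOp f) := measurable_lintegral_Ioi _

lemma haar_eq_add : haar = haar.restrict (Ioo 0 1) + haar.restrict (Ioi 1) := by
  have hd : Disjoint (Ioo (0 : ℝ) 1) (Ioi 1) := Set.disjoint_left.2 fun t h h' => lt_asymm h.2 h'
  rw [← Measure.restrict_union hd measurableSet_Ioi]
  conv_lhs => rw [← Measure.restrict_univ (μ := haar)]
  refine Measure.restrict_congr_set ?_
  have h1 : ∀ᵐ t ∂haar, t ≠ 1 := compl_mem_ae_iff.2 (measure_singleton 1)
  filter_upwards [haar_Ioi_zero_compl, h1] with t ht ht1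
  refine propext ⟨fun _ => ?_, fun _ => trivial⟩
  rcases lt_or_gt_of_ne ht1 with h | h
  exacts [Or.inl ⟨ht, h⟩, Or.inr h]

lemma headOp_eq_add (y : ℝ) : headOp α f y = ∫⁻ t in Iio y, pow α t * f t ∂(haar.restrict (Ioo 0 1))
    + ∫⁻ t in Iio y, pow α t * f t ∂(haar.restrict (Ioi 1)) := by
  rw [headOp, ← lintegral_add_measure, ← Measure.restrict_add, ← haar_eq_add]

lemma tailOp_eq_add (y : ℝ) : tailOp f y = ∫⁻ t in Ioi y, f t ∂(haar.restrict (Ioo 0 1))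
    + ∫⁻ t in Ioi y, f t ∂(haar.restrict (Ioi 1)) := by
  rw [tailOp, ← lintegral_add_measure, ← Measure.restrict_add, ← haar_eq_add]

lemma headOp_of_le {y : ℝ} (hy : y ≤ 1) :
    headOp α f y = ∫⁻ t in Iio y, pow α t * f t ∂(haar.restrict (Ioo 0 1)) := by
  have h : (haar.restrict (Ioi 1)) (Iio y) = 0 := by
    rw [Measure.restrict_apply measurableSet_Iio, Iio_inter_Ioi, Ioo_eq_empty hy.not_gt, measure_empty]
  rw [headOp_eq_add, Measure.restrict_eq_zero.2 h, lintegral_zero_measure, add_zero]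

lemma tailOp_of_gt {y : ℝ} (hy : 1 < y) :
    tailOp f y = ∫⁻ t in Ioi y, f t ∂(haar.restrict (Ioi 1)) := by
  have h : (haar.restrict (Ioo 0 1)) (Ioi y) = 0 := by
    rw [Measure.restrict_apply measurableSet_Ioi, show Ioi y ∩ Ioo 0 1 = ∅ from
      eq_empty_of_forall_notMem fun t h => lt_asymm (hy.trans h.1) h.2.2, measure_empty]
  rw [tailOp_eq_add, Measure.restrict_eq_zero.2 h, lintegral_zero_measure, zero_add]

lemma headOp_le_add (y : ℝ) :
    headOp α f y ≤ headOp α f 1 + ∫⁻ t in Iio y, pow α t * f t ∂(haar.restrict (Ioi 1)) := by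
  rw [headOp_eq_add]
  refine add_le_add_left (le_trans (lintegral_mono' restrict_le_self le_rfl) ?_) _
  exact lintegral_mono_set Ioo_subset_Iio_self

lemma tailOp_le_add (y : ℝ) :
    tailOp f y ≤ ∫⁻ t in Ioi y, f t ∂(haar.restrict (Ioo 0 1)) + tailOp f 1 := by
  rw [tailOp_eq_add]
  exact add_le_add_right (lintegral_mono' restrict_le_self le_rfl) _

lemma antitone_le_headOp (hα : 0 < α) (hf : Antitone f) {u : ℝ} (hu : 0 < u) :
    f u ≤ ofReal α * (pow (-α) u * headOp α f u) := by
  have h : f u * ∫⁻ t in Iio u, pow α t ∂haar ≤ headOp α f u := by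
    rw [← lintegral_const_mul _ (measurable_pow _)]
    refine setLIntegral_mono' measurableSet_Iio fun t ht => ?_
    rw [mul_comm]
    exact mul_le_mul_right (hf (le_of_lt ht)) _
  rw [setLIntegral_Iio_pow hα hu] at h
  calc f u = ofReal α * (pow (-α) u * (f u * (ofReal α⁻¹ * pow α u))) := by
        rw [show ofReal α * (pow (-α) u * (f u * (ofReal α⁻¹ * pow α u)))
          = f u * (ofReal α * ofReal α⁻¹) * (pow α u * pow (-α) u) by ring,
          pow_mul_neg hu, ← ofReal_mul hα.le, mul_inv_cancel₀ hα.ne', ofReal_one,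
          mul_one, mul_one]
    _ ≤ _ := by gcongr

lemma dom_tail_of_head (hα : 0 < α) (hb : Regular b) (hs : 1 ≤ s) :
    Dom (fun f => nrm s (haar.restrict J) fun y => b y * (pow α y * ∫⁻ u in Ioi y, f u ∂(haar.restrict J)))
      (fun f => nrm s (haar.restrict J) fun y => b y * headOp α f y) := by
  obtain ⟨C, hC, h⟩ := hb.hardy_Ioi hα
  refine ⟨ofReal α * C, mul_ne_top ofReal_ne_top hC, fun f hf => ?_⟩
  have hs0 : s ≠ 0 := (one_pos.trans_le hs).ne'
  have hm : Measurable fun u => pow (-α) u * headOp α f u :=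
    measurable_mul' (measurable_pow _) measurable_headOp
  have hm2 : Measurable fun y => b y * (pow α y * ∫⁻ u in Ioi y, pow (-α) u * headOp α f u
      ∂(haar.restrict J)) :=
    measurable_mul' hb.measurable (measurable_mul' (measurable_pow _) (measurable_lintegral_Ioi _))
  rw [mul_assoc]
  refine le_trans ?_ (mul_le_mul_right (h J s hs _ measurable_headOp) _)
  rw [← nrm_const_mul hs0 _ hm2.aemeasurable]
  refine nrm_mono (ae_of_all _ fun y => ?_)
  have hle : ∫⁻ u in Ioi y, f u ∂(haar.restrict J)
      ≤ ofReal α * ∫⁻ u in Ioi y, pow (-α) u * headOp α f u ∂(haar.restrict J) := by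
    rw [← lintegral_const_mul _ hm]
    exact lintegral_mono_ae (ae_restrict_of_ae (ae_haar_restrict_pos.mono fun u hu =>
      antitone_le_headOp hα hf hu))
  exact (mul_le_mul_right (mul_le_mul_right hle _) _).trans_eq (by ring)

lemma head_le_tail (hf : Measurable f) {c : ℝ≥0∞}
    (hc : ∀ t ∈ J, pow α t ≤ c + ofReal α * ∫⁻ τ in Iio t, pow α τ ∂(haar.restrict J))
    (hJ : MeasurableSet J) (y : ℝ) :
    ∫⁻ t in Iio y, pow α t * f t ∂(haar.restrict J) ≤ c * ∫⁻ t in Iio y, f t ∂(haar.restrict J)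
      + ofReal α * ∫⁻ τ in Iio y, pow α τ * tailOp f τ ∂(haar.restrict J) := by
  have hm : Measurable fun t => (∫⁻ τ in Iio t, pow α τ ∂(haar.restrict J)) * f t :=
    measurable_mul' (measurable_lintegral_Iio _) hf
  calc ∫⁻ t in Iio y, pow α t * f t ∂(haar.restrict J)
      ≤ ∫⁻ t in Iio y, (c * f t + ofReal α *
          ((∫⁻ τ in Iio t, pow α τ ∂(haar.restrict J)) * f t)) ∂(haar.restrict J) := by
        refine lintegral_mono_ae (ae_restrict_of_ae ((ae_restrict_mem hJ).mono fun t ht => ?_))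
        rw [← mul_assoc, ← add_mul]
        exact mul_le_mul_left (hc t ht) _
    _ = c * ∫⁻ t in Iio y, f t ∂(haar.restrict J) + ofReal α *
          ∫⁻ t in Iio y, (∫⁻ τ in Iio t, pow α τ ∂(haar.restrict J)) * f t ∂(haar.restrict J) := by
        rw [lintegral_add_left (hf.const_mul c), lintegral_const_mul _ hf, lintegral_const_mul _ hm]
    _ ≤ _ := by
        refine add_le_add_right (mul_le_mul_right ?_ _) _
        rw [lintegral_lintegral_Iio_mul (measurable_pow α) hf, ← lintegral_indicator measurableSet_Iio]
        refine lintegral_mono fun τ => ?_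
        rw [restrict_restrict measurableSet_Ioi]
        by_cases h : τ < y
        · rw [indicator_of_mem (by exact h)]
          refine mul_le_mul_right ?_ _
          rw [tailOp]
          exact lintegral_mono' (Measure.restrict_mono inter_subset_left restrict_le_self) le_rfl
        · rw [Ioi_inter_Iio, Ioo_eq_empty h]; simp

lemma pow_le_Ioo (hα : 0 < α) : ∀ t ∈ Ioo (0 : ℝ) 1,
    pow α t ≤ 0 + ofReal α * ∫⁻ τ in Iio t, pow α τ ∂(haar.restrict (Ioo 0 1)) := by
  intro t ht
  have h := headOp_of_le (α := α) (f := fun _ => 1) ht.2.le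
  simp only [headOp, mul_one] at h
  rw [← h, setLIntegral_Iio_pow hα ht.1, ← mul_assoc, ← ofReal_mul hα.le,
    mul_inv_cancel₀ hα.ne', ofReal_one, one_mul, zero_add]

lemma pow_le_Ioi (hα : 0 < α) : ∀ t ∈ Ioi (1 : ℝ),
    pow α t ≤ 1 + ofReal α * ∫⁻ τ in Iio t, pow α τ ∂(haar.restrict (Ioi 1)) := by
  intro t ht
  have h := headOp_le_add (α := α) (f := fun _ => 1) t
  simp only [headOp, mul_one] at h
  rw [setLIntegral_Iio_pow hα (one_pos.trans ht), setLIntegral_Iio_pow hα one_pos] at h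
  have h' := mul_le_mul_right h (ofReal α)
  rw [mul_add, ← mul_assoc, ← mul_assoc, ← ofReal_mul hα.le, mul_inv_cancel₀ hα.ne',
    ofReal_one, one_mul, one_mul] at h'
  simpa [pow] using h'

lemma dom_head_of_tail (hα : 0 < α) (hb : Regular b) (hs : 1 ≤ s) {K : (ℝ → ℝ≥0∞) → ℝ≥0∞}
    (hK : ∀ f, Antitone f → ∀ y, ∫⁻ t in Iio y, pow α t * f t ∂(haar.restrict J)
      ≤ K f + ofReal α * ∫⁻ τ in Iio y, pow α τ * tailOp f τ ∂(haar.restrict J)) :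
    Dom (fun f => nrm s (haar.restrict J) fun y => b y * (pow (-α) y *
        ∫⁻ t in Iio y, pow α t * f t ∂(haar.restrict J)))
      (fun f => K f * nrm s (haar.restrict J) (fun y => pow (-α) y * b y)
        + nrm s (haar.restrict J) fun y => b y * tailOp f y) := by
  obtain ⟨C, hC, h⟩ := hb.hardy_Iio hα
  refine ⟨1 + ofReal α * C, ENNReal.add_ne_top.2 ⟨one_ne_top,
    mul_ne_top ofReal_ne_top hC⟩, fun f hf => ?_⟩
  have hs0 : s ≠ 0 := (one_pos.trans_le hs).ne'
  have hm1 : Measurable fun y => pow (-α) y * b y := measurable_mul' (measurable_pow _) hb.measurable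
  have hm2 : Measurable fun y => b y * (pow (-α) y * ∫⁻ τ in Iio y, pow α τ * tailOp f τ
      ∂(haar.restrict J)) :=
    measurable_mul' hb.measurable (measurable_mul' (measurable_pow _) (measurable_lintegral_Iio _))
  have hle : nrm s (haar.restrict J) (fun y => b y * (pow (-α) y *
        ∫⁻ t in Iio y, pow α t * f t ∂(haar.restrict J)))
      ≤ K f * nrm s (haar.restrict J) (fun y => pow (-α) y * b y) + ofReal α *
        nrm s (haar.restrict J) (fun y => b y * (pow (-α) y * ∫⁻ τ in Iio y, pow α τ * tailOp f τ
          ∂(haar.restrict J))) := by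
    rw [← nrm_const_mul hs0 _ hm1.aemeasurable, ← nrm_const_mul hs0 _ hm2.aemeasurable]
    refine (nrm_mono (ae_of_all _ fun y => ?_)).trans (nrm_add_le hs (hm1.const_mul _).aemeasurable
      (hm2.const_mul _).aemeasurable)
    refine (mul_le_mul_right (mul_le_mul_right (hK f hf y) _) _).trans_eq ?_
    ring
  refine hle.trans ?_
  rw [add_mul, one_mul]
  have := mul_le_mul_right (h J s hs _ (measurable_tailOp (f := f))) (ofReal α)
  rw [← mul_assoc] at this
  exact add_le_add le_self_add (this.trans (mul_le_mul_right le_add_self _))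

lemma lintegral_le_nrm_weight (hr : 1 ≤ r) {w : ℝ → ℝ≥0∞} (hw : Measurable w)
    (hw0 : ∀ t, 0 < t → w t ≠ 0 ∧ w t ≠ ∞) (hf : Measurable f) :
    ∫⁻ t, f t ∂(haar.restrict J) ≤ nrm r (haar.restrict J) (fun t => w t * f t)
      * nrm (conjExponent r) (haar.restrict J) (fun t => (w t)⁻¹) := by
  have hwi : Measurable fun t => (w t)⁻¹ := hw.inv
  have hm : Measurable fun t => w t * f t := measurable_mul' hw hf
  rw [mul_comm]
  refine le_trans (lintegral_mono_ae ?_) (lintegral_mul_le_nrm hr hwi.aemeasurable hm.aemeasurable)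
  filter_upwards [ae_haar_restrict_pos] with t ht
  rw [← mul_assoc, ENNReal.inv_mul_cancel (hw0 t ht).1 (hw0 t ht).2, one_mul]

lemma Regular.lintegral_Ioo_le (ha : Regular a) (hr : 1 ≤ r) {c d : ℝ} (hc : 0 < c)
    (hJ : Ioo c d ⊆ J) : ∃ C : ℝ≥0∞, C ≠ ∞ ∧ ∀ f : ℝ → ℝ≥0∞, Measurable f →
      ∫⁻ t in Ioo c d, f t ∂haar ≤ C * nrm r (haar.restrict J) (fun t => a t * f t) := by
  refine ⟨nrm (conjExponent r) (haar.restrict (Ioo c d)) (fun t => (a t)⁻¹),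
    ha.inv.nrm_Ioo_ne_top hc conjExponent_ne_zero, fun f hf => ?_⟩
  rw [mul_comm]
  exact (lintegral_le_nrm_weight hr ha.measurable (fun t ht => ⟨ha.ne_zero t ht, ha.ne_top t ht⟩)
    hf).trans (mul_le_mul_left (nrm_mono_measure (restrict_mono_set _ hJ)) _)

lemma Regular.dom_headOp_one (ha : Regular a) (hα : 0 < α) (hr : 1 ≤ r) :
    Dom (fun f => headOp α f 1) (fun f => nrm r (haar.restrict (Ioo 0 1)) fun t => a t * f t) := by
  have hfin : nrm (conjExponent r) (haar.restrict (Ioo 0 1)) (fun t => (a t * pow (-α) t)⁻¹) ≠ ∞ := by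
    refine ((nrm_congr ?_).trans_ne (ha.inv.nrm_pow_Ioo_ne_top hα conjExponent_ne_zero))
    filter_upwards [ae_haar_restrict_pos] with t ht
    rw [ENNReal.mul_inv (Or.inr (pow_ne_top ht)) (Or.inr (pow_ne_zero ht)), mul_comm]
    congr 1
    exact (ENNReal.eq_inv_of_mul_eq_one_left (pow_mul_neg ht)).symm
  refine Dom.trans (Dom.of_le fun f hf => ?_)
    ((Dom.of_le fun f _ => le_rfl : Dom (fun f => nrm r (haar.restrict (Ioo 0 1))
      fun t => a t * f t) _).mul_const hfin)
  have h := lintegral_le_nrm_weight (J := Ioo 0 1) (f := fun t => pow α t * f t) hr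
    (measurable_mul' ha.measurable (measurable_pow (-α)))
    (fun t ht => ⟨mul_ne_zero (ha.ne_zero t ht) (pow_ne_zero ht),
      mul_ne_top (ha.ne_top t ht) (pow_ne_top ht)⟩)
    (measurable_mul' (measurable_pow α) hf.measurable)
  have e : headOp α f 1 = ∫⁻ t, pow α t * f t ∂(haar.restrict (Ioo 0 1)) := by
    rw [headOp_of_le le_rfl, restrict_restrict measurableSet_Iio,
      inter_eq_right.2 Ioo_subset_Iio_self]
  rw [e]
  refine h.trans (mul_le_mul_left (nrm_mono ?_) _)
  filter_upwards [ae_haar_restrict_pos] with t ht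
  rw [show a t * pow (-α) t * (pow α t * f t) = a t * f t * (pow α t * pow (-α) t) by ring,
    pow_mul_neg ht, mul_one]

lemma Regular.exists_lintegral_Ioi_le (ha : Regular a) (hα : 0 < α) (hr : 1 ≤ r) :
    ∃ C : ℝ≥0∞, C ≠ ∞ ∧ ∀ f : ℝ → ℝ≥0∞, Measurable f → tailOp f 1 ≤
      C * nrm r (haar.restrict (Ioi 1)) (fun t => a t * (pow α t * f t)) := by
  refine ⟨nrm (conjExponent r) (haar.restrict (Ioi 1)) (fun t => (a t * pow α t)⁻¹), ?_, fun f hf => ?_⟩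
  · refine ((nrm_congr ?_).trans_ne (ha.inv.nrm_pow_Ioi_ne_top hα conjExponent_ne_zero))
    filter_upwards [ae_haar_restrict_pos] with t ht
    rw [ENNReal.mul_inv (Or.inr (pow_ne_top ht)) (Or.inr (pow_ne_zero ht)), mul_comm]
    congr 1
    exact (ENNReal.eq_inv_of_mul_eq_one_left (by rw [mul_comm, pow_mul_neg ht])).symm
  · have h := lintegral_le_nrm_weight (J := Ioi 1) hr
      (measurable_mul' ha.measurable (measurable_pow α))
      (fun t ht => ⟨mul_ne_zero (ha.ne_zero t ht) (pow_ne_zero ht),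
        mul_ne_top (ha.ne_top t ht) (pow_ne_top ht)⟩) hf
    simp_rw [mul_assoc] at h
    rw [mul_comm]
    exact h

end Components

section SpaceEstimates

variable {r r₁ r₂ s s₁ s₂ : ℝ≥0∞} {a b : ℝ → ℝ≥0∞} {α : ℝ} {J : Set ℝ}
  {X c : (ℝ → ℝ≥0∞) → ℝ≥0∞}

lemma dom_three {l : Measure ℝ} (hs : 1 ≤ s) {P F G : (ℝ → ℝ≥0∞) → ℝ → ℝ≥0∞} {K : ℝ → ℝ≥0∞}
    (hFm : ∀ f, Measurable (F f)) (hGm : ∀ f, Measurable (G f)) (hKm : Measurable K)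
    (hF : Dom (fun f => nrm s l (F f)) X) (hG : Dom (fun f => nrm s l (G f)) X) (hc : Dom c X)
    (hK : nrm s l K ≠ ∞) (h : ∀ f, ∀ᵐ y ∂l, P f y ≤ F f y + G f y + c f * K y) :
    Dom (fun f => nrm s l (P f)) X := by
  refine Dom.trans (Dom.of_le fun f _ => ?_) ((hF.add hG).add (hc.mul_const hK))
  have hm := (hFm f).add (hGm f)
  refine (nrm_mono (h f)).trans ((nrm_add_le hs hm.aemeasurable (hKm.const_mul _).aemeasurable).trans ?_)
  rw [nrm_const_mul (one_pos.trans_le hs).ne' _ hKm.aemeasurable]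
  exact add_le_add_left (nrm_add_le hs (hFm f).aemeasurable (hGm f).aemeasurable) _

lemma mul_nrm_Ioo_le (hs0 : s ≠ 0) (hb : Regular b) {u v : ℝ} (hJ : Ioo u v ⊆ J) {k : ℝ≥0∞}
    {F : ℝ → ℝ≥0∞} (h : ∀ y ∈ Ioo u v, k ≤ F y) :
    k * nrm s (haar.restrict (Ioo u v)) b ≤ nrm s (haar.restrict J) (fun y => b y * F y) := by
  rw [← nrm_const_mul hs0 _ hb.measurable.aemeasurable]
  refine (nrm_mono ?_).trans (nrm_mono_measure (m := haar.restrict (Ioo u v))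
    (restrict_mono_set _ hJ))
  filter_upwards [ae_restrict_mem measurableSet_Ioo] with y hy
  rw [mul_comm]
  exact mul_le_mul_right (h y hy) _

lemma Dom.of_nrm (hs : 1 ≤ s) (hb : Regular b) {u v : ℝ} (hu : 0 < u) (huv : u < v) (hJ : Ioo u v ⊆ J)
    {F : (ℝ → ℝ≥0∞) → ℝ → ℝ≥0∞} (h : ∀ f, Antitone f → ∀ y ∈ Ioo u v, c f ≤ F f y)
    (hF : Dom (fun f => nrm s (haar.restrict J) fun y => b y * F f y) X) : Dom c X := by
  have hs0 : s ≠ 0 := (one_pos.trans_le hs).ne'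
  refine Dom.of_mul_const (c := nrm s (haar.restrict (Ioo u v)) b)
    (nrm_pos_of_Ioo_subset hs0 hu huv le_rfl hb.measurable fun t ht => hb.ne_zero t (hu.trans ht.1))
    (hb.nrm_Ioo_ne_top hu hs0) ((Dom.of_le fun f hf => ?_).trans hF)
  exact mul_nrm_Ioo_le hs0 hb hJ (h f hf)

lemma nrm_ne_top_of_mul (hs : 1 ≤ s) (hb : Regular b) {u v : ℝ} (hu : 0 < u) {δ : ℝ≥0∞} (hδ0 : δ ≠ 0)
    (hδ : δ ≠ ∞) {G : ℝ → ℝ≥0∞} (hG : Measurable G) (hJ : MeasurableSet J)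
    (h : ∀ y ∈ J, y ∉ Ioo u v → δ ≤ G y)
    (hfin : nrm s (haar.restrict J) (fun y => b y * G y) ≠ ∞) : nrm s (haar.restrict J) b ≠ ∞ := by
  have hs0 : s ≠ 0 := (one_pos.trans_le hs).ne'
  have hm : Measurable fun y => δ⁻¹ * (b y * G y) := (measurable_mul' hb.measurable hG).const_mul _
  have hi := hb.measurable.indicator (measurableSet_Ioo (a := u) (b := v))
  refine ne_top_of_le_ne_top (ENNReal.add_ne_top.2 ⟨?_, ?_⟩) ((nrm_mono ?_).trans
    (nrm_add_le hs hm.aemeasurable hi.aemeasurable))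
  · rw [nrm_const_mul hs0 _ (measurable_mul' hb.measurable hG).aemeasurable]
    exact mul_ne_top (ENNReal.inv_ne_top.2 hδ0) hfin
  · exact ne_top_of_le_ne_top (hb.nrm_Ioo_ne_top hu hs0) ((nrm_mono_measure
      restrict_le_self).trans (eLpNorm_indicator_eq_eLpNorm_restrict measurableSet_Ioo).le)
  · filter_upwards [ae_restrict_mem hJ] with y hy
    by_cases hyu : y ∈ Ioo u v
    · rw [indicator_of_mem hyu]; exact le_add_self
    · refine le_trans ?_ le_self_add
      calc b y = δ⁻¹ * (b y * δ) := by
            rw [mul_comm (b y), ← mul_assoc, ENNReal.inv_mul_cancel hδ0 hδ, one_mul]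
        _ ≤ _ := mul_le_mul_right (mul_le_mul_right (h y hy hyu) _) _

lemma dom_tail_Ioo (hα : 0 < α) (hb : Regular b) (hs : 1 ≤ s)
    (hT : Dom (fun f => nrm s (haar.restrict (Ioo 0 1)) fun y => b y * tailOp f y) X) :
    Dom (fun f => nrm s (haar.restrict (Ioo 0 1)) fun y => b y * (pow (-α) y *
        ∫⁻ t in Iio y, pow α t * f t ∂(haar.restrict (Ioo 0 1)))) X :=
  (dom_head_of_tail hα hb hs (K := fun _ => 0) fun f hf y => by
    simpa using head_le_tail hf.measurable (pow_le_Ioo hα) measurableSet_Ioo y).trans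
    ((Dom.of_le fun f _ => by simp).trans hT)

lemma dom_tail_Ioi (hα : 0 < α) (hb : Regular b) (hs : 1 ≤ s)
    (hT : Dom (fun f => nrm s (haar.restrict (Ioi 1)) fun y => b y * tailOp f y) X)
    (hT1 : Dom (fun f => tailOp f 1) X) :
    Dom (fun f => nrm s (haar.restrict (Ioi 1)) fun y => b y * (pow (-α) y *
        ∫⁻ t in Iio y, pow α t * f t ∂(haar.restrict (Ioi 1)))) X :=
  (dom_head_of_tail hα hb hs (K := fun f => tailOp f 1) fun f hf y =>
    (head_le_tail hf.measurable (pow_le_Ioi hα) measurableSet_Ioi y).trans (add_le_add_left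
      ((one_mul _).trans_le (lintegral_mono' restrict_le_self le_rfl)) _)).trans
    ((hT1.mul_const (hb.nrm_pow_Ioi_ne_top hα (one_pos.trans_le hs).ne')).add hT)

section Measurability

variable {f : ℝ → ℝ≥0∞} {l : Measure ℝ}

lemma measurable_weighted_head (hb : Regular b) (γ : ℝ) : Measurable fun y => b y * (pow γ y *
    ∫⁻ t in Iio y, f t ∂l) :=
  measurable_mul' hb.measurable (measurable_mul' (measurable_pow _) (measurable_lintegral_Iio _))

lemma measurable_weighted_tail (hb : Regular b) (γ : ℝ) : Measurable fun y => b y * (pow γ y *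
    ∫⁻ t in Ioi y, f t ∂l) :=
  measurable_mul' hb.measurable (measurable_mul' (measurable_pow _) (measurable_lintegral_Ioi _))

lemma measurable_pow_mul (hb : Regular b) (γ : ℝ) : Measurable fun y => pow γ y * b y :=
  measurable_mul' (measurable_pow _) hb.measurable

end Measurability

/-- The target functional of the sum together with the values at `1`. -/
def sumTarget (s₁ s₂ : ℝ≥0∞) (α : ℝ) (b f : ℝ → ℝ≥0∞) : ℝ≥0∞ :=
  nrm s₁ (haar.restrict (Ioo 0 1)) (fun y => b y * (headOp α f y + pow α y * tailOp f y))
    + nrm s₂ (haar.restrict (Ioi 1)) (fun y => b y * (pow (-α) y * headOp α f y + tailOp f y))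
    + (headOp α f 1 + tailOp f 1)

/-- The target functional of the intersection together with the values at `1`. -/
def interTarget (s₁ s₂ : ℝ≥0∞) (α : ℝ) (b f : ℝ → ℝ≥0∞) : ℝ≥0∞ :=
  nrm s₂ (haar.restrict (Ioo 0 1)) (fun y => b y * (pow (-α) y * headOp α f y + tailOp f y))
    + nrm s₁ (haar.restrict (Ioi 1)) (fun y => b y * (headOp α f y + pow α y * tailOp f y))
    + (headOp α f 1 + tailOp f 1)

theorem dom_sumTarget (hα : 0 < α) (hr₁ : 1 ≤ r₁) (hs₁ : 1 ≤ s₁) (hr₂ : 1 ≤ r₂) (hs₂ : 1 ≤ s₂)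
    (ha : Regular a) (hb : Regular b) (hL : HardyBound r₁ s₁ a b (haar.restrict (Ioo 0 1)))
    (hR : DecBound r₂ s₂ a b (haar.restrict (Ioi 1))) :
    Dom (sumTarget s₁ s₂ α b) (sumDec r₁ r₂ α a) := by
  have d₁ : Dom (fun f => nrm r₁ (haar.restrict (Ioo 0 1)) fun t => a t * (pow α t * f t))
      (sumDec r₁ r₂ α a) := Dom.of_le fun f _ => le_self_add
  have d₂ : Dom (fun f => nrm r₂ (haar.restrict (Ioi 1)) fun t => a t * f t)
      (sumDec r₁ r₂ α a) := Dom.of_le fun f _ => le_add_self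
  have dH : Dom (fun f => nrm s₁ (haar.restrict (Ioo 0 1)) fun y => b y * headOp α f y)
      (sumDec r₁ r₂ α a) := by
    obtain ⟨C, hC, h⟩ := hL
    refine Dom.trans ⟨C, hC, fun f hf => ?_⟩ d₁
    refine le_trans (nrm_mono ?_) (h _ (measurable_mul' (measurable_pow α) hf.measurable))
    filter_upwards [ae_restrict_mem measurableSet_Ioo] with y hy
    rw [headOp_of_le hy.2.le]
  have dT : Dom (fun f => nrm s₂ (haar.restrict (Ioi 1)) fun y => b y * tailOp f y)
      (sumDec r₁ r₂ α a) := by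
    refine Dom.trans (Dom.of_le fun f hf => nrm_mono ?_) (Dom.trans hR d₂)
    filter_upwards [ae_restrict_mem measurableSet_Ioi] with y hy
    rw [tailOp_of_gt hy]
  have dH1 : Dom (fun f => headOp α f 1) (sumDec r₁ r₂ α a) := by
    obtain ⟨C, hC, h⟩ := ha.lintegral_Ioo_le hr₁ (c := 1 / 4) (d := 1) (J := Ioo 0 1) (by norm_num)
      (Ioo_subset_Ioo_left (by norm_num))
    have e1 : Dom (fun f => headOp α f (1 / 2)) (sumDec r₁ r₂ α a) :=
      Dom.of_nrm hs₁ hb (u := 1 / 2) (v := 1) (by norm_num) (by norm_num)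
        (Ioo_subset_Ioo_left (by norm_num))
        (fun f _ y hy => lintegral_mono_set (Iio_subset_Iio hy.1.le)) dH
    have e2 : Dom (fun f => ∫⁻ t in Ioo (1 / 4) 1, pow α t * f t ∂haar) (sumDec r₁ r₂ α a) :=
      Dom.trans ⟨C, hC, fun f hf => h _ (measurable_mul' (measurable_pow α) hf.measurable)⟩ d₁
    refine Dom.trans (Dom.of_le fun f _ => ?_) (e1.add e2)
    refine (lintegral_mono_set fun t ht => ?_).trans (lintegral_union_le _ _ _)
    by_cases h : t < 1 / 2
    exacts [Or.inl h, Or.inr ⟨by linarith, ht⟩]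
  have dT1 : Dom (fun f => tailOp f 1) (sumDec r₁ r₂ α a) := by
    obtain ⟨C, hC, h⟩ := ha.lintegral_Ioo_le hr₂ (c := 1) (d := 3) (J := Ioi 1) one_pos
      Ioo_subset_Ioi_self
    have e1 : Dom (fun f => tailOp f 2) (sumDec r₁ r₂ α a) :=
      Dom.of_nrm hs₂ hb (u := 1) (v := 2) one_pos (by norm_num) Ioo_subset_Ioi_self
        (fun f _ y hy => lintegral_mono_set (Ioi_subset_Ioi hy.2.le)) dT
    have e2 : Dom (fun f => ∫⁻ t in Ioo 1 3, f t ∂haar) (sumDec r₁ r₂ α a) :=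
      Dom.trans ⟨C, hC, fun f hf => h _ hf.measurable⟩ d₂
    refine Dom.trans (Dom.of_le fun f _ => ?_) (e1.add e2)
    refine (lintegral_mono_set fun t ht => ?_).trans (lintegral_union_le _ _ _)
    by_cases h : 2 < t
    exacts [Or.inl h, Or.inr ⟨ht, by linarith⟩]
  refine Dom.add (Dom.add ?_ ?_) (dH1.add dT1)
  · refine dom_three hs₁ (fun f => measurable_mul' hb.measurable measurable_headOp)
      (fun f => measurable_weighted_tail hb α) (measurable_pow_mul hb α) dH
      ((dom_tail_of_head hα hb hs₁).trans dH) dT1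
      (hb.nrm_pow_Ioo_ne_top hα (one_pos.trans_le hs₁).ne') fun f => ae_of_all _ fun y => ?_
    exact (mul_le_mul_right (add_le_add_right (mul_le_mul_right (tailOp_le_add y) _) _) _).trans_eq
      (by ring)
  · refine dom_three hs₂ (fun f => measurable_mul' hb.measurable measurable_tailOp)
      (fun f => measurable_weighted_head hb (-α)) (measurable_pow_mul hb (-α)) dT
      (dom_tail_Ioi hα hb hs₂ dT dT1) dH1
      (hb.nrm_pow_Ioi_ne_top hα (one_pos.trans_le hs₂).ne') fun f => ae_of_all _ fun y => ?_
    exact (mul_le_mul_right (add_le_add_left (mul_le_mul_right (headOp_le_add y) _) _) _).trans_eq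
      (by ring)

theorem dom_interTarget_of_ne_top (hα : 0 < α) (hr₁ : 1 ≤ r₁) (hs₁ : 1 ≤ s₁) (hr₂ : 1 ≤ r₂)
    (hs₂ : 1 ≤ s₂) (ha : Regular a) (hb : Regular b)
    (hfin : nrm r₂ (haar.restrict (Ioo 0 1)) a ≠ ∞) (hL : HardyBound r₁ s₁ a b (haar.restrict (Ioi 1)))
    (hR : DecBound r₂ s₂ a b (haar.restrict (Ioo 0 1))) :
    Dom (interTarget s₁ s₂ α b) (interDec r₁ r₂ α a) := by
  have d₂ : Dom (fun f => nrm r₂ (haar.restrict (Ioo 0 1)) fun t => a t * f t)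
      (interDec r₁ r₂ α a) := Dom.of_le fun f _ => le_self_add
  have d₁ : Dom (fun f => nrm r₁ (haar.restrict (Ioi 1)) fun t => a t * (pow α t * f t))
      (interDec r₁ r₂ α a) := Dom.of_le fun f _ => le_add_self
  have dH1 : Dom (fun f => headOp α f 1) (interDec r₁ r₂ α a) := (ha.dom_headOp_one hα hr₂).trans d₂
  have dT1 : Dom (fun f => tailOp f 1) (interDec r₁ r₂ α a) := by
    obtain ⟨C, hC, h⟩ := ha.exists_lintegral_Ioi_le hα hr₁
    exact Dom.trans ⟨C, hC, fun f hf => h f hf.measurable⟩ d₁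
  have hb₂ : nrm s₂ (haar.restrict (Ioo 0 1)) b ≠ ∞ := by
    obtain ⟨C, hC, h⟩ := hR
    have h1 := DecBound.kerHead_le h 1
    rw [kerHead, restrict_restrict measurableSet_Iio, inter_eq_right.2 Ioo_subset_Iio_self] at h1
    refine nrm_ne_top_of_mul hs₂ hb (u := 1 / 4) (v := 1) (δ := ofReal (Real.log (1 / (1 / 4))))
      (by norm_num) ?_ ofReal_ne_top (measurable_kernel_left (l := haar.restrict (Ioo 0 1)) 1)
      measurableSet_Ioo (fun y hy hyu => ?_) (ne_top_of_le_ne_top (mul_ne_top hC hfin) h1)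
    · rw [Ne, ofReal_eq_zero, not_le]; exact Real.log_pos (by norm_num)
    · have hy4 : y ≤ 1 / 4 := by by_contra hc; exact hyu ⟨not_le.1 hc, hy.2⟩
      rw [Measure.restrict_eq_self _ (Ioo_subset_Ioo_left hy.1.le), haar_Ioo hy.1 one_pos]
      exact ofReal_le_ofReal (Real.log_le_log (by norm_num)
        (one_div_le_one_div_of_le hy.1 hy4))
  have hb₁ : nrm s₁ (haar.restrict (Ioi 1)) b ≠ ∞ := by
    obtain ⟨C, hC, h⟩ := hL
    have h1 := h ((Ioo 1 2).indicator 1) (measurable_one.indicator measurableSet_Ioo)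
    have h2 : nrm r₁ (haar.restrict (Ioi 1)) (fun t => a t * (Ioo 1 2).indicator 1 t) ≠ ∞ := by
      have e : (fun t => a t * (Ioo 1 2).indicator 1 t) = (Ioo 1 2).indicator a := by
        ext t; by_cases ht : t ∈ Ioo (1 : ℝ) 2 <;> simp [ht]
      rw [e]
      exact ne_top_of_le_ne_top (ha.nrm_Ioo_ne_top one_pos (one_pos.trans_le hr₁).ne')
        ((nrm_mono_measure restrict_le_self).trans
          (eLpNorm_indicator_eq_eLpNorm_restrict measurableSet_Ioo).le)
    refine nrm_ne_top_of_mul hs₁ hb (u := 1) (v := 2) (δ := ofReal (Real.log (2 / 1)))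
      one_pos ?_ ofReal_ne_top (measurable_lintegral_Iio _)
      measurableSet_Ioi (fun y hy hyu => ?_) (ne_top_of_le_ne_top (mul_ne_top hC h2) h1)
    · rw [Ne, ofReal_eq_zero, not_le]; exact Real.log_pos (by norm_num)
    · have hy2 : 2 ≤ y := by by_contra hc; exact hyu ⟨hy, not_le.1 hc⟩
      rw [lintegral_indicator_one measurableSet_Ioo, restrict_restrict measurableSet_Iio,
        ← haar_Ioo one_pos two_pos]
      refine (Measure.restrict_eq_self _ fun t ht => ?_).ge
      exact ⟨ht.2.trans_le hy2, ht.1⟩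
  have dH : Dom (fun f => nrm s₁ (haar.restrict (Ioi 1)) fun y => b y * headOp α f y)
      (interDec r₁ r₂ α a) := by
    obtain ⟨C, hC, h⟩ := hL
    refine dom_three (c := fun f => headOp α f 1) (G := fun _ _ => 0) hs₁
      (fun f => measurable_mul' hb.measurable (measurable_lintegral_Iio _))
      (fun _ => measurable_const) hb.measurable
      (Dom.trans ⟨C, hC, fun f hf => h _ (measurable_mul' (measurable_pow α) hf.measurable)⟩ d₁)
      (Dom.of_le fun f _ => by simp [nrm]) dH1 hb₁ fun f => ae_of_all _ fun y => ?_
    exact (mul_le_mul_right (headOp_le_add y) _).trans_eq (by ring)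
  have dT : Dom (fun f => nrm s₂ (haar.restrict (Ioo 0 1)) fun y => b y * tailOp f y)
      (interDec r₁ r₂ α a) := by
    refine dom_three (c := fun f => tailOp f 1) (G := fun _ _ => 0) hs₂
      (fun f => measurable_mul' hb.measurable (measurable_lintegral_Ioi _))
      (fun _ => measurable_const) hb.measurable (Dom.trans hR d₂)
      (Dom.of_le fun f _ => by simp [nrm]) dT1 hb₂ fun f => ae_of_all _ fun y => ?_
    exact (mul_le_mul_right (tailOp_le_add y) _).trans_eq (by ring)
  refine Dom.add (Dom.add ?_ ?_) (dH1.add dT1)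
  · refine dom_three (c := fun _ => 0) hs₂ (fun f => measurable_mul' hb.measurable measurable_tailOp)
      (fun f => measurable_weighted_head hb (-α)) hb.measurable dT (dom_tail_Ioo hα hb hs₂ dT)
      (Dom.of_le fun f _ => zero_le) hb₂ fun f => ?_
    filter_upwards [ae_restrict_mem measurableSet_Ioo] with y hy
    rw [headOp_of_le hy.2.le]
    exact le_of_eq (by ring)
  · refine dom_three (c := fun _ => 0) hs₁ (fun f => measurable_mul' hb.measurable measurable_headOp)
      (fun f => measurable_weighted_tail hb α) hb.measurable dH ((dom_tail_of_head hα hb hs₁).trans dH)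
      (Dom.of_le fun f _ => zero_le) hb₁ fun f => ?_
    filter_upwards [ae_restrict_mem measurableSet_Ioi] with y hy
    rw [tailOp_of_gt hy]
    exact le_of_eq (by ring)

theorem dom_interTarget (hα : 0 < α) (hr₁ : 1 ≤ r₁) (hs₁ : 1 ≤ s₁) (hr₂ : 1 ≤ r₂)
    (hs₂ : 1 ≤ s₂) (ha : Regular a) (hb : Regular b) (hL : HardyBound r₁ s₁ a b (haar.restrict (Ioi 1)))
    (hR : nrm r₂ (haar.restrict (Ioo 0 1)) a ≠ ∞ → DecBound r₂ s₂ a b (haar.restrict (Ioo 0 1))) :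
    Dom (interTarget s₁ s₂ α b) (interDec r₁ r₂ α a) := by
  by_cases hfin : nrm r₂ (haar.restrict (Ioo 0 1)) a = ∞
  swap
  · exact dom_interTarget_of_ne_top hα hr₁ hs₁ hr₂ hs₂ ha hb hfin hL (hR hfin)
  have hr0 : r₂ ≠ 0 := (one_pos.trans_le hr₂).ne'
  refine ⟨1, one_ne_top, fun f hf => ?_⟩
  rw [one_mul]
  by_cases h0 : ∀ t, 0 < t → f t = 0
  · have hf0 : ∀ᵐ t ∂haar, f t = 0 := haar_Ioi_zero_compl.mono h0
    have e1 : ∀ y, headOp α f y = 0 := fun y => by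
      rw [headOp, lintegral_congr_ae (g := fun _ => 0) (ae_restrict_of_ae (hf0.mono fun t ht => by
        simp [ht])), lintegral_zero]
    have e2 : ∀ y, tailOp f y = 0 := fun y => by
      rw [tailOp, lintegral_congr_ae (g := fun _ => 0) (ae_restrict_of_ae (hf0.mono fun t ht => by
        simp [ht])), lintegral_zero]
    simp [interTarget, e1, e2, nrm]
  · push Not at h0
    obtain ⟨t, ht, hft⟩ := h0
    have h1 : f t * nrm r₂ (haar.restrict ((Ioo 0 1) ∩ Iio t)) a ≤ interDec r₁ r₂ α a f := by
      refine le_trans ?_ le_self_add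
      rw [← nrm_const_mul hr0 _ ha.measurable.aemeasurable]
      refine (nrm_mono ?_).trans (nrm_mono_measure (m := haar.restrict ((Ioo 0 1) ∩ Iio t))
        (restrict_mono_set _ inter_subset_left))
      filter_upwards [ae_restrict_mem (measurableSet_Ioo.inter measurableSet_Iio)] with y hy
      rw [mul_comm]
      exact mul_le_mul_right (hf (le_of_lt hy.2)) _
    have h2 : nrm r₂ (haar.restrict ((Ioo 0 1) ∩ Iio t)) a = ∞ := by
      by_contra hc
      refine nrm_ne_top_of_mul (J := Ioo 0 1) hr₂ ha (u := t / 2) (v := 1) (δ := 1) (by positivity)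
        one_ne_zero one_ne_top (G := (Iio t).indicator 1)
        (measurable_one.indicator measurableSet_Iio) measurableSet_Ioo (fun y hy hyu => ?_) ?_ hfin
      · have : y ≤ t / 2 := by by_contra hc; exact hyu ⟨not_le.1 hc, hy.2⟩
        rw [indicator_of_mem (by show y < t; linarith)]; rfl
      · have e : (fun y => a y * (Iio t).indicator 1 y) = (Iio t).indicator a := by
          ext y; by_cases hy : y ∈ Iio t <;> simp [hy]
        rw [e]
        refine ((eLpNorm_indicator_eq_eLpNorm_restrict measurableSet_Iio).trans ?_).trans_ne hc
        rw [restrict_restrict measurableSet_Iio, inter_comm]; rfl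
    rw [h2, mul_top hft, top_le_iff] at h1
    rw [h1]; exact le_top

end SpaceEstimates

/-! ### Necessity for decreasing functions -/

section Necessity

variable {r r₁ r₂ s s₁ s₂ : ℝ≥0∞} {a b : ℝ → ℝ≥0∞} {α : ℝ} {J : Set ℝ}
  {X : (ℝ → ℝ≥0∞) → ℝ≥0∞}

/-- Bounded decreasing functions which vanish near infinity. -/
def Good (f : ℝ → ℝ≥0∞) : Prop :=
  Antitone f ∧ ∃ n : ℕ, (∀ t, f t ≤ n) ∧ ∀ t, (n : ℝ) ≤ t → f t = 0

lemma nrm_le_of_appr {l : Measure ℝ} (hs0 : s ≠ 0) {P : ℕ → ℝ → ℝ≥0∞} {Q : ℝ → ℝ≥0∞}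
    (hm : ∀ n, Measurable (P n)) (h : ∀ y, Appr (fun n => P n y) (Q y)) {C : ℝ≥0∞}
    (hC : ∀ n, nrm s l (P n) ≤ C) : nrm s l Q ≤ C := by
  rcases eq_or_ne s ∞ with rfl | hs
  · have : ∀ᵐ y ∂l, ∀ n, P n y ≤ C := ae_all_iff.2 fun n =>
      ae_le_nrm_top.mono fun y hy => hy.trans (hC n)
    exact nrm_top_le (this.mono fun y hy => (h y).le_of_forall_le hy)
  · have hS := toReal_pos hs0 hs
    have key : Appr (fun n => nrm s l (P n)) (nrm s l Q) := by
      simp_rw [nrm_eq hs0 hs]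
      exact (Appr.lintegral (fun n => (hm n).pow_const _) fun y => (h y).rpow hS.le).rpow (by positivity)
    exact key.le_of_forall_le hC

lemma dom_of_good (hs0 : s ≠ 0) (hb : Regular b) (hX : Monotone X) {w : ℝ → ℝ≥0∞} (hw : Measurable w)
    {S : ℝ → Set ℝ}
    (hO : ∀ f, Measurable f → Measurable fun y => ∫⁻ t in S y, w t * f t ∂haar) {C : ℝ≥0∞} (hC : C ≠ ∞)
    (h : ∀ f, Good f → nrm s (haar.restrict J) (fun y => b y * ∫⁻ t in S y, w t * f t ∂haar) ≤ C * X f) :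
    Dom (fun f => nrm s (haar.restrict J) fun y => b y * ∫⁻ t in S y, w t * f t ∂haar) X := by
  refine ⟨C, hC, fun f hf => ?_⟩
  set F : ℕ → ℝ → ℝ≥0∞ := fun n => (Iio (n : ℝ)).indicator fun t => min (f t) n with hF
  have hFa : ∀ n, Antitone (F n) := fun n x y hxy => by
    by_cases hy : y < n
    · rw [hF]
      simp only [indicator_of_mem (show y ∈ Iio (n : ℝ) from hy),
        indicator_of_mem (show x ∈ Iio (n : ℝ) from hxy.trans_lt hy)]
      exact min_le_min_right _ (hf hxy)
    · rw [hF]; simp only [indicator_of_notMem (show y ∉ Iio (n : ℝ) from hy)]; exact zero_le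
  have hFle : ∀ n t, F n t ≤ min (f t) n := fun n t => indicator_le_self' (fun _ _ => zero_le) t
  have hFA : ∀ t, Appr (fun n => F n t) (f t) := fun t =>
    Appr.indicator (S := fun n : ℕ => Iio (n : ℝ)) (F := fun n t => min (f t) n)
      (fun m n hmn => Iio_subset_Iio (by exact_mod_cast hmn))
      (eq_univ_of_forall fun x => mem_iUnion.2 (exists_nat_gt x)) (Appr.min_nat (f t))
  refine nrm_le_of_appr hs0 (fun n => measurable_mul' hb.measurable (hO _ (hFa n).measurable))
    (fun y => (Appr.const _).mul (Appr.lintegral (fun n => measurable_mul' hw (hFa n).measurable)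
      fun t => (Appr.const _).mul (hFA t))) fun n => ?_
  refine (h _ ⟨hFa n, n, fun t => (hFle n t).trans (min_le_right _ _), fun t ht =>
    indicator_of_notMem (by simpa using ht) _⟩).trans (mul_le_mul_right (hX fun t => ?_) _)
  exact (hFle n t).trans (min_le_left _ _)

lemma monotone_sumDec : Monotone (sumDec r₁ r₂ α a) := fun _ _ h => add_le_add
  (nrm_mono (ae_of_all _ fun t => mul_le_mul_right (mul_le_mul_right (h t) _) _))
  (nrm_mono (ae_of_all _ fun t => mul_le_mul_right (h t) _))

lemma monotone_interDec : Monotone (interDec r₁ r₂ α a) := fun _ _ h => add_le_add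
  (nrm_mono (ae_of_all _ fun t => mul_le_mul_right (h t) _))
  (nrm_mono (ae_of_all _ fun t => mul_le_mul_right (mul_le_mul_right (h t) _) _))

lemma antitone_tail (F : ℝ → ℝ≥0∞) {l : Measure ℝ} : Antitone fun t => ∫⁻ u in Ioi t, F u ∂l :=
  fun _ _ h => lintegral_mono_set (Ioi_subset_Ioi h)

lemma hardyBound_of_dom (hα : 0 < α) (hs : 1 ≤ s) (hb : Regular b) {C : ℝ≥0∞} (hC : C ≠ ∞)
    (hX : ∀ F : ℝ → ℝ≥0∞, Measurable F →
      X (fun t => ∫⁻ u in Ioi t, pow (-α) u * F u ∂(haar.restrict J))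
        ≤ C * nrm r (haar.restrict J) (fun t => a t * F t))
    (h : Dom (fun f => nrm s (haar.restrict J) fun y => b y * headOp α f y) X) :
    HardyBound r s a b (haar.restrict J) := by
  obtain ⟨D, hD, h⟩ := h
  have hs0 : s ≠ 0 := (one_pos.trans_le hs).ne'
  refine ⟨ofReal α * (D * C), mul_ne_top ofReal_ne_top
    (mul_ne_top hD hC), fun F hF => ?_⟩
  set f : ℝ → ℝ≥0∞ := fun t => ∫⁻ u in Ioi t, pow (-α) u * F u ∂(haar.restrict J) with hf
  have hGm : Measurable fun u => pow (-α) u * F u := measurable_mul' (measurable_pow _) hF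
  have key : ∀ y, ofReal α⁻¹ * ∫⁻ t in Iio y, F t ∂(haar.restrict J) ≤ headOp α f y := fun y => by
    have e : headOp α f y = ∫⁻ t, (pow (-α) t * F t) * ∫⁻ u in Iio t, pow α u ∂(haar.restrict (Iio y))
        ∂(haar.restrict J) := by
      rw [← lintegral_lintegral_Ioi_mul hGm (measurable_pow α), headOp]
      exact lintegral_congr fun t => mul_comm _ _
    rw [e, ← lintegral_const_mul _ hF, ← lintegral_indicator measurableSet_Iio]
    refine lintegral_mono_ae ?_
    filter_upwards [ae_haar_restrict_pos] with t ht
    by_cases hty : t < y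
    · rw [indicator_of_mem (by exact hty), restrict_restrict measurableSet_Iio, Iio_inter_Iio,
        min_eq_left hty.le, setLIntegral_Iio_pow hα ht,
        show pow (-α) t * F t * (ofReal α⁻¹ * pow α t)
          = ofReal α⁻¹ * F t * (pow α t * pow (-α) t) by ring, pow_mul_neg ht, mul_one]
    · rw [indicator_of_notMem (by exact hty)]; exact zero_le
  have h1 := (h f (antitone_tail _)).trans (mul_le_mul_right (hX F hF) D)
  have h2 : nrm s (haar.restrict J) (fun y => b y * ∫⁻ t in Iio y, F t ∂(haar.restrict J))
      ≤ ofReal α * nrm s (haar.restrict J) (fun y => b y * headOp α f y) := by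
    rw [← nrm_const_mul hs0 _ (measurable_mul' hb.measurable measurable_headOp).aemeasurable]
    refine nrm_mono (ae_of_all _ fun y => ?_)
    calc b y * ∫⁻ t in Iio y, F t ∂(haar.restrict J)
        = ofReal α * (b y * (ofReal α⁻¹ * ∫⁻ t in Iio y, F t ∂(haar.restrict J))) := by
          rw [mul_left_comm (b y), ← mul_assoc, ← ofReal_mul hα.le, mul_inv_cancel₀ hα.ne',
            ofReal_one, one_mul]
      _ ≤ _ := mul_le_mul_right (mul_le_mul_right (key y) _) _
  exact h2.trans ((mul_le_mul_right h1 _).trans_eq (by ring))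

theorem hardyBound_of_sumDec (hα : 0 < α) (hr₁ : 1 ≤ r₁) (hs₁ : 1 ≤ s₁) (ha : Regular a) (hb : Regular b)
    (h : Dom (fun f => nrm s₁ (haar.restrict (Ioo 0 1)) fun y => b y * headOp α f y)
      (sumDec r₁ r₂ α a)) : HardyBound r₁ s₁ a b (haar.restrict (Ioo 0 1)) := by
  obtain ⟨C, hC, hP⟩ := ha.hardy_Ioi hα
  refine hardyBound_of_dom hα hs₁ hb hC (fun F hF => ?_) h
  have h0 : nrm r₂ (haar.restrict (Ioi 1)) (fun t => a t * ∫⁻ u in Ioi t, pow (-α) u * F u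
      ∂(haar.restrict (Ioo 0 1))) = 0 := by
    refine (nrm_congr (G := fun _ => 0) ?_).trans (by simp [nrm])
    filter_upwards [ae_restrict_mem measurableSet_Ioi] with t ht
    rw [restrict_restrict measurableSet_Ioi, show Ioi t ∩ Ioo 0 1 = ∅ from
      eq_empty_of_forall_notMem fun u h => lt_asymm (lt_trans ht h.1) h.2.2]
    simp
  rw [sumDec, h0, add_zero]
  exact hP (Ioo 0 1) r₁ hr₁ F hF

theorem hardyBound_of_interDec (hα : 0 < α) (hr₁ : 1 ≤ r₁) (hr₂ : 1 ≤ r₂) (hs₁ : 1 ≤ s₁) (ha : Regular a)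
    (hb : Regular b) (hfin : nrm r₂ (haar.restrict (Ioo 0 1)) a ≠ ∞)
    (h : Dom (fun f => nrm s₁ (haar.restrict (Ioi 1)) fun y => b y * headOp α f y)
      (interDec r₁ r₂ α a)) : HardyBound r₁ s₁ a b (haar.restrict (Ioi 1)) := by
  obtain ⟨C, hC, hP⟩ := ha.hardy_Ioi hα
  obtain ⟨D, hD, hQ⟩ := ha.exists_lintegral_Ioi_le hα hr₁
  refine hardyBound_of_dom hα hs₁ hb (ENNReal.add_ne_top.2 ⟨mul_ne_top hD hfin, hC⟩)
    (fun F hF => ?_) h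
  rw [interDec, add_mul]
  refine add_le_add ?_ (hP (Ioi 1) r₁ hr₁ F hF)
  have h1 := hQ _ (measurable_mul' (measurable_pow (-α)) hF)
  have h2 : nrm r₁ (haar.restrict (Ioi 1)) (fun t => a t * (pow α t * (pow (-α) t * F t)))
      = nrm r₁ (haar.restrict (Ioi 1)) fun t => a t * F t :=
    nrm_congr (ae_haar_restrict_pos.mono fun t ht => by
      show a t * (pow α t * (pow (-α) t * F t)) = a t * F t
      rw [← mul_assoc (pow α t), pow_mul_neg ht, one_mul])
  rw [h2] at h1
  rw [mul_right_comm]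
  refine le_trans ?_ (mul_le_mul_left h1 _)
  rw [← nrm_const_mul (one_pos.trans_le hr₂).ne' _ ha.measurable.aemeasurable]
  refine nrm_mono (ae_of_all _ fun t => ?_)
  rw [mul_comm]
  exact mul_le_mul_left (lintegral_mono' restrict_le_self le_rfl) _

lemma haar_Ioi_eq_top {y : ℝ} (hy : 0 < y) : haar (Ioi y) = ∞ := by
  refine ENNReal.eq_top_of_forall_nnreal_le fun c => ?_
  have h := haar_Ioo hy (mul_pos hy (Real.exp_pos c))
  rw [mul_div_cancel_left₀ _ hy.ne', Real.log_exp, ENNReal.ofReal_coe_nnreal] at h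
  exact h ▸ measure_mono Ioo_subset_Ioi_self

theorem decBound_of_sumDec (hα : 0 < α) (hr₁ : 1 ≤ r₁) (hr₂ : 1 ≤ r₂) (hs₂ : 1 ≤ s₂) (ha : Regular a)
    (hb : Regular b) (h : Dom (fun f => nrm s₂ (haar.restrict (Ioi 1)) fun y => b y * tailOp f y)
      (sumDec r₁ r₂ α a)) :
    nrm r₂ (haar.restrict (Ioi 1)) a = ∞ ∧ DecBound r₂ s₂ a b (haar.restrict (Ioi 1)) := by
  have hr0 : r₁ ≠ 0 := (one_pos.trans_le hr₁).ne'
  have hs0 : s₂ ≠ 0 := (one_pos.trans_le hs₂).ne'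
  have hfin := ha.nrm_pow_Ioo_ne_top hα hr0
  have hap : Measurable fun t => pow α t * a t := measurable_pow_mul ha α
  have e1 : ∀ k : ℝ≥0∞, nrm r₁ (haar.restrict (Ioo 0 1)) (fun t => a t * (pow α t * k))
      = k * nrm r₁ (haar.restrict (Ioo 0 1)) (fun t => pow α t * a t) := fun k => by
    rw [← nrm_const_mul hr0 _ hap.aemeasurable]
    congr 1 with t
    ring
  constructor
  · obtain ⟨C, hC, h⟩ := h
    by_contra hne
    have h1 := h (fun _ => 1) antitone_const
    have h2 : sumDec r₁ r₂ α a (fun _ => 1) ≠ ∞ := by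
      rw [sumDec, e1]
      simp only [mul_one, one_mul]
      exact ENNReal.add_ne_top.2 ⟨hfin, hne⟩
    refine mul_ne_top hC h2 (top_le_iff.1 (le_trans ?_ h1))
    have h3 := mul_nrm_Ioo_le (J := Ioi 1) (u := 1) (v := 2) (k := ∞) (F := tailOp fun _ => 1) hs0 hb
      Ioo_subset_Ioi_self fun y hy => by
        rw [tailOp, setLIntegral_one, haar_Ioi_eq_top (one_pos.trans hy.1)]
    rwa [top_mul (nrm_pos_of_Ioo_subset hs0 (c := 1) (d := 2) one_pos (by norm_num) le_rfl
      hb.measurable fun t ht => hb.ne_zero t (one_pos.trans ht.1))] at h3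
  · have hmax : ∀ {f : ℝ → ℝ≥0∞}, Antitone f → Antitone fun t => f (max t 2) :=
      fun hf x y hxy => hf (max_le_max_right _ hxy)
    have d₀ : Dom (fun f => nrm r₂ (haar.restrict (Ioi 1)) fun t => a t * f t)
      (fun f => nrm r₂ (haar.restrict (Ioi 1)) fun t => a t * f t) := Dom.of_le fun f _ => le_rfl
    have d₂ : Dom (fun f => f 2) (fun f => nrm r₂ (haar.restrict (Ioi 1)) fun t => a t * f t) :=
      Dom.of_nrm hr₂ ha (u := 1) (v := 2) one_pos (by norm_num) Ioo_subset_Ioi_self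
        (fun f hf y hy => hf hy.2.le) d₀
    have d₃ : Dom (fun f => sumDec r₁ r₂ α a fun t => f (max t 2))
        (fun f => nrm r₂ (haar.restrict (Ioi 1)) fun t => a t * f t) := by
      refine Dom.trans (Dom.of_le fun f hf => ?_) ((d₂.mul_const hfin).add d₀)
      rw [sumDec, ← e1]
      refine add_le_add (nrm_mono ?_)
        (nrm_mono (ae_of_all _ fun t => mul_le_mul_right (hf (le_max_left _ _)) _))
      filter_upwards [ae_restrict_mem measurableSet_Ioo] with t ht
      rw [max_eq_right (by linarith [ht.2])]
    have d₄ : Dom (fun f => nrm s₂ (haar.restrict (Ioi 1)) fun y => b y * tailOp (fun t => f (max t 2)) y)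
        (fun f => nrm r₂ (haar.restrict (Ioi 1)) fun t => a t * f t) := by
      obtain ⟨C, hC, h⟩ := h
      exact Dom.trans ⟨C, hC, fun f hf => h _ (hmax hf)⟩ d₃
    obtain ⟨D, hD, hint⟩ := ha.lintegral_Ioo_le hr₂ (c := 1) (d := 2) (J := Ioi 1) one_pos
      Ioo_subset_Ioi_self
    have hmi := hb.measurable.indicator (measurableSet_Iio (a := (2 : ℝ)))
    refine dom_three (c := fun f => ∫⁻ t in Ioo 1 2, f t ∂haar) (G := fun _ _ => 0)
      (K := (Iio 2).indicator b) hs₂ (fun f => measurable_mul' hb.measurable measurable_tailOp)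
      (fun _ => measurable_const) hmi d₄ (Dom.of_le fun f _ => by simp [nrm])
      ⟨D, hD, fun f hf => hint f hf.measurable⟩ ?_ fun f => ?_
    · refine (eLpNorm_indicator_eq_eLpNorm_restrict measurableSet_Iio).trans_ne ?_
      rw [restrict_restrict measurableSet_Iio, inter_comm, Ioi_inter_Iio]
      exact hb.nrm_Ioo_ne_top one_pos hs0
    · filter_upwards [ae_restrict_mem measurableSet_Ioi] with y hy
      have hy' : (1 : ℝ) < y := hy
      have hsub : ∀ z, 2 ≤ z → ∫⁻ t in Ioi z, f t ∂haar ≤ tailOp (fun t => f (max t 2)) z := fun z hz =>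
        setLIntegral_mono' measurableSet_Ioi fun t ht => by
          rw [max_eq_left (hz.trans (le_of_lt ht))]
      have hle : ∫⁻ t in Ioi y, f t ∂(haar.restrict (Ioi 1)) ≤ ∫⁻ t in Ioi y, f t ∂haar :=
        lintegral_mono' (Measure.restrict_mono le_rfl restrict_le_self) le_rfl
      rw [add_zero, mul_comm (∫⁻ t in Ioo 1 2, f t ∂haar)]
      refine (mul_le_mul_right hle _).trans ?_
      rcases lt_or_ge y 2 with h2 | h2
      · rw [indicator_of_mem (by exact h2), ← mul_add]
        refine mul_le_mul_right ?_ _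
        have hU : Ioi y ⊆ Ioi 2 ∪ Ioc 1 2 := fun t ht => by
          rcases lt_or_ge 2 t with h | h
          exacts [Or.inl h, Or.inr ⟨hy'.trans ht, h⟩]
        refine (lintegral_mono_set hU).trans ((lintegral_union_le _ _ _).trans (add_le_add ?_ ?_))
        · exact (hsub 2 le_rfl).trans (lintegral_mono_set (Ioi_subset_Ioi h2.le))
        · exact (setLIntegral_congr Ioo_ae_eq_Ioc.symm).le
      · exact (mul_le_mul_right (hsub y h2) _).trans le_self_add

theorem decBound_of_interDec
    (h : Dom (fun f => nrm s₂ (haar.restrict (Ioo 0 1)) fun y => b y * tailOp f y)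
      (interDec r₁ r₂ α a)) : DecBound r₂ s₂ a b (haar.restrict (Ioo 0 1)) := by
  obtain ⟨C, hC, h⟩ := h
  refine ⟨C, hC, fun f hf => ?_⟩
  have hf' : Antitone ((Iio 1).indicator f) := fun x y hxy => by
    by_cases hy : y < 1
    · rw [indicator_of_mem (by exact hy), indicator_of_mem (by exact hxy.trans_lt hy)]; exact hf hxy
    · rw [indicator_of_notMem (by exact hy)]; exact zero_le
  refine (nrm_mono (ae_of_all _ fun y => mul_le_mul_right ?_ _)).trans
    ((h _ hf').trans (mul_le_mul_right ?_ _))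
  · rw [restrict_restrict measurableSet_Ioi, tailOp, setLIntegral_indicator measurableSet_Iio]
    exact lintegral_mono_set fun t ht => ⟨ht.2.2, ht.1⟩
  · have h0 : nrm r₁ (haar.restrict (Ioi 1)) (fun t => a t * (pow α t * (Iio 1).indicator f t)) = 0 := by
      refine (nrm_congr (G := fun _ => 0) ?_).trans (by simp [nrm])
      filter_upwards [ae_restrict_mem measurableSet_Ioi] with t ht
      rw [indicator_of_notMem (by simpa using le_of_lt ht), mul_zero, mul_zero]
    rw [interDec, h0, add_zero]
    exact nrm_mono (ae_of_all _ fun t => mul_le_mul_right (indicator_le_self' (fun _ _ => zero_le) t) _)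

end Necessity

/-! ### Invariance of the quantities under a.e. equality of the weights -/

section Congr

variable {r s : ℝ≥0∞} {a a' b b' : ℝ → ℝ≥0∞} {I : Set ℝ}

theorem lp_congr_weight {J : Set ℝ} (hJ : J ⊆ Ioi 0) (ha : a =ᵐ[volume.restrict (Ioi 0)] a')
    {F G : ℝ → ℝ≥0∞} (h : ∀ t, a t = a' t → F t = G t) : lp s J F = lp s J G :=
  lp_congr ((ae_restrict_of_ae_restrict_of_subset hJ ha).mono h)

theorem star_congr {m : ℝ} (hm : m ≠ 0) (hb : b =ᵐ[volume.restrict (Ioi 0)] b') :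
    star m b =ᵐ[volume.restrict (Ioi 0)] star m b' := by
  refine absolutelyContinuous_haar.ae_le (Filter.Tendsto.eventually (f := fun x : ℝ => x ^ (1 / m))
    (p := fun t => b t = b' t) ?_ (haar_absolutelyContinuous.ae_le hb))
  have hmeas : AEMeasurable (fun x : ℝ => x ^ (1 / m)) haar := by fun_prop
  refine (Measure.tendsto_ae_map hmeas).mono_right (Measure.AbsolutelyContinuous.ae_le ?_)
  rw [map_rpow_haar (one_div_ne_zero hm)]
  exact Measure.smul_absolutelyContinuous

theorem quantL_congr (hI : I ⊆ Ioi 0) (ha : a =ᵐ[volume.restrict (Ioi 0)] a')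
    (hb : b =ᵐ[volume.restrict (Ioi 0)] b') : quantL r s a b I = quantL r s a' b' I := by
  have hI' : ∀ S : Set ℝ, I ∩ S ⊆ Ioi 0 := fun S => inter_subset_left.trans hI
  have hU : ∀ x, lp (conjExponent r) (I ∩ Iio x)
      (fun t => pow (-recip (conjExponent r)) t * (a t)⁻¹)
      = lp (conjExponent r) (I ∩ Iio x)
      (fun t => pow (-recip (conjExponent r)) t * (a' t)⁻¹) := fun x =>
    lp_congr_weight (hI' _) ha fun t ht => by rw [ht]
  have hW : ∀ x, lp s (I ∩ Ioi x) (fun t => pow (-recip s) t * b t)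
      = lp s (I ∩ Ioi x) (fun t => pow (-recip s) t * b' t) := fun x =>
    lp_congr_weight (hI' _) hb fun t ht => by rw [ht]
  simp only [quantL, hU, hW]
  split_ifs
  · rfl
  · exact lp_congr_weight hI ha fun t ht => by rw [ht]

theorem quantR₁_congr (hI : I ⊆ Ioi 0) (ha : a =ᵐ[volume.restrict (Ioi 0)] a')
    (hb : b =ᵐ[volume.restrict (Ioi 0)] b') : quantR₁ r s a b I = quantR₁ r s a' b' I := by
  have hI' : ∀ S : Set ℝ, I ∩ S ⊆ Ioi 0 := fun S => inter_subset_left.trans hI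
  have hU : ∀ x, lp r (I ∩ Iio x) (fun t => pow (-recip r) t * a t)
      = lp r (I ∩ Iio x) (fun t => pow (-recip r) t * a' t) := fun x =>
    lp_congr_weight (hI' _) ha fun t ht => by rw [ht]
  have hW : ∀ x, lp s (I ∩ Iio x) (fun t => pow (-recip s) t * b t * logRatio x t)
      = lp s (I ∩ Iio x) (fun t => pow (-recip s) t * b' t * logRatio x t) := fun x =>
    lp_congr_weight (hI' _) hb fun t ht => by rw [ht]
  simp only [quantR₁, hU, hW]
  split_ifs
  · rfl
  · exact lp_congr_weight hI ha fun t ht => by rw [ht]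

theorem quantR₂_congr (hI : I ⊆ Ioi 0) (ha : a =ᵐ[volume.restrict (Ioi 0)] a')
    (hb : b =ᵐ[volume.restrict (Ioi 0)] b') : quantR₂ r s a b I = quantR₂ r s a' b' I := by
  have hI' : ∀ S : Set ℝ, I ∩ S ⊆ Ioi 0 := fun S => inter_subset_left.trans hI
  have hV : primV r a I = primV r a' I := funext fun t =>
    lintegral_congr_ae ((ae_restrict_of_ae_restrict_of_subset (hI' _) ha).mono fun u hu => by
      simp only [hu])
  have hU : ∀ x, lp (conjExponent r) (I ∩ Ioi x) (fun t =>
        pow (-recip (conjExponent r)) t * a t ^ (r.toReal * recip (conjExponent r))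
          * (primV r a' I t)⁻¹ * logRatio t x)
      = lp (conjExponent r) (I ∩ Ioi x) (fun t =>
        pow (-recip (conjExponent r)) t * a' t ^ (r.toReal * recip (conjExponent r))
          * (primV r a' I t)⁻¹ * logRatio t x) := fun x =>
    lp_congr_weight (hI' _) ha fun t ht => by rw [ht]
  have hW : ∀ x, lp s (I ∩ Iio x) (fun t => pow (-recip s) t * b t)
      = lp s (I ∩ Iio x) (fun t => pow (-recip s) t * b' t) := fun x =>
    lp_congr_weight (hI' _) hb fun t ht => by rw [ht]
  simp only [quantR₂, hV, hU, hW]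
  split_ifs
  · rfl
  · exact lp_congr_weight hI hb fun t ht => by rw [ht]

theorem quantRInf_congr (hI : I ⊆ Ioi 0) (ha : a =ᵐ[volume.restrict (Ioi 0)] a')
    (hb : b =ᵐ[volume.restrict (Ioi 0)] b') : quantRInf r s a b I = quantRInf r s a' b' I := by
  have h₃ : quantR₃ s a b I = quantR₃ s a' b' I := by
    have hA : ∀ t, lp ∞ (I ∩ Iio t) a = lp ∞ (I ∩ Iio t) a' := fun t =>
      lp_congr_weight (inter_subset_left.trans hI) ha fun t ht => ht
    simp only [quantR₃, hA]
    exact lp_congr_weight hI hb fun t ht => by rw [ht]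
  simp only [quantRInf, h₃, quantR₁_congr hI ha hb, quantR₂_congr hI ha hb]

end Congr

/-! ### Rearrangements and the Calderón operator in terms of the measure `dt/t` -/

section Rearr

variable {R ε : Type*} [MeasurableSpace R] [ENorm ε] {μ : Measure R}

theorem antitone_rearr (g : R → ε) : Antitone (rearr μ g) := fun _ _ h =>
  sInf_le_sInf fun _ hk => ⟨hk.1, hk.2.trans (ofReal_le_ofReal h)⟩

theorem Equimeasurable.rearr_le {g : R → ε} {f : ℝ → ℝ≥0∞} (h : Equimeasurable μ g f)
    (hf : Antitone f) (t : ℝ) : rearr μ g t ≤ f t := by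
  refine le_of_forall_gt_imp_ge_of_dense fun k hk => ?_
  rcases eq_or_ne k ∞ with rfl | hk'
  · exact le_top
  lift k to ℝ≥0 using hk'
  refine sInf_le ⟨pos_of_gt hk, ?_⟩
  rw [h k, distrib]
  have hsub : {x | (k : ℝ≥0∞) < ‖f x‖ₑ} ⊆ Iio t := fun x hx =>
    lt_of_not_ge fun htx => (hx.trans_le (hf htx)).not_ge hk.le
  refine (measure_mono hsub).trans ?_
  rw [Measure.restrict_apply measurableSet_Iio, inter_comm, Ioi_inter_Iio, Real.volume_Ioo, sub_zero]

theorem lkNorm_eq_nrm {q s : ℝ≥0∞} (hs : s ≠ 0) {b b' : ℝ → ℝ≥0∞}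
    (hb : b =ᵐ[volume.restrict (Ioi 0)] b') {J : Set ℝ} (hJ : MeasurableSet J) (hJ0 : J ⊆ Ioi 0)
    (g : R → ε) : lkNorm μ q s b J g
      = nrm s (haar.restrict J) (fun t => b' t * (pow (recip q) t * rearr μ g t)) := by
  rw [← lp_eq_nrm hJ hJ0 hs]
  refine lp_congr ?_
  filter_upwards [ae_restrict_of_ae_restrict_of_subset hJ0 hb, ae_restrict_mem hJ] with t ht htJ
  rw [ht, show recip q - recip s = -recip s + recip q by ring, ← pow_add (hJ0 htJ)]
  ring

theorem sumNorm_eq_sumDec {p r₁ r₂ : ℝ≥0∞} (hp : p < ∞) (hr₁ : r₁ ≠ 0) (hr₂ : r₂ ≠ 0)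
    {a a' : ℝ → ℝ≥0∞} (ha : a =ᵐ[volume.restrict (Ioi 0)] a') (g : R → ε) :
    sumNorm μ p r₁ ∞ r₂ a g = sumDec r₁ r₂ (recip p) a' (rearr μ g) := by
  rw [sumNorm, if_pos hp, lkNorm_eq_nrm hr₁ ha measurableSet_Ioo Ioo_subset_Ioi_self,
    lkNorm_eq_nrm hr₂ ha measurableSet_Ioi (Ioi_subset_Ioi zero_le_one), sumDec, recip_top]
  simp only [pow_zero', one_mul]

theorem interNorm_eq_interDec {p r₁ r₂ : ℝ≥0∞} (hp : p < ∞) (hr₁ : r₁ ≠ 0) (hr₂ : r₂ ≠ 0)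
    {a a' : ℝ → ℝ≥0∞} (ha : a =ᵐ[volume.restrict (Ioi 0)] a') (g : R → ε) :
    interNorm μ p r₁ ∞ r₂ a g = interDec r₁ r₂ (recip p) a' (rearr μ g) := by
  rw [interNorm, if_pos hp, lkNorm_eq_nrm hr₂ ha measurableSet_Ioo Ioo_subset_Ioi_self,
    lkNorm_eq_nrm hr₁ ha measurableSet_Ioi (Ioi_subset_Ioi zero_le_one), interDec, recip_top]
  simp only [pow_zero', one_mul]

theorem calderonLeft_eq {p q : ℝ≥0∞} {m : ℝ} (f : ℝ → ℝ≥0∞) {x : ℝ} :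
    calderonLeft p q m f x = pow (-recip q) x * headOp (recip p) f (x ^ m) := by
  rw [calderonLeft, headOp]
  congr 1
  have h : haar.restrict (Iio (x ^ m)) = haar.restrict (Ioo 0 (x ^ m)) := by
    refine Measure.restrict_congr_set ?_
    filter_upwards [haar_Ioi_zero_compl] with t ht
    exact propext ⟨fun h => ⟨ht, h⟩, fun h => h.2⟩
  rw [h, setLIntegral_haar measurableSet_Ioo Ioo_subset_Ioi_self]
  refine setLIntegral_congr_fun measurableSet_Ioo fun t ht => ?_
  rw [← mul_assoc, pow_add ht.1]
  congr 2; ring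

theorem calderonRight_eq {q : ℝ≥0∞} {m : ℝ} (f : ℝ → ℝ≥0∞) {x : ℝ} (hx : 0 < x) :
    calderonRight ∞ q m f x = pow (-recip q) x * tailOp f (x ^ m) := by
  rw [calderonRight, tailOp, setLIntegral_haar measurableSet_Ioi
    (Ioi_subset_Ioi (Real.rpow_nonneg hx.le _)), recip_top, zero_sub]

theorem calderon_one {p q₁ q₂ : ℝ≥0∞} (f : ℝ → ℝ≥0∞) :
    calderon p q₁ ∞ q₂ f 1 = headOp (recip p) f 1 + tailOp f 1 := by
  have h : ∀ e, pow e 1 = 1 := fun e => by simp [pow]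
  rw [calderon, calderonLeft_eq, calderonRight_eq f one_pos, Real.one_rpow, h, h, one_mul, one_mul]

theorem Good.admissible {p q₁ q₂ : ℝ≥0∞} (hp : 0 < recip p) {f : ℝ → ℝ≥0∞} (hf : Good f) :
    Admissible p q₁ ∞ q₂ f := by
  obtain ⟨hf, n, hn, hn0⟩ := hf
  refine ⟨hf.antitoneOn _, fun t _ => ((hn t).trans_lt (natCast_lt_top n)).ne, ?_⟩
  rw [calderon_one]
  refine ENNReal.add_lt_top.2 ⟨?_, ?_⟩
  · have h : headOp (recip p) f 1 ≤ ∫⁻ t in Iio 1, pow (recip p) t * n ∂haar :=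
      lintegral_mono fun t => mul_le_mul_right (hn t) _
    refine h.trans_lt ?_
    rw [lintegral_mul_const _ (measurable_pow _), setLIntegral_Iio_pow hp one_pos]
    exact mul_lt_top (mul_lt_top ENNReal.ofReal_lt_top (pow_ne_top one_pos).lt_top)
      (natCast_lt_top n)
  · have hN : (0 : ℝ) < n + 1 := by positivity
    have h : tailOp f 1 ≤ ∫⁻ t in Ioo 1 ((n : ℝ) + 1), n ∂haar := by
      rw [tailOp, ← lintegral_indicator measurableSet_Ioi, ← lintegral_indicator measurableSet_Ioo]
      refine lintegral_mono fun t => ?_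
      by_cases ht : t ∈ Ioo 1 ((n : ℝ) + 1)
      · rw [indicator_of_mem ht, indicator_of_mem (by exact ht.1)]; exact hn t
      · rw [indicator_of_notMem ht]
        by_cases h1 : (1 : ℝ) < t
        · have : (n : ℝ) ≤ t := by
            have : ¬ t < (n : ℝ) + 1 := fun h => ht ⟨h1, h⟩
            linarith
          rw [indicator_of_mem (by exact h1), hn0 t this]
        · rw [indicator_of_notMem (by exact h1)]
    refine h.trans_lt ?_
    rw [setLIntegral_const, haar_Ioo one_pos hN]
    exact mul_lt_top (natCast_lt_top n) ENNReal.ofReal_lt_top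

/-! ### The substitution `y = x ^ m` in the target norms -/

theorem lkNorm_substitution {q s : ℝ≥0∞} (hs : 1 ≤ s) {m : ℝ} (hm : m ≠ 0) {b b' : ℝ → ℝ≥0∞}
    (hb' : Regular b') (hb : b =ᵐ[volume.restrict (Ioi 0)] b') {J J' : Set ℝ}
    (hJ : MeasurableSet J) (hJ0 : J ⊆ Ioi 0) (hJ' : MeasurableSet J')
    (hJJ : ∀ x, 0 < x → (x ∈ J ↔ x ^ m ∈ J')) :
    ∃ K : ℝ≥0, ∀ (g : R → ε) (Φ : ℝ → ℝ≥0∞), Measurable Φ → ∀ C : ℝ≥0∞,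
      ((∀ x, 0 < x → pow (recip q) x * rearr μ g x ≤ C * Φ (x ^ m)) →
        lkNorm μ q s b J g ≤ K * C * nrm s (haar.restrict J') (fun y => star m b' y * Φ y)) ∧
      ((∀ x, 0 < x → Φ (x ^ m) ≤ C * (pow (recip q) x * rearr μ g x)) →
        nrm s (haar.restrict J') (fun y => star m b' y * Φ y) ≤ K * C * lkNorm μ q s b J g) := by
  have hs0 : s ≠ 0 := (one_pos.trans_le hs).ne'
  set κ := ofReal |m⁻¹| with hκ
  have hκ0 : κ ≠ 0 := by simpa [hκ] using hm
  have hκt : κ ≠ ∞ := ofReal_ne_top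
  have hK₁ : 1 + κ ≠ ∞ := ENNReal.add_ne_top.2 ⟨one_ne_top, hκt⟩
  have hK₂ : 1 + κ⁻¹ ≠ ∞ := ENNReal.add_ne_top.2 ⟨one_ne_top, ENNReal.inv_ne_top.2 hκ0⟩
  have hβ : Measurable (star m b') := (hb'.star hm).measurable
  have hsub : ∀ Φ : ℝ → ℝ≥0∞, Measurable Φ → nrm s (haar.restrict J) (fun x => b' x * Φ (x ^ m))
      = nrm s (κ • haar.restrict J') (fun y => star m b' y * Φ y) := fun Φ hΦ => by
    rw [hκ, ← nrm_comp_rpow hm hJ' hJJ (measurable_mul' hβ hΦ)]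
    refine nrm_congr ?_
    filter_upwards [ae_haar_restrict_pos] with x hx
    rw [star, ← Real.rpow_mul hx.le, mul_one_div_cancel hm, Real.rpow_one]
  refine ⟨((1 + κ) + (1 + κ⁻¹)).toNNReal, fun g Φ hΦ C => ⟨fun h => ?_, fun h => ?_⟩⟩ <;>
    rw [ENNReal.coe_toNNReal (ENNReal.add_ne_top.2 ⟨hK₁, hK₂⟩), lkNorm_eq_nrm hs0 hb hJ hJ0]
  · have hm' : Measurable fun x : ℝ => b' x * Φ (x ^ m) :=
      measurable_mul' hb'.measurable (hΦ.comp (by fun_prop))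
    refine (nrm_mono (G := fun x => C * (b' x * Φ (x ^ m))) ?_).trans ?_
    · filter_upwards [ae_haar_restrict_pos] with x hx
      refine (mul_le_mul_right (h x hx) _).trans_eq (by ring)
    · rw [nrm_const_mul hs0 C hm'.aemeasurable, hsub Φ hΦ, mul_comm _ C, mul_assoc]
      exact mul_le_mul_right ((nrm_smul_measure_le hs).trans (mul_le_mul_left le_self_add _)) _
  · have hm' : Measurable fun x : ℝ => b' x * (pow (recip q) x * rearr μ g x) :=
      measurable_mul' hb'.measurable (measurable_mul' (measurable_pow _) (antitone_rearr g).measurable)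
    have h₁ : nrm s (haar.restrict J') (fun y => star m b' y * Φ y)
        ≤ (1 + κ⁻¹) * nrm s (κ • haar.restrict J') (fun y => star m b' y * Φ y) := by
      refine le_of_eq_of_le ?_ (nrm_smul_measure_le hs)
      rw [smul_smul, ENNReal.inv_mul_cancel hκ0 hκt, one_smul]
    refine h₁.trans ?_
    rw [← hsub Φ hΦ, mul_assoc]
    refine mul_le_mul' le_add_self ?_
    rw [← nrm_const_mul hs0 C hm'.aemeasurable]
    refine nrm_mono ?_
    filter_upwards [ae_haar_restrict_pos] with x hx
    refine (mul_le_mul_right (h x hx) _).trans_eq (by ring)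

end Rearr

/-! ### Boundedness of operators of joint weak type -/

section Bounded

variable {p₁ q₁ q₂ s₁ s₂ : ℝ≥0∞} {m : ℝ}

theorem recip_lt_recip {p q : ℝ≥0∞} (hp : 1 ≤ p) (h : p < q) : recip q < recip p :=
  (toReal_lt_toReal (ENNReal.inv_ne_top.2 (one_pos.trans_le (hp.trans h.le)).ne')
    (ENNReal.inv_ne_top.2 (one_pos.trans_le hp).ne')).2 (ENNReal.inv_lt_inv.2 h)

theorem slope_mul (hp : 0 < recip p₁) : slope p₁ q₁ ∞ q₂ * recip p₁ = recip q₁ - recip q₂ := by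
  rw [slope, recip_top, sub_zero, div_mul_cancel₀ _ hp.ne']

/-- The preimage in `(0,∞)` of `A` under `x ↦ x ^ m`. -/
def powPreimage (m : ℝ) (A : Set ℝ) : Set ℝ := Ioi 0 ∩ (fun x => x ^ m) ⁻¹' A

theorem powPreimage_Ioo_of_pos (hm : 0 < m) : powPreimage m (Ioo 0 1) = Ioo 0 1 := by
  ext x
  constructor
  · rintro ⟨hx, -, h⟩
    exact ⟨hx, lt_of_not_ge fun h1 => h.not_ge (Real.one_le_rpow h1 hm.le)⟩
  · exact fun h => ⟨h.1, Real.rpow_pos_of_pos h.1 m, Real.rpow_lt_one h.1.le h.2 hm⟩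

theorem powPreimage_Ioi_of_pos (hm : 0 < m) : powPreimage m (Ioi 1) = Ioi 1 := by
  ext x
  constructor
  · rintro ⟨hx, h⟩
    exact lt_of_not_ge fun h1 => h.not_ge (Real.rpow_le_one (le_of_lt hx) h1 hm.le)
  · exact fun h => ⟨one_pos.trans (mem_Ioi.1 h), Real.one_lt_rpow h hm⟩

theorem powPreimage_Ioo_of_neg (hm : m < 0) : powPreimage m (Ioo 0 1) = Ioi 1 := by
  ext x
  constructor
  · rintro ⟨hx, -, h⟩
    exact lt_of_not_ge fun h1 => h.not_ge (Real.one_le_rpow_of_pos_of_le_one_of_nonpos hx h1 hm.le)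
  · exact fun h => ⟨one_pos.trans (mem_Ioi.1 h), Real.rpow_pos_of_pos (one_pos.trans (mem_Ioi.1 h)) m,
      Real.rpow_lt_one_of_one_lt_of_neg h hm⟩

theorem powPreimage_Ioi_of_neg (hm : m < 0) : powPreimage m (Ioi 1) = Ioo 0 1 := by
  ext x
  constructor
  · rintro ⟨hx, h⟩
    exact ⟨hx, lt_of_not_ge fun h1 => h.not_ge (Real.rpow_le_one_of_one_le_of_nonpos h1 hm.le)⟩
  · exact fun h => ⟨h.1, Real.one_lt_rpow_of_pos_of_lt_one_of_neg h.1 h.2 hm⟩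

theorem sumNorm_interNorm_eq {R ε : Type*} [MeasurableSpace R] [ENorm ε] {μ : Measure R}
    (hp : 0 < recip p₁) (hq₁ : 1 ≤ q₁) (hq₂ : 1 ≤ q₂) (hq : q₁ ≠ q₂) (b : ℝ → ℝ≥0∞) (g : R → ε) :
    sumNorm μ q₁ s₁ q₂ s₂ b g = lkNorm μ q₁ s₁ b (powPreimage (slope p₁ q₁ ∞ q₂) (Ioo 0 1)) g
      + lkNorm μ q₂ s₂ b (powPreimage (slope p₁ q₁ ∞ q₂) (Ioi 1)) g ∧
    interNorm μ q₁ s₁ q₂ s₂ b g = lkNorm μ q₁ s₁ b (powPreimage (slope p₁ q₁ ∞ q₂) (Ioi 1)) g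
      + lkNorm μ q₂ s₂ b (powPreimage (slope p₁ q₁ ∞ q₂) (Ioo 0 1)) g := by
  have hsl := slope_mul (q₁ := q₁) (q₂ := q₂) hp
  rcases hq.lt_or_gt with h | h
  · have hm : 0 < slope p₁ q₁ ∞ q₂ :=
      pos_of_mul_pos_left (hsl ▸ sub_pos.2 (recip_lt_recip hq₁ h)) hp.le
    rw [powPreimage_Ioo_of_pos hm, powPreimage_Ioi_of_pos hm, sumNorm, interNorm, if_pos h, if_pos h]
    exact ⟨rfl, add_comm _ _⟩
  · have hm : slope p₁ q₁ ∞ q₂ < 0 :=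
      neg_of_mul_neg_left (hsl ▸ sub_neg.2 (recip_lt_recip hq₂ h)) hp.le
    rw [powPreimage_Ioo_of_neg hm, powPreimage_Ioi_of_neg hm, sumNorm, interNorm, if_neg h.not_gt,
      if_neg h.not_gt]
    exact ⟨add_comm _ _, rfl⟩

theorem slope_ne_zero (hp : 0 < recip p₁) (hq₁ : 1 ≤ q₁) (hq₂ : 1 ≤ q₂) (hq : q₁ ≠ q₂) :
    slope p₁ q₁ ∞ q₂ ≠ 0 := fun h => by
  have hsl := slope_mul (q₁ := q₁) (q₂ := q₂) hp
  rw [h, zero_mul] at hsl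
  rcases hq.lt_or_gt with h | h
  · linarith [recip_lt_recip hq₁ h]
  · linarith [recip_lt_recip hq₂ h]

theorem pow_comp_rpow {e x : ℝ} (hx : 0 < x) (α : ℝ) : pow α (x ^ e) = pow (e * α) x := by
  rw [pow_eq_ofReal (Real.rpow_pos_of_pos hx e), pow_eq_ofReal hx, Real.rpow_mul hx.le]

theorem pow_mul_calderon (hp : 0 < recip p₁) (f : ℝ → ℝ≥0∞) {x : ℝ} (hx : 0 < x) :
    pow (recip q₁) x * calderon p₁ q₁ ∞ q₂ f x = headOp (recip p₁) f (x ^ slope p₁ q₁ ∞ q₂)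
        + pow (recip p₁) (x ^ slope p₁ q₁ ∞ q₂) * tailOp f (x ^ slope p₁ q₁ ∞ q₂) ∧
    pow (recip q₂) x * calderon p₁ q₁ ∞ q₂ f x
      = pow (-recip p₁) (x ^ slope p₁ q₁ ∞ q₂) * headOp (recip p₁) f (x ^ slope p₁ q₁ ∞ q₂)
        + tailOp f (x ^ slope p₁ q₁ ∞ q₂) := by
  rw [calderon, calderonLeft_eq, calderonRight_eq f hx, pow_comp_rpow hx, pow_comp_rpow hx, mul_neg,
    slope_mul hp, mul_add, mul_add, ← mul_assoc, ← mul_assoc, ← mul_assoc, ← mul_assoc, pow_mul_neg hx,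
    pow_mul_neg hx, pow_add hx, pow_add hx, one_mul, one_mul, neg_sub]
  exact ⟨rfl, rfl⟩

variable {𝕜 R₁ R₂ : Type*} [RCLike 𝕜] [MeasurableSpace R₁] [MeasurableSpace R₂]
  {μ₁ : Measure R₁} {μ₂ : Measure R₂} {T : QuasilinearOp 𝕜 μ₁ μ₂} {b b' : ℝ → ℝ≥0∞} {A B : Set ℝ}
  {X : (ℝ → ℝ≥0∞) → ℝ≥0∞} {NX : (R₁ → 𝕜) → ℝ≥0∞} {NY : (R₂ → 𝕜) → ℝ≥0∞}

theorem JointWeakType.boundedOp (hT : JointWeakType T p₁ q₁ ∞ q₂) (hp : 0 < recip p₁)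
    (hm : slope p₁ q₁ ∞ q₂ ≠ 0) (hs₁ : 1 ≤ s₁) (hs₂ : 1 ≤ s₂) (hb' : Regular b')
    (hb : b =ᵐ[volume.restrict (Ioi 0)] b') (hA : MeasurableSet A) (hB : MeasurableSet B)
    (hNX : ∀ g, NX g = X (rearr μ₁ g))
    (hNY : ∀ g, NY g = lkNorm μ₂ q₁ s₁ b (powPreimage (slope p₁ q₁ ∞ q₂) A) g
      + lkNorm μ₂ q₂ s₂ b (powPreimage (slope p₁ q₁ ∞ q₂) B) g)
    (h : Dom (fun f => nrm s₁ (haar.restrict A) (fun y => star (slope p₁ q₁ ∞ q₂) b' y *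
          (headOp (recip p₁) f y + pow (recip p₁) y * tailOp f y))
        + nrm s₂ (haar.restrict B) (fun y => star (slope p₁ q₁ ∞ q₂) b' y *
          (pow (-recip p₁) y * headOp (recip p₁) f y + tailOp f y))
        + (headOp (recip p₁) f 1 + tailOp f 1)) X) : BoundedOp T NX NY := by
  obtain ⟨C, hC, h⟩ := h
  obtain ⟨D, hD⟩ := hT
  have hJm : ∀ A, MeasurableSet A → MeasurableSet (powPreimage (slope p₁ q₁ ∞ q₂) A) := fun A hA =>
    measurableSet_Ioi.inter ((by fun_prop : Measurable fun x : ℝ => x ^ slope p₁ q₁ ∞ q₂) hA)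
  obtain ⟨K₁, hK₁⟩ := lkNorm_substitution (μ := μ₂) (ε := 𝕜) (q := q₁) hs₁ hm hb' hb (hJm A hA)
    inter_subset_left hA fun x hx => ⟨fun h => h.2, fun h => ⟨hx, h⟩⟩
  obtain ⟨K₂, hK₂⟩ := lkNorm_substitution (μ := μ₂) (ε := 𝕜) (q := q₂) hs₂ hm hb' hb (hJm B hB)
    inter_subset_left hB fun x hx => ⟨fun h => h.2, fun h => ⟨hx, h⟩⟩
  lift C to ℝ≥0 using hC
  refine ⟨(K₁ + K₂) * D * C, fun f hfm hf => ?_⟩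
  rw [hNX] at hf
  have hCX := h _ (antitone_rearr (μ := μ₁) f)
  obtain ⟨hfd, hTf⟩ := hD f hfm (by
    rw [calderon_one]
    exact le_add_self.trans_lt (hCX.trans_lt (mul_lt_top ENNReal.coe_lt_top hf)))
  refine ⟨hfd, ?_⟩
  rw [hNY, hNX]
  have e₁ := (hK₁ (T.toFun ⟨f, hfd⟩) _
    (measurable_headOp.add (measurable_mul' (measurable_pow _) measurable_tailOp)) D).1
    fun x hx => (mul_le_mul_right (hTf x hx) _).trans_eq (by
      rw [mul_left_comm, (pow_mul_calderon hp _ hx).1]; rfl)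
  have e₂ := (hK₂ (T.toFun ⟨f, hfd⟩) _
    ((measurable_mul' (measurable_pow _) measurable_headOp).add measurable_tailOp) D).1
    fun x hx => (mul_le_mul_right (hTf x hx) _).trans_eq (by
      rw [mul_left_comm, (pow_mul_calderon hp _ hx).2]; rfl)
  refine (add_le_add (e₁.trans (mul_le_mul_right ((le_add_right le_self_add).trans hCX) _))
    (e₂.trans (mul_le_mul_right ((le_add_right le_add_self).trans hCX) _))).trans_eq ?_
  push_cast
  ring

/-- A lower bound `Φ f ≲ (Tg)^*`, with `g` equimeasurable with `f`, turns boundedness of `T` into an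
inequality for non-increasing functions. -/
theorem BoundedOp.exists_nrm_le (hT : BoundedOp T NX NY) {q s : ℝ≥0∞} {m : ℝ} (hm : m ≠ 0)
    (hs : 1 ≤ s) (hb' : Regular b') (hb : b =ᵐ[volume.restrict (Ioi 0)] b') (hA : MeasurableSet A)
    (hX : Monotone X) (hNX : ∀ g, NX g = X (rearr μ₁ g))
    (hNY : ∀ g, lkNorm μ₂ q s b (powPreimage m A) g ≤ NY g)
    {Φ : (ℝ → ℝ≥0∞) → ℝ → ℝ≥0∞} (hΦ : ∀ f, Measurable (Φ f)) {D : ℝ≥0}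
    (hD : ∀ f, Good f → ∃ g : T.domain, Equimeasurable μ₁ (g : R₁ → 𝕜) f ∧ ∀ x : ℝ, 0 < x →
      Φ f (x ^ m) ≤ D * (pow (recip q) x * rearr μ₂ (T.toFun g) x)) :
    ∃ C : ℝ≥0∞, C ≠ ∞ ∧ ∀ f, Good f →
      nrm s (haar.restrict A) (fun y => star m b' y * Φ f y) ≤ C * X f := by
  obtain ⟨C, hC⟩ := hT
  obtain ⟨K, hK⟩ := lkNorm_substitution (μ := μ₂) (ε := 𝕜) (q := q) hs hm hb' hb
    (measurableSet_Ioi.inter ((by fun_prop : Measurable fun x : ℝ => x ^ m) hA))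
    inter_subset_left hA fun x hx => ⟨fun h => h.2, fun h => ⟨hx, h⟩⟩
  refine ⟨K * D * C + 1, by finiteness, fun f hf => ?_⟩
  rcases eq_or_ne (X f) ∞ with hXf | hXf
  · rw [hXf, mul_top (by simp)]; exact le_top
  obtain ⟨g, hg, hgT⟩ := hD f hf
  have hgX : NX g ≤ X f := (hNX g).trans_le (hX fun t => hg.rearr_le hf.1 t)
  obtain ⟨hgd, hgC⟩ := hC g (T.aemeasurable_of_mem g g.2) (hgX.trans_lt hXf.lt_top)
  refine ((hK (T.toFun g) (Φ f) (hΦ f) D).2 hgT).trans ?_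
  refine (mul_le_mul_right ((hNY _).trans (hgC.trans (mul_le_mul_right hgX _))) _).trans ?_
  rw [← mul_assoc]
  exact mul_le_mul_left le_self_add _

theorem BoundedOp.dom_headOp (hT : BoundedOp T NX NY) (hLB : LowerBound₁ T p₁ q₁ ∞ q₂)
    (hp : 0 < recip p₁) (hm : slope p₁ q₁ ∞ q₂ ≠ 0) (hs : 1 ≤ s₁) (hb' : Regular b')
    (hb : b =ᵐ[volume.restrict (Ioi 0)] b') (hA : MeasurableSet A)
    (hX : Monotone X) (hNX : ∀ g, NX g = X (rearr μ₁ g))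
    (hNY : ∀ g, lkNorm μ₂ q₁ s₁ b (powPreimage (slope p₁ q₁ ∞ q₂) A) g ≤ NY g) :
    Dom (fun f => nrm s₁ (haar.restrict A) fun y => star (slope p₁ q₁ ∞ q₂) b' y *
      headOp (recip p₁) f y) X := by
  obtain ⟨D, hD⟩ := hLB
  obtain ⟨C, hC, h⟩ := hT.exists_nrm_le hm hs hb' hb hA hX hNX hNY (D := D)
    (Φ := headOp (recip p₁)) (fun f => measurable_headOp) fun f hf => by
      obtain ⟨g, hg, hgx⟩ := hD f (hf.admissible hp)
      refine ⟨g, hg, fun x hx => ?_⟩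
      rw [mul_left_comm, ← one_mul (headOp _ _ _), ← pow_mul_neg (α := recip q₁) hx, mul_assoc,
        ← calderonLeft_eq]
      exact mul_le_mul_right (hgx x hx) _
  exact dom_of_good (one_pos.trans_le hs).ne' (hb'.star hm) hX (measurable_pow _)
    (fun f hf => measurable_headOp) hC h

theorem BoundedOp.dom_tailOp (hT : BoundedOp T NX NY) (hLB : LowerBound₂ T p₁ q₁ ∞ q₂)
    (hp : 0 < recip p₁) (hm : slope p₁ q₁ ∞ q₂ ≠ 0) (hs : 1 ≤ s₂) (hb' : Regular b')
    (hb : b =ᵐ[volume.restrict (Ioi 0)] b') (hA : MeasurableSet A)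
    (hX : Monotone X) (hNX : ∀ g, NX g = X (rearr μ₁ g))
    (hNY : ∀ g, lkNorm μ₂ q₂ s₂ b (powPreimage (slope p₁ q₁ ∞ q₂) A) g ≤ NY g) :
    Dom (fun f => nrm s₂ (haar.restrict A) fun y => star (slope p₁ q₁ ∞ q₂) b' y * tailOp f y) X := by
  obtain ⟨D, hD⟩ := hLB
  obtain ⟨C, hC, h⟩ := hT.exists_nrm_le hm hs hb' hb hA hX hNX hNY (D := D)
    (Φ := tailOp) (fun f => measurable_tailOp) fun f hf => by
      obtain ⟨g, hg, hgx⟩ := hD f (hf.admissible hp)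
      refine ⟨g, hg, fun x hx => ?_⟩
      rw [mul_left_comm, ← one_mul (tailOp _ _), ← pow_mul_neg (α := recip q₂) hx, mul_assoc,
        ← calderonRight_eq f hx]
      exact mul_le_mul_right (hgx x hx) _
  have := dom_of_good (X := X) (J := A) (w := fun _ => 1) (S := fun y => Ioi y)
    (one_pos.trans_le hs).ne' (hb'.star hm) hX measurable_const
    (fun f hf => by simp only [one_mul]; exact measurable_tailOp) hC
    (fun f hf => by simp only [one_mul]; exact h f hf)
  simp only [one_mul] at this
  exact this

end Bounded

end LK

end

theorem theorem3p6 {𝕜 R₁ R₂ : Type*} [RCLike 𝕜] [MeasurableSpace R₁] [MeasurableSpace R₂]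
    (μ₁ : Measure R₁) (μ₂ : Measure R₂) [SigmaFinite μ₁] [SigmaFinite μ₂]
    (hμ₁ : μ₁ univ = ∞) (hμ₂ : μ₂ univ = ∞)
    (p₁ q₁ q₂ r₁ s₁ r₂ s₂ : ℝ≥0∞)
    (hp₁ : 1 ≤ p₁) (hp₁' : p₁ < ∞) (hq₁ : 1 ≤ q₁) (hq₂ : 1 ≤ q₂) (hq : q₁ ≠ q₂)
    (hr₁ : 1 ≤ r₁) (hs₁ : 1 ≤ s₁) (hr₂ : 1 ≤ r₂) (hs₂ : 1 ≤ s₂)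
    (a b : ℝ → ℝ≥0∞)
    (ha : LK.SlowlyVarying (Ioi 0) a) (hb : LK.SlowlyVarying (Ioi 0) b)
    (h210 : r₂ = ∞ → MonotoneOn a (Ioi 0))
    (T : LK.QuasilinearOp 𝕜 μ₁ μ₂)
    (hJW : LK.JointWeakType T p₁ q₁ ∞ q₂)
    (hLB₁ : LK.LowerBound₁ T p₁ q₁ ∞ q₂)
    (hLB₂ : LK.LowerBound₂ T p₁ q₁ ∞ q₂) :
    (LK.BoundedOp T (LK.sumNorm μ₁ p₁ r₁ ∞ r₂ a) (LK.sumNorm μ₂ q₁ s₁ q₂ s₂ b) ↔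
      LK.lp r₂ (Ioi 1) (fun t => LK.pow (-LK.recip r₂) t * a t) = ∞ ∧
      LK.quantL r₁ s₁ a (LK.star (LK.slope p₁ q₁ ∞ q₂) b) (Ioo 0 1) +
        LK.quantRInf r₂ s₂ a (LK.star (LK.slope p₁ q₁ ∞ q₂) b) (Ioi 1) < ∞) ∧
    ((LK.quantL r₁ s₁ a (LK.star (LK.slope p₁ q₁ ∞ q₂) b) (Ioi 1) +
        LK.quantRInf r₂ s₂ a (LK.star (LK.slope p₁ q₁ ∞ q₂) b) (Ioo 0 1) < ∞ →
      LK.BoundedOp T (LK.interNorm μ₁ p₁ r₁ ∞ r₂ a) (LK.interNorm μ₂ q₁ s₁ q₂ s₂ b)) ∧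
     (LK.lp r₂ (Ioo 0 1) (fun t => LK.pow (-LK.recip r₂) t * a t) < ∞ →
      LK.BoundedOp T (LK.interNorm μ₁ p₁ r₁ ∞ r₂ a) (LK.interNorm μ₂ q₁ s₁ q₂ s₂ b) →
      LK.quantL r₁ s₁ a (LK.star (LK.slope p₁ q₁ ∞ q₂) b) (Ioi 1) +
        LK.quantRInf r₂ s₂ a (LK.star (LK.slope p₁ q₁ ∞ q₂) b) (Ioo 0 1) < ∞)) := by
  have hp : 0 < LK.recip p₁ := by
    simpa [LK.recip_top] using LK.recip_lt_recip hp₁ hp₁'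
  have hm := LK.slope_ne_zero hp hq₁ hq₂ hq
  obtain ⟨a', ha', haa⟩ := ha.exists_regular
  obtain ⟨b', hb', hbb⟩ := hb.exists_regular
  have hβ := hb'.star hm
  have hββ := LK.star_congr hm hbb
  have hr₁0 : r₁ ≠ 0 := (one_pos.trans_le hr₁).ne'
  have hr₂0 : r₂ ≠ 0 := (one_pos.trans_le hr₂).ne'
  have hoo : Ioo (0 : ℝ) 1 ⊆ Ioi 0 := Ioo_subset_Ioi_self
  have hoi : Ioi (1 : ℝ) ⊆ Ioi 0 := Ioi_subset_Ioi zero_le_one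
  have hlp : ∀ J : Set ℝ, MeasurableSet J → J ⊆ Ioi 0 →
      LK.lp r₂ J (fun t => LK.pow (-LK.recip r₂) t * a t) = LK.nrm r₂ (LK.haar.restrict J) a' :=
    fun J hJ hJ0 => (LK.lp_congr_weight hJ0 haa fun t ht => by rw [ht]).trans
      (LK.lp_eq_nrm hJ hJ0 hr₂0)
  rw [hlp _ measurableSet_Ioi hoi, hlp _ measurableSet_Ioo hoo, LK.quantL_congr hoo haa hββ,
    LK.quantL_congr hoi haa hββ, LK.quantRInf_congr hoo haa hββ, LK.quantRInf_congr hoi haa hββ,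
    ENNReal.add_lt_top, ENNReal.add_lt_top, lt_top_iff_ne_top, lt_top_iff_ne_top, lt_top_iff_ne_top,
    lt_top_iff_ne_top, lt_top_iff_ne_top,
    ← LK.hardyBound_iff_quantL measurableSet_Ioo hoo ordConnected_Ioo hr₁ hs₁ ha' hβ,
    ← LK.hardyBound_iff_quantL measurableSet_Ioi hoi ordConnected_Ioi hr₁ hs₁ ha' hβ]
  have hXs := LK.sumNorm_eq_sumDec (μ := μ₁) (ε := 𝕜) hp₁' hr₁0 hr₂0 haa
  have hXi := LK.interNorm_eq_interDec (μ := μ₁) (ε := 𝕜) hp₁' hr₁0 hr₂0 haa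
  have hYs : ∀ g : R₂ → 𝕜, _ := fun g => (LK.sumNorm_interNorm_eq (μ := μ₂) (s₁ := s₁) (s₂ := s₂)
    hp hq₁ hq₂ hq b g).1
  have hYi : ∀ g : R₂ → 𝕜, _ := fun g => (LK.sumNorm_interNorm_eq (μ := μ₂) (s₁ := s₁) (s₂ := s₂)
    hp hq₁ hq₂ hq b g).2
  refine ⟨⟨fun hT => ?_, fun ⟨htop, hL, hR⟩ => ?_⟩, fun ⟨hL, hR⟩ => ?_, fun hfin hT => ?_⟩
  · have hL := hT.dom_headOp hLB₁ hp hm hs₁ hb' hbb measurableSet_Ioo LK.monotone_sumDec hXs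
      fun g => le_self_add.trans_eq (hYs g).symm
    have hR := hT.dom_tailOp hLB₂ hp hm hs₂ hb' hbb measurableSet_Ioi LK.monotone_sumDec hXs
      fun g => le_add_self.trans_eq (hYs g).symm
    obtain ⟨htop, hD⟩ := LK.decBound_of_sumDec hp hr₁ hr₂ hs₂ ha' hβ hR
    exact ⟨htop, LK.hardyBound_of_sumDec hp hr₁ hs₁ ha' hβ hL,
      (LK.decBound_Ioi_iff hr₂ hs₂ ha' hβ htop).1 hD⟩
  · exact hJW.boundedOp hp hm hs₁ hs₂ hb' hbb measurableSet_Ioo measurableSet_Ioi hXs hYs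
      (LK.dom_sumTarget hp hr₁ hs₁ hr₂ hs₂ ha' hβ hL ((LK.decBound_Ioi_iff hr₂ hs₂ ha' hβ htop).2 hR))
  · refine hJW.boundedOp hp hm hs₁ hs₂ hb' hbb measurableSet_Ioi measurableSet_Ioo hXi hYi ?_
    obtain ⟨C, hC, h⟩ := LK.dom_interTarget hp hr₁ hs₁ hr₂ hs₂ ha' hβ hL
      fun hfin => (LK.decBound_Ioo_iff hr₂ hs₂ ha' hβ hfin).2 hR
    exact ⟨C, hC, fun f hf => (congrArg (· + _) (add_comm _ _)).trans_le (h f hf)⟩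
  · have hL := hT.dom_headOp hLB₁ hp hm hs₁ hb' hbb measurableSet_Ioi LK.monotone_interDec hXi
      fun g => le_self_add.trans_eq (hYi g).symm
    have hR := hT.dom_tailOp hLB₂ hp hm hs₂ hb' hbb measurableSet_Ioo LK.monotone_interDec hXi
      fun g => le_add_self.trans_eq (hYi g).symm
    exact ⟨LK.hardyBound_of_interDec hp hr₁ hr₂ hs₁ ha' hβ hfin hL,
      (LK.decBound_Ioo_iff hr₂ hs₂ ha' hβ hfin).1 (LK.decBound_of_interDec hR)⟩
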